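/- Let $C$ be a smooth projective curve over $\mathbf{C}$, let $r,n\ge 1$, and let $\mathbf{t}=(t_1,\dots,t_n)$ be distinct points of $C$. For $d\in\mathbf{Z}$ put $$\Lambda^{(n)}_r(d)=\Big\{(\lambda^{(i)}_j)^{1\le i\le n}_{0\le j\le r-1}\in\mathbf{C}^{nr}\;\Big|\; d+\sum_{i,j}\lambda^{(i)}_j=0\Big\}.$$ A $(\mathbf{t},\boldsymbol\lambda)$-parabolic connection of rank $r$ is a triple $(E,\nabla,\{l^{(i)}_*\})$ with $E$ a rank $r$ vector bundle on $C$, $\nabla:E\to E\otimes\Omega^1_C(t_1+\cdots+t_n)$ a connection, and $E|_{t_i}=l^{(i)}_0\supset l^{(i)}_1\supset\cdots\supset l^{(i)}_r=0$ filtrations with $\dim l^{(i)}_j/l^{(i)}_{j+1}=1$ and $(\mathrm{res}_{t_i}(\nabla)-\lambda^{(i)}_j)(l^{(i)}_j)\subset l^{(i)}_{j+1}$ for $0\le j\le r-1$. Let $\mathcal{M}_C(\mathbf{t},\boldsymbol\lambda)$ be the moduli stack of $(\mathbf{t},\boldsymbol\lambda)$-parabolic connections (families over $\mathbf{C}$-schemes,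 no stability condition). Consider the following transforms, each changing only the $i$-th row of the exponents: * $a_i:\mathcal{M}_C(\mathbf{t},\boldsymbol\lambda)\to\mathcal{M}_C(\mathbf{t},\boldsymbol\nu)$, where $(\nu^{(i)}_j)_j$ is any rearrangement of $(\lambda^{(i)}_j)_j$: it keeps $(E,\nabla)$ and replaces $l^{(i)}_*$ by the filtration $l'^{(i)}_*$ such that for every $c\in\mathbf{C}$ one has $l'^{(i)}_q\cap V_c=l^{(i)}_p\cap V_c$ whenever $\#\{s<q:\nu^{(i)}_s=c\}=\#\{s<p:\lambda^{(i)}_s=c\}$, where $V_c$ is the generalized $c$-eigenspace of $\mathrm{res}_{t_i}(\nabla)$; * $b_i^{\pm1}$: tensoring with $\mathcal{O}_C(\pm t_i)$; here $\nu^{(i)}_j=\lambda^{(i)}_j\mp1$; * $Elm_{l^{(i)}_j}$ ($0\le j\le r-1$): it replaces $E$ by $E'=\ker(E\to E|_{t_i}/l^{(i)}_j)$ with the induced connection; the new flag at $t_i$ consists of the preimages of $l^{(i)}_j\supset\cdots\supset l^{(i)}_r$ under $E'|_{t_i}\to E|_{t_i}$, followed by the images of $l^{(i)}_0\otimes1\supset\cdots\supset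 l^{(i)}_j\otimes 1$ under $E(-t_i)|_{t_i}\to E'|_{t_i}$; here $(\nu^{(i)}_0,\dots,\nu^{(i)}_{r-1})=(\lambda^{(i)}_j,\dots,\lambda^{(i)}_{r-1},\lambda^{(i)}_0+1,\dots,\lambda^{(i)}_{j-1}+1)$. (1) For every $\boldsymbol\lambda\in\Lambda^{(n)}_r(d)$ there are $d'\in\mathbf{Z}$, $\boldsymbol\mu\in\Lambda^{(n)}_r(d')$ with $0\le\mathrm{Re}(\mu^{(i)}_j)<1$ for all $i,j$, and an isomorphism of stacks $\sigma:\mathcal{M}_C(\mathbf{t},\boldsymbol\lambda)\xrightarrow{\sim}\mathcal{M}_C(\mathbf{t},\boldsymbol\mu)$ which is a composition of isomorphisms $a_i$, $b_i$, $b_i^{-1}$ and $Elm_{l^{(i)}_j}$, $1\le i\le n$. (2) Let $rh(\boldsymbol\lambda)=(a^{(i)}_j)$ be defined by $\prod_{j=0}^{r-1}\big(X-\exp(-2\pi\sqrt{-1}\,\lambda^{(i)}_j)\big)=X^r+a^{(i)}_{r-1}X^{r-1}+\cdots+a^{(i)}_0$. If $\boldsymbol\lambda\in\Lambda^{(n)}_r(d)$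 and $\boldsymbol\mu\in\Lambda^{(n)}_r(d')$ satisfy $rh(\boldsymbol\lambda)=rh(\boldsymbol\mu)$, then there is an isomorphism of stacks $\sigma:\mathcal{M}_C(\mathbf{t},\boldsymbol\lambda)\xrightarrow{\sim}\mathcal{M}_C(\mathbf{t},\boldsymbol\mu)$ which is a composition of isomorphisms $a_i$, $b_i$, $b_i^{-1}$ and $Elm_{l^{(i)}_j}$. -/

import Mathlib

open CategoryTheory AlgebraicGeometry TensorProduct

noncomputable section

/-! ### Base change of modules along a ring homomorphism -/

/-- A `σ`-semilinear additive map `f : M → M'` exhibits `M'` as the base change `S' ⊗_S M`. -/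
def IsBaseChangeAlong {S S' : Type} [CommRing S] [CommRing S'] (σ : S →+* S')
    {M M' : Type} [AddCommGroup M] [AddCommGroup M'] [Module S M] [Module S' M']
    (f : M →+ M') (hf : ∀ (s : S) (m : M), f (s • m) = σ s • f m) : Prop :=
  letI : Algebra S S' := σ.toAlgebra
  letI : Module S M' := Module.compHom M' σ
  haveI : IsScalarTower S S' M' := ⟨fun a b c => mul_smul (σ a) b c⟩
  IsBaseChange S' ({ toFun := f, map_add' := f.map_add, map_smul' := hf } : M →ₗ[S] M')

theorem IsBaseChangeAlong.id {S : Type} [CommRing S] {M : Type} [AddCommGroup M] [Module S M]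
    (σ : S →+* S) (hσ : ∀ s, σ s = s) (f : M →+ M) (h : ∀ m, f m = m)
    (hf : ∀ (s : S) (m : M), f (s • m) = σ s • f m) : IsBaseChangeAlong σ f hf := by
  obtain rfl : σ = RingHom.id S := RingHom.ext hσ
  obtain rfl : f = AddMonoidHom.id M := AddMonoidHom.ext h
  exact IsBaseChange.ofEquiv (LinearEquiv.refl S M)

theorem isBaseChangeAlong_comp_aux {S S' S'' : Type} [CommRing S] [CommRing S'] [CommRing S'']
    [i₁ : Algebra S S'] [i₂ : Algebra S' S''] [i₃ : Algebra S S''] [IsScalarTower S S' S'']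
    {M M' M'' : Type} [AddCommGroup M] [AddCommGroup M'] [AddCommGroup M'']
    [Module S M] [Module S' M'] [Module S'' M''] [Module S M'] [Module S' M''] [Module S M'']
    [IsScalarTower S S' M'] [IsScalarTower S' S'' M''] [IsScalarTower S S'' M'']
    (F : M →ₗ[S] M') (G : M' →ₗ[S'] M'') (H : M →ₗ[S] M'') (e : ∀ m, H m = G (F m))
    (hF : IsBaseChange S' F) (hG : IsBaseChange S'' G) : IsBaseChange S'' H := by
  have : IsScalarTower S S' M'' := IsScalarTower.to₁₂₄ S S' S'' M''
  have h := IsBaseChange.comp hF hG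
  have e' : H = (G.restrictScalars S).comp F := LinearMap.ext e
  rw [e']
  exact h

theorem IsBaseChangeAlong.comp {S S' S'' : Type} [CommRing S] [CommRing S'] [CommRing S'']
    {σ : S →+* S'} {τ : S' →+* S''} {M M' M'' : Type} [AddCommGroup M] [AddCommGroup M']
    [AddCommGroup M''] [Module S M] [Module S' M'] [Module S'' M'']
    {f : M →+ M'} {hf : ∀ (s : S) (m : M), f (s • m) = σ s • f m}
    {g : M' →+ M''} {hg : ∀ (s : S') (m : M'), g (s • m) = τ s • g m}
    (hbf : IsBaseChangeAlong σ f hf) (hbg : IsBaseChangeAlong τ g hg)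
    (ρ : S →+* S'') (hρ : ∀ s, ρ s = τ (σ s))
    (hgf : ∀ (s : S) (m : M), (g.comp f) (s • m) = ρ s • (g.comp f) m) :
    IsBaseChangeAlong ρ (g.comp f) hgf :=
  letI : Algebra S S' := σ.toAlgebra
  letI : Algebra S' S'' := τ.toAlgebra
  letI : Algebra S S'' := ρ.toAlgebra
  letI : Module S M' := Module.compHom M' σ
  letI : Module S' M'' := Module.compHom M'' τ
  letI : Module S M'' := Module.compHom M'' ρ
  haveI : IsScalarTower S S' M' := ⟨fun a b c => mul_smul (σ a) b c⟩
  haveI : IsScalarTower S' S'' M'' := ⟨fun a b c => mul_smul (τ a) b c⟩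
  haveI : IsScalarTower S S'' M'' := ⟨fun a b c => mul_smul (ρ a) b c⟩
  haveI : IsScalarTower S S' S'' := IsScalarTower.of_algebraMap_eq hρ
  isBaseChangeAlong_comp_aux
    ({ toFun := f, map_add' := f.map_add, map_smul' := hf } : M →ₗ[S] M')
    ({ toFun := g, map_add' := g.map_add, map_smul' := hg } : M' →ₗ[S'] M'')
    { toFun := g.comp f, map_add' := (g.comp f).map_add, map_smul' := hgf }
    (fun _ => rfl) hbf hbg

/-- The biadditive map `(m, x) ↦ f m ⊗ g x`. -/
def tensorMapAux {R' : Type} [CommRing R']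
    {M M' N N' : Type} [AddCommGroup M] [AddCommGroup M'] [AddCommGroup N] [AddCommGroup N']
    [Module R' M'] [Module R' N'] (f : M →+ M') (g : N →+ N') : M →+ N →+ M' ⊗[R'] N' :=
  { toFun := fun m => (TensorProduct.mk R' M' N' (f m)).toAddMonoidHom.comp g
    map_zero' := by ext x; simp
    map_add' := fun m m' => by ext x; simp }

/-- The additive map `f ⊗ g : M ⊗_R N → M' ⊗_{R'} N'` for maps `f`, `g` semilinear over
`ρ : R → R'`. -/
def tensorMapAlong {R R' : Type} [CommRing R] [CommRing R'] (ρ : R →+* R')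
    {M M' N N' : Type} [AddCommGroup M] [AddCommGroup M'] [AddCommGroup N] [AddCommGroup N']
    [Module R M] [Module R' M'] [Module R N] [Module R' N'] (f : M →+ M') (g : N →+ N')
    (hf : ∀ (a : R) (m : M), f (a • m) = ρ a • f m)
    (hg : ∀ (a : R) (m : N), g (a • m) = ρ a • g m) : M ⊗[R] N →+ M' ⊗[R'] N' :=
  TensorProduct.liftAddHom (tensorMapAux f g) (fun a m x => by
    change f (a • m) ⊗ₜ[R'] g x = f m ⊗ₜ[R'] g (a • x)
    rw [hf, hg, TensorProduct.smul_tmul])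

theorem tensorMapAlong_tmul {R R' : Type} [CommRing R] [CommRing R'] (ρ : R →+* R')
    {M M' N N' : Type} [AddCommGroup M] [AddCommGroup M'] [AddCommGroup N] [AddCommGroup N']
    [Module R M] [Module R' M'] [Module R N] [Module R' N'] (f : M →+ M') (g : N →+ N')
    (hf : ∀ (a : R) (m : M), f (a • m) = ρ a • f m)
    (hg : ∀ (a : R) (m : N), g (a • m) = ρ a • g m) (m : M) (x : N) :
    tensorMapAlong ρ f g hf hg (m ⊗ₜ x) = f m ⊗ₜ g x := rfl

/-! ### The curve, its points, and logarithmic differentials -/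

/-- A smooth projective curve over `ℂ`: an integral scheme, smooth of relative dimension one and
proper over `ℂ` (for smooth curves over a field, proper is the same as projective). -/
structure SmoothProjCurve where
  X : Scheme.{0}
  toSpec : X ⟶ Spec (CommRingCat.of ℂ)
  [isIntegral : IsIntegral X]
  [smooth : SmoothOfRelativeDimension 1 toSpec]
  [proper : IsProper toSpec]

namespace SmoothProjCurve

variable (C : SmoothProjCurve)

instance : IsIntegral C.X := C.isIntegral

instance : Nonempty ((⊤ : C.X.Opens) : Type) := ⟨⟨genericPoint C.X, trivial⟩⟩

/-- The (closed) points of the curve. -/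
def Pt : Type := {x : C.X // IsClosed ({x} : Set C.X)}

/-- The nonempty affine open subsets of the curve. -/
def AffOpen : Type := {U : C.X.affineOpens // Nonempty U.1}

instance : LE C.AffOpen := ⟨fun U V => U.1 ≤ V.1⟩

instance (U : C.AffOpen) : Nonempty U.1.1 := U.2

/-- The ring of regular functions on `U`. -/
abbrev 𝒪 (U : C.AffOpen) : Type := Γ(C.X, U.1.1)

/-- The function field of the curve. -/
abbrev K : Type := C.X.functionField

/-- The constants inside the ring of functions on an open subset. -/
def const (U : C.X.Opens) : ℂ →+* Γ(C.X, U) :=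
  ((Scheme.ΓSpecIso (CommRingCat.of ℂ)).inv ≫ C.toSpec.appTop ≫
    C.X.presheaf.map (homOfLE (le_top : U ≤ ⊤)).op).hom

instance (U : C.AffOpen) : Algebra ℂ (C.𝒪 U) := (C.const U.1.1).toAlgebra

instance : Algebra ℂ C.K := ((algebraMap Γ(C.X, ⊤) C.K).comp (C.const ⊤)).toAlgebra

theorem rest_const {U V : C.X.Opens} (h : U ≤ V) (c : ℂ) :
    (C.X.presheaf.map (homOfLE h).op).hom (C.const V c) = C.const U c := by
  have e : C.X.presheaf.map (homOfLE (le_top : V ≤ ⊤)).op ≫ C.X.presheaf.map (homOfLE h).op =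
      C.X.presheaf.map (homOfLE (le_top : U ≤ ⊤)).op := by
    rw [← Functor.map_comp]; rfl
  unfold const
  rw [← e]
  rfl

instance (U : C.AffOpen) : IsScalarTower ℂ (C.𝒪 U) C.K :=
  IsScalarTower.of_algebraMap_eq fun c => by
    change (C.X.germToFunctionField ⊤).hom (C.const ⊤ c) =
      (C.X.germToFunctionField U.1.1).hom (C.const U.1.1 c)
    rw [← C.rest_const (le_top : U.1.1 ≤ ⊤) c, ← CommRingCat.comp_apply]
    simp [Scheme.germToFunctionField]

variable {C}

/-- Restriction of functions. -/
def rest {U V : C.AffOpen} (h : U ≤ V) : C.𝒪 V →ₐ[ℂ] C.𝒪 U where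
  __ := (C.X.presheaf.map (homOfLE (show U.1.1 ≤ V.1.1 from h)).op).hom
  commutes' c := C.rest_const h c

variable (C)

/-- The image in `Ω_{K/ℂ}` of the module of differentials of `𝒪(U)`, i.e. `Ω¹_C(U)`. -/
def regDiff (U : C.AffOpen) : Submodule (C.𝒪 U) (Ω[C.K⁄ℂ]) :=
  Submodule.span (C.𝒪 U) (Set.range fun f : C.𝒪 U =>
    KaehlerDifferential.D ℂ C.K (algebraMap (C.𝒪 U) C.K f))

variable {C}

/-- The ideal of functions on `U` vanishing at the point `x` (the unit ideal if `x ∉ U`). -/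
def ptIdeal (x : C.Pt) (U : C.AffOpen) : Ideal (C.𝒪 U) :=
  (Scheme.IdealSheafData.vanishingIdeal ⟨{x.1}, x.2⟩).ideal U.1

/-- The ideal sheaf of the reduced divisor `t_1 + ⋯ + t_n`. -/
def divSheaf {n : ℕ} (t : Fin n → C.Pt) : C.X.IdealSheafData :=
  Scheme.IdealSheafData.vanishingIdeal
    ⟨⋃ i, {(t i).1}, isClosed_iUnion_of_finite fun i => (t i).2⟩

/-- The rational one-forms `ω` with `I_D ω ⊆ Ω¹_C`, i.e. the sections of
`Ω¹_C(t_1 + ⋯ + t_n)` over `U`. -/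
def logDiff {n : ℕ} (t : Fin n → C.Pt) (U : C.AffOpen) : Submodule (C.𝒪 U) (Ω[C.K⁄ℂ]) where
  carrier := {ω | ∀ f ∈ (divSheaf t).ideal U.1, f • ω ∈ C.regDiff U}
  add_mem' ha hb f hf := by rw [smul_add]; exact add_mem (ha f hf) (hb f hf)
  zero_mem' f _ := by rw [smul_zero]; exact zero_mem _
  smul_mem' a ω h f hf := by rw [smul_comm]; exact Submodule.smul_mem _ a (h f hf)

/-- The differential `df`, as a section of `Ω¹_C(t_1 + ⋯ + t_n)`. -/
def dform {n : ℕ} (t : Fin n → C.Pt) {U : C.AffOpen} (f : C.𝒪 U) : logDiff t U :=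
  ⟨KaehlerDifferential.D ℂ C.K (algebraMap (C.𝒪 U) C.K f), fun g _ =>
    Submodule.smul_mem _ g (Submodule.subset_span ⟨f, rfl⟩)⟩

theorem algebraMap_rest {U V : C.AffOpen} (h : U ≤ V) (f : C.𝒪 V) :
    algebraMap (C.𝒪 U) C.K (rest h f) = algebraMap (C.𝒪 V) C.K f := by
  change (C.X.germToFunctionField U.1.1).hom
    ((C.X.presheaf.map (homOfLE (show U.1.1 ≤ V.1.1 from h)).op).hom f) =
      (C.X.germToFunctionField V.1.1).hom f
  rw [← CommRingCat.comp_apply]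
  simp [Scheme.germToFunctionField]

theorem rest_smul {U V : C.AffOpen} (h : U ≤ V) (f : C.𝒪 V) (ω : Ω[C.K⁄ℂ]) :
    rest h f • ω = f • ω := by
  rw [← algebraMap_smul C.K (rest h f) ω, ← algebraMap_smul C.K f ω, algebraMap_rest]

theorem regDiff_rest {U V : C.AffOpen} (h : U ≤ V) {ω : Ω[C.K⁄ℂ]} (hω : ω ∈ C.regDiff V) :
    ω ∈ C.regDiff U := by
  induction hω using Submodule.span_induction with
  | mem x hx =>
    obtain ⟨f, rfl⟩ := hx
    exact Submodule.subset_span ⟨rest h f, by simp only [algebraMap_rest]⟩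
  | zero => exact zero_mem _
  | add x y _ _ hx hy => exact add_mem hx hy
  | smul a x _ hx => rw [← rest_smul h]; exact Submodule.smul_mem _ _ hx

theorem logDiff_rest {n : ℕ} (t : Fin n → C.Pt) {U V : C.AffOpen} (h : U ≤ V)
    {ω : Ω[C.K⁄ℂ]} (hω : ω ∈ logDiff t V) : ω ∈ logDiff t U := by
  intro f hf
  have e : (divSheaf t).ideal U.1 = ((divSheaf t).ideal V.1).map (rest h).toRingHom :=
    ((divSheaf t).map_ideal (U := U.1) (V := V.1) h).symm
  rw [e] at hf
  induction hf using Submodule.span_induction with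
  | mem x hx =>
    obtain ⟨g, hg, rfl⟩ := hx
    have := regDiff_rest h (hω g hg)
    rwa [← rest_smul h] at this
  | zero => rw [zero_smul]; exact zero_mem _
  | add x y _ _ hx hy => rw [add_smul]; exact add_mem hx hy
  | smul a x _ hx => rw [smul_eq_mul, mul_smul]; exact Submodule.smul_mem _ _ hx

/-- Restriction of logarithmic one-forms. -/
def logRest {n : ℕ} (t : Fin n → C.Pt) {U V : C.AffOpen} (h : U ≤ V) :
    logDiff t V →+ logDiff t U where
  toFun ω := ⟨ω.1, logDiff_rest t h ω.2⟩
  map_zero' := rfl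
  map_add' _ _ := rfl

theorem logRest_smul {n : ℕ} (t : Fin n → C.Pt) {U V : C.AffOpen} (h : U ≤ V) (f : C.𝒪 V)
    (ω : logDiff t V) : logRest t h (f • ω) = (rest h).toRingHom f • logRest t h ω :=
  Subtype.ext (rest_smul h f ω.1).symm

/-! ### Vector bundles on `C × Spec A` -/

/-- The ring of functions `𝒪(U) ⊗ A` on the affine scheme `U × Spec A`. -/
abbrev OA (A : Type) [CommRing A] [Algebra ℂ A] (U : C.AffOpen) : Type := C.𝒪 U ⊗[ℂ] A

/-- The ring map `𝒪(V) ⊗ A → 𝒪(U) ⊗ B` given by restriction to `U ≤ V` and by `φ : A → B`. -/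
def OAmap {A B : Type} [CommRing A] [Algebra ℂ A] [CommRing B] [Algebra ℂ B] {U V : C.AffOpen}
    (h : U ≤ V) (φ : A →ₐ[ℂ] B) : OA A V →+* OA B U :=
  (Algebra.TensorProduct.map (rest h) φ).toRingHom

variable (C) in
/-- A vector bundle of rank `r` on `C × Spec A`, given as a quasi-coherent sheaf through its modules
of sections `M U` on the affine open subschemes `U × Spec A`. -/
structure VectorBundle (r : ℕ) (A : Type) [CommRing A] [Algebra ℂ A] where
  M : C.AffOpen → Type
  [addCommGroup : ∀ U, AddCommGroup (M U)]
  [module : ∀ U, Module (OA A U) (M U)]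
  /-- Restriction of sections. -/
  res : ∀ {U V : C.AffOpen}, U ≤ V → M V →+ M U
  res_id : ∀ {U : C.AffOpen} (h : U ≤ U) (m : M U), res h m = m
  res_res : ∀ {U V W : C.AffOpen} (h : U ≤ V) (h' : V ≤ W) (h'' : U ≤ W) (m : M W),
    res h (res h' m) = res h'' m
  res_smul : ∀ {U V : C.AffOpen} (h : U ≤ V) (a : OA A V) (m : M V),
    res h (a • m) = OAmap h (AlgHom.id ℂ A) a • res h m
  quasiCoherent : ∀ {U V : C.AffOpen} (h : U ≤ V),
    IsBaseChangeAlong (OAmap h (AlgHom.id ℂ A)) (res h) (res_smul h)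
  finite : ∀ U, Module.Finite (OA A U) (M U)
  projective : ∀ U, Module.Projective (OA A U) (M U)
  rank_eq : ∀ U, Module.rankAtStalk (R := OA A U) (M U) = fun _ => r

namespace VectorBundle

variable {r : ℕ} {A : Type} [CommRing A] [Algebra ℂ A] (E : C.VectorBundle r A)

instance (U : C.AffOpen) : AddCommGroup (E.M U) := E.addCommGroup U

instance (U : C.AffOpen) : Module (OA A U) (E.M U) := E.module U

/-- Sections over `U × Spec A` as an `𝒪(U)`-module. -/
instance (U : C.AffOpen) : Module (C.𝒪 U) (E.M U) :=
  Module.compHom (E.M U) (algebraMap (C.𝒪 U) (OA A U))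

instance (U : C.AffOpen) : IsScalarTower (C.𝒪 U) (OA A U) (E.M U) :=
  ⟨fun a b c => by
    rw [Algebra.smul_def, mul_smul]
    rfl⟩

instance (U : C.AffOpen) : SMulCommClass (C.𝒪 U) (OA A U) (E.M U) :=
  ⟨fun a b c => by
    change algebraMap (C.𝒪 U) (OA A U) a • b • c = b • algebraMap (C.𝒪 U) (OA A U) a • c
    rw [smul_comm]⟩

theorem smul_def (U : C.AffOpen) (f : C.𝒪 U) (m : E.M U) :
    f • m = ((f ⊗ₜ[ℂ] (1 : A) : OA A U)) • m := rfl

theorem res_smul' {U V : C.AffOpen} (h : U ≤ V) (f : C.𝒪 V) (m : E.M V) :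
    E.res h (f • m) = (rest h).toRingHom f • E.res h m := by
  rw [smul_def, smul_def, E.res_smul]
  simp [OAmap]

/-- The submodule `I_x E(U)` of sections vanishing on `{x} × Spec A` (all sections if `x ∉ U`). -/
def vanishing (x : C.Pt) (U : C.AffOpen) : Submodule (OA A U) (E.M U) :=
  (ptIdeal x U).map (algebraMap (C.𝒪 U) (OA A U)) • ⊤

end VectorBundle

/-! ### Logarithmic connections -/

/-- A pair `(E, ∇)` of a vector bundle `E` on `C × Spec A` and a logarithmic connection
`∇ : E → E ⊗ Ω¹(t_1 + ⋯ + t_n)` relative to `Spec A`. -/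
structure LogConn {n : ℕ} (t : Fin n → C.Pt) (r : ℕ) where
  A : CommAlgCat.{0} ℂ
  E : C.VectorBundle r A
  nabla : ∀ U, E.M U →+ E.M U ⊗[C.𝒪 U] logDiff t U
  linear : ∀ U (a : A) (m : E.M U),
    nabla U (((1 : C.𝒪 U) ⊗ₜ[ℂ] a : OA A U) • m) = ((1 : C.𝒪 U) ⊗ₜ[ℂ] a : OA A U) • nabla U m
  leibniz : ∀ U (f : C.𝒪 U) (m : E.M U),
    nabla U (f • m) = m ⊗ₜ[C.𝒪 U] dform t f + f • nabla U m
  nabla_res : ∀ {U V : C.AffOpen} (h : U ≤ V) (m : E.M V),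
    nabla U (E.res h m) = tensorMapAlong (rest h).toRingHom (E.res h) (logRest t h)
      (E.res_smul' h) (logRest_smul t h) (nabla V m)

namespace LogConn

variable {n : ℕ} {t : Fin n → C.Pt} {r : ℕ}

/-- The module of sections of the bundle over `U × Spec A`. -/
abbrev M (X : LogConn t r) (U : C.AffOpen) : Type := X.E.M U

theorem OAmap_algebraMap {A B : Type} [CommRing A] [Algebra ℂ A] [CommRing B] [Algebra ℂ B]
    {U : C.AffOpen} (h : U ≤ U) (φ : A →ₐ[ℂ] B) (f : C.𝒪 U) :
    OAmap h φ (f ⊗ₜ[ℂ] (1 : A)) = f ⊗ₜ[ℂ] (1 : B) := by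
  have : rest h f = f := by
    change (C.X.presheaf.map (𝟙 (Opposite.op U.1.1))).hom f = f
    simp
  simp [OAmap, this]

theorem le_rfl' (U : C.AffOpen) : U ≤ U := le_refl U.1

/-- A horizontal `𝒪`-linear map `X → Y`, over a ring homomorphism `X.A → Y.A`. -/
@[ext]
structure Hom (X Y : LogConn t r) where
  base : X.A ⟶ Y.A
  app : ∀ U, X.M U →+ Y.M U
  app_smul : ∀ U (a : OA X.A U) (m : X.M U),
    app U (a • m) = OAmap (le_rfl' U) base.hom a • app U m
  app_res : ∀ {U V : C.AffOpen} (h : U ≤ V) (m : X.M V),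
    app U (X.E.res h m) = Y.E.res h (app V m)
  horizontal : ∀ U (m : X.M U), Y.nabla U (app U m) =
    tensorMapAlong (RingHom.id (C.𝒪 U)) (app U) (AddMonoidHom.id (logDiff t U))
      (fun f m => by
        rw [VectorBundle.smul_def, app_smul, OAmap_algebraMap]; rfl)
      (fun _ _ => rfl) (X.nabla U m)

theorem OAmap_id {A : Type} [CommRing A] [Algebra ℂ A] {U : C.AffOpen} (h : U ≤ U)
    (a : OA A U) : OAmap h (AlgHom.id ℂ A) a = a := by
  have : rest h = AlgHom.id ℂ (C.𝒪 U) := by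
    ext f
    change (C.X.presheaf.map (𝟙 (Opposite.op U.1.1))).hom f = f
    simp
  simp [OAmap, this]

theorem OAmap_comp {A B D : Type} [CommRing A] [Algebra ℂ A] [CommRing B] [Algebra ℂ B]
    [CommRing D] [Algebra ℂ D] {U : C.AffOpen} (h : U ≤ U) (φ : A →ₐ[ℂ] B) (ψ : B →ₐ[ℂ] D)
    (a : OA A U) : OAmap h (ψ.comp φ) a = OAmap h ψ (OAmap h φ a) := by
  have : rest h = AlgHom.id ℂ (C.𝒪 U) := by
    ext f
    change (C.X.presheaf.map (𝟙 (Opposite.op U.1.1))).hom f = f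
    simp
  simp only [OAmap, this]
  induction a using TensorProduct.induction_on with
  | zero => simp
  | add x y hx hy => rw [map_add, map_add, map_add, hx, hy]
  | tmul x y => simp

instance : Category (LogConn t r) where
  Hom := Hom
  id X :=
    { base := 𝟙 X.A
      app := fun U => AddMonoidHom.id _
      app_smul := fun U a m => by
        change a • m = OAmap _ (AlgHom.id ℂ X.A) a • m
        rw [OAmap_id]
      app_res := fun _ _ => rfl
      horizontal := fun U m => by
        change X.nabla U m = _
        induction X.nabla U m with
        | zero => simp
        | add x y hx hy => rw [map_add, ← hx, ← hy]
        | tmul x y => rfl }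
  comp {X Y Z} f g :=
    { base := f.base ≫ g.base
      app := fun U => (g.app U).comp (f.app U)
      app_smul := fun U a m => by
        change g.app U (f.app U (a • m)) = OAmap _ (g.base.hom.comp f.base.hom) a • _
        rw [f.app_smul, g.app_smul, OAmap_comp]
        rfl
      app_res := fun h m => by
        change g.app _ (f.app _ _) = _
        rw [f.app_res, g.app_res]
        rfl
      horizontal := fun U m => by
        change Z.nabla U (g.app U (f.app U m)) = _
        rw [g.horizontal, f.horizontal]
        induction X.nabla U m with
        | zero => simp
        | add x y hx hy => rw [map_add, map_add, map_add, hx, hy]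
        | tmul x y => rfl }
  id_comp _ := rfl
  comp_id _ := rfl
  assoc _ _ _ := rfl

@[simp]
theorem comp_app {X Y Z : LogConn t r} (f : X ⟶ Y) (g : Y ⟶ Z) (U : C.AffOpen) (m : X.M U) :
    (f ≫ g).app U m = g.app U (f.app U m) := rfl

@[simp]
theorem id_app (X : LogConn t r) (U : C.AffOpen) (m : X.M U) : Hom.app (𝟙 X) U m = m := rfl

/-- `n` represents the image of `m|_{t_i}` under the residue `res_{t_i}(∇)` of the connection:
near `t_i` one has `∇ m = n' ⊗ dz/z` for a local coordinate `z` at `t_i`, where `n'` and `n` have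
the same value at `t_i`. -/
def IsResidue (X : LogConn t r) (i : Fin n) (U : C.AffOpen) (m m' : X.M U) : Prop :=
  ∃ (W : C.AffOpen) (h : W ≤ U) (z : C.𝒪 W) (ω : logDiff t W) (n' : X.M W),
    (t i).1 ∈ W.1.1 ∧ ptIdeal (t i) W = Ideal.span {z} ∧ z • ω = dform t z ∧
    X.nabla W (X.E.res h m) = n' ⊗ₜ ω ∧ n' - X.E.res h m' ∈ X.E.vanishing (t i) W

/-- The sections `m` over `U` with `(res_{t_i}(∇) - c)^k (m|_{t_i}) = 0`. -/
def genEigen (X : LogConn t r) (i : Fin n) (c : ℂ) (U : C.AffOpen) : ℕ → Set (X.M U)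
  | 0 => X.E.vanishing (t i) U
  | k + 1 => {m | ∃ m', X.IsResidue i U m m' ∧
      m' - algebraMap ℂ (OA X.A U) c • m ∈ genEigen X i c U k}

/-- Pairs `(E, ∇)` as a category over the category of `ℂ`-algebras. -/
def based (t : Fin n → C.Pt) (r : ℕ) : BasedCategory (CommAlgCat.{0} ℂ) where
  obj := LogConn t r
  p :=
    { obj := fun X => X.A
      map := fun {X Y} f => LogConn.Hom.base (X := X) (Y := Y) f }

end LogConn

/-! ### Parabolic connections and their moduli stack -/

/-- A family over `Spec A` of `(t, λ)`-parabolic connections of rank `r` on `C`. The flag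
`E|_{t_i} = l_0 ⊃ l_1 ⊃ ⋯ ⊃ l_r = 0` is given by the subsheaves
`L i j = ker (E → E|_{t_i} / l_j)` of `E`. -/
structure ParConn {n : ℕ} (t : Fin n → C.Pt) {r : ℕ} (lam : Fin n → Fin r → ℂ) extends
    LogConn t r where
  L : Fin n → Fin (r + 1) → ∀ U, Submodule (OA A U) (E.M U)
  L_zero : ∀ i U, L i 0 U = ⊤
  L_last : ∀ i U, L i (Fin.last r) U = E.vanishing (t i) U
  L_succ_le : ∀ i (j : Fin r) U, L i j.succ U ≤ L i j.castSucc U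
  L_res : ∀ i j {U V : C.AffOpen} (h : U ≤ V),
    L i j U = Submodule.span (OA A U) (E.res h '' (L i j V : Set (E.M V)))
  /-- The successive quotients `l_j / l_{j+1}` are line bundles on `Spec A`. -/
  invertible : ∀ i (j : Fin r) (U : C.AffOpen), (t i).1 ∈ U.1.1 →
    letI : Module A (L i j.castSucc U ⧸ (L i j.succ U).submoduleOf (L i j.castSucc U)) :=
      Module.compHom _ (Algebra.TensorProduct.includeRight : A →ₐ[ℂ] OA A U).toRingHom
    Module.Invertible A (L i j.castSucc U ⧸ (L i j.succ U).submoduleOf (L i j.castSucc U))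
  /-- `(res_{t_i}(∇) - λ_j) (l_j) ⊆ l_{j+1}`. -/
  residue : ∀ i (j : Fin r) (U : C.AffOpen), (t i).1 ∈ U.1.1 → ∀ m ∈ L i j.castSucc U,
    ∃ m', toLogConn.IsResidue i U m m' ∧
      m' - algebraMap ℂ (OA A U) (lam i j) • m ∈ L i j.succ U

namespace ParConn

variable {n : ℕ} {t : Fin n → C.Pt} {r : ℕ} {lam : Fin n → Fin r → ℂ}

/-- A morphism `X → Y` over `X.A → Y.A`: an isomorphism of the base change of `X` to `Y.A` with
`Y`, respecting the connections and the flags. -/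
@[ext]
structure Hom (X Y : ParConn t lam) where
  hom : X.toLogConn ⟶ Y.toLogConn
  cartesian : ∀ U, IsBaseChangeAlong (OAmap (LogConn.le_rfl' U) hom.base.hom) (hom.app U)
    (hom.app_smul U)
  flag : ∀ i j U, Y.L i j U = Submodule.span (OA Y.A U) (hom.app U '' (X.L i j U : Set (X.M U)))

instance : Category (ParConn t lam) where
  Hom := Hom
  id X :=
    { hom := 𝟙 X.toLogConn
      cartesian := fun U =>
        IsBaseChangeAlong.id _ (fun a => LogConn.OAmap_id _ a) _ (fun _ => rfl) _
      flag := fun i j U => by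
        change X.L i j U = Submodule.span _ ((fun m => m) '' (X.L i j U : Set (X.M U)))
        rw [Set.image_id', Submodule.span_eq] }
  comp {X Y Z} f g :=
    { hom := f.hom ≫ g.hom
      cartesian := fun U => (f.cartesian U).comp (g.cartesian U) _
        (fun a => LogConn.OAmap_comp _ _ _ a) _
      flag := fun i j U => by
        rw [g.flag i j U, f.flag i j U]
        apply le_antisymm
        · rw [Submodule.span_le]
          rintro _ ⟨y, hy, rfl⟩
          induction hy using Submodule.span_induction with
          | mem x hx =>
            obtain ⟨x, hx, rfl⟩ := hx
            exact Submodule.subset_span ⟨x, hx, rfl⟩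
          | zero => rw [map_zero]; exact zero_mem _
          | add x y _ _ hx hy => rw [map_add]; exact add_mem hx hy
          | smul a x _ hx => rw [g.hom.app_smul]; exact Submodule.smul_mem _ _ hx
        · apply Submodule.span_mono
          rintro _ ⟨x, hx, rfl⟩
          exact ⟨f.hom.app U x, Submodule.subset_span ⟨x, hx, rfl⟩, rfl⟩ }
  id_comp _ := rfl
  comp_id _ := rfl
  assoc _ _ _ := rfl

end ParConn

end SmoothProjCurve

open SmoothProjCurve

/-- The moduli stack of `(t, λ)`-parabolic connections on `C`, as a category over the category of
`ℂ`-algebras (the opposite of the category of affine schemes over `ℂ`). -/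
def parStack {C : SmoothProjCurve} {n : ℕ} (t : Fin n → C.Pt) {r : ℕ} (lam : Fin n → Fin r → ℂ) :
    BasedCategory (CommAlgCat.{0} ℂ) where
  obj := ParConn t lam
  p :=
    { obj := fun X => X.A
      map := fun {X Y} f => LogConn.Hom.base (ParConn.Hom.hom (X := X) (Y := Y) f) }

/-- An isomorphism of stacks: a functor over the base which is an equivalence of categories. -/
structure StackIso (𝒳 𝒴 : BasedCategory.{0, 1} (CommAlgCat.{0} ℂ)) where
  functor : BasedFunctor 𝒳 𝒴
  isEquivalence : functor.toFunctor.IsEquivalence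

namespace StackIso

/-- The identity. -/
def refl (𝒳 : BasedCategory.{0, 1} (CommAlgCat.{0} ℂ)) : StackIso 𝒳 𝒳 where
  functor := BasedFunctor.id 𝒳
  isEquivalence := inferInstanceAs (𝟭 𝒳.obj).IsEquivalence

/-- Composition: first `σ`, then `τ`. -/
def trans {𝒳 𝒴 𝒵 : BasedCategory.{0, 1} (CommAlgCat.{0} ℂ)} (σ : StackIso 𝒳 𝒴)
    (τ : StackIso 𝒴 𝒵) : StackIso 𝒳 𝒵 where
  functor := BasedFunctor.comp σ.functor τ.functor
  isEquivalence :=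
    haveI := σ.isEquivalence
    haveI := τ.isEquivalence
    inferInstanceAs (σ.functor.toFunctor ⋙ τ.functor.toFunctor).IsEquivalence

end StackIso

section Transforms

variable {C : SmoothProjCurve} {n : ℕ} {t : Fin n → C.Pt} {r : ℕ}

/-- Forgetting the flags. -/
def forgetFlags (t : Fin n → C.Pt) {r : ℕ} (lam : Fin n → Fin r → ℂ) :
    BasedFunctor (parStack t lam) (LogConn.based t r) where
  obj X := X.toLogConn
  map f := f.hom
  w := rfl

/-- `σ` is the transform `a_i` for a rearrangement `ν` of `λ` at `t_i`: `σ(E, ∇, l) = (E, ∇, l')`,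
where `l'` agrees with `l` away from `t_i`, and where for every `c ∈ ℂ` the filtrations induced by
`l^{(i)}` and `l'^{(i)}` on the generalized `c`-eigenspace of `res_{t_i}(∇)` agree (up to
repetitions, the indices being matched by the number of times `c` has occurred so far). -/
def IsPermutation (i : Fin n) {lam nu : Fin n → Fin r → ℂ}
    (σ : StackIso (parStack t lam) (parStack t nu)) : Prop :=
  (∃ π : Equiv.Perm (Fin r), ∀ j, nu i j = lam i (π j)) ∧ (∀ i' ≠ i, nu i' = lam i') ∧
  ∃ ι : BasedFunctor.comp σ.functor (forgetFlags t nu) ⟶ forgetFlags t lam,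
    ∀ X : ParConn t lam,
      let Y : ParConn t nu := σ.functor.obj X
      let f : Y.toLogConn ⟶ X.toLogConn := ι.toNatTrans.app X
      ∀ U, Function.Bijective (f.app U) ∧
        (∀ i' ≠ i, ∀ q, ∀ m, m ∈ Y.L i' q U ↔ f.app U m ∈ X.L i' q U) ∧
        ∀ (c : ℂ) (p q : Fin (r + 1)),
          (Finset.univ.filter fun s : Fin r => s.castSucc < p ∧ lam i s = c).card =
            (Finset.univ.filter fun s : Fin r => s.castSucc < q ∧ nu i s = c).card →
          ∀ m ∈ Y.toLogConn.genEigen i c U r, m ∈ Y.L i q U ↔ f.app U m ∈ X.L i p U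

/-- The relation `Y = X ⊗ 𝒪_C(t_i)`, realised by the inclusion `f : X → Y`: the map `f` identifies
`X`, its connection and its flags with `Y ⊗ 𝒪_C(-t_i)`, i.e. with `I_{t_i} Y`. -/
def IsTwistPair (i : Fin n) {lam nu : Fin n → Fin r → ℂ} (X : ParConn t lam) (Y : ParConn t nu)
    (f : X.toLogConn ⟶ Y.toLogConn) : Prop :=
  ∀ U, Function.Injective (f.app U) ∧
    Set.range (f.app U) = (Y.E.vanishing (t i) U : Set (Y.M U)) ∧
    ∀ i' q, f.app U '' (X.L i' q U : Set (X.M U)) =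
      ((ptIdeal (t i) U).map (algebraMap (C.𝒪 U) (OA Y.A U)) • Y.L i' q U :
        Submodule (OA Y.A U) (Y.M U))

/-- `σ` is the transform `b_i`, i.e. tensoring with `𝒪_C(t_i)`. -/
def IsTwist (i : Fin n) {lam nu : Fin n → Fin r → ℂ}
    (σ : StackIso (parStack t lam) (parStack t nu)) : Prop :=
  (∀ j, nu i j = lam i j - 1) ∧ (∀ i' ≠ i, nu i' = lam i') ∧
  ∃ ι : forgetFlags t lam ⟶ BasedFunctor.comp σ.functor (forgetFlags t nu),
    ∀ X : ParConn t lam, IsTwistPair i X (σ.functor.obj X) (ι.toNatTrans.app X)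

/-- `σ` is the transform `b_i⁻¹`, i.e. tensoring with `𝒪_C(-t_i)`. -/
def IsUntwist (i : Fin n) {lam nu : Fin n → Fin r → ℂ}
    (σ : StackIso (parStack t lam) (parStack t nu)) : Prop :=
  (∀ j, nu i j = lam i j + 1) ∧ (∀ i' ≠ i, nu i' = lam i') ∧
  ∃ ι : BasedFunctor.comp σ.functor (forgetFlags t nu) ⟶ forgetFlags t lam,
    ∀ X : ParConn t lam, IsTwistPair i (σ.functor.obj X) X (ι.toNatTrans.app X)

/-- `σ` is the elementary transform along `t_i` by `l^{(i)}_j`: `E' = ker (E → E|_{t_i} / l_j)` with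
the induced connection; the flag `l'` at `t_i` consists of the preimages of `l_j ⊃ ⋯ ⊃ l_r` under
`E'|_{t_i} → E|_{t_i}` followed by the images of `l_0(-t_i) ⊃ ⋯ ⊃ l_j(-t_i)` under
`E(-t_i)|_{t_i} → E'|_{t_i}`; the flags at the other points are unchanged. -/
def IsElementary (i : Fin n) (j : Fin r) {lam nu : Fin n → Fin r → ℂ}
    (σ : StackIso (parStack t lam) (parStack t nu)) : Prop :=
  (∀ p q : Fin r, (p : ℕ) = q + j → nu i q = lam i p) ∧
  (∀ p q : Fin r, (p : ℕ) + r = q + j → nu i q = lam i p + 1) ∧ (∀ i' ≠ i, nu i' = lam i') ∧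
  ∃ ι : BasedFunctor.comp σ.functor (forgetFlags t nu) ⟶ forgetFlags t lam,
    ∀ X : ParConn t lam,
      let Y : ParConn t nu := σ.functor.obj X
      let f : Y.toLogConn ⟶ X.toLogConn := ι.toNatTrans.app X
      ∀ U, Function.Injective (f.app U) ∧
        Set.range (f.app U) = (X.L i j.castSucc U : Set (X.M U)) ∧
        (∀ p q : Fin (r + 1), (p : ℕ) = q + j →
          ∀ m, m ∈ Y.L i q U ↔ f.app U m ∈ X.L i p U) ∧
        (∀ p q : Fin (r + 1), (p : ℕ) + r = q + j → f.app U '' (Y.L i q U : Set (Y.M U)) =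
          ((ptIdeal (t i) U).map (algebraMap (C.𝒪 U) (OA X.A U)) • X.L i p U :
            Submodule (OA X.A U) (X.M U))) ∧
        ∀ i' ≠ i, ∀ q, ∀ m, m ∈ Y.L i' q U ↔ f.app U m ∈ X.L i' q U

/-- The isomorphisms of moduli stacks obtained by composing transforms `a_i`, `b_i`, `b_i⁻¹` and
elementary transforms. -/
inductive IsComposite (t : Fin n → C.Pt) : ∀ {lam nu : Fin n → Fin r → ℂ},
    StackIso (parStack t lam) (parStack t nu) → Prop
  | refl (lam : Fin n → Fin r → ℂ) : IsComposite t (StackIso.refl (parStack t lam))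
  | permutation {lam nu : Fin n → Fin r → ℂ} (i : Fin n)
      (σ : StackIso (parStack t lam) (parStack t nu)) : IsPermutation i σ → IsComposite t σ
  | twist {lam nu : Fin n → Fin r → ℂ} (i : Fin n)
      (σ : StackIso (parStack t lam) (parStack t nu)) : IsTwist i σ → IsComposite t σ
  | untwist {lam nu : Fin n → Fin r → ℂ} (i : Fin n)
      (σ : StackIso (parStack t lam) (parStack t nu)) : IsUntwist i σ → IsComposite t σ
  | elementary {lam nu : Fin n → Fin r → ℂ} (i : Fin n) (j : Fin r)
      (σ : StackIso (parStack t lam) (parStack t nu)) : IsElementary i j σ → IsComposite t σ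
  | trans {lam nu mu : Fin n → Fin r → ℂ} (σ : StackIso (parStack t lam) (parStack t nu))
      (τ : StackIso (parStack t nu) (parStack t mu)) :
      IsComposite t σ → IsComposite t τ → IsComposite t (σ.trans τ)

end Transforms

/-- The parameter space `Λ_r^{(n)}(d)`. -/
def exponents (n r : ℕ) (d : ℤ) : Set (Fin n → Fin r → ℂ) :=
  {lam | (d : ℂ) + ∑ i, ∑ j, lam i j = 0}

/-- The map `rh` sending the exponents to the coefficients `a^{(i)}_j`, `0 ≤ j ≤ r - 1`, of the
polynomials `∏_j (X - exp(-2π√-1 λ^{(i)}_j))`. -/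
def rh {n r : ℕ} (lam : Fin n → Fin r → ℂ) : Fin n → Fin r → ℂ := fun i j =>
  (∏ k : Fin r, (Polynomial.X -
    Polynomial.C (Complex.exp (-2 * Real.pi * Complex.I * lam i k)))).coeff j

end

/-! Both parts follow from one fact about a single row of exponents: composites of the transforms
carry v ∈ ℂ^r to v ∘ π + m for every permutation π and every m ∈ ℤ^r. For (1) take m = -⌊Re λ⌋. For
(2), monic polynomials with the same coefficients have the same roots, so after a permutation the
two rows have equal exponentials and differ by integers.

The moves on a row are these. Tensoring with 𝒪(t_i) subtracts 1 from every entry. Distinct adjacent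
entries are exchanged by a_i (equal ones need nothing), and adjacent transpositions generate all
permutations. The elementary transform along l_1 sends (v_0, …, v_{r-1}) to (v_1, …, v_{r-1}, v_0 +
1), which is permuted back to v + e_0; see `RowReach.add_single` and `RowReach.add_int`.

The substance is that the transforms exist in families over arbitrary ℂ-algebras and are
equivalences of categories over the base. Three mechanisms carry this.

(a) Vector bundles. Since the quotients of the flag are line bundles, each step l_j is a direct
summand of E up to an error in I_{t_i}E (`ParConn.exists_projection`). As I_{t_i} is invertible,
there are f_a ∈ I_{t_i} and sections j_a of 𝒪(t_i) with Σ f_a j_a = 1 (`exists_twist_partition`).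
Together these make l_j a retract of finitely many copies of E, compatibly with restriction and with
change of base, so l_j is a vector bundle and commutes with base change without any flatness
(`isBaseChange_of_retract`). The same device handles E ⊗ 𝒪(t_i).

(b) Connections. A residue independent of coordinates is defined on E ⊗ Ω¹(D) with values in
E|_{t_i} (`LogConn.isResidue_iff`). A section whose residue lies in l_j comes from l_j ⊗ Ω¹(D), so
the connection restricts to l_j. The residue of j df is the value of fj, and this accounts for the
shifts of exponents by ±1.

(c) Equivalences. Continue the flag by l_{k+r} = l_k(-t_i). An elementary transform along l_j then
shifts the index by j, so the transforms along l_j and l_{r-j} compose to tensoring with 𝒪(-t_i).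
The latter is an equivalence, because E ⊗ 𝒪(t_i) provides preimages and morphisms extend from
E(-t_i) to E. Hence every elementary transform is an equivalence (`elmFunctor_isEquivalence`).

To exchange adjacent exponents at a and b = a + 1, the step l_b is replaced by the kernel of res -
λ_a on l_a modulo l_{b+1}. It is complementary to l_b in l_a / l_{b+1}, and it equals (res - λ_b)
l_a + l_{b+1}, which gives base change. Exchanging twice is the identity. Since res acts on l_j /
l_{j+1} as λ_j, generalized c-eigensections do not see the steps with λ_j ≠ c, so the exchange is of
the type required of a_i. -/

open CategoryTheory AlgebraicGeometry TensorProduct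

noncomputable section

/-! ### Differentials and uniformizers of a local ring with residue field `k` -/

section LocalDifferentials

open IsLocalRing

variable {k O : Type} [Field k] [CommRing O] [IsLocalRing O] [Algebra k O]

/-- The derivation `f ↦ f - f(t)` into the cotangent space at a rational point. -/
def cotangentDerivation (ev : O →ₐ[k] k) (hev : RingHom.ker ev = maximalIdeal O) :
    Derivation k O (maximalIdeal O).Cotangent where
  toFun f := (maximalIdeal O).toCotangent ⟨f - algebraMap k O (ev f), by
    rw [← hev, RingHom.mem_ker]; simp⟩
  map_add' f g := by
    rw [← map_add]; congr 1; ext; simp; ring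
  map_smul' c f := by
    rw [RingHom.id_apply, ← algebraMap_smul O c ((maximalIdeal O).toCotangent _), ← map_smul]
    congr 1
    ext
    simp [Algebra.smul_def, mul_sub]
  map_one_eq_zero' := by
    rw [← map_zero (maximalIdeal O).toCotangent]
    exact congrArg _ (Subtype.ext (by simp))
  leibniz' f g := by
    have hf : f - algebraMap k O (ev f) ∈ maximalIdeal O := by
      rw [← hev, RingHom.mem_ker]; simp
    have hg : g - algebraMap k O (ev g) ∈ maximalIdeal O := by
      rw [← hev, RingHom.mem_ker]; simp
    change (maximalIdeal O).toCotangent _ = f • (maximalIdeal O).toCotangent _ +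
      g • (maximalIdeal O).toCotangent _
    rw [← map_smul, ← map_smul, ← map_add, Ideal.toCotangent_eq]
    -- Up to sign the two sides of the Leibniz rule differ by (f - f(t))(g - g(t)), which lies in
    -- the square of the maximal ideal.
    have := Ideal.mul_mem_mul hf hg
    rw [← pow_two] at this
    rw [← neg_mem_iff]
    convert this using 1
    simp
    ring

theorem cotangentDerivation_apply (ev : O →ₐ[k] k) (hev : RingHom.ker ev = maximalIdeal O)
    {f : O} (hf : f ∈ maximalIdeal O) :
    cotangentDerivation ev hev f = (maximalIdeal O).toCotangent ⟨f, hf⟩ := by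
  change (maximalIdeal O).toCotangent _ = _
  congr 1
  ext
  rw [← hev, RingHom.mem_ker] at hf
  simp [hf]

/-- The cotangent space is spanned by one vector: the linear map attached to `cotangentDerivation`
sends dw to the class of w, and dw is a multiple of η. -/
theorem maximalIdeal_isPrincipal_of_span_kaehler [IsDomain O] [IsNoetherianRing O]
    (ev : O →ₐ[k] k) (hev : RingHom.ker ev = maximalIdeal O) (η : Ω[O⁄k])
    (hη : Submodule.span O {η} = ⊤) : (maximalIdeal O).IsPrincipal := by
  rw [← finrank_cotangentSpace_le_one_iff]
  set L := (cotangentDerivation ev hev).liftKaehlerDifferential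
  refine finrank_le_one (R := ResidueField O) (M := CotangentSpace O) (L η) fun w => ?_
  obtain ⟨⟨w, hw⟩, rfl⟩ := (maximalIdeal O).toCotangent_surjective w
  have : KaehlerDifferential.D k O w ∈ Submodule.span O {η} := hη ▸ Submodule.mem_top
  obtain ⟨u, hu⟩ := Submodule.mem_span_singleton.mp this
  refine ⟨residue O u, ?_⟩
  have h2 := cotangentDerivation_apply ev hev hw
  rw [← h2, ← Derivation.liftKaehlerDifferential_comp_D, ← hu, map_smul]
  rfl

/-- With dz = uη it suffices that u is a unit. Otherwise the class of z in the cotangent space,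
being the image of dz, would vanish, and z ∈ (z²) contradicts z ≠ 0 and z being a non-unit. -/
theorem exists_D_eq_smul_D [IsDomain O] (ev : O →ₐ[k] k) (hev : RingHom.ker ev = maximalIdeal O)
    (η : Ω[O⁄k]) (hη : Submodule.span O {η} = ⊤) {z : O} (hz : maximalIdeal O = Ideal.span {z})
    (hz0 : z ≠ 0) (f : O) : ∃ h : O, KaehlerDifferential.D k O f = h • KaehlerDifferential.D k O z := by
  have hs : ∀ w, ∃ u : O, u • η = KaehlerDifferential.D k O w := fun w =>
    Submodule.mem_span_singleton.mp (hη ▸ Submodule.mem_top)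
  obtain ⟨u, hu⟩ := hs z
  obtain ⟨v, hv⟩ := hs f
  have hzm : z ∈ maximalIdeal O := hz ▸ Ideal.mem_span_singleton_self z
  have hun : IsUnit u := by
    by_contra hun
    have hum : u ∈ maximalIdeal O := hun
    have h2 := cotangentDerivation_apply ev hev hzm
    rw [← Derivation.liftKaehlerDifferential_comp_D, ← hu, map_smul] at h2
    obtain ⟨⟨y, hy⟩, hy'⟩ := (maximalIdeal O).toCotangent_surjective
      ((cotangentDerivation ev hev).liftKaehlerDifferential η)
    rw [← hy', ← map_smul] at h2
    have h3 : u * y - z ∈ maximalIdeal O ^ 2 := (Ideal.toCotangent_eq _).mp h2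
    have h4 : z ∈ maximalIdeal O ^ 2 := by
      have := Ideal.mul_mem_mul hum hy
      rw [← pow_two] at this
      have := sub_mem this h3
      simpa using this
    rw [hz, Ideal.span_singleton_pow, Ideal.mem_span_singleton] at h4
    obtain ⟨c, hc⟩ := h4
    have h5 : z * (1 - z * c) = 0 := by linear_combination hc
    rcases mul_eq_zero.mp h5 with h | h
    · exact hz0 h
    · have : z * c = 1 := (sub_eq_zero.mp h).symm
      exact (mem_maximalIdeal z).mp hzm (IsUnit.of_mul_eq_one c this)
  obtain ⟨u, rfl⟩ := hun
  refine ⟨v * (↑u⁻¹ : O), ?_⟩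
  rw [← hu, ← hv, smul_smul, mul_assoc, Units.inv_mul, mul_one]

theorem exists_span_kaehler_of_isStandardSmooth {R : Type} [CommRing R] [Nontrivial R] [Algebra k R]
    [Algebra.IsStandardSmoothOfRelativeDimension 1 k R] :
    ∃ η : Ω[R⁄k], Submodule.span R {η} = ⊤ ∧ LinearIndependent R (fun _ : Unit => η) := by
  have : Algebra.IsStandardSmooth k R :=
    Algebra.IsStandardSmoothOfRelativeDimension.isStandardSmooth 1
  have h1 := Algebra.IsStandardSmoothOfRelativeDimension.rank_kaehlerDifferential (R := k) (S := R) 1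
  have h2 : Module.finrank R Ω[R⁄k] = 1 := by
    rw [Module.finrank, h1]; simp
  let b := Module.basisUnique Unit h2
  refine ⟨b (), ?_, ?_⟩
  · rw [← b.span_eq]; congr 1; ext ω
    exact ⟨fun h => ⟨(), h.symm⟩, fun ⟨_, h⟩ => h.symm⟩
  · exact b.linearIndependent

theorem exists_span_kaehler_localization {R : Type} [CommRing R] [Algebra k R]
    {T : Type} [CommRing T] [Algebra k T] [Algebra R T] [IsScalarTower k R T] (M : Submonoid R)
    [IsLocalization M T] {η : Ω[R⁄k]} (h : Submodule.span R {η} = ⊤) :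
    Submodule.span T {KaehlerDifferential.map k k R T η} = ⊤ := by
  rw [eq_top_iff]
  rintro ω -
  obtain ⟨⟨x, s⟩, hx⟩ := IsLocalizedModule.surj M (KaehlerDifferential.map k k R T) ω
  obtain ⟨u, rfl⟩ := Submodule.mem_span_singleton.mp (h ▸ Submodule.mem_top : x ∈ Submodule.span R {η})
  rw [Submodule.mem_span_singleton]
  refine ⟨IsLocalization.mk' T u s, ?_⟩
  have hu : IsUnit (algebraMap R T s) := IsLocalization.map_units T s
  apply hu.smul_left_cancel.mp
  rw [smul_smul, IsLocalization.mk'_spec', algebraMap_smul, algebraMap_smul, ← map_smul]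
  exact hx.symm

/-- An element of the kernel of Ω_R → Ω_T is killed by a non-zero-divisor of R, which linear
independence of η excludes. -/
theorem kaehler_map_ne_zero {R : Type} [CommRing R] [IsDomain R] [Algebra k R]
    {T : Type} [CommRing T] [Algebra k T] [Algebra R T] [IsScalarTower k R T]
    [IsFractionRing R T] {η : Ω[R⁄k]} (h : LinearIndependent R (fun _ : Unit => η)) :
    KaehlerDifferential.map k k R T η ≠ 0 := by
  intro h0
  obtain ⟨c, hc⟩ := (IsLocalizedModule.eq_zero_iff (nonZeroDivisors R) (KaehlerDifferential.map k k R T)).mp h0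
  have h2 := (linearIndependent_iff'.mp h) {()} (fun _ => (c : R))
    (by rw [Finset.sum_singleton]; exact hc) () (by simp)
  exact nonZeroDivisors.coe_ne_zero c h2

end LocalDifferentials

/-! ### Stalks at closed points: residue field ℂ and discrete valuation rings -/

namespace SmoothProjCurve

variable (C : SmoothProjCurve)
instance : IsProper C.toSpec := C.proper
instance : IsLocallyNoetherian C.X := LocallyOfFiniteType.isLocallyNoetherian C.toSpec
instance : JacobsonSpace C.X := LocallyOfFiniteType.jacobsonSpace C.toSpec

variable {C}
abbrev Stalk (x : C.X) : Type := C.X.presheaf.stalk x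

instance (x : C.X) : Algebra ℂ (Stalk x) :=
  ((C.X.presheaf.germ ⊤ x trivial).hom.comp (C.const ⊤)).toAlgebra

instance (x : C.X) : IsScalarTower ℂ (Stalk x) C.K :=
  IsScalarTower.of_algebraMap_eq fun c =>
    (Scheme.algebraMap_germ_eq_germToFunctionField (X := C.X) (U := ⊤) (x := x)
      (Set.mem_univ x) (C.const ⊤ c)).symm

/-- The algebra structure on a stalk is defined through global constants. Identifying it with the
one coming from the structure morphism makes general results on residue fields applicable. -/
theorem fromSpecStalk_toSpec (x : C.X) :
    C.X.fromSpecStalk x ≫ C.toSpec = Spec.map (CommRingCat.ofHom (algebraMap ℂ (Stalk x))) := by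
  have h1 : C.toSpec = C.X.toSpecΓ ≫ Spec.map C.toSpec.appTop ≫
      Spec.map (Scheme.ΓSpecIso (CommRingCat.of ℂ)).inv := by
    rw [← Scheme.toSpecΓ_naturality_assoc, ← SpecMap_ΓSpecIso_hom, ← Spec.map_comp,
      Iso.inv_hom_id, Spec.map_id, Category.comp_id]
  rw [h1, Scheme.fromSpecStalk_toSpecΓ_assoc, ← Spec.map_comp, ← Spec.map_comp]
  congr 1
  ext c
  change _ = C.X.presheaf.germ ⊤ x trivial (C.const ⊤ c)
  simp [const]

/-- This is the Nullstellensatz at a closed point, contained in `residueFieldIsoBase`; what remains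
is that the isomorphism given there is the structure map. -/
theorem bijective_residue (x : C.X) (hx : IsClosed {x}) :
    Function.Bijective (algebraMap ℂ (IsLocalRing.ResidueField (Stalk x))) := by
  have h := SpecMap_residueFieldIsoBase_inv C.toSpec x hx
  rw [Scheme.fromSpecResidueField, Category.assoc, fromSpecStalk_toSpec, ← Spec.map_comp] at h
  have h2 : (residueFieldIsoBase C.toSpec x hx).inv.hom =
      algebraMap ℂ (IsLocalRing.ResidueField (Stalk x)) :=
    congrArg CommRingCat.Hom.hom (Spec.map_injective h)
  rw [← h2]
  exact (ConcreteCategory.isIso_iff_bijective (residueFieldIsoBase C.toSpec x hx).inv).mp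
    inferInstance

/-- Evaluation at a closed point. -/
def stalkEval (x : C.X) (hx : IsClosed {x}) : Stalk x →ₐ[ℂ] ℂ :=
  ((AlgEquiv.ofBijective (Algebra.ofId ℂ (IsLocalRing.ResidueField (Stalk x)))
    (bijective_residue x hx)).symm : _ →ₐ[ℂ] ℂ).comp
    (IsScalarTower.toAlgHom ℂ (Stalk x) (IsLocalRing.ResidueField (Stalk x)))

theorem ker_stalkEval (x : C.X) (hx : IsClosed {x}) :
    RingHom.ker (stalkEval x hx) = IsLocalRing.maximalIdeal (Stalk x) := by
  ext f
  rw [RingHom.mem_ker, ← IsLocalRing.residue_eq_zero_iff]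
  simp [stalkEval]

instance (U : C.AffOpen) : IsFractionRing (C.𝒪 U) C.K :=
  functionField_isFractionRing_of_isAffineOpen C.X U.1.1 U.1.2

instance (U : C.AffOpen) : IsNoetherianRing (C.𝒪 U) :=
  IsLocallyNoetherian.component_noetherian U.1

instance (U : C.AffOpen) : IsDomain (C.𝒪 U) := inferInstance

/-- Smoothness provides an affine neighbourhood whose differentials are free of rank one. The
generator still generates over the stalk and stays nonzero over the function field. -/
theorem exists_stalk_kaehler (x : C.X) :
    (∃ η : Ω[Stalk x⁄ℂ], Submodule.span (Stalk x) {η} = ⊤) ∧ Nontrivial (Ω[C.K⁄ℂ]) := by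
  obtain ⟨U, hU, V, hV, hx, e, h⟩ :=
    C.smooth.exists_isStandardSmoothOfRelativeDimension x
  obtain ⟨W, rfl⟩ : ∃ W : C.AffOpen, W.1.1 = V := ⟨⟨⟨V, hV⟩, ⟨⟨x, hx⟩⟩⟩, rfl⟩
  have hW : Algebra.IsStandardSmoothOfRelativeDimension 1 ℂ (C.𝒪 W) := by
    -- `Spec ℂ` has a single point, so the affine open of the base is everything and the smoothness
    -- statement is over ℂ itself.
    obtain rfl : U = ⊤ := by
      ext y
      have : Subsingleton (Spec (CommRingCat.of ℂ)) :=
        inferInstanceAs (Subsingleton (PrimeSpectrum ℂ))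
      rw [Subsingleton.elim y (C.toSpec x)]
      exact ⟨fun _ => trivial, fun _ => e hx⟩
    have h1 := RingHom.IsStandardSmoothOfRelativeDimension.comp h
      (RingHom.IsStandardSmoothOfRelativeDimension.equiv
        (Scheme.ΓSpecIso (CommRingCat.of ℂ)).symm.commRingCatIsoToRingEquiv)
    have h2 : (C.toSpec.appLE ⊤ W.1.1 e).hom.comp
      (((Scheme.ΓSpecIso (CommRingCat.of ℂ)).symm.commRingCatIsoToRingEquiv) : ℂ →+* _) =
        C.const W.1.1 := rfl
    rw [h2] at h1
    exact h1
  obtain ⟨η, h1, h2⟩ := exists_span_kaehler_of_isStandardSmooth (k := ℂ) (R := C.𝒪 W)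
  constructor
  · let := C.X.presheaf.algebra_section_stalk (⟨x, hx⟩ : W.1.1)
    have := hV.isLocalization_stalk ⟨x, hx⟩
    have : IsScalarTower ℂ (C.𝒪 W) (Stalk x) := IsScalarTower.of_algebraMap_eq fun c => by
      change C.X.presheaf.germ ⊤ x trivial (C.const ⊤ c) =
        C.X.presheaf.germ W.1.1 x hx (C.const W.1.1 c)
      rw [← C.rest_const (le_top : W.1.1 ≤ ⊤) c]
      exact (C.X.presheaf.germ_res_apply (homOfLE le_top) x hx _).symm
    exact ⟨_, exists_span_kaehler_localization (hV.primeIdealOf ⟨x, hx⟩).asIdeal.primeCompl h1⟩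
  · exact ⟨_, 0, kaehler_map_ne_zero (T := C.K) h2⟩

theorem isPrincipal_stalk (x : C.X) (hx : IsClosed {x}) :
    (IsLocalRing.maximalIdeal (Stalk x)).IsPrincipal := by
  obtain ⟨⟨η, h⟩, -⟩ := exists_stalk_kaehler x
  exact maximalIdeal_isPrincipal_of_span_kaehler (stalkEval x hx) (ker_stalkEval x hx) η h

/-- If the maximal ideal were zero, every germ would be a constant, hence so would every fraction of
germs, and the differentials of the function field would vanish. -/
theorem maximalIdeal_stalk_ne_bot (x : C.X) (hx : IsClosed {x}) :
    IsLocalRing.maximalIdeal (Stalk x) ≠ ⊥ := by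
  intro h
  obtain ⟨-, h2⟩ := exists_stalk_kaehler x
  have hD : ∀ k : C.K, KaehlerDifferential.D ℂ C.K k = 0 := by
    intro k
    obtain ⟨a, b, hb, rfl⟩ := IsFractionRing.div_surjective (A := Stalk x) k
    have hc : ∀ f : Stalk x, algebraMap (Stalk x) C.K f = algebraMap ℂ C.K (stalkEval x hx f) := by
      intro f
      have : f - algebraMap ℂ (Stalk x) (stalkEval x hx f) ∈ RingHom.ker (stalkEval x hx) := by
        rw [RingHom.mem_ker]; simp
      rw [ker_stalkEval, h, Ideal.mem_bot, sub_eq_zero] at this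
      rw [IsScalarTower.algebraMap_apply ℂ (Stalk x) C.K, ← this]
    rw [hc, hc, ← map_div₀]
    exact Derivation.map_algebraMap _ _
  refine not_subsingleton (Ω[C.K⁄ℂ]) ?_
  rw [← Submodule.subsingleton_iff C.K, ← subsingleton_iff_bot_eq_top,
    ← KaehlerDifferential.span_range_derivation]
  symm
  rw [Submodule.span_eq_bot]
  rintro _ ⟨k, rfl⟩
  exact hD k

theorem isDiscreteValuationRing_stalk (x : C.X) (hx : IsClosed {x}) :
    IsDiscreteValuationRing (Stalk x) := by
  have := (IsDiscreteValuationRing.TFAE (Stalk x) (fun h => maximalIdeal_stalk_ne_bot x hx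
    (IsLocalRing.isField_iff_maximalIdeal_eq.mp h))).out 0 4
  exact this.mpr (isPrincipal_stalk x hx)

end SmoothProjCurve

/-! ### Local rings inside the function field, uniformizers, logarithmic coefficients -/

namespace SmoothProjCurve

variable {C : SmoothProjCurve}

/-- The local ring at a closed point, inside the function field. -/
def locRing (t : C.Pt) : Subalgebra ℂ C.K :=
  (IsScalarTower.toAlgHom ℂ (Stalk t.1) C.K).range

theorem mem_locRing {t : C.Pt} {k : C.K} :
    k ∈ locRing t ↔ ∃ s : Stalk t.1, algebraMap (Stalk t.1) C.K s = k := Iff.rfl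

/-- The local ring at a closed point is the stalk. -/
def stalkEquiv (t : C.Pt) : Stalk t.1 ≃ₐ[ℂ] locRing t :=
  AlgEquiv.ofInjective (IsScalarTower.toAlgHom ℂ (Stalk t.1) C.K)
    (IsFractionRing.injective (Stalk t.1) C.K)

theorem coe_stalkEquiv (t : C.Pt) (s : Stalk t.1) :
    (stalkEquiv t s : C.K) = algebraMap (Stalk t.1) C.K s := rfl

/-- Evaluation of a function at a closed point. -/
def ev (t : C.Pt) : locRing t →ₐ[ℂ] ℂ :=
  (stalkEval t.1 t.2).comp (stalkEquiv t).symm.toAlgHom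

theorem ev_stalkEquiv (t : C.Pt) (s : Stalk t.1) : ev t (stalkEquiv t s) = stalkEval t.1 t.2 s := by
  simp [ev]

/-- A generator z of the maximal ideal of the stalk works. For the last clause, dz generates the
differentials of the stalk, and this relation is pushed to the function field. -/
theorem exists_uniformizer (t : C.Pt) : ∃ z : locRing t, (z : C.K) ≠ 0 ∧ ev t z = 0 ∧
    (∀ k, ev t k = 0 → ∃ h, k = z * h) ∧
    ∀ k : locRing t, ∃ h : locRing t, KaehlerDifferential.D ℂ C.K k.1 =
      h.1 • KaehlerDifferential.D ℂ C.K z.1 := by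
  obtain ⟨z, hz⟩ := isPrincipal_stalk t.1 t.2
  change _ = Ideal.span {z} at hz
  have hz0 : z ≠ 0 := by
    rintro rfl
    exact maximalIdeal_stalk_ne_bot t.1 t.2 (by rw [hz]; simp)
  refine ⟨stalkEquiv t z, ?_, ?_, ?_, ?_⟩
  · rw [coe_stalkEquiv]
    exact fun h => hz0 ((IsFractionRing.injective (Stalk t.1) C.K) (h.trans (map_zero _).symm))
  · rw [ev_stalkEquiv, ← RingHom.mem_ker (f := stalkEval t.1 t.2), ker_stalkEval, hz]
    exact Ideal.mem_span_singleton_self z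
  · intro k hk
    obtain ⟨s, rfl⟩ := (stalkEquiv t).surjective k
    rw [ev_stalkEquiv, ← RingHom.mem_ker (f := stalkEval t.1 t.2), ker_stalkEval, hz,
      Ideal.mem_span_singleton] at hk
    obtain ⟨c, rfl⟩ := hk
    exact ⟨stalkEquiv t c, map_mul _ _ _⟩
  · intro k
    obtain ⟨s, rfl⟩ := (stalkEquiv t).surjective k
    obtain ⟨⟨η, hη⟩, -⟩ := exists_stalk_kaehler t.1
    obtain ⟨h, hh⟩ := exists_D_eq_smul_D (stalkEval t.1 t.2) (ker_stalkEval t.1 t.2) η hη hz hz0 s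
    refine ⟨stalkEquiv t h, ?_⟩
    have := congrArg (KaehlerDifferential.map ℂ ℂ (Stalk t.1) C.K) hh
    rw [map_smul, KaehlerDifferential.map_D, KaehlerDifferential.map_D] at this
    rw [coe_stalkEquiv, coe_stalkEquiv, this, coe_stalkEquiv, algebraMap_smul]

/-- A uniformizer at a closed point. -/
def unif (t : C.Pt) : locRing t := (exists_uniformizer t).choose

theorem unif_ne_zero (t : C.Pt) : (unif t : C.K) ≠ 0 := (exists_uniformizer t).choose_spec.1

theorem ev_unif (t : C.Pt) : ev t (unif t) = 0 := (exists_uniformizer t).choose_spec.2.1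

theorem exists_eq_unif_mul {t : C.Pt} {k : locRing t} (h : ev t k = 0) :
    ∃ h, k = unif t * h := (exists_uniformizer t).choose_spec.2.2.1 k h

theorem exists_D_eq {t : C.Pt} (k : locRing t) : ∃ h : locRing t, KaehlerDifferential.D ℂ C.K k.1 =
    h.1 • KaehlerDifferential.D ℂ C.K (unif t).1 := (exists_uniformizer t).choose_spec.2.2.2 k

theorem isUnit_of_ev_ne_zero {t : C.Pt} {k : locRing t} (h : ev t k ≠ 0) : IsUnit k := by
  obtain ⟨s, rfl⟩ := (stalkEquiv t).surjective k
  rw [ev_stalkEquiv] at h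
  have : s ∉ IsLocalRing.maximalIdeal (Stalk t.1) := by
    rwa [← ker_stalkEval t.1 t.2, RingHom.mem_ker]
  exact (IsLocalRing.notMem_maximalIdeal.mp this).map (stalkEquiv t)

/-- Differentials of germs are multiples of dz, and the quotient rule extends this to the function
field, which is the fraction field of the stalk. -/
theorem exists_eq_smul_D (t : C.Pt) (ω : Ω[C.K⁄ℂ]) :
    ∃ k : C.K, ω = k • KaehlerDifferential.D ℂ C.K (unif t).1 := by
  have : ω ∈ Submodule.span C.K (Set.range (KaehlerDifferential.D ℂ C.K)) :=
    KaehlerDifferential.span_range_derivation ℂ C.K ▸ Submodule.mem_top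
  have h2 : Submodule.span C.K (Set.range (KaehlerDifferential.D ℂ C.K)) ≤
      Submodule.span C.K {KaehlerDifferential.D ℂ C.K (unif t).1} := by
    rw [Submodule.span_le]
    rintro _ ⟨k, rfl⟩
    obtain ⟨a, b, hb, rfl⟩ := IsFractionRing.div_surjective (A := Stalk t.1) k
    have ha : ∀ a : Stalk t.1, KaehlerDifferential.D ℂ C.K (algebraMap (Stalk t.1) C.K a) ∈
        Submodule.span C.K {KaehlerDifferential.D ℂ C.K (unif t).1} := fun a => by
      obtain ⟨h, hh⟩ := exists_D_eq (stalkEquiv t a)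
      rw [coe_stalkEquiv] at hh
      exact Submodule.mem_span_singleton.mpr ⟨_, hh.symm⟩
    rw [SetLike.mem_coe, Derivation.leibniz_div]
    exact Submodule.smul_mem _ _ (sub_mem (Submodule.smul_mem _ _ (ha a))
      (Submodule.smul_mem _ _ (ha b)))
  obtain ⟨k, hk⟩ := Submodule.mem_span_singleton.mp (h2 this)
  exact ⟨k, hk.symm⟩

theorem D_unif_ne_zero (t : C.Pt) : KaehlerDifferential.D ℂ C.K (unif t).1 ≠ 0 := by
  intro h
  obtain ⟨-, h2⟩ := exists_stalk_kaehler t.1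
  obtain ⟨ω, hω⟩ := exists_ne (0 : Ω[C.K⁄ℂ])
  obtain ⟨k, hk⟩ := exists_eq_smul_D t ω
  exact hω (by rw [hk, h, smul_zero])

/-- The coefficient `k` in `ω = k dz / z`. -/
def logCoeff (t : C.Pt) : Ω[C.K⁄ℂ] →ₗ[C.K] C.K where
  toFun ω := (exists_eq_smul_D t ω).choose * (unif t).1
  map_add' a b := by
    rw [← add_mul]
    congr 1
    apply smul_left_injective C.K (D_unif_ne_zero t)
    simp only [add_smul]
    rw [← (exists_eq_smul_D t a).choose_spec, ← (exists_eq_smul_D t b).choose_spec,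
      ← (exists_eq_smul_D t (a + b)).choose_spec]
  map_smul' c a := by
    rw [RingHom.id_apply, smul_eq_mul, ← mul_assoc]
    congr 1
    apply smul_left_injective C.K (D_unif_ne_zero t)
    simp only [mul_smul]
    rw [← (exists_eq_smul_D t a).choose_spec, ← (exists_eq_smul_D t (c • a)).choose_spec]

theorem logCoeff_smul_D (t : C.Pt) (ω : Ω[C.K⁄ℂ]) :
    logCoeff t ω • KaehlerDifferential.D ℂ C.K (unif t).1 = (unif t).1 • ω := by
  conv_rhs => rw [(exists_eq_smul_D t ω).choose_spec]
  rw [smul_smul, mul_comm]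
  rfl

theorem logCoeff_D_unif (t : C.Pt) : logCoeff t (KaehlerDifferential.D ℂ C.K (unif t).1) = unif t := by
  apply smul_left_injective C.K (D_unif_ne_zero t)
  exact logCoeff_smul_D t _

/-- Since dk = h dz = (zh) dz/z, the coefficient is divisible by z. This is why exact differentials
of regular functions have no residue. -/
theorem logCoeff_D {t : C.Pt} (k : locRing t) :
    ∃ h : locRing t, logCoeff t (KaehlerDifferential.D ℂ C.K k.1) = (unif t * h : locRing t) := by
  obtain ⟨h, hh⟩ := exists_D_eq k
  refine ⟨h, ?_⟩
  rw [hh, map_smul, logCoeff_D_unif, smul_eq_mul, mul_comm]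
  rfl

/-! ### Functions on affine open subsets -/

theorem algebraMap_germ (U : C.AffOpen) {x : C.X} (hx : x ∈ U.1.1) (f : C.𝒪 U) :
    algebraMap (Stalk x) C.K (C.X.presheaf.germ U.1.1 x hx f) = algebraMap (C.𝒪 U) C.K f :=
  Scheme.algebraMap_germ_eq_germToFunctionField (X := C.X) hx f

theorem algebraMap_mem_locRing {t : C.Pt} {U : C.AffOpen} (ht : t.1 ∈ U.1.1) (f : C.𝒪 U) :
    algebraMap (C.𝒪 U) C.K f ∈ locRing t := ⟨_, algebraMap_germ U ht f⟩

/-- A function on an open subset, as an element of the local ring at a point. -/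
def toLoc {t : C.Pt} {U : C.AffOpen} (ht : t.1 ∈ U.1.1) : C.𝒪 U →+* locRing t :=
  (algebraMap (C.𝒪 U) C.K).codRestrict (locRing t) (algebraMap_mem_locRing ht)

@[simp] theorem coe_toLoc {t : C.Pt} {U : C.AffOpen} (ht : t.1 ∈ U.1.1) (f : C.𝒪 U) :
    (toLoc ht f : C.K) = algebraMap (C.𝒪 U) C.K f := rfl

theorem algebraMap_injective (U : C.AffOpen) : Function.Injective (algebraMap (C.𝒪 U) C.K) :=
  IsFractionRing.injective _ _

theorem mem_ptIdeal_iff_forall {t : C.Pt} {U : C.AffOpen} {f : C.𝒪 U} :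
    f ∈ ptIdeal t U ↔ ∀ p : PrimeSpectrum (C.𝒪 U), U.1.2.fromSpec p = t.1 → f ∈ p.asIdeal := by
  rw [ptIdeal, Scheme.IdealSheafData.vanishingIdeal_ideal, PrimeSpectrum.mem_vanishingIdeal]
  rfl

theorem ptIdeal_eq_top {t : C.Pt} {U : C.AffOpen} (ht : t.1 ∉ U.1.1) : ptIdeal t U = ⊤ := by
  rw [eq_top_iff]
  rintro f -
  rw [mem_ptIdeal_iff_forall]
  rintro p hp
  refine (ht ?_).elim
  rw [← hp]
  have : U.1.2.fromSpec p ∈ Set.range U.1.2.fromSpec := ⟨p, rfl⟩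
  rw [U.1.2.range_fromSpec] at this
  exact this

/-- The germ of f lies in the maximal ideal exactly when f lies in the prime of t, and the
injectivity of the affine chart makes that prime the only one over t. -/
theorem mem_ptIdeal {t : C.Pt} {U : C.AffOpen} (ht : t.1 ∈ U.1.1) {f : C.𝒪 U} :
    f ∈ ptIdeal t U ↔ ev t (toLoc ht f) = 0 := by
  have h1 : toLoc ht f = stalkEquiv t (C.X.presheaf.germ U.1.1 t.1 ht f) :=
    Subtype.ext (algebraMap_germ U ht f).symm
  rw [h1, ev_stalkEquiv, ← RingHom.mem_ker (f := stalkEval t.1 t.2), ker_stalkEval]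
  let := C.X.presheaf.algebra_section_stalk (⟨t.1, ht⟩ : U.1.1)
  have := U.1.2.isLocalization_stalk ⟨t.1, ht⟩
  have h2 : C.X.presheaf.germ U.1.1 t.1 ht f ∈ IsLocalRing.maximalIdeal (Stalk t.1) ↔
      f ∈ (U.1.2.primeIdealOf ⟨t.1, ht⟩).asIdeal :=
    IsLocalization.AtPrime.to_map_mem_maximal_iff _ (U.1.2.primeIdealOf ⟨t.1, ht⟩).asIdeal f
  rw [h2, mem_ptIdeal_iff_forall]
  constructor
  · exact fun h => h _ (U.1.2.fromSpec_primeIdealOf ⟨t.1, ht⟩)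
  · intro h p hp
    have h3 : p = U.1.2.primeIdealOf ⟨t.1, ht⟩ := by
      have := U.1.2.isOpenImmersion_fromSpec
      apply U.1.2.fromSpec.isOpenEmbedding.injective
      rw [hp]
      exact (U.1.2.fromSpec_primeIdealOf ⟨t.1, ht⟩).symm
    rwa [h3]

end SmoothProjCurve

/-! ### Affine open subsets: ideals of points, the Dedekind property, sections of 𝒪(t) -/

namespace SmoothProjCurve

variable {C : SmoothProjCurve}

theorem exists_affOpen_mem_range {t : C.Pt} {U : C.AffOpen} (ht : t.1 ∈ U.1.1) (k : locRing t) :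
    ∃ W : C.AffOpen, W ≤ U ∧ t.1 ∈ W.1.1 ∧ ∃ f : C.𝒪 W, algebraMap (C.𝒪 W) C.K f = k := by
  obtain ⟨s, hs⟩ := mem_locRing.mp k.2
  obtain ⟨V, hV, f, rfl⟩ := C.X.presheaf.exists_germ_eq s
  obtain ⟨W, hW, htW, hWV⟩ := exists_isAffineOpen_mem_and_subset (X := C.X) (U := U.1.1 ⊓ V)
    (x := t.1) ⟨ht, hV⟩
  refine ⟨⟨⟨W, hW⟩, ⟨⟨t.1, htW⟩⟩⟩, fun x hx => (hWV hx).1, htW,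
    C.X.presheaf.map (homOfLE fun x hx => (hWV hx).2).op f, ?_⟩
  refine (algebraMap_germ (C := C) ⟨⟨W, hW⟩, ⟨⟨t.1, htW⟩⟩⟩ htW _).symm.trans ?_
  rw [← hs]
  congr 1
  exact C.X.presheaf.germ_res_apply _ _ _ _

theorem exists_affOpen_forall_mem_range {t : C.Pt} {U : C.AffOpen} (ht : t.1 ∈ U.1.1)
    (s : Set C.K) (hs : s.Finite) (h : ∀ k ∈ s, k ∈ locRing t) :
    ∃ W : C.AffOpen, W ≤ U ∧ t.1 ∈ W.1.1 ∧ ∀ k ∈ s, ∃ f : C.𝒪 W, algebraMap (C.𝒪 W) C.K f = k := by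
  induction s, hs using Set.Finite.induction_on with
  | empty => exact ⟨U, le_refl U.1, ht, fun _ h => h.elim⟩
  | @insert a s _ _ ih =>
    obtain ⟨W, hWU, htW, hW⟩ := ih fun k hk => h k (Set.mem_insert_of_mem _ hk)
    obtain ⟨W', hWW, htW', f, hf⟩ := exists_affOpen_mem_range htW ⟨a, h a (Set.mem_insert _ _)⟩
    refine ⟨W', fun x hx => hWU (hWW hx), htW', ?_⟩
    rintro k (rfl | hk)
    · exact ⟨f, hf⟩
    · obtain ⟨g, rfl⟩ := hW k hk
      exact ⟨rest hWW g, algebraMap_rest hWW g⟩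

theorem ptIdeal_map {t : C.Pt} {U V : C.AffOpen} (h : U ≤ V) :
    (ptIdeal t V).map (rest h).toRingHom = ptIdeal t U :=
  (Scheme.IdealSheafData.vanishingIdeal ⟨{t.1}, t.2⟩).map_ideal (U := U.1) (V := V.1) h

theorem toLoc_rest {t : C.Pt} {U V : C.AffOpen} (h : U ≤ V) (htU : t.1 ∈ U.1.1) (f : C.𝒪 V) :
    toLoc htU (rest h f) = toLoc (show t.1 ∈ V.1.1 from h htU) f :=
  Subtype.ext (algebraMap_rest h f)

/-- Evaluation of functions at a point of an affine open subset. -/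
def evU {t : C.Pt} {U : C.AffOpen} (ht : t.1 ∈ U.1.1) : C.𝒪 U →ₐ[ℂ] ℂ where
  __ := (ev t).toRingHom.comp (toLoc ht)
  commutes' c := by
    change ev t (toLoc ht (algebraMap ℂ (C.𝒪 U) c)) = c
    have : toLoc ht (algebraMap ℂ (C.𝒪 U) c) = algebraMap ℂ (locRing t) c :=
      Subtype.ext (IsScalarTower.algebraMap_apply ℂ (C.𝒪 U) C.K c).symm
    rw [this, AlgHom.commutes]
    rfl

theorem evU_apply {t : C.Pt} {U : C.AffOpen} (ht : t.1 ∈ U.1.1) (f : C.𝒪 U) :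
    evU ht f = ev t (toLoc ht f) := rfl

theorem mem_ptIdeal_iff {t : C.Pt} {U : C.AffOpen} (ht : t.1 ∈ U.1.1) {f : C.𝒪 U} :
    f ∈ ptIdeal t U ↔ evU ht f = 0 := mem_ptIdeal ht

theorem ptIdeal_eq_ker {t : C.Pt} {U : C.AffOpen} (ht : t.1 ∈ U.1.1) :
    ptIdeal t U = RingHom.ker (evU ht) := by
  ext f; exact mem_ptIdeal_iff ht

theorem sub_evU_mem {t : C.Pt} {U : C.AffOpen} (ht : t.1 ∈ U.1.1) (f : C.𝒪 U) :
    f - algebraMap ℂ (C.𝒪 U) (evU ht f) ∈ ptIdeal t U := by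
  rw [mem_ptIdeal_iff ht]; simp

theorem evU_rest {t : C.Pt} {U V : C.AffOpen} (h : U ≤ V) (htU : t.1 ∈ U.1.1) (f : C.𝒪 V) :
    evU htU (rest h f) = evU (show t.1 ∈ V.1.1 from h htU) f := by
  rw [evU_apply, toLoc_rest]; rfl

theorem isMaximal_ptIdeal {t : C.Pt} {U : C.AffOpen} (ht : t.1 ∈ U.1.1) :
    (ptIdeal t U).IsMaximal := by
  rw [ptIdeal_eq_ker ht]
  exact RingHom.ker_isMaximal_of_surjective _ fun c => ⟨algebraMap ℂ _ c, by simp⟩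

theorem ptIdeal_sup_eq_top {t t' : C.Pt} (h : t ≠ t') (U : C.AffOpen) :
    ptIdeal t U ⊔ ptIdeal t' U = ⊤ := by
  by_cases ht : t.1 ∈ U.1.1
  · by_cases ht' : t'.1 ∈ U.1.1
    · refine Ideal.IsMaximal.coprime_of_ne (isMaximal_ptIdeal ht) (isMaximal_ptIdeal ht') ?_
      intro he
      apply h
      apply Subtype.ext
      have h1 := U.1.2.fromSpec_primeIdealOf ⟨t.1, ht⟩
      have h2 := U.1.2.fromSpec_primeIdealOf ⟨t'.1, ht'⟩
      have key : ∀ (s : C.Pt) (hs : s.1 ∈ U.1.1),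
          (U.1.2.primeIdealOf ⟨s.1, hs⟩).asIdeal = ptIdeal s U := by
        intro s hs
        symm
        refine (isMaximal_ptIdeal hs).eq_of_le (U.1.2.primeIdealOf ⟨s.1, hs⟩).2.ne_top ?_
        intro f hf
        exact mem_ptIdeal_iff_forall.mp hf _ (U.1.2.fromSpec_primeIdealOf ⟨s.1, hs⟩)
      have h3 : U.1.2.primeIdealOf ⟨t.1, ht⟩ = U.1.2.primeIdealOf ⟨t'.1, ht'⟩ :=
        PrimeSpectrum.ext (by rw [key t ht, key t' ht', he])
      rw [h3, h2] at h1
      exact h1.symm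
    · rw [ptIdeal_eq_top ht', sup_top_eq]
  · rw [ptIdeal_eq_top ht, top_sup_eq]

/-- If t ∈ U, write the uniformizer as a fraction of functions on U; its numerator is nonzero and
vanishes at t. -/
theorem ptIdeal_ne_bot (t : C.Pt) (U : C.AffOpen) : ptIdeal t U ≠ ⊥ := by
  by_cases ht : t.1 ∈ U.1.1
  · intro h0
    obtain ⟨a, b, hb, hab⟩ := IsFractionRing.div_surjective (A := C.𝒪 U) (unif t : C.K)
    have h1 : toLoc ht a = unif t * toLoc ht b := by
      ext
      have : algebraMap (C.𝒪 U) C.K b ≠ 0 := by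
        rw [map_ne_zero_iff _ (algebraMap_injective U)]; exact nonZeroDivisors.ne_zero hb
      change algebraMap (C.𝒪 U) C.K a = unif t * algebraMap (C.𝒪 U) C.K b
      rw [← hab, div_mul_cancel₀ _ this]
    have h2 : a ∈ ptIdeal t U := by
      rw [mem_ptIdeal ht, h1, map_mul, ev_unif, zero_mul]
    rw [h0, Ideal.mem_bot] at h2
    rw [h2, map_zero, zero_div] at hab
    exact unif_ne_zero t hab.symm
  · rw [ptIdeal_eq_top ht]; exact top_ne_bot

/-- A closed point of U is closed in C because C is a Jacobson space. So every maximal ideal of 𝒪(U)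
belongs to a closed point of the curve, where the stalk is known. -/
theorem exists_pt_of_isMaximal {U : C.AffOpen} (m : Ideal (C.𝒪 U)) [hm : m.IsMaximal] :
    ∃ (t : C.Pt) (ht : t.1 ∈ U.1.1), (U.1.2.primeIdealOf ⟨t.1, ht⟩).asIdeal = m := by
  let p : PrimeSpectrum (C.𝒪 U) := ⟨m, hm.isPrime⟩
  have hp : IsClosed ({p} : Set (PrimeSpectrum (C.𝒪 U))) :=
    (PrimeSpectrum.isClosed_singleton_iff_isMaximal p).mpr hm
  have := U.1.2.isOpenImmersion_fromSpec
  have hc : IsClosed {U.1.2.fromSpec p} := by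
    apply isClosed_singleton_of_isLocallyClosed_singleton
    have h1 := hp.isLocallyClosed.image U.1.2.fromSpec.isOpenEmbedding.isInducing
      U.1.2.fromSpec.isOpenEmbedding.isOpen_range.isLocallyClosed
    exact (Set.image_singleton (f := U.1.2.fromSpec) (a := p)) ▸ h1
  have hU : U.1.2.fromSpec p ∈ U.1.1 := by
    have : U.1.2.fromSpec p ∈ Set.range U.1.2.fromSpec := ⟨p, rfl⟩
    rw [U.1.2.range_fromSpec] at this
    exact this
  refine ⟨⟨_, hc⟩, hU, ?_⟩
  have : U.1.2.primeIdealOf ⟨_, hU⟩ = p := by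
    apply U.1.2.fromSpec.isOpenEmbedding.injective
    exact U.1.2.fromSpec_primeIdealOf ⟨_, hU⟩
  rw [this]

theorem isDiscreteValuationRing_localization {U : C.AffOpen} (m : Ideal (C.𝒪 U)) [m.IsMaximal] :
    IsDiscreteValuationRing (Localization.AtPrime m) := by
  obtain ⟨t, ht, rfl⟩ := exists_pt_of_isMaximal m
  let := C.X.presheaf.algebra_section_stalk (⟨t.1, ht⟩ : U.1.1)
  have := U.1.2.isLocalization_stalk ⟨t.1, ht⟩
  have := isDiscreteValuationRing_stalk t.1 t.2
  exact IsDiscreteValuationRing.RingEquivClass.isDiscreteValuationRing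
    (IsLocalization.algEquiv (U.1.2.primeIdealOf ⟨t.1, ht⟩).asIdeal.primeCompl (Stalk t.1)
      (Localization.AtPrime (U.1.2.primeIdealOf ⟨t.1, ht⟩).asIdeal))

/-- In the discrete valuation ring at a maximal ideal m containing P, the extension of P is a
nonzero prime, hence the maximal ideal; contracting back gives P = m. -/
theorem isMaximal_of_isPrime {U : C.AffOpen} {P : Ideal (C.𝒪 U)} (hP : P ≠ ⊥) (hP' : P.IsPrime) :
    P.IsMaximal := by
  obtain ⟨m, hm, hPm⟩ := Ideal.exists_le_maximal P hP'.ne_top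
  have := isDiscreteValuationRing_localization m
  have hd : Disjoint (m.primeCompl : Set (C.𝒪 U)) P :=
    Set.disjoint_left.mpr fun x hx hx' => hx (hPm hx')
  have h1 : (P.map (algebraMap _ (Localization.AtPrime m))).IsPrime :=
    IsLocalization.isPrime_of_isPrime_disjoint m.primeCompl _ P hP' hd
  have h2 := IsLocalization.under_map_of_isPrime_disjoint m.primeCompl (Localization.AtPrime m) hP' hd
  have h3 : P.map (algebraMap _ (Localization.AtPrime m)) ≠ ⊥ := by
    intro h
    rw [Ideal.map_eq_bot_iff_of_injective
      (IsLocalization.injective (Localization.AtPrime m) m.primeCompl_le_nonZeroDivisors)] at h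
    exact hP h
  have h4 := IsLocalRing.eq_maximalIdeal (h1.isMaximal h3)
  rw [h4] at h2
  have h5 := IsLocalization.AtPrime.under_maximalIdeal (Localization.AtPrime m) m
  rw [← h2, h5]
  exact hm

instance (U : C.AffOpen) : IsDedekindDomainDvr (C.𝒪 U) where
  is_dvr_at_nonzero_prime P hP hP' := by
    have := isMaximal_of_isPrime hP hP'
    exact isDiscreteValuationRing_localization P

instance (U : C.AffOpen) : IsDedekindDomain (C.𝒪 U) := IsDedekindDomainDvr.isDedekindDomain _

/-- The sections over `U` of `𝒪_C(t)`, inside the function field. -/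
def twistFun (t : C.Pt) (U : C.AffOpen) : Submodule (C.𝒪 U) C.K where
  carrier := {k | ∀ f ∈ ptIdeal t U, ∃ g, algebraMap (C.𝒪 U) C.K g = f • k}
  add_mem' ha hb f hf := by
    obtain ⟨g, hg⟩ := ha f hf
    obtain ⟨g', hg'⟩ := hb f hf
    exact ⟨g + g', by rw [map_add, hg, hg', smul_add]⟩
  zero_mem' f _ := ⟨0, by simp⟩
  smul_mem' a k h f hf := by
    obtain ⟨g, hg⟩ := h f hf
    exact ⟨a * g, by rw [map_mul, hg, smul_comm, Algebra.smul_def a]⟩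

/-- The product of a function vanishing at `t` and a section of `𝒪_C(t)`. -/
def twistMul {t : C.Pt} {U : C.AffOpen} (f : ptIdeal t U) (k : twistFun t U) : C.𝒪 U :=
  (k.2 f.1 f.2).choose

theorem algebraMap_twistMul {t : C.Pt} {U : C.AffOpen} (f : ptIdeal t U) (k : twistFun t U) :
    algebraMap (C.𝒪 U) C.K (twistMul f k) = algebraMap (C.𝒪 U) C.K f * k := by
  rw [twistMul, (k.2 f.1 f.2).choose_spec, Algebra.smul_def]

variable (C) in
-- This is the invertibility of I_t in the Dedekind domain 𝒪(U): 1 ∈ I_t · I_t⁻¹. The partition of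
-- unity replaces a local equation of t. Constructions are written as sums of operations with f_a
-- and j_a over all of U, without shrinking U until I_t is principal, and identities are checked
-- after multiplication by a nonzero element of I_t.
theorem exists_twist_partition (t : C.Pt) (U : C.AffOpen) :
    ∃ (m : ℕ) (f : Fin m → ptIdeal t U) (j : Fin m → twistFun t U), ∑ a, twistMul (f a) (j a) = 1 := by
  have hI := ptIdeal_ne_bot t U
  have h1 : (ptIdeal t U : FractionalIdeal (nonZeroDivisors (C.𝒪 U)) C.K) *
      (ptIdeal t U : FractionalIdeal (nonZeroDivisors (C.𝒪 U)) C.K)⁻¹ = 1 :=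
    mul_inv_cancel₀ (FractionalIdeal.coeIdeal_ne_zero.mpr hI)
  have h2 : (1 : C.K) ∈ (1 : FractionalIdeal (nonZeroDivisors (C.𝒪 U)) C.K) :=
    FractionalIdeal.one_mem_one _
  rw [← h1, ← FractionalIdeal.mem_coe, FractionalIdeal.coe_mul] at h2
  have h3 : ∀ x : C.K, x ∈ ((ptIdeal t U : FractionalIdeal (nonZeroDivisors (C.𝒪 U)) C.K) :
      Submodule (C.𝒪 U) C.K) * (((ptIdeal t U : FractionalIdeal (nonZeroDivisors (C.𝒪 U)) C.K)⁻¹ :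
        FractionalIdeal (nonZeroDivisors (C.𝒪 U)) C.K) : Submodule (C.𝒪 U) C.K) →
      ∃ (m : ℕ) (f : Fin m → ptIdeal t U) (j : Fin m → twistFun t U),
        x = ∑ a, algebraMap (C.𝒪 U) C.K (twistMul (f a) (j a)) := by
    intro x hx
    induction hx using Submodule.mul_induction_on' with
    | mem_mul_mem a ha b hb =>
      obtain ⟨f, hf, rfl⟩ := (FractionalIdeal.mem_coeIdeal _).mp ha
      have hb' : b ∈ twistFun t U := by
        intro g hg
        have := (FractionalIdeal.mem_inv_iff (FractionalIdeal.coeIdeal_ne_zero.mpr hI)).mp hb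
          (algebraMap _ _ g) (FractionalIdeal.mem_coeIdeal_of_mem _ hg)
        obtain ⟨y, hy⟩ := (FractionalIdeal.mem_one_iff _).mp this
        exact ⟨y, by rw [hy, Algebra.smul_def, mul_comm]⟩
      exact ⟨1, fun _ => ⟨f, hf⟩, fun _ => ⟨b, hb'⟩, by simp [algebraMap_twistMul]⟩
    | add a _ b _ ha hb =>
      obtain ⟨m, f, j, rfl⟩ := ha
      obtain ⟨m', f', j', rfl⟩ := hb
      refine ⟨m + m', Fin.append f f', Fin.append j j', ?_⟩
      rw [Fin.sum_univ_add]
      simp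
  obtain ⟨m, f, j, h⟩ := h3 1 h2
  refine ⟨m, f, j, algebraMap_injective U ?_⟩
  rw [map_sum, ← h, map_one]

end SmoothProjCurve

/-! ### Residues of logarithmic one-forms -/

namespace SmoothProjCurve

variable {C : SmoothProjCurve}

theorem exists_mul_eq_of_mem_locRing {t : C.Pt} {U : C.AffOpen} (hU : t.1 ∈ U.1.1) (k : locRing t) :
    ∃ a b : C.𝒪 U, evU hU b ≠ 0 ∧ k * toLoc hU b = toLoc hU a := by
  obtain ⟨s, hs⟩ := mem_locRing.mp k.2
  let := C.X.presheaf.algebra_section_stalk (⟨t.1, hU⟩ : U.1.1)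
  have := U.1.2.isLocalization_stalk ⟨t.1, hU⟩
  obtain ⟨⟨a, b⟩, hab⟩ := IsLocalization.surj
    (U.1.2.primeIdealOf ⟨t.1, hU⟩).asIdeal.primeCompl s
  refine ⟨a, b, ?_, ?_⟩
  · intro h
    rw [← mem_ptIdeal_iff hU, mem_ptIdeal_iff_forall] at h
    exact b.2 (h _ (U.1.2.fromSpec_primeIdealOf ⟨t.1, hU⟩))
  · ext
    have h1 := congrArg (algebraMap (Stalk t.1) C.K) hab
    rw [map_mul, hs] at h1
    exact (congrArg ((k : C.K) * ·) (algebraMap_germ U hU b).symm).trans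
      (h1.trans (algebraMap_germ U hU a))

theorem mul_mem_locRing {t : C.Pt} {U : C.AffOpen} (hU : t.1 ∈ U.1.1) (j : twistFun t U)
    {k : locRing t} (hk : ev t k = 0) : (j : C.K) * k ∈ locRing t := by
  obtain ⟨a, b, hb, hab⟩ := exists_mul_eq_of_mem_locRing hU k
  have ha : a ∈ ptIdeal t U := by rw [mem_ptIdeal_iff hU, evU_apply, ← hab, map_mul, hk, zero_mul]
  obtain ⟨u, hu⟩ := isUnit_of_ev_ne_zero hb
  have h1 : (j : C.K) * k = toLoc hU (twistMul ⟨a, ha⟩ j) * (↑u⁻¹ : locRing t) := by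
    have h2 : (u : C.K) * ((↑u⁻¹ : locRing t) : C.K) = 1 := congrArg Subtype.val u.mul_inv
    have h3 : (k : C.K) * (u : locRing t) = algebraMap (C.𝒪 U) C.K a := by
      rw [hu]; exact congrArg Subtype.val hab
    rw [coe_toLoc, algebraMap_twistMul, ← h3]
    linear_combination (-(j : C.K) * k) * h2
  rw [h1]
  exact (toLoc hU (twistMul ⟨a, ha⟩ j) * (↑u⁻¹ : locRing t)).2

theorem logCoeff_regDiff {t : C.Pt} {U : C.AffOpen} (hU : t.1 ∈ U.1.1) {ω : Ω[C.K⁄ℂ]}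
    (h : ω ∈ C.regDiff U) : ∃ h : locRing t, logCoeff t ω = (unif t * h : locRing t) := by
  induction h using Submodule.span_induction with
  | mem x hx =>
    obtain ⟨f, rfl⟩ := hx
    exact logCoeff_D (toLoc hU f)
  | zero => exact ⟨0, by simp⟩
  | add x y _ _ hx hy =>
    obtain ⟨a, ha⟩ := hx
    obtain ⟨b, hb⟩ := hy
    exact ⟨a + b, by rw [map_add, ha, hb, mul_add]; rfl⟩
  | smul f x _ hx =>
    obtain ⟨a, ha⟩ := hx
    refine ⟨toLoc hU f * a, ?_⟩
    rw [← algebraMap_smul C.K f x, map_smul, ha, ← coe_toLoc hU, smul_eq_mul, mul_left_comm]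
    rfl

section Div

variable {n : ℕ} {t : Fin n → C.Pt}

theorem mem_divSheaf {U : C.AffOpen} {f : C.𝒪 U} :
    f ∈ (divSheaf t).ideal U.1 ↔ ∀ i, f ∈ ptIdeal (t i) U := by
  simp only [mem_ptIdeal_iff_forall]
  rw [divSheaf, Scheme.IdealSheafData.vanishingIdeal_ideal, PrimeSpectrum.mem_vanishingIdeal]
  constructor
  · intro h i p hp
    exact h p (Set.mem_iUnion.mpr ⟨i, hp⟩)
  · intro h p hp
    obtain ⟨i, hi⟩ := Set.mem_iUnion.mp hp
    exact h i p hi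

/-- Here the points must be distinct: ideals of distinct points are coprime, and the product of the
functions obtained for the single points i' ≠ i has the desired property. -/
theorem exists_separating (ht : Function.Injective t) {i : Fin n} {U : C.AffOpen}
    (hU : (t i).1 ∈ U.1.1) :
    ∃ g : C.𝒪 U, evU hU g ≠ 0 ∧ ∀ i' ≠ i, g ∈ ptIdeal (t i') U := by
  have h1 : ∀ i' : Fin n, ∃ g : C.𝒪 U, evU hU g ≠ 0 ∧ (i' ≠ i → g ∈ ptIdeal (t i') U) := by
    intro i'
    by_cases h : i' = i
    · exact ⟨1, by simp, fun h' => (h' h).elim⟩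
    · have h2 := ptIdeal_sup_eq_top (ht.ne h) U
      have h3 : (1 : C.𝒪 U) ∈ ptIdeal (t i') U ⊔ ptIdeal (t i) U := h2 ▸ Submodule.mem_top
      obtain ⟨a, ha, b, hb, hab⟩ := Submodule.mem_sup.mp h3
      refine ⟨a, fun h0 => ?_, fun _ => ha⟩
      have := congrArg (evU hU) hab
      rw [map_add, h0, (mem_ptIdeal_iff hU).mp hb, map_one, add_zero] at this
      exact zero_ne_one this
  choose g hg hg' using h1
  refine ⟨∏ i', g i', ?_, fun i' hi' => ?_⟩
  · rw [map_prod]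
    exact Finset.prod_ne_zero_iff.mpr fun i' _ => hg i'
  · exact Ideal.mem_of_dvd _ (Finset.dvd_prod_of_mem g (Finset.mem_univ i')) (hg' i' hi')

/-- Multiply ω by a·g, where a = z b with b invertible at t_i and g vanishes at the other points but
not at t_i. The product is regular, so its coefficient is divisible by z; then cancel z and the
units b and g. -/
theorem logCoeff_logDiff (ht : Function.Injective t) {i : Fin n} {U : C.AffOpen}
    (hU : (t i).1 ∈ U.1.1) {ω : Ω[C.K⁄ℂ]} (h : ω ∈ logDiff t U) :
    logCoeff (t i) ω ∈ locRing (t i) := by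
  obtain ⟨a, b, hb, hab⟩ := exists_mul_eq_of_mem_locRing hU (unif (t i))
  obtain ⟨g, hg, hg'⟩ := exists_separating ht hU
  have ha : a ∈ ptIdeal (t i) U := by
    rw [mem_ptIdeal_iff hU, evU_apply, ← hab, map_mul, ev_unif, zero_mul]
  have h1 : a * g ∈ (divSheaf t).ideal U.1 := by
    rw [mem_divSheaf]
    intro i'
    by_cases h : i' = i
    · subst h; exact Ideal.mul_mem_right _ _ ha
    · exact Ideal.mul_mem_left _ _ (hg' i' h)
  obtain ⟨c, hc⟩ := logCoeff_regDiff hU (h _ h1)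
  obtain ⟨u, hu⟩ := isUnit_of_ev_ne_zero (k := toLoc hU (b * g))
    (by rw [map_mul, map_mul]; exact mul_ne_zero hb hg)
  have h2 : (u : C.K) * ((↑u⁻¹ : locRing (t i)) : C.K) = 1 := congrArg Subtype.val u.mul_inv
  have h4 : logCoeff (t i) ω = c * (↑u⁻¹ : locRing (t i)) := by
    rw [← algebraMap_smul C.K (a * g) ω, map_smul, ← coe_toLoc hU, map_mul, ← hab, smul_eq_mul] at hc
    have h5 : ((unif (t i) * toLoc hU b * toLoc hU g : locRing (t i)) : C.K) = unif (t i) * u := by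
      rw [hu, map_mul, mul_assoc]; rfl
    rw [h5, mul_assoc] at hc
    have h6 := mul_left_cancel₀ (unif_ne_zero (t i)) hc
    linear_combination (-logCoeff (t i) ω) * h2 + ((↑u⁻¹ : locRing (t i)) : C.K) * h6
  rw [h4]
  exact (c * (↑u⁻¹ : locRing (t i))).2

/-- The residue of a logarithmic form at `t_i`. -/
def resLog (ht : Function.Injective t) {i : Fin n} {U : C.AffOpen} (hU : (t i).1 ∈ U.1.1) :
    logDiff t U →+ ℂ where
  toFun ω := ev (t i) ⟨logCoeff (t i) ω.1, logCoeff_logDiff ht hU ω.2⟩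
  map_zero' := by
    rw [← map_zero (ev (t i))]; congr 1; ext; exact map_zero _
  map_add' a b := by
    rw [← map_add (ev (t i))]; congr 1; ext; exact map_add _ _ _

variable (ht : Function.Injective t) {i : Fin n}

theorem resLog_eq {U : C.AffOpen} (hU : (t i).1 ∈ U.1.1) (ω : logDiff t U) (k : locRing (t i))
    (hk : logCoeff (t i) ω.1 = k) : resLog ht hU ω = ev (t i) k :=
  congrArg (ev (t i)) (Subtype.ext hk)

theorem resLog_smul {U : C.AffOpen} (hU : (t i).1 ∈ U.1.1) (f : C.𝒪 U) (ω : logDiff t U) :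
    resLog ht hU (f • ω) = evU hU f * resLog ht hU ω := by
  rw [evU_apply, resLog_eq ht hU ω ⟨_, logCoeff_logDiff ht hU ω.2⟩ rfl, ← map_mul]
  apply resLog_eq
  change logCoeff (t i) (f • ω.1) = _
  rw [← algebraMap_smul C.K f ω.1, map_smul]
  rfl

theorem resLog_logRest {U V : C.AffOpen} (h : U ≤ V) (hU : (t i).1 ∈ U.1.1) (ω : logDiff t V) :
    resLog ht hU (logRest t h ω) = resLog ht (show (t i).1 ∈ V.1.1 from h hU) ω := rfl

theorem resLog_dform {U : C.AffOpen} (hU : (t i).1 ∈ U.1.1) (f : C.𝒪 U) :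
    resLog ht hU (dform t f) = 0 := by
  obtain ⟨h, hh⟩ := logCoeff_D (toLoc hU f)
  rw [resLog_eq ht hU _ _ hh, map_mul, ev_unif, zero_mul]

theorem twist_smul_mem_logDiff {U : C.AffOpen} (j : twistFun (t i) U) {ω : Ω[C.K⁄ℂ]}
    (hω : ω ∈ C.regDiff U) : j.1 • ω ∈ logDiff t U := by
  intro f hf
  have h1 := algebraMap_twistMul ⟨f, mem_divSheaf.mp hf i⟩ j
  rw [← algebraMap_smul C.K f, smul_smul, ← h1, algebraMap_smul]
  exact Submodule.smul_mem _ _ hω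

/-- The logarithmic form `j df` for a section `j` of `𝒪_C(t_i)`. -/
def twistD {U : C.AffOpen} (j : twistFun (t i) U) (f : C.𝒪 U) : logDiff t U :=
  ⟨j.1 • (dform t f).1, twist_smul_mem_logDiff j (Submodule.subset_span ⟨f, rfl⟩)⟩

/-- With f = z h one has j df = (jf) dz/z + (jz) dh, and the second term is regular at t_i. This
computation produces the shifts of exponents by ±1. -/
theorem resLog_twistD {U : C.AffOpen} (hU : (t i).1 ∈ U.1.1) (j : twistFun (t i) U)
    (f : ptIdeal (t i) U) : resLog ht hU (twistD j f.1) = evU hU (twistMul f j) := by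
  have hf : ev (t i) (toLoc hU f) = 0 := (mem_ptIdeal hU).mp f.2
  obtain ⟨h, hh⟩ := exists_eq_unif_mul hf
  obtain ⟨h', hh'⟩ := exists_D_eq h
  have hj := mul_mem_locRing hU j (ev_unif (t i))
  have h1 : logCoeff (t i) (twistD j f.1).1 = (toLoc hU (twistMul f j) +
      ⟨_, hj⟩ * (unif (t i) * h') : locRing (t i)) := by
    change logCoeff (t i) (j.1 • KaehlerDifferential.D ℂ C.K (toLoc hU f : C.K)) = _
    rw [hh]
    change logCoeff (t i) (j.1 • KaehlerDifferential.D ℂ C.K ((unif (t i) : C.K) * h)) =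
      algebraMap (C.𝒪 U) C.K (twistMul f j) + (j * unif (t i)) * (unif (t i) * h')
    rw [algebraMap_twistMul, ← coe_toLoc hU, hh, Derivation.leibniz, hh']
    simp only [map_smul, map_add, logCoeff_D_unif, smul_eq_mul]
    change _ = (unif (t i) : C.K) * h * _ + _
    ring
  rw [resLog_eq ht hU _ _ h1, map_add, map_mul, map_mul, ev_unif, zero_mul, mul_zero, add_zero]
  rfl

/-- If h = a/b and z = a'/b', the quotient rule shows that the factor b b'² clears the denominators
of h dz. -/
theorem exists_smul_mem_regDiff {U : C.AffOpen} (hU : (t i).1 ∈ U.1.1) (h : locRing (t i)) :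
    ∃ g : C.𝒪 U, evU hU g ≠ 0 ∧
      g • (h.1 • KaehlerDifferential.D ℂ C.K (unif (t i)).1) ∈ C.regDiff U := by
  obtain ⟨a, b, hb, hab⟩ := exists_mul_eq_of_mem_locRing hU h
  obtain ⟨a', b', hb', hab'⟩ := exists_mul_eq_of_mem_locRing hU (unif (t i))
  refine ⟨b * (b' * b'), by simp [hb, hb'], ?_⟩
  have h1 : h.1 * algebraMap (C.𝒪 U) C.K b = algebraMap (C.𝒪 U) C.K a := congrArg Subtype.val hab
  have h2 : (unif (t i)).1 * algebraMap (C.𝒪 U) C.K b' = algebraMap (C.𝒪 U) C.K a' :=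
    congrArg Subtype.val hab'
  have h3 := congrArg (KaehlerDifferential.D ℂ C.K) h2
  rw [Derivation.leibniz] at h3
  have h5 : (b * (b' * b')) • (h.1 • KaehlerDifferential.D ℂ C.K (unif (t i)).1) =
      a • (b' • KaehlerDifferential.D ℂ C.K (algebraMap (C.𝒪 U) C.K a') -
        a' • KaehlerDifferential.D ℂ C.K (algebraMap (C.𝒪 U) C.K b')) := by
    simp only [← algebraMap_smul C.K (_ : C.𝒪 U) (_ : Ω[C.K⁄ℂ]), map_mul]
    rw [← h3, ← h1, ← h2]
    module
  rw [h5]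
  exact Submodule.smul_mem _ _ (sub_mem (Submodule.smul_mem _ _ (Submodule.subset_span ⟨_, rfl⟩))
    (Submodule.smul_mem _ _ (Submodule.subset_span ⟨_, rfl⟩)))

/-- Zero residue means ω = h dz with h regular at t_i. For f vanishing on the divisor, the functions
that make f j ω regular form an ideal. It contains I_{t_i}, since j has at most a simple pole, and
also a function not vanishing at t_i that clears the denominators of h dz. As I_{t_i} is maximal,
the ideal contains 1. -/
theorem twist_smul_mem_of_resLog_eq_zero {U : C.AffOpen} (hU : (t i).1 ∈ U.1.1) {ω : logDiff t U}
    (h0 : resLog ht hU ω = 0) (j : twistFun (t i) U) : j.1 • ω.1 ∈ logDiff t U := by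
  intro f hf
  obtain ⟨h, hh⟩ := exists_eq_unif_mul h0
  have hh : logCoeff (t i) ω.1 = (unif (t i) * h : locRing (t i)) := congrArg Subtype.val hh
  have hω : ω.1 = h.1 • KaehlerDifferential.D ℂ C.K (unif (t i)).1 := by
    have := logCoeff_smul_D (t i) ω.1
    rw [hh] at this
    change ((unif (t i)).1 * h.1) • _ = _ at this
    rw [mul_smul] at this
    exact (smul_right_injective _ (unif_ne_zero (t i)) this).symm
  obtain ⟨g, hg, hgω⟩ := exists_smul_mem_regDiff hU h
  rw [← hω] at hgω
  let f' : ptIdeal (t i) U := ⟨f, mem_divSheaf.mp hf i⟩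
  have h1 : f • j.1 • ω.1 = twistMul f' j • ω.1 := by
    rw [← algebraMap_smul C.K f, ← algebraMap_smul C.K (twistMul f' j), algebraMap_twistMul, smul_smul]
  let c : Ideal (C.𝒪 U) :=
    (C.regDiff U).comap (LinearMap.toSpanSingleton (C.𝒪 U) _ (f • j.1 • ω.1))
  have hc : ptIdeal (t i) U ≤ c := by
    intro x hx
    change x • f • j.1 • ω.1 ∈ C.regDiff U
    have h2 : x • f • j.1 • ω.1 = twistMul ⟨x, hx⟩ j • f • ω.1 := by
      simp only [← algebraMap_smul C.K (_ : C.𝒪 U) (_ : Ω[C.K⁄ℂ]), algebraMap_twistMul, smul_smul]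
      congr 1
      ring
    rw [h2]
    exact Submodule.smul_mem _ _ (ω.2 f hf)
  have hgc : g ∈ c := by
    change g • f • j.1 • ω.1 ∈ C.regDiff U
    rw [h1, smul_comm]
    exact Submodule.smul_mem _ _ hgω
  have htop : c = ⊤ := by
    by_contra hne
    rw [← (isMaximal_ptIdeal hU).eq_of_le hne hc] at hgc
    exact hg ((mem_ptIdeal_iff hU).mp hgc)
  have : (1 : C.𝒪 U) ∈ c := htop ▸ Submodule.mem_top
  change (1 : C.𝒪 U) • f • j.1 • ω.1 ∈ C.regDiff U at this
  rwa [one_smul] at this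

/-- Write ω = Σ f_a (j_a ω); each j_a ω is still logarithmic because ω has no residue at t_i. -/
theorem mem_smul_top_of_resLog_eq_zero {U : C.AffOpen} (hU : (t i).1 ∈ U.1.1) {ω : logDiff t U}
    (h0 : resLog ht hU ω = 0) : ω ∈ ptIdeal (t i) U • (⊤ : Submodule (C.𝒪 U) (logDiff t U)) := by
  obtain ⟨m, f, j, h⟩ := C.exists_twist_partition (t i) U
  have h1 : ω = ∑ a, (f a).1 • (⟨(j a).1 • ω.1, twist_smul_mem_of_resLog_eq_zero ht hU h0 (j a)⟩ :
      logDiff t U) := by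
    apply Subtype.ext
    rw [Submodule.coe_sum]
    refine (one_smul (C.𝒪 U) ω.1).symm.trans ?_
    rw [← h, Finset.sum_smul]
    refine Finset.sum_congr rfl fun a _ => ?_
    rw [SetLike.val_smul, ← algebraMap_smul C.K (twistMul (f a) (j a)), algebraMap_twistMul,
      mul_smul, algebraMap_smul]
  rw [h1]
  exact sum_mem fun a _ => Submodule.smul_mem_smul (f a).2 Submodule.mem_top

/-- Write z = z₀ u with z₀ the chosen uniformizer. As z generates the ideal of the point, u is a
unit, and dz/z = dz₀/z₀ + du/u. -/
theorem resLog_eq_one {W : C.AffOpen} (hW : (t i).1 ∈ W.1.1) {z : C.𝒪 W} {ω : logDiff t W}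
    (hz : ptIdeal (t i) W = Ideal.span {z}) (hω : z • ω = dform t z) : resLog ht hW ω = 1 := by
  have hz0 : ev (t i) (toLoc hW z) = 0 :=
    (mem_ptIdeal hW).mp (hz ▸ Ideal.mem_span_singleton_self z)
  obtain ⟨u, hu⟩ := exists_eq_unif_mul hz0
  obtain ⟨a, b, hb, hab⟩ := exists_mul_eq_of_mem_locRing hW (unif (t i))
  have ha : a ∈ ptIdeal (t i) W := by
    rw [mem_ptIdeal_iff hW, evU_apply, ← hab, map_mul, ev_unif, zero_mul]
  rw [hz, Ideal.mem_span_singleton] at ha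
  obtain ⟨x, rfl⟩ := ha
  rw [map_mul, hu, mul_assoc] at hab
  have hne : unif (t i) ≠ 0 := fun h => unif_ne_zero (t i) (congrArg Subtype.val h)
  have h1 := mul_left_cancel₀ hne hab
  have hu0 : ev (t i) u ≠ 0 := by
    intro h
    apply hb
    rw [evU_apply, h1, map_mul, h, zero_mul]
  obtain ⟨h', hh'⟩ := exists_D_eq u
  let c : locRing (t i) := ⟨_, logCoeff_logDiff ht hW ω.2⟩
  have h2 : unif (t i) * (u * c) = unif (t i) * (u + unif (t i) * h') := by
    ext
    have h3 := congrArg (fun ω => logCoeff (t i) (Subtype.val ω)) hω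
    change logCoeff (t i) (z • ω.1) = logCoeff (t i) (KaehlerDifferential.D ℂ C.K (toLoc hW z).1) at h3
    rw [← algebraMap_smul C.K z, map_smul, ← coe_toLoc hW, hu] at h3
    change ((unif (t i) : C.K) * u) * logCoeff (t i) ω.1 = logCoeff (t i)
      (KaehlerDifferential.D ℂ C.K ((unif (t i) : C.K) * u)) at h3
    rw [Derivation.leibniz, hh'] at h3
    simp only [map_smul, map_add, logCoeff_D_unif, smul_eq_mul] at h3
    change (unif (t i) : C.K) * (u * logCoeff (t i) ω.1) = unif (t i) * (u + unif (t i) * h')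
    linear_combination h3
  have h3 := congrArg (ev (t i)) (mul_left_cancel₀ hne h2)
  rw [map_mul, map_add, map_mul, ev_unif, zero_mul, add_zero] at h3
  exact mul_left_cancel₀ hu0 (h3.trans (mul_one _).symm)

include ht in
-- Shrink U until three finite families become regular functions: the uniformizer, the quotients by
-- it of generators of I_{t_i} (which makes this ideal principal), and the logarithmic coefficients
-- of the forms in `s` (which makes them multiples of dz/z).
theorem exists_good_coordinate {U : C.AffOpen} (hU : (t i).1 ∈ U.1.1)
    (s : Set (logDiff t U)) (hs : s.Finite) :
    ∃ (W : C.AffOpen) (h : W ≤ U) (z : C.𝒪 W) (ω : logDiff t W), (t i).1 ∈ W.1.1 ∧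
      ptIdeal (t i) W = Ideal.span {z} ∧ z • ω = dform t z ∧
      ∀ η ∈ s, ∃ f : C.𝒪 W, logRest t h η = f • ω := by
  obtain ⟨I, hI⟩ := IsNoetherian.noetherian (ptIdeal (t i) U)
  have h1 : ∀ f ∈ I, ∃ k : locRing (t i), toLoc hU f = unif (t i) * k := fun f hf =>
    exists_eq_unif_mul ((mem_ptIdeal hU).mp (hI ▸ Submodule.subset_span hf))
  choose! k hk using h1
  obtain ⟨W, hWU, hW, hs'⟩ := exists_affOpen_forall_mem_range hU
    ({(unif (t i)).1} ∪ ((fun f => (k f).1) '' I) ∪ ((fun η : logDiff t U => logCoeff (t i) η.1) '' s))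
    (((Set.finite_singleton _).union (I.finite_toSet.image _)).union (hs.image _)) (by
      rintro x ((rfl | ⟨f, _, rfl⟩) | ⟨η, _, rfl⟩)
      · exact (unif (t i)).2
      · exact (k f).2
      · exact logCoeff_logDiff ht hU η.2)
  obtain ⟨z, hz⟩ := hs' _ (Or.inl (Or.inl rfl))
  have hzI : ptIdeal (t i) W = Ideal.span {z} := by
    apply le_antisymm
    · rw [← ptIdeal_map hWU, Ideal.map_le_iff_le_comap, ← hI, Submodule.span_le]
      intro f hf
      obtain ⟨g, hg⟩ := hs' _ (Or.inl (Or.inr ⟨f, hf, rfl⟩))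
      refine Ideal.mem_span_singleton.mpr ⟨g, algebraMap_injective W ?_⟩
      rw [map_mul, hz, hg]
      exact (algebraMap_rest hWU f).trans (congrArg Subtype.val (hk f hf))
    · rw [Ideal.span_singleton_le_iff_mem, mem_ptIdeal hW]
      have : toLoc hW z = unif (t i) := Subtype.ext hz
      rw [this, ev_unif]
  have hω : (unif (t i)).1⁻¹ • (dform t z).1 ∈ logDiff t W := by
    intro f hf
    have hf' := mem_divSheaf.mp hf i
    rw [hzI, Ideal.mem_span_singleton] at hf'
    obtain ⟨g, rfl⟩ := hf'
    rw [← algebraMap_smul C.K, smul_smul, map_mul, hz, mul_right_comm, mul_inv_cancel₀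
      (unif_ne_zero (t i)), one_mul, algebraMap_smul]
    exact Submodule.smul_mem _ _ (Submodule.subset_span ⟨z, rfl⟩)
  refine ⟨W, hWU, z, ⟨_, hω⟩, hW, hzI, ?_, ?_⟩
  · apply Subtype.ext
    change z • (unif (t i)).1⁻¹ • (dform t z).1 = (dform t z).1
    rw [← algebraMap_smul C.K z, hz, smul_smul, mul_inv_cancel₀ (unif_ne_zero (t i)), one_smul]
  · intro η hη
    obtain ⟨f, hf⟩ := hs' _ (Or.inr ⟨η, hη, rfl⟩)
    refine ⟨f, Subtype.ext ?_⟩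
    change η.1 = f • (unif (t i)).1⁻¹ • KaehlerDifferential.D ℂ C.K (algebraMap (C.𝒪 W) C.K z)
    rw [← algebraMap_smul C.K f, hf, hz, smul_comm, logCoeff_smul_D, smul_smul,
      inv_mul_cancel₀ (unif_ne_zero (t i)), one_smul]

end Div

end SmoothProjCurve

/-! ### Retracts and base change -/

section Retract

variable {ι : Type} [Fintype ι]

/-- The families α, β present N as a direct summand of a finite power of M, and α', β' do the same
for N' and M'. The inverse of S' ⊗ N → N' is Σ (1 ⊗ β_a) ∘ e⁻¹ ∘ α'_a, with e : S' ⊗ M ≅ M'. No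
flatness of S → S' enters, which matters because changes of the base ring are arbitrary. -/
theorem isBaseChange_of_retract {S S' : Type} [CommRing S] [CommRing S'] [Algebra S S']
    {N N' M M' : Type} [AddCommGroup N] [AddCommGroup N'] [AddCommGroup M] [AddCommGroup M']
    [Module S N] [Module S M] [Module S' N'] [Module S' M'] [Module S N'] [Module S M']
    [IsScalarTower S S' N'] [IsScalarTower S S' M'] (f : N →ₗ[S] N') {g : M →ₗ[S] M'}
    (hg : IsBaseChange S' g) (α : ι → N →ₗ[S] M) (β : ι → M →ₗ[S] N)
    (α' : ι → N' →ₗ[S'] M') (β' : ι → M' →ₗ[S'] N') (h1 : ∀ a x, α' a (f x) = g (α a x))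
    (h2 : ∀ a x, β' a (g x) = f (β a x)) (h3 : ∀ x, ∑ a, β a (α a x) = x)
    (h4 : ∀ x, ∑ a, β' a (α' a x) = x) : IsBaseChange S' f := by
  let F : S' ⊗[S] N →ₗ[S'] N' := AlgebraTensorModule.lift
    ((LinearMap.toSpanSingleton S' (N →ₗ[S] N') f))
  have hF : ∀ s x, F (s ⊗ₜ x) = s • f x := fun s x => rfl
  let B : ι → S' ⊗[S] M →ₗ[S'] S' ⊗[S] N := fun a => (β a).baseChange S'
  let G : N' →ₗ[S'] S' ⊗[S] N := ∑ a, (B a).comp ((hg.equiv.symm : M' →ₗ[S'] _).comp (α' a))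
  have hFB : ∀ a y, F (B a y) = β' a (hg.equiv y) := by
    intro a y
    induction y with
    | zero => simp
    | add x y hx hy => simp only [map_add, hx, hy]
    | tmul s x =>
      change F (s ⊗ₜ β a x) = _
      rw [hF, IsBaseChange.equiv_tmul, map_smul, h2]
  have hFG : ∀ y, F (G y) = y := by
    intro y
    simp only [G, LinearMap.sum_apply, map_sum, LinearMap.comp_apply, hFB]
    simp [h4]
  have hGF : ∀ y, G (F y) = y := by
    intro y
    induction y with
    | zero => simp
    | add x y hx hy => simp only [map_add, hx, hy]
    | tmul s x =>
      have h5 : ∀ a, hg.equiv.symm (g (α a x)) = (1 : S') ⊗ₜ[S] α a x := fun a =>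
        hg.equiv_symm_apply _
      simp only [G, LinearMap.sum_apply, LinearMap.comp_apply, hF, map_smul, h1]
      simp only [LinearEquiv.coe_coe, h5]
      change s • ∑ a, ((1 : S') ⊗ₜ[S] β a (α a x)) = _
      rw [← TensorProduct.tmul_sum, h3, TensorProduct.smul_tmul', smul_eq_mul,
        mul_one]
  exact IsBaseChange.of_equiv (LinearEquiv.ofLinearMap F G (LinearMap.ext hFG) (LinearMap.ext hGF))
    (fun x => by change F (1 ⊗ₜ x) = _; rw [hF, one_smul])

theorem IsBaseChangeAlong.of_retract {S S' : Type} [CommRing S] [CommRing S'] {σ : S →+* S'}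
    {N N' M M' : Type} [AddCommGroup N] [AddCommGroup N'] [AddCommGroup M] [AddCommGroup M']
    [Module S N] [Module S M] [Module S' N'] [Module S' M'] {f : N →+ N'} {g : M →+ M'}
    (hf : ∀ (s : S) (m : N), f (s • m) = σ s • f m) {hg : ∀ (s : S) (m : M), g (s • m) = σ s • g m}
    (hbg : IsBaseChangeAlong σ g hg) (α : ι → N →ₗ[S] M) (β : ι → M →ₗ[S] N)
    (α' : ι → N' →ₗ[S'] M') (β' : ι → M' →ₗ[S'] N') (h1 : ∀ a x, α' a (f x) = g (α a x))
    (h2 : ∀ a x, β' a (g x) = f (β a x)) (h3 : ∀ x, ∑ a, β a (α a x) = x)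
    (h4 : ∀ x, ∑ a, β' a (α' a x) = x) : IsBaseChangeAlong σ f hf :=
  let _ : Algebra S S' := σ.toAlgebra
  let _ : Module S M' := Module.compHom M' σ
  have : IsScalarTower S S' M' := ⟨fun a b c => mul_smul (σ a) b c⟩
  let _ : Module S N' := Module.compHom N' σ
  have : IsScalarTower S S' N' := ⟨fun a b c => mul_smul (σ a) b c⟩
  isBaseChange_of_retract ({ toFun := f, map_add' := f.map_add, map_smul' := hf } : N →ₗ[S] N')
    (g := ({ toFun := g, map_add' := g.map_add, map_smul' := hg } : M →ₗ[S] M'))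
    hbg α β α' β' h1 h2 h3 h4

/-- The linear extension of a semilinear map along a base change. -/
theorem IsBaseChangeAlong.exists_lift {S S' : Type} [CommRing S] [CommRing S'] {σ : S →+* S'}
    {M M' Q : Type} [AddCommGroup M] [AddCommGroup M'] [AddCommGroup Q]
    [Module S M] [Module S' M'] [Module S' Q] {f : M →+ M'}
    {hf : ∀ (s : S) (m : M), f (s • m) = σ s • f m} (h : IsBaseChangeAlong σ f hf)
    (g : M →+ Q) (hg : ∀ (s : S) (m : M), g (s • m) = σ s • g m) :
    ∃ G : M' →ₗ[S'] Q, ∀ m, G (f m) = g m :=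
  let _ : Algebra S S' := σ.toAlgebra
  let _ : Module S M' := Module.compHom M' σ
  have : IsScalarTower S S' M' := ⟨fun a b c => mul_smul (σ a) b c⟩
  let _ : Module S Q := Module.compHom Q σ
  have : IsScalarTower S S' Q := ⟨fun a b c => mul_smul (σ a) b c⟩
  have h' : IsBaseChange S' ({ toFun := f, map_add' := f.map_add, map_smul' := hf } : M →ₗ[S] M') := h
  ⟨h'.lift ({ toFun := g, map_add' := g.map_add, map_smul' := hg } : M →ₗ[S] Q), fun m =>
    h'.lift_eq _ m⟩

theorem IsBaseChangeAlong.span_range {S S' : Type} [CommRing S] [CommRing S'] {σ : S →+* S'}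
    {M M' : Type} [AddCommGroup M] [AddCommGroup M']
    [Module S M] [Module S' M'] {f : M →+ M'}
    {hf : ∀ (s : S) (m : M), f (s • m) = σ s • f m} (h : IsBaseChangeAlong σ f hf) :
    Submodule.span S' (Set.range f) = ⊤ := by
  let _ : Algebra S S' := σ.toAlgebra
  let _ : Module S M' := Module.compHom M' σ
  have : IsScalarTower S S' M' := ⟨fun a b c => mul_smul (σ a) b c⟩
  have h' : IsBaseChange S' ({ toFun := f, map_add' := f.map_add, map_smul' := hf } : M →ₗ[S] M') := h
  rw [eq_top_iff]
  rintro x -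
  induction x using h'.inductionOn with
  | zero => exact zero_mem _
  | tmul m => exact Submodule.subset_span ⟨m, rfl⟩
  | smul s n hn => exact Submodule.smul_mem _ _ hn
  | add a b ha hb => exact add_mem ha hb

theorem IsBaseChangeAlong.of_bijective {S S' : Type} [CommRing S] [CommRing S'] {σ : S →+* S'}
    (hσ : Function.Bijective σ) {M M' : Type} [AddCommGroup M] [AddCommGroup M']
    [Module S M] [Module S' M'] {f : M →+ M'} (hb : Function.Bijective f)
    (hf : ∀ (s : S) (m : M), f (s • m) = σ s • f m) : IsBaseChangeAlong σ f hf := by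
  let _ : Algebra S S' := σ.toAlgebra
  let _ : Module S M' := Module.compHom M' σ
  have : IsScalarTower S S' M' := ⟨fun a b c => mul_smul (σ a) b c⟩
  let φ : M →ₗ[S] M' := { toFun := f, map_add' := f.map_add, map_smul' := hf }
  let e : S ≃ₐ[S] S' := AlgEquiv.ofBijective (Algebra.ofId S S') hσ
  let e1 : S' ⊗[S] M ≃ₗ[S] M' := (LinearEquiv.rTensor M e.symm.toLinearEquiv).trans
    ((TensorProduct.lid S M).trans (LinearEquiv.ofBijective φ hb))
  have he1 : ∀ s m, e1 (s ⊗ₜ m) = s • f m := by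
    intro s m
    obtain ⟨s, rfl⟩ := e.surjective s
    change f (e.symm (e s) • m) = _
    rw [e.symm_apply_apply, hf]
    rfl
  refine IsBaseChange.of_equiv (f := φ) { e1 with map_smul' := ?_ } (fun x => ?_)
  · intro s x
    change e1 (s • x) = s • e1 x
    induction x with
    | zero => simp
    | add x y hx hy => simp only [smul_add, map_add, hx, hy]
    | tmul s' x => rw [TensorProduct.smul_tmul', he1, he1, smul_eq_mul, mul_smul]
  · exact (he1 1 x).trans (one_smul _ _)

theorem Module.Projective.of_retract {S : Type} [CommRing S] {N M : Type} [AddCommGroup N]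
    [AddCommGroup M] [Module S N] [Module S M] [Module.Projective S M]
    (α : ι → N →ₗ[S] M) (β : ι → M →ₗ[S] N) (h : ∀ x, ∑ a, β a (α a x) = x) :
    Module.Projective S N := by
  classical
  refine Module.Projective.of_split (M := Π₀ _ : ι, M)
    (∑ a, (DFinsupp.lsingle a).comp (α a)) (DFinsupp.lsum ℕ β) ?_
  ext x
  simp [h]

theorem Module.Finite.of_retract {S : Type} [CommRing S] {N M : Type} [AddCommGroup N]
    [AddCommGroup M] [Module S N] [Module S M] [Module.Finite S M]
    (α : ι → N →ₗ[S] M) (β : ι → M →ₗ[S] N) (h : ∀ x, ∑ a, β a (α a x) = x) :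
    Module.Finite S N := by
  classical
  refine Module.Finite.of_surjective (M := ι → M) (LinearMap.lsum S _ S β) fun x => ⟨fun a => α a x, ?_⟩
  simp [LinearMap.lsum_apply, h]

end Retract

/-! ### Line bundle quotients -/

section InvQuot

variable {A R : Type} [CommRing A] [CommRing R] (φ : A →+* R)
variable {M M' : Type} [AddCommGroup M] [AddCommGroup M'] [Module R M] [Module R M']

/-- The quotient `N₀ / N₁` is an invertible `A`-module. -/
def InvQuot (N₀ N₁ : Submodule R M) : Prop :=
  letI : Module A (N₀ ⧸ N₁.submoduleOf N₀) := Module.compHom _ φ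
  Module.Invertible A (N₀ ⧸ N₁.submoduleOf N₀)

variable {φ}

variable (φ) in
-- The hypotheses are those of an isomorphism theorem: `h1` gives well-definedness and injectivity
-- on quotients, `h2` surjectivity. Since g lives on a submodule, an inclusion or the multiplication
-- by a function can be used for it.
theorem InvQuot.nonempty_equiv {N₀ N₁ : Submodule R M} {N₀' N₁' : Submodule R M'}
    (g : N₀ →ₗ[R] M') (h0 : ∀ x, g x ∈ N₀') (h1 : ∀ x, g x ∈ N₁' ↔ (x : M) ∈ N₁)
    (h2 : ∀ y ∈ N₀', ∃ x, y - g x ∈ N₁') :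
    letI : Module A (N₀ ⧸ N₁.submoduleOf N₀) := Module.compHom _ φ
    letI : Module A (N₀' ⧸ N₁'.submoduleOf N₀') := Module.compHom _ φ
    Nonempty ((N₀ ⧸ N₁.submoduleOf N₀) ≃ₗ[A] (N₀' ⧸ N₁'.submoduleOf N₀')) := by
  let _ : Module A (N₀ ⧸ N₁.submoduleOf N₀) := Module.compHom _ φ
  let _ : Module A (N₀' ⧸ N₁'.submoduleOf N₀') := Module.compHom _ φ
  let G : (N₀ ⧸ N₁.submoduleOf N₀) →ₗ[R] (N₀' ⧸ N₁'.submoduleOf N₀') :=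
    Submodule.mapQ _ _ (g.codRestrict N₀' h0) (fun x hx => (h1 x).mpr hx)
  have hGmk : ∀ x, G (Submodule.Quotient.mk x) = Submodule.Quotient.mk ⟨g x, h0 x⟩ := fun _ => rfl
  have hG : Function.Bijective G := by
    constructor
    · rw [injective_iff_map_eq_zero]
      intro x hx
      obtain ⟨x, rfl⟩ := Submodule.Quotient.mk_surjective _ x
      rw [hGmk, Submodule.Quotient.mk_eq_zero] at hx
      rw [Submodule.Quotient.mk_eq_zero]
      exact (h1 x).mp hx
    · intro y
      obtain ⟨y, rfl⟩ := Submodule.Quotient.mk_surjective _ y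
      obtain ⟨x, hx⟩ := h2 y y.2
      refine ⟨Submodule.Quotient.mk x, ?_⟩
      rw [hGmk, eq_comm, Submodule.Quotient.eq]
      exact hx
  exact ⟨{ Equiv.ofBijective G hG with
      map_add' := G.map_add
      map_smul' := fun a x => G.map_smul (φ a) x }⟩

theorem InvQuot.of_map {N₀ N₁ : Submodule R M} {N₀' N₁' : Submodule R M'} (h : InvQuot φ N₀ N₁)
    (g : N₀ →ₗ[R] M') (h0 : ∀ x, g x ∈ N₀') (h1 : ∀ x, g x ∈ N₁' ↔ (x : M) ∈ N₁)
    (h2 : ∀ y ∈ N₀', ∃ x, y - g x ∈ N₁') : InvQuot φ N₀' N₁' := by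
  let _ : Module A (N₀ ⧸ N₁.submoduleOf N₀) := Module.compHom _ φ
  let _ : Module A (N₀' ⧸ N₁'.submoduleOf N₀') := Module.compHom _ φ
  obtain ⟨e⟩ := InvQuot.nonempty_equiv φ g h0 h1 h2
  have : Module.Invertible A (N₀ ⧸ N₁.submoduleOf N₀) := h
  exact Module.Invertible.congr e

theorem InvQuot.of_comap {N₀ N₁ : Submodule R M} {N₀' N₁' : Submodule R M'}
    (h : InvQuot φ N₀' N₁')
    (g : N₀ →ₗ[R] M') (h0 : ∀ x, g x ∈ N₀') (h1 : ∀ x, g x ∈ N₁' ↔ (x : M) ∈ N₁)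
    (h2 : ∀ y ∈ N₀', ∃ x, y - g x ∈ N₁') : InvQuot φ N₀ N₁ := by
  let _ : Module A (N₀ ⧸ N₁.submoduleOf N₀) := Module.compHom _ φ
  let _ : Module A (N₀' ⧸ N₁'.submoduleOf N₀') := Module.compHom _ φ
  obtain ⟨e⟩ := InvQuot.nonempty_equiv φ g h0 h1 h2
  have : Module.Invertible A (N₀' ⧸ N₁'.submoduleOf N₀') := h
  exact Module.Invertible.congr e.symm

theorem exists_section_of_projective {A N Q : Type} [CommRing A] [AddCommGroup N] [AddCommGroup Q]
    [Module A N] [Module A Q] [Module.Projective A Q] (q : N →+ Q) (hq : Function.Surjective q)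
    (hqs : ∀ (a : A) x, q (a • x) = a • q x) :
    ∃ s : Q →+ N, (∀ (a : A) x, s (a • x) = a • s x) ∧ ∀ x, q (s x) = x := by
  let q' : N →ₗ[A] Q := { toFun := q, map_add' := q.map_add, map_smul' := hqs }
  obtain ⟨s, hs⟩ := Module.projective_lifting_property q' LinearMap.id hq
  exact ⟨s.toAddMonoidHom, s.map_smul, LinearMap.congr_fun hs⟩

/-- An invertible module is projective, so N₀ → N₀/N₁ splits over A; s is the quotient map followed
by the splitting. -/
theorem InvQuot.exists_section {N₀ N₁ : Submodule R M} (h : InvQuot φ N₀ N₁) :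
    ∃ s : N₀ →+ N₀, (∀ a x, s (φ a • x) = φ a • s x) ∧ (∀ x, (s x - x : N₀).1 ∈ N₁) ∧
      ∀ x : N₀, x.1 ∈ N₁ → s x = 0 := by
  have key : ∃ s : (N₀ ⧸ N₁.submoduleOf N₀) →+ N₀, (∀ (a : A) x, s (φ a • x) = φ a • s x) ∧
      ∀ x, (N₁.submoduleOf N₀).mkQ (s x) = x := by
    let _ : Module A (N₀ ⧸ N₁.submoduleOf N₀) := Module.compHom _ φ
    let _ : Module A N₀ := Module.compHom _ φ
    have : Module.Invertible A (N₀ ⧸ N₁.submoduleOf N₀) := h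
    exact exists_section_of_projective (A := A) (N₁.submoduleOf N₀).mkQ.toAddMonoidHom
      (Submodule.mkQ_surjective _) (fun a x => (N₁.submoduleOf N₀).mkQ.map_smul (φ a) x)
  obtain ⟨s, hs, hs1⟩ := key
  refine ⟨s.comp (N₁.submoduleOf N₀).mkQ.toAddMonoidHom, fun a x => ?_, fun x => ?_,
    fun x hx => ?_⟩
  · refine Eq.trans ?_ (hs a _)
    exact congrArg s ((N₁.submoduleOf N₀).mkQ.map_smul (φ a) x)
  · exact (Submodule.Quotient.eq (N₁.submoduleOf N₀)).mp (hs1 ((N₁.submoduleOf N₀).mkQ x))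
  · have h1 : (N₁.submoduleOf N₀).mkQ x = 0 :=
      (Submodule.Quotient.mk_eq_zero (N₁.submoduleOf N₀)).mpr hx
    exact (congrArg s h1).trans (map_zero s)

/-- An `A`-linear projection onto a submodule extends to one onto the next step of a filtration
with line bundle quotients. -/
theorem InvQuot.exists_projection {N₀ N₁ : Submodule R M} (h : InvQuot φ N₀ N₁)
    (hle : N₁ ≤ N₀) (p : M →+ M) (hp : ∀ a x, p (φ a • x) = φ a • p x) (hp0 : ∀ x, p x ∈ N₀)
    (hp1 : ∀ x ∈ N₀, p x = x) :
    ∃ p' : M →+ M, (∀ a x, p' (φ a • x) = φ a • p' x) ∧ (∀ x, p' x ∈ N₁) ∧ ∀ x ∈ N₁, p' x = x := by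
  obtain ⟨s, hs, hs1, hs2⟩ := h.exists_section
  let P : M →+ N₀ := p.codRestrict N₀ hp0
  -- Subtracting from p its component along the split complement of N₁ in N₀ leaves a projection
  -- onto N₁.
  refine ⟨p - N₀.subtype.toAddMonoidHom.comp (s.comp P), fun a x => ?_, fun x => ?_, fun x hx => ?_⟩
  · have h1 : P (φ a • x) = φ a • P x := Subtype.ext (hp a x)
    change p (φ a • x) - (s (P (φ a • x)) : M) = φ a • (p x - (s (P x) : M))
    rw [h1, hs, hp, smul_sub]
    rfl
  · have h1 := N₁.neg_mem (hs1 (P x))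
    convert h1 using 1
    change p x - (s (P x) : M) = - ((s (P x) : M) - p x)
    abel
  · have h1 : (P x).1 ∈ N₁ := by change p x ∈ N₁; rwa [hp1 x (hle hx)]
    change p x - (s (P x) : M) = x
    rw [hs2 _ h1, hp1 x (hle hx)]
    simp

end InvQuot

/-! ### Submodules spanned by images under semilinear maps -/

section SpanImage

variable {R R' : Type} [CommRing R] [CommRing R'] {σ : R →+* R'}
variable {M M' : Type} [AddCommGroup M] [AddCommGroup M'] [Module R M] [Module R' M']
variable {f : M →+ M'}

theorem span_image_smul (hf : ∀ (a : R) (m : M), f (a • m) = σ a • f m) (I : Ideal R) (N : Submodule R M) :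
    Submodule.span R' (f '' (I • N : Submodule R M)) =
      I.map σ • Submodule.span R' (f '' (N : Set M)) := by
  apply le_antisymm
  · rw [Submodule.span_le]
    rintro _ ⟨x, hx, rfl⟩
    induction hx using Submodule.smul_induction_on' with
    | smul a ha n hn =>
      rw [SetLike.mem_coe, hf]
      exact Submodule.smul_mem_smul (Ideal.mem_map_of_mem σ ha) (Submodule.subset_span ⟨n, hn, rfl⟩)
    | add x _ y _ hx hy => rw [map_add]; exact add_mem hx hy
  · rw [Submodule.smul_le]
    intro a ha y hy
    have key : ∀ b ∈ I, ∀ z ∈ Submodule.span R' (f '' (N : Set M)),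
        σ b • z ∈ Submodule.span R' (f '' (I • N : Submodule R M)) := by
      intro b hb z hz
      induction hz using Submodule.span_induction with
      | mem x hx =>
        obtain ⟨n, hn, rfl⟩ := hx
        rw [← hf]
        exact Submodule.subset_span ⟨_, Submodule.smul_mem_smul hb hn, rfl⟩
      | zero => rw [smul_zero]; exact zero_mem _
      | add x y _ _ hx hy => rw [smul_add]; exact add_mem hx hy
      | smul c x _ hx => rw [smul_comm]; exact Submodule.smul_mem _ _ hx
    induction ha using Submodule.span_induction with
    | mem x hx =>
      obtain ⟨b, hb, rfl⟩ := hx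
      exact key b hb y hy
    | zero => rw [zero_smul]; exact zero_mem _
    | add x y _ _ hx hy => rw [add_smul]; exact add_mem hx hy
    | smul c x _ hx => rw [smul_eq_mul, mul_smul]; exact Submodule.smul_mem _ _ hx

theorem span_image_sup (N N' : Submodule R M) :
    Submodule.span R' (f '' (N ⊔ N' : Submodule R M)) =
      Submodule.span R' (f '' (N : Set M)) ⊔ Submodule.span R' (f '' (N' : Set M)) := by
  apply le_antisymm
  · rw [Submodule.span_le]
    rintro _ ⟨x, hx, rfl⟩
    obtain ⟨y, hy, z, hz, rfl⟩ := Submodule.mem_sup.mp hx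
    rw [SetLike.mem_coe, map_add]
    exact Submodule.add_mem_sup (Submodule.subset_span ⟨y, hy, rfl⟩)
      (Submodule.subset_span ⟨z, hz, rfl⟩)
  · exact sup_le (Submodule.span_mono (Set.image_mono (SetLike.coe_subset_coe.mpr le_sup_left)))
      (Submodule.span_mono (Set.image_mono (SetLike.coe_subset_coe.mpr le_sup_right)))

end SpanImage

/-! ### The rank of a submodule -/

/-- Ranks of finite flat modules are constant along specialization, so they may be compared at a
minimal prime q below p. The non-zero-divisor z lies outside q, and inverting it turns f into an
isomorphism. -/
theorem rankAtStalk_eq_of_injective {R : Type} [CommRing R] {M N : Type} [AddCommGroup M]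
    [AddCommGroup N] [Module R M] [Module R N] [Module.Finite R M] [Module.Projective R M]
    [Module.Finite R N] [Module.Projective R N] (f : N →ₗ[R] M) (hf : Function.Injective f) {z : R}
    (hz : z ∈ nonZeroDivisors R) (h : ∀ m, z • m ∈ LinearMap.range f) :
    Module.rankAtStalk (R := R) N = Module.rankAtStalk (R := R) M := by
  ext p
  obtain ⟨q, hq, hqp⟩ := Ideal.exists_minimalPrimes_le (bot_le : (⊥ : Ideal R) ≤ p.asIdeal)
  have hqprime : q.IsPrime := hq.1.1
  let q' : PrimeSpectrum R := ⟨q, hqprime⟩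
  have hle : q' ≤ p := hqp
  rw [← Module.rankAtStalk_eq_of_le_of_finite_of_flat (M := N) hle,
    ← Module.rankAtStalk_eq_of_le_of_finite_of_flat (M := M) hle]
  have hzq : z ∉ q := fun hzq => by
    have := Ideal.disjoint_nonZeroDivisors_of_mem_minimalPrimes hq
    exact Set.disjoint_left.mp this hzq hz
  let F := IsLocalizedModule.map q.primeCompl (LocalizedModule.mkLinearMap q.primeCompl N)
    (LocalizedModule.mkLinearMap q.primeCompl M) f
  have hF : Function.Bijective F := by
    constructor
    · exact IsLocalizedModule.map_injective _ _ _ f hf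
    · intro y
      obtain ⟨⟨m, s⟩, hy⟩ := IsLocalizedModule.mk'_surjective q.primeCompl
        (LocalizedModule.mkLinearMap q.primeCompl M) y
      obtain ⟨n, hn⟩ := h m
      refine ⟨IsLocalizedModule.mk' (LocalizedModule.mkLinearMap q.primeCompl N) n
        (⟨z, hzq⟩ * s), ?_⟩
      rw [IsLocalizedModule.map_mk', hn, ← hy]
      exact IsLocalizedModule.mk'_cancel_left _ m ⟨z, hzq⟩ s
  let F' : LocalizedModule q.primeCompl N →ₗ[Localization q.primeCompl]
      LocalizedModule q.primeCompl M := LinearMap.extendScalarsOfIsLocalization q.primeCompl _ F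
  exact LinearEquiv.finrank_eq (LinearEquiv.ofBijective F' hF)

theorem Module.Flat.smul_left_injective {S M : Type} [CommRing S] [IsDomain S] [AddCommGroup M]
    [Module S M] [Module.Flat S M] {f : S} (hf : f ≠ 0) {x y : M} (h : f • x = f • y) : x = y :=
  (Module.Flat.isSMulRegular_of_nonZeroDivisors (mem_nonZeroDivisors_of_ne_zero hf)) h

namespace SmoothProjCurve

variable {C : SmoothProjCurve} {A B : Type} [CommRing A] [Algebra ℂ A] [CommRing B] [Algebra ℂ B]

theorem rest_injective {U V : C.AffOpen} (h : U ≤ V) : Function.Injective (rest h) := by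
  intro f g hfg
  apply algebraMap_injective V
  rw [← algebraMap_rest h, ← algebraMap_rest h, hfg]

/-- Torsion-free modules over a Dedekind domain are flat. Hence inclusions of bundles stay injective
after tensoring with logarithmic forms, and connections can be compared there. -/
instance {n : ℕ} (t : Fin n → C.Pt) (U : C.AffOpen) : Module.Flat (C.𝒪 U) (logDiff t U) := by
  have : Module.IsTorsionFree (C.𝒪 U) (Ω[C.K⁄ℂ]) := by
    have := Module.IsTorsionFree.trans_faithfulSMul (C.𝒪 U) C.K (Ω[C.K⁄ℂ])
    exact this
  infer_instance

/-! ### The ideal of a point in `𝒪(U) ⊗ A` -/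

/-- The ideal of `{x} × Spec A` in `U × Spec A`. -/
abbrev ptIdealA (x : C.Pt) (A : Type) [CommRing A] [Algebra ℂ A] (U : C.AffOpen) : Ideal (OA A U) :=
  (ptIdeal x U).map (algebraMap (C.𝒪 U) (OA A U))

/-- Evaluation at the point `x`, on `U × Spec A`. -/
def evA {x : C.Pt} {U : C.AffOpen} (hx : x.1 ∈ U.1.1) : OA A U →ₐ[ℂ] A :=
  Algebra.TensorProduct.lift ((Algebra.ofId ℂ A).comp (evU hx)) (AlgHom.id ℂ A)
    (fun _ _ => Commute.all _ _)

theorem evA_tmul {x : C.Pt} {U : C.AffOpen} (hx : x.1 ∈ U.1.1) (f : C.𝒪 U) (a : A) :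
    evA hx (f ⊗ₜ a) = algebraMap ℂ A (evU hx f) * a := rfl

theorem OAmap_tmul {U V : C.AffOpen} (h : U ≤ V) (φ : A →ₐ[ℂ] B) (f : C.𝒪 V) (a : A) :
    OAmap h φ (f ⊗ₜ a) = rest h f ⊗ₜ φ a := rfl

theorem OAmap_algebraMap' {U V : C.AffOpen} (h : U ≤ V) (φ : A →ₐ[ℂ] B) (f : C.𝒪 V) :
    OAmap h φ (algebraMap (C.𝒪 V) (OA A V) f) = algebraMap (C.𝒪 U) (OA B U) (rest h f) := by
  change OAmap h φ (f ⊗ₜ 1) = rest h f ⊗ₜ 1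
  rw [OAmap_tmul, map_one]

theorem OAmap_const {U V : C.AffOpen} (h : U ≤ V) (φ : A →ₐ[ℂ] B) (c : ℂ) :
    OAmap h φ (algebraMap ℂ (OA A V) c) = algebraMap ℂ (OA B U) c :=
  (Algebra.TensorProduct.map (rest h) φ).commutes c

theorem evA_OAmap {x : C.Pt} {U V : C.AffOpen} (h : U ≤ V) (hx : x.1 ∈ U.1.1)
    (hx' : x.1 ∈ V.1.1) (φ : A →ₐ[ℂ] B) (s : OA A V) :
    evA hx (OAmap h φ s) = φ (evA hx' s) := by
  induction s using TensorProduct.induction_on with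
  | zero => simp
  | add a b ha hb => rw [map_add, map_add, map_add, map_add, ha, hb]
  | tmul f a =>
    rw [OAmap_tmul, evA_tmul, evA_tmul, map_mul, evU_rest h hx]
    simp

/-- It suffices to treat f ⊗ a, where f minus its value at x lies in I_x. This is what promotes
A-linear data at x to data linear over 𝒪(U) ⊗ A modulo I_x. -/
theorem tmul_sub_mem_ptIdealA {x : C.Pt} {U : C.AffOpen} (hx : x.1 ∈ U.1.1) (s : OA A U) :
    s - (1 : C.𝒪 U) ⊗ₜ evA hx s ∈ ptIdealA x A U := by
  induction s using TensorProduct.induction_on with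
  | zero => simp
  | add a b ha hb =>
    have := add_mem ha hb
    rw [map_add, TensorProduct.tmul_add]
    convert this using 1
    abel
  | tmul f a =>
    have h1 : f ⊗ₜ[ℂ] a - (1 : C.𝒪 U) ⊗ₜ[ℂ] evA hx (f ⊗ₜ[ℂ] a) =
        ((1 : C.𝒪 U) ⊗ₜ[ℂ] a) *
          algebraMap (C.𝒪 U) (OA A U) (f - algebraMap ℂ (C.𝒪 U) (evU hx f)) := by
      rw [evA_tmul, ← Algebra.smul_def, TensorProduct.tmul_smul, TensorProduct.smul_tmul',
        ← TensorProduct.sub_tmul, Algebra.TensorProduct.algebraMap_apply,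
        Algebra.TensorProduct.tmul_mul_tmul, Algebra.algebraMap_eq_smul_one]
      simp [Algebra.algebraMap_eq_smul_one]
    rw [h1]
    exact Ideal.mul_mem_left _ _ (Ideal.mem_map_of_mem _ (sub_evU_mem hx f))

theorem evA_eq_zero {x : C.Pt} {U : C.AffOpen} (hx : x.1 ∈ U.1.1) {s : OA A U}
    (hs : s ∈ ptIdealA x A U) : evA hx s = 0 := by
  have : ptIdealA x A U ≤ RingHom.ker (evA (A := A) hx) := by
    rw [Ideal.map_le_iff_le_comap]
    intro f hf
    change evA hx (f ⊗ₜ 1) = 0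
    rw [evA_tmul, (mem_ptIdeal_iff hx).mp hf]
    simp
  exact this hs

theorem ptIdealA_map {x : C.Pt} {U V : C.AffOpen} (h : U ≤ V) (φ : A →ₐ[ℂ] B) :
    (ptIdealA x A V).map (OAmap h φ) = ptIdealA x B U := by
  rw [ptIdealA, Ideal.map_map, ptIdealA, ← ptIdeal_map h, Ideal.map_map]
  congr 1
  exact RingHom.ext fun f => OAmap_algebraMap' h φ f

theorem algebraMap_mem_nonZeroDivisors {U : C.AffOpen} {f : C.𝒪 U} (hf : f ≠ 0) :
    algebraMap (C.𝒪 U) (OA A U) f ∈ nonZeroDivisors (OA A U) := by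
  rw [mem_nonZeroDivisors_iff_right]
  intro s hs
  refine Module.Flat.smul_left_injective (S := C.𝒪 U) hf ?_
  rw [smul_zero, Algebra.smul_def, mul_comm, hs]

/-! ### Sections of bundles -/

namespace VectorBundle

variable {r : ℕ} (E : C.VectorBundle r A) (F : C.VectorBundle r B)

instance (U : C.AffOpen) : Module.Flat (C.𝒪 U) (E.M U) := by
  have := E.projective U
  exact Module.Flat.trans (C.𝒪 U) (OA A U) (E.M U)

variable {E F}

theorem smul_left_injective {U : C.AffOpen} {f : C.𝒪 U} (hf : f ≠ 0) {x y : E.M U}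
    (h : f • x = f • y) : x = y := Module.Flat.smul_left_injective hf h

theorem algebraMap_smul_eq {U : C.AffOpen} (f : C.𝒪 U) (m : E.M U) :
    algebraMap (C.𝒪 U) (OA A U) f • m = f • m := rfl

theorem ptIdealA_smul_le {x : C.Pt} {U : C.AffOpen} {N P : Submodule (OA A U) (E.M U)} :
    ptIdealA x A U • N ≤ P ↔ ∀ f ∈ ptIdeal x U, ∀ m ∈ N, f • m ∈ P := by
  constructor
  · intro h f hf m hm
    exact h (Submodule.smul_mem_smul (Ideal.mem_map_of_mem _ hf) hm)
  · intro h
    rw [Submodule.smul_le]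
    intro s hs m hm
    induction hs using Submodule.span_induction with
    | mem s hs =>
      obtain ⟨f, hf, rfl⟩ := hs
      exact h f hf m hm
    | zero => rw [zero_smul]; exact zero_mem _
    | add a b _ _ ha hb => rw [add_smul]; exact add_mem ha hb
    | smul a b _ hb => rw [smul_eq_mul, mul_smul]; exact Submodule.smul_mem _ _ hb

theorem smul_mem_ptIdealA_smul {x : C.Pt} {U : C.AffOpen} {N : Submodule (OA A U) (E.M U)}
    {f : C.𝒪 U} (hf : f ∈ ptIdeal x U) {m : E.M U} (hm : m ∈ N) : f • m ∈ ptIdealA x A U • N :=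
  ptIdealA_smul_le.mp le_rfl f hf m hm

theorem vanishing_eq (x : C.Pt) (U : C.AffOpen) : E.vanishing x U = ptIdealA x A U • ⊤ := rfl

theorem smul_mem_vanishing {x : C.Pt} {U : C.AffOpen} {f : C.𝒪 U} (hf : f ∈ ptIdeal x U)
    (m : E.M U) : f • m ∈ E.vanishing x U :=
  smul_mem_ptIdealA_smul hf Submodule.mem_top

theorem vanishing_eq_top {x : C.Pt} {U : C.AffOpen} (hx : x.1 ∉ U.1.1) : E.vanishing x U = ⊤ := by
  rw [eq_top_iff]
  intro m _
  have := smul_mem_vanishing (E := E) (x := x) (U := U) (f := 1) (by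
    rw [ptIdeal_eq_top hx]; trivial) m
  rwa [one_smul] at this

theorem smul_mem_of_mem {U : C.AffOpen} (N : Submodule (OA A U) (E.M U)) {f : C.𝒪 U} {m : E.M U} (hm : m ∈ N) :
    f • m ∈ N := N.smul_mem (algebraMap (C.𝒪 U) (OA A U) f) hm

/-- `g` is a semilinear map of sections over a restriction and a change of the base. -/
theorem map_smul_of_semilinear {U V : C.AffOpen} (h : U ≤ V) {φ : A →ₐ[ℂ] B}
    {g : E.M V →+ F.M U} (hg : ∀ a m, g (a • m) = OAmap h φ a • g m) (f : C.𝒪 V) (m : E.M V) :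
    g (f • m) = rest h f • g m := by
  rw [← algebraMap_smul_eq, hg, OAmap_algebraMap', algebraMap_smul_eq]

theorem map_mem_of_smul {x : C.Pt} {U V : C.AffOpen} (h : U ≤ V) {f : C.𝒪 V}
    (hf : f ∈ ptIdeal x V) : rest h f ∈ ptIdeal x U := by
  rw [← ptIdeal_map h]
  exact Ideal.mem_map_of_mem _ hf

theorem span_image_vanishing (x : C.Pt) {U V : C.AffOpen} (h : U ≤ V) {φ : A →ₐ[ℂ] B}
    {g : E.M V →+ F.M U} (hg : ∀ a m, g (a • m) = OAmap h φ a • g m)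
    (hs : Submodule.span (OA B U) (Set.range g) = ⊤) :
    Submodule.span (OA B U) (g '' (E.vanishing x V : Set (E.M V))) = F.vanishing x U := by
  rw [vanishing_eq, span_image_smul hg, ptIdealA_map, vanishing_eq]
  congr 1
  rw [← hs, Submodule.top_coe, Set.image_univ]

theorem map_mem_vanishing {x : C.Pt} {U V : C.AffOpen} (h : U ≤ V) {φ : A →ₐ[ℂ] B}
    {g : E.M V →+ F.M U} (hg : ∀ a m, g (a • m) = OAmap h φ a • g m) {m : E.M V}
    (hm : m ∈ E.vanishing x V) : g m ∈ F.vanishing x U := by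
  have : E.vanishing x V ≤ (F.vanishing x U).comap
      ({ toFun := g, map_add' := g.map_add, map_smul' := hg } : E.M V →ₛₗ[OAmap h φ] F.M U) := by
    rw [vanishing_eq, ptIdealA_smul_le]
    intro f hf m _
    change g (f • m) ∈ F.vanishing x U
    rw [map_smul_of_semilinear h hg]
    exact smul_mem_vanishing (map_mem_of_smul h hf) _
  exact this hm

/-- The fibre at a point may be computed on any affine neighbourhood. -/
theorem mem_vanishing_of_map_mem {x : C.Pt} {U V : C.AffOpen} (h : U ≤ V) (hx : x.1 ∈ U.1.1)
    {m : E.M V} (hm : E.res h m ∈ E.vanishing x U) : m ∈ E.vanishing x V := by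
  have hx' : x.1 ∈ V.1.1 := h hx
  let Q := E.M V ⧸ E.vanishing x V
  -- Through evaluation at x, the fibre quotient over V becomes a module over 𝒪(U) ⊗ A. The quotient
  -- map on E(V) therefore extends to the base change E(U), and the extension kills every section
  -- vanishing at x.
  let ψ : OA A U →+* OA A V :=
    (Algebra.TensorProduct.includeRight.comp (evA (A := A) hx)).toRingHom
  let _ : Module (OA A U) Q := Module.compHom Q ψ
  obtain ⟨G, hG⟩ := (E.quasiCoherent h).exists_lift (E.vanishing x V).mkQ.toAddMonoidHom (by
    intro s m
    change (E.vanishing x V).mkQ (s • m) = ψ (OAmap h (AlgHom.id ℂ A) s) • (E.vanishing x V).mkQ m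
    rw [← map_smul, ← sub_eq_zero, ← map_sub, ← sub_smul]
    refine (Submodule.Quotient.mk_eq_zero _).mpr (Submodule.smul_mem_smul ?_ Submodule.mem_top)
    have h1 : ψ (OAmap h (AlgHom.id ℂ A) s) = (1 : C.𝒪 V) ⊗ₜ evA hx' s := by
      change (1 : C.𝒪 V) ⊗ₜ[ℂ] evA hx (OAmap h (AlgHom.id ℂ A) s) = _
      rw [evA_OAmap h hx hx']
      rfl
    rw [h1]
    exact tmul_sub_mem_ptIdealA hx' s)
  have hk : ∀ y ∈ E.vanishing x U, G y = 0 := by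
    intro y hy
    refine Submodule.smul_induction_on hy (fun s hs m _ => ?_) (fun a b ha hb => ?_)
    · rw [map_smul]
      change ψ s • G m = 0
      have : ψ s = 0 := by
        change (1 : C.𝒪 V) ⊗ₜ[ℂ] evA hx s = 0
        rw [evA_eq_zero hx hs, TensorProduct.tmul_zero]
      rw [this, zero_smul]
    · rw [map_add, ha, hb, add_zero]
  have h2 := (hG m).symm.trans (hk _ hm)
  exact (Submodule.Quotient.mk_eq_zero _).mp h2

/-! ### Division of sections vanishing at a point -/

/-- The section y stands for j m. As j is not a function on U, it is pinned down by its multiples f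
y = (f j) m for f ∈ I_x, which is enough because E is torsion-free. -/
theorem exists_division {x : C.Pt} {U : C.AffOpen} (j : twistFun x U) {m : E.M U}
    (hm : m ∈ E.vanishing x U) :
    ∃ y : E.M U, ∀ f : ptIdeal x U, (f : C.𝒪 U) • y = twistMul f j • m := by
  refine Submodule.smul_induction_on hm (fun s hs m _ => ?_) (fun a b ha hb => ?_)
  · induction hs using Submodule.span_induction with
    | mem s hs =>
      obtain ⟨g, hg, rfl⟩ := hs
      refine ⟨twistMul ⟨g, hg⟩ j • m, fun f => ?_⟩
      rw [algebraMap_smul_eq, smul_smul, smul_smul]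
      congr 1
      apply algebraMap_injective U
      rw [map_mul, map_mul, algebraMap_twistMul, algebraMap_twistMul]
      ring
    | zero => exact ⟨0, fun f => by rw [zero_smul, smul_zero, smul_zero]⟩
    | add a b _ _ ha hb =>
      obtain ⟨y, hy⟩ := ha
      obtain ⟨z, hz⟩ := hb
      exact ⟨y + z, fun f => by rw [smul_add, hy, hz, add_smul, smul_add]⟩
    | smul a b _ hb =>
      obtain ⟨y, hy⟩ := hb
      exact ⟨a • y, fun f => by rw [smul_comm, hy, smul_eq_mul, mul_smul, smul_comm]⟩
  · obtain ⟨y, hy⟩ := ha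
    obtain ⟨z, hz⟩ := hb
    exact ⟨y + z, fun f => by rw [smul_add, hy, hz, smul_add]⟩

theorem exists_mem_ptIdeal_ne_zero (x : C.Pt) (U : C.AffOpen) : ∃ f ∈ ptIdeal x U, f ≠ 0 := by
  by_contra! h
  exact ptIdeal_ne_bot x U ((Submodule.eq_bot_iff _).mpr h)

/-- Two sections with the same multiples by `I_x` agree. -/
theorem eq_of_forall_smul_eq (x : C.Pt) {U : C.AffOpen} {m m' : E.M U}
    (h : ∀ f ∈ ptIdeal x U, f • m = f • m') : m = m' := by
  obtain ⟨f, hf, hf0⟩ := exists_mem_ptIdeal_ne_zero x U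
  exact smul_left_injective hf0 (h f hf)

/-- Multiplication `I_x E → E` by a function `j` with at most a simple pole at `x`. -/
def divMap {x : C.Pt} {U : C.AffOpen} (j : twistFun x U) : E.vanishing x U →ₗ[OA A U] E.M U where
  toFun m := (exists_division j m.2).choose
  map_add' m m' := eq_of_forall_smul_eq x fun f hf => by
    rw [smul_add, (exists_division j m.2).choose_spec ⟨f, hf⟩,
      (exists_division j m'.2).choose_spec ⟨f, hf⟩,
      (exists_division j (m + m').2).choose_spec ⟨f, hf⟩, ← smul_add]
    rfl
  map_smul' a m := eq_of_forall_smul_eq x fun f hf => by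
    rw [RingHom.id_apply, smul_comm, (exists_division j m.2).choose_spec ⟨f, hf⟩,
      (exists_division j (a • m).2).choose_spec ⟨f, hf⟩, smul_comm]
    rfl

theorem smul_divMap {x : C.Pt} {U : C.AffOpen} (j : twistFun x U) (m : E.vanishing x U)
    (f : ptIdeal x U) : (f : C.𝒪 U) • divMap j m = twistMul f j • (m : E.M U) :=
  (exists_division j m.2).choose_spec f

theorem divMap_eq {x : C.Pt} {U : C.AffOpen} {j : twistFun x U} {m : E.vanishing x U} {y : E.M U}
    (f : ptIdeal x U) (hf : (f : C.𝒪 U) ≠ 0)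
    (h : (f : C.𝒪 U) • y = twistMul f j • (m : E.M U)) : divMap j m = y :=
  smul_left_injective hf (by rw [smul_divMap, h])

end VectorBundle
end SmoothProjCurve

/-! ### Functions with a simple pole under restriction, and subsheaves of a bundle -/

namespace SmoothProjCurve

variable {C : SmoothProjCurve} {A B : Type} [CommRing A] [Algebra ℂ A] [CommRing B] [Algebra ℂ B]

theorem twistFun_rest {x : C.Pt} {U V : C.AffOpen} (h : U ≤ V) {k : C.K} (hk : k ∈ twistFun x V) :
    k ∈ twistFun x U := by
  intro f hf
  rw [← ptIdeal_map h] at hf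
  induction hf using Submodule.span_induction with
  | mem f hf =>
    obtain ⟨g, hg, rfl⟩ := hf
    obtain ⟨p, hp⟩ := hk g hg
    refine ⟨rest h p, ?_⟩
    rw [algebraMap_rest, hp, Algebra.smul_def, Algebra.smul_def]
    congr 1
    exact (algebraMap_rest h g).symm
  | zero => exact ⟨0, by simp⟩
  | add a b _ _ ha hb =>
    obtain ⟨p, hp⟩ := ha
    obtain ⟨q, hq⟩ := hb
    exact ⟨p + q, by rw [map_add, hp, hq, add_smul]⟩
  | smul a b _ hb =>
    obtain ⟨p, hp⟩ := hb
    exact ⟨a * p, by rw [map_mul, hp, smul_eq_mul, mul_smul, Algebra.smul_def a]⟩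

/-- Restriction of functions with at most a simple pole at `x`. -/
def twistRest {x : C.Pt} {U V : C.AffOpen} (h : U ≤ V) (k : twistFun x V) : twistFun x U :=
  ⟨k, twistFun_rest h k.2⟩

/-- Restriction of functions vanishing at `x`. -/
def idealRest {x : C.Pt} {U V : C.AffOpen} (h : U ≤ V) (f : ptIdeal x V) : ptIdeal x U :=
  ⟨rest h f, VectorBundle.map_mem_of_smul h f.2⟩

theorem twistMul_rest {x : C.Pt} {U V : C.AffOpen} (h : U ≤ V) (f : ptIdeal x V)
    (k : twistFun x V) : twistMul (idealRest h f) (twistRest h k) = rest h (twistMul f k) := by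
  apply algebraMap_injective U
  rw [algebraMap_rest, algebraMap_twistMul, algebraMap_twistMul]
  change algebraMap _ _ (rest h (f : C.𝒪 V)) * (k : C.K) = _
  rw [algebraMap_rest]

namespace VectorBundle

variable {r : ℕ} {E : C.VectorBundle r A} {F : C.VectorBundle r B}

theorem map_divMap {x : C.Pt} {U V : C.AffOpen} (h : U ≤ V) {φ : A →ₐ[ℂ] B}
    {g : E.M V →+ F.M U} (hg : ∀ a m, g (a • m) = OAmap h φ a • g m) (j : twistFun x V)
    (m : E.vanishing x V) (m' : F.vanishing x U) (hm : (m' : F.M U) = g m) :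
    divMap (twistRest h j) m' = g (divMap j m) := by
  obtain ⟨f, hf, hf0⟩ := exists_mem_ptIdeal_ne_zero x V
  refine divMap_eq (idealRest h ⟨f, hf⟩) ?_ ?_
  · exact fun h0 => hf0 (rest_injective h (h0.trans (map_zero _).symm))
  · rw [twistMul_rest, hm, ← map_smul_of_semilinear h hg, ← smul_divMap j m ⟨f, hf⟩,
      map_smul_of_semilinear h hg]
    rfl

/-! ### Subsheaves containing `I_x E` which are locally direct summands at `x` -/

section Retract

variable {x : C.Pt} {U V : C.AffOpen} {N : Submodule (OA A U) (E.M U)} {m : ℕ}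

/-- The inclusion of `N` and multiplications by the `j_a` on the complement. -/
def retractIn (e : E.M U →ₗ[OA A U] E.M U) (he' : ∀ y ∈ N, y - e y ∈ E.vanishing x U)
    (j : Fin m → twistFun x U) : Option (Fin m) → N →ₗ[OA A U] E.M U
  | none => N.subtype
  | some a => (divMap (j a)).comp
      (((LinearMap.id - e).comp N.subtype).codRestrict (E.vanishing x U) fun y => he' y y.2)

/-- The projection `e` to `N` and multiplications by the `f_a`. -/
def retractOut (hN : E.vanishing x U ≤ N) (e : E.M U →ₗ[OA A U] E.M U) (he : ∀ y, e y ∈ N)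
    (f : Fin m → ptIdeal x U) : Option (Fin m) → E.M U →ₗ[OA A U] N
  | none => e.codRestrict N he
  | some a => ((algebraMap (C.𝒪 U) (OA A U) (f a)) • LinearMap.id).codRestrict N fun y =>
      hN (smul_mem_vanishing (f a).2 y)

/-- On y the sum is e y + Σ f_a j_a (y - e y): the error y - e y lies in I_x E, and the partition of
unity recovers it. -/
theorem retract_sum (hN : E.vanishing x U ≤ N) (e : E.M U →ₗ[OA A U] E.M U) (he : ∀ y, e y ∈ N)
    (he' : ∀ y ∈ N, y - e y ∈ E.vanishing x U) (f : Fin m → ptIdeal x U)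
    (j : Fin m → twistFun x U) (hfj : ∑ a, twistMul (f a) (j a) = 1) (y : N) :
    ∑ a, retractOut hN e he f a (retractIn e he' j a y) = y := by
  apply Subtype.ext
  rw [Fintype.sum_option, Submodule.coe_add, AddSubmonoidClass.coe_finsetSum]
  have h1 : ∀ a, (retractOut hN e he f (some a) (retractIn e he' j (some a) y) : E.M U) =
      twistMul (f a) (j a) • ((y : E.M U) - e y) := fun a =>
    smul_divMap (j a) ⟨(y : E.M U) - e y, he' y y.2⟩ (f a)
  simp only [h1]
  rw [← Finset.sum_smul, hfj, one_smul]
  change e y + ((y : E.M U) - e y) = y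
  abel

theorem projective_submodule (hN : E.vanishing x U ≤ N)
    (h : ∃ e : E.M U →ₗ[OA A U] E.M U, (∀ y, e y ∈ N) ∧ ∀ y ∈ N, y - e y ∈ E.vanishing x U) :
    Module.Projective (OA A U) N := by
  obtain ⟨e, he, he'⟩ := h
  obtain ⟨m, f, j, hfj⟩ := C.exists_twist_partition x U
  have := E.projective U
  exact Module.Projective.of_retract _ _ (retract_sum hN e he he' f j hfj)

theorem finite_submodule (hN : E.vanishing x U ≤ N)
    (h : ∃ e : E.M U →ₗ[OA A U] E.M U, (∀ y, e y ∈ N) ∧ ∀ y ∈ N, y - e y ∈ E.vanishing x U) :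
    Module.Finite (OA A U) N := by
  obtain ⟨e, he, he'⟩ := h
  obtain ⟨m, f, j, hfj⟩ := C.exists_twist_partition x U
  have := E.finite U
  exact Module.Finite.of_retract _ _ (retract_sum hN e he he' f j hfj)

theorem rankAtStalk_submodule (hN : E.vanishing x U ≤ N)
    (h : ∃ e : E.M U →ₗ[OA A U] E.M U, (∀ y, e y ∈ N) ∧ ∀ y ∈ N, y - e y ∈ E.vanishing x U) :
    Module.rankAtStalk (R := OA A U) N = fun _ => r := by
  have := E.projective U
  have := E.finite U
  have := projective_submodule hN h
  have := finite_submodule hN h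
  obtain ⟨f, hf, hf0⟩ := exists_mem_ptIdeal_ne_zero x U
  rw [← E.rank_eq U]
  refine rankAtStalk_eq_of_injective N.subtype N.subtype_injective
    (algebraMap_mem_nonZeroDivisors hf0) fun y => ?_
  rw [Submodule.range_subtype]
  exact hN (smul_mem_vanishing hf y)

/-- Base change of such subsheaves. -/
theorem isBaseChangeAlong_submodule {N : Submodule (OA A V) (E.M V)} (h : U ≤ V) {φ : A →ₐ[ℂ] B}
    {g : E.M V →+ F.M U} {hg : ∀ a m, g (a • m) = OAmap h φ a • g m}
    (hb : IsBaseChangeAlong (OAmap h φ) g hg) (hN : E.vanishing x V ≤ N)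
    {N' : Submodule (OA B U) (F.M U)}
    (hN' : N' = Submodule.span (OA B U) (g '' (N : Set (E.M V))))
    (hE : ∃ e : E.M V →ₗ[OA A V] E.M V, (∀ y, e y ∈ N) ∧ ∀ y ∈ N, y - e y ∈ E.vanishing x V)
    {g' : N →+ N'} (hg' : ∀ y, (g' y : F.M U) = g y)
    (hs : ∀ s y, g' (s • y) = OAmap h φ s • g' y) : IsBaseChangeAlong (OAmap h φ) g' hs := by
  obtain ⟨e, he, he'⟩ := hE
  obtain ⟨m, f, j, hfj⟩ := C.exists_twist_partition x V
  -- The projection on the target is not chosen independently: it is the linear extension of e, so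
  -- that the two retract structures are compatible with g.
  obtain ⟨e', hee⟩ := hb.exists_lift (g.comp e.toAddMonoidHom) (fun s y => by
    change g (e (s • y)) = OAmap h φ s • g (e y)
    rw [map_smul, hg])
  replace hee : ∀ y, e' (g y) = g (e y) := hee
  have he1 : ∀ y, e' y ∈ N' := by
    intro y
    have hy : y ∈ Submodule.span (OA B U) (Set.range g) := by rw [hb.span_range]; trivial
    induction hy using Submodule.span_induction with
    | mem y hy =>
      obtain ⟨y, rfl⟩ := hy
      rw [hee, hN']
      exact Submodule.subset_span ⟨_, he y, rfl⟩
    | zero => rw [map_zero]; exact zero_mem _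
    | add a b _ _ ha hb => rw [map_add]; exact add_mem ha hb
    | smul a b _ hb => rw [map_smul]; exact N'.smul_mem _ hb
  have he1' : ∀ y ∈ N', y - e' y ∈ F.vanishing x U := by
    intro y hy
    rw [hN'] at hy
    induction hy using Submodule.span_induction with
    | mem y hy =>
      obtain ⟨y, hy, rfl⟩ := hy
      rw [hee, ← map_sub]
      exact map_mem_vanishing h hg (he' y hy)
    | zero => rw [map_zero, sub_zero]; exact zero_mem _
    | add a b _ _ ha hb => rw [map_add, add_sub_add_comm]; exact add_mem ha hb
    | smul a b _ hb => rw [map_smul, ← smul_sub]; exact Submodule.smul_mem _ _ hb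
  have hvan : F.vanishing x U ≤ N' := by
    rw [hN', ← span_image_vanishing x h hg hb.span_range]
    exact Submodule.span_mono (Set.image_mono hN)
  have hfj' : ∑ a, twistMul (idealRest h (f a)) (twistRest h (j a)) = 1 := by
    simp only [twistMul_rest]
    rw [← map_sum, hfj, map_one]
  refine IsBaseChangeAlong.of_retract hs hb (retractIn e he' j) (retractOut hN e he f)
    (retractIn e' he1' fun a => twistRest h (j a))
    (retractOut hvan e' he1 fun a => idealRest h (f a)) ?_ ?_ (retract_sum hN e he he' f j hfj)
    (retract_sum hvan e' he1 he1' _ _ hfj')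
  · rintro (_ | a) y
    · exact hg' y
    · refine map_divMap h hg (j a) ⟨(y : E.M V) - e y, he' y y.2⟩
        ⟨(g' y : F.M U) - e' (g' y), he1' _ (g' y).2⟩ ?_
      change (g' y : F.M U) - e' (g' y) = g ((y : E.M V) - e y)
      rw [hg', hee, map_sub]
  · rintro (_ | a) y
    · apply Subtype.ext
      rw [hg']
      exact hee y
    · apply Subtype.ext
      rw [hg']
      exact (map_smul_of_semilinear h hg (f a : C.𝒪 V) y).symm

end Retract

/-- If `N₁` is cut out of `N₀` by line bundle quotients, projections onto `N₀` modulo `I_x E` may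
be corrected to `N₁`. -/
theorem exists_projection_of_linear {x : C.Pt} {U : C.AffOpen} (hx : x.1 ∈ U.1.1)
    {N : Submodule (OA A U) (E.M U)} (hN : E.vanishing x U ≤ N) (p : E.M U →+ E.M U)
    (hp : ∀ (a : A) y, p (((1 : C.𝒪 U) ⊗ₜ a : OA A U) • y) = ((1 : C.𝒪 U) ⊗ₜ a : OA A U) • p y)
    (hp0 : ∀ y, p y ∈ N) (hp1 : ∀ y ∈ N, p y = y) :
    ∃ e : E.M U →ₗ[OA A U] E.M U, (∀ y, e y ∈ N) ∧ ∀ y ∈ N, y - e y ∈ E.vanishing x U := by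
  let W := (E.vanishing x U).submoduleOf N
  -- The map p is only A-linear, but modulo I_x E it is linear over 𝒪(U) ⊗ A: s differs from 1 ⊗
  -- s(x) by an element of I_x, and p fixes I_x E. Projectivity of E then lifts the result to a
  -- linear map into N.
  let P : E.M U →ₗ[OA A U] N ⧸ W :=
    { toFun := fun y => W.mkQ ⟨p y, hp0 y⟩
      map_add' := fun y z => by
        rw [← map_add]
        congr 1
        exact Subtype.ext (map_add p y z)
      map_smul' := fun s y => by
        rw [RingHom.id_apply, ← map_smul]
        refine (Submodule.Quotient.eq W).mpr ?_
        change p (s • y) - s • p y ∈ E.vanishing x U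
        have h1 : ∀ z : E.M U, (s - (1 : C.𝒪 U) ⊗ₜ evA hx s) • z ∈ E.vanishing x U := fun z =>
          Submodule.smul_mem_smul (tmul_sub_mem_ptIdealA hx s) Submodule.mem_top
        have h2 : p (s • y) - s • p y = (s - (1 : C.𝒪 U) ⊗ₜ evA hx s) • y -
            (s - (1 : C.𝒪 U) ⊗ₜ evA hx s) • p y := by
          conv_lhs => rw [← sub_add_cancel s ((1 : C.𝒪 U) ⊗ₜ evA hx s)]
          rw [add_smul, map_add, hp1 _ (hN (h1 y)), hp, sub_add_cancel, sub_smul s _ (p y)]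
          abel
        rw [h2]
        exact sub_mem (h1 y) (h1 _) }
  have := E.projective U
  obtain ⟨e, he⟩ := Module.projective_lifting_property W.mkQ P W.mkQ_surjective
  refine ⟨N.subtype.comp e, fun y => (e y).2, fun y hy => ?_⟩
  have h3 := LinearMap.congr_fun he y
  have h4 := (Submodule.Quotient.eq W).mp h3.symm
  have h5 : p y - (e y : E.M U) ∈ E.vanishing x U := h4
  rwa [hp1 y hy] at h5

end VectorBundle

/-! ### Steps of the flag are direct summands modulo I_{t_i}E -/

namespace ParConn

variable {n : ℕ} {t : Fin n → C.Pt} {r : ℕ} {lam : Fin n → Fin r → ℂ} (X : ParConn t lam)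

theorem invQuot (i : Fin n) (j : Fin r) (U : C.AffOpen) (hU : (t i).1 ∈ U.1.1) :
    InvQuot (Algebra.TensorProduct.includeRight : X.A →ₐ[ℂ] OA X.A U).toRingHom
      (X.L i j.castSucc U) (X.L i j.succ U) := X.invertible i j U hU

theorem L_antitone (i : Fin n) (U : C.AffOpen) : Antitone fun q => X.L i q U :=
  Fin.antitone_iff_succ_le.mpr fun q => X.L_succ_le i q U

theorem vanishing_le (i : Fin n) (q : Fin (r + 1)) (U : C.AffOpen) :
    X.E.vanishing (t i) U ≤ X.L i q U := by
  rw [← X.L_last]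
  exact X.L_antitone i U (Fin.le_last q)

theorem L_eq_top {i : Fin n} {U : C.AffOpen} (hU : (t i).1 ∉ U.1.1) (q : Fin (r + 1)) :
    X.L i q U = ⊤ := by
  rw [eq_top_iff, ← VectorBundle.vanishing_eq_top hU]
  exact X.vanishing_le i q U

/-- Going down the flag, each line bundle quotient lets an A-linear projection onto one step be cut
down to the next. At the end the projection is made linear over 𝒪(U) ⊗ A, at the cost of an error in
I_{t_i}E. -/
theorem exists_projection (i : Fin n) (q : Fin (r + 1)) (U : C.AffOpen) :
    ∃ e : X.M U →ₗ[OA X.A U] X.M U, (∀ y, e y ∈ X.L i q U) ∧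
      ∀ y ∈ X.L i q U, y - e y ∈ X.E.vanishing (t i) U := by
  by_cases hU : (t i).1 ∈ U.1.1
  · have key : ∃ p : X.M U →+ X.M U,
        (∀ (a : X.A) y, p (((1 : C.𝒪 U) ⊗ₜ a : OA X.A U) • y) =
          ((1 : C.𝒪 U) ⊗ₜ a : OA X.A U) • p y) ∧ (∀ y, p y ∈ X.L i q U) ∧
        ∀ y ∈ X.L i q U, p y = y := by
      induction q using Fin.induction with
      | zero => exact ⟨AddMonoidHom.id _, fun _ _ => rfl, fun y => by rw [X.L_zero]; trivial,
          fun _ _ => rfl⟩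
      | succ q ih =>
        obtain ⟨p, hp, hp0, hp1⟩ := ih
        exact (X.invQuot i q U hU).exists_projection (X.L_succ_le i q U) p hp hp0 hp1
    obtain ⟨p, hp, hp0, hp1⟩ := key
    exact VectorBundle.exists_projection_of_linear hU (X.vanishing_le i q U) p hp hp0 hp1
  · exact ⟨LinearMap.id, fun y => by rw [X.L_eq_top hU]; trivial, fun y _ => by
      rw [VectorBundle.vanishing_eq_top hU]; trivial⟩

end ParConn
end SmoothProjCurve

/-! ### Residues of logarithmic connections, without coordinates -/

namespace SmoothProjCurve

variable {C : SmoothProjCurve} {A B : Type} [CommRing A] [Algebra ℂ A] [CommRing B] [Algebra ℂ B]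
variable {n : ℕ} {t : Fin n → C.Pt} (ht : Function.Injective t) {i : Fin n} {r : ℕ}

theorem resLog_id {U : C.AffOpen} (hU : (t i).1 ∈ U.1.1) (ω : logDiff t U) :
    resLog ht hU (AddMonoidHom.id (logDiff t U) ω) = resLog ht hU ω := by
  rw [AddMonoidHom.id_apply]

namespace VectorBundle

variable (E : C.VectorBundle r A) {F : C.VectorBundle r B}

theorem mk_vanishing_eq {x : C.Pt} {U : C.AffOpen} {m m' : E.M U} :
    (E.vanishing x U).mkQ m = (E.vanishing x U).mkQ m' ↔ m - m' ∈ E.vanishing x U :=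
  Submodule.Quotient.eq _

theorem const_smul_sub_mem {x : C.Pt} {U : C.AffOpen} (hU : x.1 ∈ U.1.1) (f : C.𝒪 U) (m : E.M U) :
    f • m - algebraMap ℂ (OA A U) (evU hU f) • m ∈ E.vanishing x U := by
  have h1 : f • m - algebraMap ℂ (OA A U) (evU hU f) • m =
      (f - algebraMap ℂ (C.𝒪 U) (evU hU f)) • m := by
    rw [sub_smul, ← algebraMap_smul_eq (algebraMap ℂ (C.𝒪 U) (evU hU f)),
      ← IsScalarTower.algebraMap_apply]
  rw [h1]
  exact smul_mem_vanishing (sub_evU_mem hU f) m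

/-- The residue at `t_i` of a section of `E ⊗ Ω¹(t_1 + ⋯ + t_n)`, as an element of `E|_{t_i}`. -/
def resTensor {U : C.AffOpen} (hU : (t i).1 ∈ U.1.1) :
    E.M U ⊗[C.𝒪 U] logDiff t U →+ E.M U ⧸ E.vanishing (t i) U :=
  TensorProduct.liftAddHom
    { toFun := fun m =>
        { toFun := fun ω => (E.vanishing (t i) U).mkQ (algebraMap ℂ (OA A U) (resLog ht hU ω) • m)
          map_zero' := by simp
          map_add' := fun ω ω' => by rw [map_add, map_add, add_smul, map_add] }
      map_zero' := by ext; simp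
      map_add' := fun m m' => by ext ω; simp }
    (fun f m ω => by
      change (E.vanishing (t i) U).mkQ (algebraMap ℂ (OA A U) (resLog ht hU ω) • f • m) =
        (E.vanishing (t i) U).mkQ (algebraMap ℂ (OA A U) (resLog ht hU (f • ω)) • m)
      rw [mk_vanishing_eq, resLog_smul, mul_comm, map_mul, mul_smul, ← smul_sub]
      exact Submodule.smul_mem _ _ (E.const_smul_sub_mem hU f m))

theorem resTensor_tmul {U : C.AffOpen} (hU : (t i).1 ∈ U.1.1) (m : E.M U) (ω : logDiff t U) :
    E.resTensor ht hU (m ⊗ₜ ω) =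
      (E.vanishing (t i) U).mkQ (algebraMap ℂ (OA A U) (resLog ht hU ω) • m) := rfl

theorem resTensor_smul {U : C.AffOpen} (hU : (t i).1 ∈ U.1.1) (s : OA A U)
    (y : E.M U ⊗[C.𝒪 U] logDiff t U) : E.resTensor ht hU (s • y) = s • E.resTensor ht hU y := by
  induction y with
  | zero => simp
  | add a b ha hb => rw [smul_add, map_add, map_add, smul_add, ha, hb]
  | tmul m ω =>
    rw [TensorProduct.smul_tmul', resTensor_tmul, resTensor_tmul, ← map_smul, smul_comm]

variable {E}

/-- The shape of g covers both the restriction to a smaller open subset and morphisms over a change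
of the base ring. -/
theorem resTensor_map {U V : C.AffOpen} (h : U ≤ V) (hU : (t i).1 ∈ U.1.1) {φ : A →ₐ[ℂ] B}
    {g : E.M V →+ F.M U} (hg : ∀ a m, g (a • m) = OAmap h φ a • g m) {σ : C.𝒪 V →+* C.𝒪 U}
    {gl : logDiff t V →+ logDiff t U} (hf : ∀ (f : C.𝒪 V) (m : E.M V), g (f • m) = σ f • g m)
    (hgl : ∀ (f : C.𝒪 V) (ω : logDiff t V), gl (f • ω) = σ f • gl ω)
    (hres : ∀ ω, resLog ht hU (gl ω) = resLog ht (show (t i).1 ∈ V.1.1 from h hU) ω)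
    {y : E.M V ⊗[C.𝒪 V] logDiff t V} {m : E.M V}
    (hy : E.resTensor ht (h hU) y = (E.vanishing (t i) V).mkQ m) :
    F.resTensor ht hU (tensorMapAlong σ g gl hf hgl y) = (F.vanishing (t i) U).mkQ (g m) := by
  -- A residue has a representative only modulo I_{t_i}E. The claim is proved for some
  -- representative, additively in y, and then transferred to the given one.
  have key : ∃ m, E.resTensor ht (h hU) y = (E.vanishing (t i) V).mkQ m ∧
      F.resTensor ht hU (tensorMapAlong σ g gl hf hgl y) = (F.vanishing (t i) U).mkQ (g m) := by
    clear hy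
    induction y with
    | zero => exact ⟨0, by simp, by simp⟩
    | add a b ha hb =>
      obtain ⟨m, h1, h2⟩ := ha
      obtain ⟨m', h1', h2'⟩ := hb
      exact ⟨m + m', by rw [map_add, map_add, h1, h1'], by rw [map_add, map_add, map_add, map_add, h2, h2']⟩
    | tmul m ω =>
      refine ⟨algebraMap ℂ (OA A V) (resLog ht (h hU) ω) • m, rfl, ?_⟩
      rw [tensorMapAlong_tmul, resTensor_tmul, hg, OAmap_const, hres]
  obtain ⟨m', h1, h2⟩ := key
  rw [h2, mk_vanishing_eq, ← map_sub]
  rw [hy, eq_comm, mk_vanishing_eq] at h1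
  exact map_mem_vanishing h hg h1

variable (t) in
-- The form Σ j_a df_a has as residue the value of Σ f_a j_a = 1.
theorem exists_resLog_eq_one {U : C.AffOpen} (hU : (t i).1 ∈ U.1.1) :
    ∃ ω : logDiff t U, resLog ht hU ω = 1 := by
  obtain ⟨m, f, j, h⟩ := C.exists_twist_partition (t i) U
  refine ⟨∑ a, twistD (j a) (f a).1, ?_⟩
  rw [map_sum]
  simp only [resLog_twistD]
  rw [← map_sum, h, map_one]

/-- A section of `E ⊗ Ω¹(t_1 + ⋯ + t_n)` with residue in `N` comes from `N ⊗ Ω¹(t_1 + ⋯ + t_n)`,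
if `I_{t_i} E ⊆ N`. -/
theorem mem_of_resTensor_eq {U : C.AffOpen} (hU : (t i).1 ∈ U.1.1) {N : Submodule (OA A U) (E.M U)}
    (hN : E.vanishing (t i) U ≤ N) {y : E.M U ⊗[C.𝒪 U] logDiff t U} {m : E.M U} (hm : m ∈ N)
    (hy : E.resTensor ht hU y = (E.vanishing (t i) U).mkQ m)
    (P : AddSubgroup (E.M U ⊗[C.𝒪 U] logDiff t U)) (hmem : ∀ m ∈ N, ∀ ω, m ⊗ₜ ω ∈ P) : y ∈ P := by
  obtain ⟨ω₀, hω₀⟩ := exists_resLog_eq_one t ht hU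
  -- Modulo tensors from N, y equals m ⊗ ω₀ with m a representative of its residue. Indeed ω -
  -- res(ω) ω₀ has no residue, so it lies in I_{t_i} Ω¹(D), and the ideal can be moved to the first
  -- factor, where it lands in I_{t_i}E ⊆ N.
  have key : ∀ y : E.M U ⊗[C.𝒪 U] logDiff t U, ∃ m,
      E.resTensor ht hU y = (E.vanishing (t i) U).mkQ m ∧ y - m ⊗ₜ ω₀ ∈ P := by
    intro y
    induction y with
    | zero => exact ⟨0, by simp, by simp⟩
    | add a b ha hb =>
      obtain ⟨m, h1, h2⟩ := ha
      obtain ⟨m', h1', h2'⟩ := hb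
      refine ⟨m + m', by rw [map_add, map_add, h1, h1'], ?_⟩
      rw [TensorProduct.add_tmul, add_sub_add_comm]
      exact add_mem h2 h2'
    | tmul m ω =>
      refine ⟨algebraMap ℂ (OA A U) (resLog ht hU ω) • m, rfl, ?_⟩
      have h1 : resLog ht hU (ω - algebraMap ℂ (C.𝒪 U) (resLog ht hU ω) • ω₀) = 0 := by
        rw [map_sub, resLog_smul, hω₀, AlgHom.commutes]
        simp
      have h2 := mem_smul_top_of_resLog_eq_zero ht hU h1
      have h3 : (algebraMap ℂ (OA A U) (resLog ht hU ω) • m) ⊗ₜ[C.𝒪 U] ω₀ =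
          m ⊗ₜ[C.𝒪 U] (algebraMap ℂ (C.𝒪 U) (resLog ht hU ω) • ω₀) := by
        rw [← TensorProduct.smul_tmul, ← algebraMap_smul_eq, ← IsScalarTower.algebraMap_apply]
      rw [h3, ← TensorProduct.tmul_sub]
      refine Submodule.smul_induction_on h2 (fun f hf η _ => ?_) (fun a b ha hb => ?_)
      · rw [← TensorProduct.smul_tmul]
        exact hmem _ (hN (smul_mem_vanishing hf m)) η
      · rw [TensorProduct.tmul_add]
        exact add_mem ha hb
  obtain ⟨m', h1, h2⟩ := key y
  have h3 : m' ∈ N := by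
    rw [hy, mk_vanishing_eq] at h1
    have := sub_mem hm (hN h1)
    rwa [sub_sub_cancel] at this
  rw [← sub_add_cancel y (m' ⊗ₜ ω₀)]
  exact add_mem h2 (hmem _ h3 _)

end VectorBundle

namespace LogConn

variable (X Y : LogConn t r)

/-- The residue of a section at `t_i`. -/
def resid {U : C.AffOpen} (hU : (t i).1 ∈ U.1.1) : X.M U →+ X.M U ⧸ X.E.vanishing (t i) U :=
  (X.E.resTensor ht hU).comp (X.nabla U)

variable {X Y}

theorem resid_res {U V : C.AffOpen} (h : U ≤ V) (hU : (t i).1 ∈ U.1.1) {m m' : X.M V}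
    (hm : X.resid ht (h hU) m = (X.E.vanishing (t i) V).mkQ m') :
    X.resid ht hU (X.E.res h m) = (X.E.vanishing (t i) U).mkQ (X.E.res h m') := by
  change X.E.resTensor ht hU (X.nabla U _) = _
  rw [X.nabla_res]
  exact VectorBundle.resTensor_map ht h hU (X.E.res_smul h) _ _ (resLog_logRest ht h hU) hm

theorem resid_hom (g : X ⟶ Y) {U : C.AffOpen} (hU : (t i).1 ∈ U.1.1) {m m' : X.M U}
    (hm : X.resid ht hU m = (X.E.vanishing (t i) U).mkQ m') :
    Y.resid ht hU (g.app U m) = (Y.E.vanishing (t i) U).mkQ (g.app U m') := by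
  change Y.E.resTensor ht hU (Y.nabla U _) = _
  rw [g.horizontal]
  exact VectorBundle.resTensor_map ht (le_rfl' U) hU (g.app_smul U) _ _ (resLog_id ht hU) hm

/-- The definition of `IsResidue` chooses a neighbourhood and a coordinate, whereas `resid` is a map
that depends on neither. One direction uses that dz/z has residue 1 and that the fibre at t_i may be
computed on W; the other shrinks U until all forms occurring in ∇m are multiples of a single dz/z.
-/
theorem isResidue_iff {U : C.AffOpen} (hU : (t i).1 ∈ U.1.1) {m m' : X.M U} :
    X.IsResidue i U m m' ↔ X.resid ht hU m = (X.E.vanishing (t i) U).mkQ m' := by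
  constructor
  · rintro ⟨W, h, z, ω, n', hW, hz, hω, hn, hv⟩
    obtain ⟨m'', hm''⟩ := (X.E.vanishing (t i) U).mkQ_surjective (X.resid ht hU m)
    have h1 := resid_res ht h hW hm''.symm
    have h2 : X.resid ht hW (X.E.res h m) = (X.E.vanishing (t i) W).mkQ n' := by
      change X.E.resTensor ht hW (X.nabla W _) = _
      rw [hn, VectorBundle.resTensor_tmul, resLog_eq_one ht hW hz hω, map_one, one_smul]
    rw [h2, VectorBundle.mk_vanishing_eq] at h1
    rw [← hm'', VectorBundle.mk_vanishing_eq]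
    apply VectorBundle.mem_vanishing_of_map_mem h hW
    rw [map_sub]
    have := sub_mem hv h1
    convert this using 1
    abel
  · intro hm
    obtain ⟨k, a, b, hab⟩ := TensorProduct.exists_sum_tmul_eq (X.nabla U m)
    obtain ⟨W, h, z, ω, hW, hz, hω, hs⟩ := exists_good_coordinate ht hU (Set.range b)
      (Set.finite_range b)
    choose f hf using fun l => hs (b l) ⟨l, rfl⟩
    have h1 : X.nabla W (X.E.res h m) = (∑ l, f l • X.E.res h (a l)) ⊗ₜ ω := by
      rw [X.nabla_res, hab, map_sum, TensorProduct.sum_tmul]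
      refine Finset.sum_congr rfl fun l _ => ?_
      rw [tensorMapAlong_tmul, hf, TensorProduct.smul_tmul]
    refine ⟨W, h, z, ω, _, hW, hz, hω, h1, ?_⟩
    have h2 := resid_res ht h hW hm
    rw [← VectorBundle.mk_vanishing_eq, ← h2]
    change _ = X.E.resTensor ht hW (X.nabla W _)
    rw [h1, VectorBundle.resTensor_tmul, resLog_eq_one ht hW hz hω, map_one, one_smul]

theorem resid_const_smul {U : C.AffOpen} (hU : (t i).1 ∈ U.1.1) (a : X.A) (m : X.M U) :
    X.resid ht hU (((1 : C.𝒪 U) ⊗ₜ a : OA X.A U) • m) =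
      ((1 : C.𝒪 U) ⊗ₜ a : OA X.A U) • X.resid ht hU m := by
  change X.E.resTensor ht hU (X.nabla U _) = _
  rw [X.linear, VectorBundle.resTensor_smul]
  rfl

theorem resid_smul' {U : C.AffOpen} (hU : (t i).1 ∈ U.1.1) (f : C.𝒪 U) (m : X.M U) :
    X.resid ht hU (f • m) = algebraMap (C.𝒪 U) (OA X.A U) f • X.resid ht hU m := by
  change X.E.resTensor ht hU (X.nabla U _) = _
  rw [X.leibniz, map_add, VectorBundle.resTensor_tmul, resLog_dform, map_zero, zero_smul, map_zero,
    zero_add, ← algebraMap_smul (OA X.A U) f (X.nabla U m), VectorBundle.resTensor_smul]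
  rfl

/-- The residue is linear although ∇ is not, because the Leibniz term m ⊗ df has no residue. -/
theorem resid_smul {U : C.AffOpen} (hU : (t i).1 ∈ U.1.1) (s : OA X.A U) (m : X.M U) :
    X.resid ht hU (s • m) = s • X.resid ht hU m := by
  induction s using TensorProduct.induction_on with
  | zero => simp
  | add a b ha hb => rw [add_smul, map_add, ha, hb, add_smul]
  | tmul f a =>
    have h1 : f ⊗ₜ[ℂ] a = algebraMap (C.𝒪 U) (OA X.A U) f * ((1 : C.𝒪 U) ⊗ₜ a) := by
      rw [Algebra.TensorProduct.algebraMap_apply, Algebra.TensorProduct.tmul_mul_tmul]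
      simp
    rw [h1, mul_smul, VectorBundle.algebraMap_smul_eq, resid_smul', resid_const_smul, mul_smul]

theorem resid_vanishing {U : C.AffOpen} (hU : (t i).1 ∈ U.1.1) {m : X.M U}
    (hm : m ∈ X.E.vanishing (t i) U) : X.resid ht hU m = 0 := by
  refine Submodule.smul_induction_on hm (fun s hs m _ => ?_) (fun a b ha hb => ?_)
  · rw [resid_smul]
    obtain ⟨m', hm'⟩ := (X.E.vanishing (t i) U).mkQ_surjective (X.resid ht hU m)
    rw [← hm', ← map_smul]
    exact (Submodule.Quotient.mk_eq_zero _).mpr (Submodule.smul_mem_smul hs Submodule.mem_top)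
  · rw [map_add, ha, hb, add_zero]

theorem exists_resid_eq {U : C.AffOpen} (hU : (t i).1 ∈ U.1.1) (m : X.M U) :
    ∃ m', X.resid ht hU m = (X.E.vanishing (t i) U).mkQ m' := by
  obtain ⟨m', hm'⟩ := (X.E.vanishing (t i) U).mkQ_surjective (X.resid ht hU m)
  exact ⟨m', hm'.symm⟩

end LogConn

namespace ParConn

variable {lam : Fin n → Fin r → ℂ} (X : ParConn t lam)

theorem exists_resid_eq_add (j : Fin r) {U : C.AffOpen} (hU : (t i).1 ∈ U.1.1) {m : X.M U}
    (hm : m ∈ X.L i j.castSucc U) : ∃ m' ∈ X.L i j.succ U, X.resid ht hU m =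
      (X.E.vanishing (t i) U).mkQ (algebraMap ℂ (OA X.A U) (lam i j) • m + m') := by
  obtain ⟨m', h1, h2⟩ := X.residue i j U hU m hm
  refine ⟨_, h2, ?_⟩
  rw [add_sub_cancel]
  exact (LogConn.isResidue_iff ht hU).mp h1

theorem exists_resid_mem (q : Fin (r + 1)) {U : C.AffOpen} (hU : (t i).1 ∈ U.1.1) {m : X.M U}
    (hm : m ∈ X.L i q U) : ∃ m' ∈ X.L i q U, X.resid ht hU m = (X.E.vanishing (t i) U).mkQ m' := by
  induction q using Fin.lastCases with
  | last =>
    rw [X.L_last] at hm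
    exact ⟨0, zero_mem _, by rw [LogConn.resid_vanishing ht hU hm, map_zero]⟩
  | cast j =>
    obtain ⟨m', h1, h2⟩ := X.exists_resid_eq_add ht j hU hm
    exact ⟨_, add_mem (Submodule.smul_mem _ _ hm) (X.L_succ_le i j U h1), h2⟩

end ParConn
end SmoothProjCurve

namespace SmoothProjCurve

variable {C : SmoothProjCurve} {n : ℕ} {t : Fin n → C.Pt} {r : ℕ}

namespace LogConn

/-! ### Lifting morphisms -/

section Lift

variable {X Y Z : LogConn t r}

theorem Hom.app_smul' (k : X ⟶ Y) (U : C.AffOpen) (f : C.𝒪 U) (m : X.M U) :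
    k.app U (f • m) = f • k.app U m := by
  rw [VectorBundle.smul_def, k.app_smul, OAmap_algebraMap]; rfl

/-- A morphism as an `𝒪(U)`-linear map. -/
def Hom.lin (k : X ⟶ Y) (U : C.AffOpen) : X.M U →ₗ[C.𝒪 U] Y.M U :=
  { toFun := k.app U, map_add' := map_add _, map_smul' := k.app_smul' U }

theorem Hom.horizontal' (k : X ⟶ Y) (U : C.AffOpen) (m : X.M U) :
    Y.nabla U (k.app U m) = (k.lin U).rTensor (logDiff t U) (X.nabla U m) := by
  rw [k.horizontal]
  induction X.nabla U m with
  | zero => simp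
  | add a b ha hb => rw [map_add, map_add, ha, hb]
  | tmul a b => rfl

theorem Hom.rTensor_injective {k : Y ⟶ Z} {U : C.AffOpen} (hk : Function.Injective (k.app U)) :
    Function.Injective ((k.lin U).rTensor (logDiff t U)) :=
  Module.Flat.rTensor_preserves_injective_linearMap (k.lin U) hk

/-- Construct a morphism from the semilinear maps on sections. -/
def homMk (b : X.A ⟶ Y.A) (app : ∀ U, X.M U →+ Y.M U)
    (app_smul : ∀ U (a : OA X.A U) (m : X.M U),
      app U (a • m) = OAmap (le_rfl' U) b.hom a • app U m)
    (app_res : ∀ {U V : C.AffOpen} (h : U ≤ V) (m : X.M V),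
      app U (X.E.res h m) = Y.E.res h (app V m))
    (lin : ∀ U, X.M U →ₗ[C.𝒪 U] Y.M U) (hlin : ∀ U m, lin U m = app U m)
    (horizontal : ∀ U (m : X.M U), Y.nabla U (app U m) =
      (lin U).rTensor (logDiff t U) (X.nabla U m)) : X ⟶ Y where
  base := b
  app := app
  app_smul := app_smul
  app_res := app_res
  horizontal U m := by
    rw [horizontal]
    induction X.nabla U m with
    | zero => simp
    | add a b ha hb => rw [map_add, map_add, ha, hb]
    | tmul a b => rw [LinearMap.rTensor_tmul, hlin]; rfl

/-- Preimages under an injective map are unique, so additivity, semilinearity and compatibility with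
restriction are inherited. Horizontality is checked after k ⊗ id, which stays injective because
logarithmic forms are flat. -/
theorem exists_lift (h : X ⟶ Z) (k : Y ⟶ Z) (b : X.A ⟶ Y.A) (hb : h.base = b ≫ k.base)
    (hk : ∀ U, Function.Injective (k.app U)) (hr : ∀ U m, ∃ y, k.app U y = h.app U m) :
    ∃ l : X ⟶ Y, l.base = b ∧ ∀ U m, k.app U (l.app U m) = h.app U m := by
  choose g hg using hr
  have hsmul : ∀ U (a : OA X.A U) (m : X.M U), g U (a • m) = OAmap (le_rfl' U) b.hom a • g U m := by
    intro U a m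
    apply hk U
    rw [hg, h.app_smul, k.app_smul, hg, hb]
    change OAmap _ (k.base.hom.comp b.hom) a • _ = _
    rw [OAmap_comp]
  let app : ∀ U, X.M U →+ Y.M U := fun U =>
    { toFun := g U
      map_zero' := hk U (by rw [hg, map_zero, map_zero])
      map_add' := fun m m' => hk U (by rw [hg, map_add, map_add, hg, hg]) }
  let lin : ∀ U, X.M U →ₗ[C.𝒪 U] Y.M U := fun U =>
    { app U with
      map_smul' := fun f m => hk U (by
        change k.app U (g U (f • m)) = k.app U (f • g U m)
        rw [hg, h.app_smul', k.app_smul', hg]) }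
  refine ⟨homMk b app hsmul (fun {U V} e m => hk U ?_) lin (fun _ _ => rfl) (fun U m => ?_), rfl, hg⟩
  · change k.app U (g U _) = k.app U (Y.E.res e (g V m))
    rw [hg, h.app_res, k.app_res, hg]
  · apply k.rTensor_injective (hk U)
    rw [← k.horizontal', ← LinearMap.rTensor_comp_apply]
    have h1 : (k.lin U).comp (lin U) = h.lin U := LinearMap.ext fun m => hg U m
    rw [h1, ← h.horizontal']
    exact congrArg _ (hg U m)

/-- The factorization of `h : X → Z` through a monomorphism `k : Y → Z`. -/
def lift (h : X ⟶ Z) (k : Y ⟶ Z) (b : X.A ⟶ Y.A) (hb : h.base = b ≫ k.base)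
    (hk : ∀ U, Function.Injective (k.app U)) (hr : ∀ U m, ∃ y, k.app U y = h.app U m) : X ⟶ Y :=
  { (exists_lift h k b hb hk hr).choose with
    -- The base component is replaced by b itself, so that it is known definitionally; later
    -- identities between base morphisms rely on this.
    base := b
    app_smul := by
      intro U a m
      exact ((exists_lift h k b hb hk hr).choose.app_smul U a m).trans
        (congrArg (fun b' : X.A ⟶ Y.A => OAmap (le_rfl' U) b'.hom a •
          (exists_lift h k b hb hk hr).choose.app U m) (exists_lift h k b hb hk hr).choose_spec.1) }

@[simp]
theorem app_lift (h : X ⟶ Z) (k : Y ⟶ Z) (b : X.A ⟶ Y.A) (hb : h.base = b ≫ k.base)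
    (hk : ∀ U, Function.Injective (k.app U)) (hr : ∀ U m, ∃ y, k.app U y = h.app U m)
    (U : C.AffOpen) (m : X.M U) : k.app U ((lift h k b hb hk hr).app U m) = h.app U m :=
  (exists_lift h k b hb hk hr).choose_spec.2 U m

theorem hom_ext {f g : X ⟶ Y} (hb : f.base = g.base) (h : ∀ U m, f.app U m = g.app U m) : f = g :=
  Hom.ext hb (funext fun U => AddMonoidHom.ext (h U))

end Lift

/-! ### Modifications at a point -/

/-- A subsheaf `N` of `E` with `E(-t_i) ⊆ N ⊆ E`, which is a vector bundle stable under the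
connection. -/
structure Modification (X : LogConn t r) (i : Fin n) where
  N : ∀ U, Submodule (OA X.A U) (X.M U)
  vanishing_le : ∀ U, X.E.vanishing (t i) U ≤ N U
  res_eq : ∀ {U V : C.AffOpen} (h : U ≤ V),
    N U = Submodule.span (OA X.A U) (X.E.res h '' (N V : Set (X.M V)))
  exists_projection : ∀ U, ∃ e : X.M U →ₗ[OA X.A U] X.M U, (∀ y, e y ∈ N U) ∧
    ∀ y ∈ N U, y - e y ∈ X.E.vanishing (t i) U
  exists_residue : ∀ U, (t i).1 ∈ U.1.1 → ∀ m ∈ N U, ∃ m' ∈ N U, X.IsResidue i U m m'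

namespace Modification

variable {X : LogConn t r} {i : Fin n} (N : X.Modification i)

theorem res_mem {U V : C.AffOpen} (h : U ≤ V) {m : X.M V} (hm : m ∈ N.N V) :
    X.E.res h m ∈ N.N U := by
  rw [N.res_eq h]
  exact Submodule.subset_span ⟨m, hm, rfl⟩

/-- Restriction of sections of `N`. -/
def res {U V : C.AffOpen} (h : U ≤ V) : N.N V →+ N.N U where
  toFun m := ⟨X.E.res h m, N.res_mem h m.2⟩
  map_zero' := Subtype.ext (map_zero (X.E.res h))
  map_add' a b := Subtype.ext (map_add (X.E.res h) a.1 b.1)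

/-- The subsheaf `N` as a vector bundle. -/
def bundle : C.VectorBundle r X.A where
  M U := N.N U
  res h := N.res h
  res_id h m := Subtype.ext (X.E.res_id h m)
  res_res h h' h'' m := Subtype.ext (X.E.res_res h h' h'' m)
  res_smul h a m := Subtype.ext (X.E.res_smul h a m)
  quasiCoherent {_ V} h := VectorBundle.isBaseChangeAlong_submodule h (X.E.quasiCoherent h)
    (N.vanishing_le V) (N.res_eq h) (N.exists_projection V) (fun _ => rfl) _
  finite U := VectorBundle.finite_submodule (N.vanishing_le U) (N.exists_projection U)
  projective U := VectorBundle.projective_submodule (N.vanishing_le U) (N.exists_projection U)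
  rank_eq U := VectorBundle.rankAtStalk_submodule (N.vanishing_le U) (N.exists_projection U)

/-- The inclusion of `N` on sections. -/
def lin (U : C.AffOpen) : N.bundle.M U →ₗ[C.𝒪 U] X.M U where
  toFun := Subtype.val
  map_add' _ _ := rfl
  map_smul' _ _ := rfl

theorem rTensor_injective (U : C.AffOpen) :
    Function.Injective ((N.lin U).rTensor (logDiff t U)) :=
  Module.Flat.rTensor_preserves_injective_linearMap (N.lin U) Subtype.val_injective

theorem N_eq_top {U : C.AffOpen} (hU : (t i).1 ∉ U.1.1) : N.N U = ⊤ := by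
  rw [eq_top_iff, ← VectorBundle.vanishing_eq_top hU]
  exact N.vanishing_le U

variable (ht : Function.Injective t)

include ht in
-- If t_i ∈ U, the residue of m has a representative in N, so ∇m comes from N ⊗ Ω¹(D). If t_i ∉ U,
-- then N is all of E.
theorem exists_nabla (U : C.AffOpen) (m : N.bundle.M U) :
    ∃ z, (N.lin U).rTensor (logDiff t U) z = X.nabla U m.1 := by
  have hmem : ∀ m ∈ N.N U, ∀ ω, m ⊗ₜ ω ∈
      ((N.lin U).rTensor (logDiff t U)).toAddMonoidHom.range := fun m hm ω =>
    ⟨(⟨m, hm⟩ : N.N U) ⊗ₜ ω, rfl⟩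
  by_cases hU : (t i).1 ∈ U.1.1
  · obtain ⟨m', h1, h2⟩ := N.exists_residue U hU m.1 m.2
    exact VectorBundle.mem_of_resTensor_eq ht hU (N.vanishing_le U) h1
      ((LogConn.isResidue_iff ht hU).mp h2) _ hmem
  · change X.nabla U m.1 ∈ ((N.lin U).rTensor (logDiff t U)).toAddMonoidHom.range
    induction X.nabla U m.1 with
    | zero => exact zero_mem _
    | add a b ha hb => exact add_mem ha hb
    | tmul m ω => exact hmem m (by rw [N.N_eq_top hU]; trivial) ω

/-- The induced connection. -/
def nabla (U : C.AffOpen) : N.bundle.M U →+ N.bundle.M U ⊗[C.𝒪 U] logDiff t U where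
  toFun m := (N.exists_nabla ht U m).choose
  map_zero' := N.rTensor_injective U (by
    rw [(N.exists_nabla ht U 0).choose_spec, map_zero]
    exact map_zero (X.nabla U))
  map_add' a b := N.rTensor_injective U (by
    rw [(N.exists_nabla ht U (a + b)).choose_spec, map_add, (N.exists_nabla ht U a).choose_spec,
      (N.exists_nabla ht U b).choose_spec]
    exact map_add (X.nabla U) a.1 b.1)

theorem rTensor_nabla (U : C.AffOpen) (m : N.bundle.M U) :
    (N.lin U).rTensor (logDiff t U) (N.nabla ht U m) = X.nabla U m.1 :=
  (N.exists_nabla ht U m).choose_spec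

theorem rTensor_smul (U : C.AffOpen) (s : OA X.A U) (z : N.bundle.M U ⊗[C.𝒪 U] logDiff t U) :
    (N.lin U).rTensor (logDiff t U) (s • z) = s • (N.lin U).rTensor (logDiff t U) z := by
  induction z with
  | zero => simp
  | add a b ha hb => rw [smul_add, map_add, map_add, smul_add, ha, hb]
  | tmul m ω => rfl

/-- The subsheaf `N` with the induced connection. -/
def conn : LogConn t r where
  A := X.A
  E := N.bundle
  nabla := N.nabla ht
  linear U a m := N.rTensor_injective U (by
    rw [rTensor_smul, rTensor_nabla, rTensor_nabla]
    exact X.linear U a m.1)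
  leibniz U f m := N.rTensor_injective U (by
    rw [map_add, ((N.lin U).rTensor (logDiff t U)).map_smul f, rTensor_nabla, rTensor_nabla]
    exact X.leibniz U f m.1)
  nabla_res {U V} h m := N.rTensor_injective U (by
    rw [rTensor_nabla]
    change X.nabla U (X.E.res h m.1) = _
    rw [X.nabla_res, ← N.rTensor_nabla ht V m]
    induction N.nabla ht V m with
    | zero => simp
    | add a b ha hb => rw [map_add, map_add, ha, hb, map_add, map_add]
    | tmul m ω => rfl)

/-- The inclusion of `N`. -/
def incl : N.conn ht ⟶ X :=
  homMk (X := N.conn ht) (𝟙 X.A) (fun U => (N.N U).subtype.toAddMonoidHom)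
    (fun U (a : OA X.A U) (m : N.N U) => by
      change a • m.1 = OAmap _ (AlgHom.id ℂ X.A) a • m.1
      rw [OAmap_id])
    (fun _ _ => rfl) N.lin (fun _ _ => rfl) (fun U m => (N.rTensor_nabla ht U m).symm)

theorem incl_injective (U : C.AffOpen) : Function.Injective ((N.incl ht).app U) :=
  Subtype.val_injective

variable {Y : LogConn t r} (P : Y.Modification i)

/-- The morphism of modifications induced by a morphism. -/
def map (g : X ⟶ Y) (hg : ∀ U, ∀ m ∈ N.N U, g.app U m ∈ P.N U) : N.conn ht ⟶ P.conn ht :=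
  lift (N.incl ht ≫ g) (P.incl ht) g.base
    (by change 𝟙 _ ≫ g.base = g.base ≫ 𝟙 _; simp) (P.incl_injective ht)
    (fun U m => ⟨⟨g.app U m.1, hg U m.1 m.2⟩, rfl⟩)

theorem map_app (g : X ⟶ Y) (hg : ∀ U, ∀ m ∈ N.N U, g.app U m ∈ P.N U) (U : C.AffOpen)
    (m : (N.conn ht).M U) : ((N.map ht P g hg).app U m).1 = g.app U m.1 :=
  app_lift (N.incl ht ≫ g) (P.incl ht) _ _ _ _ U m

theorem map_isBaseChangeAlong (g : X ⟶ Y) (U : C.AffOpen)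
    (hP : ∀ U, P.N U = Submodule.span (OA Y.A U) (g.app U '' (N.N U : Set (X.M U))))
    (hc : IsBaseChangeAlong (OAmap (LogConn.le_rfl' U) g.base.hom) (g.app U) (g.app_smul U))
    (hg : ∀ U, ∀ m ∈ N.N U, g.app U m ∈ P.N U) :
    IsBaseChangeAlong (OAmap (LogConn.le_rfl' U) (N.map ht P g hg).base.hom)
      ((N.map ht P g hg).app U) ((N.map ht P g hg).app_smul U) :=
  VectorBundle.isBaseChangeAlong_submodule (le_rfl' U) hc (N.vanishing_le U) (hP U)
    (N.exists_projection U) (N.map_app ht P g hg U) _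

end Modification
end LogConn
end SmoothProjCurve

/-! ### Products with ideals of points, and residues on a modification -/

namespace SmoothProjCurve

variable {C : SmoothProjCurve} {n : ℕ} {t : Fin n → C.Pt} {r : ℕ}

namespace VectorBundle

variable {A : Type} [CommRing A] [Algebra ℂ A] {E : C.VectorBundle r A}

theorem ptIdealA_smul_induction {x : C.Pt} {U : C.AffOpen} {N : Submodule (OA A U) (E.M U)}
    {P : E.M U → Prop} {y : E.M U} (hy : y ∈ ptIdealA x A U • N)
    (smul : ∀ f ∈ ptIdeal x U, ∀ m ∈ N, P (f • m)) (zero : P 0)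
    (add : ∀ a b, P a → P b → P (a + b)) : P y := by
  have key : ∀ s ∈ ptIdealA x A U, ∀ m ∈ N, P (s • m) := by
    intro s hs
    induction hs using Submodule.span_induction with
    | mem s hs =>
      obtain ⟨f, hf, rfl⟩ := hs
      exact smul f hf
    | zero => intro m _; rwa [zero_smul]
    | add a b _ _ ha hb => intro m hm; rw [add_smul]; exact add _ _ (ha m hm) (hb m hm)
    | smul a b _ hb =>
      intro m hm
      rw [smul_eq_mul, mul_comm, mul_smul]
      exact hb _ (N.smul_mem a hm)
  exact Submodule.smul_induction_on hy key add

theorem divMap_mem {x : C.Pt} {U : C.AffOpen} {N : Submodule (OA A U) (E.M U)} (j : twistFun x U)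
    (m : E.vanishing x U) (hm : (m : E.M U) ∈ ptIdealA x A U • N) : divMap j m ∈ N := by
  obtain ⟨f₀, hf₀, hf0⟩ := exists_mem_ptIdeal_ne_zero x U
  have key : ∃ (h : (m : E.M U) ∈ E.vanishing x U), divMap j ⟨m, h⟩ ∈ N := by
    refine ptIdealA_smul_induction (P := fun y => ∃ (h : y ∈ E.vanishing x U), divMap j ⟨y, h⟩ ∈ N)
      hm (fun f hf y hy => ⟨smul_mem_vanishing hf y, ?_⟩) ⟨zero_mem _, ?_⟩ ?_
    · have h1 : divMap j ⟨f • y, smul_mem_vanishing hf y⟩ = twistMul ⟨f, hf⟩ j • y := by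
        refine divMap_eq ⟨f₀, hf₀⟩ hf0 ?_
        rw [smul_smul, smul_smul]
        congr 1
        apply algebraMap_injective U
        rw [map_mul, map_mul, algebraMap_twistMul, algebraMap_twistMul]
        ring
      rw [h1]
      exact smul_mem_of_mem N hy
    · exact (map_zero (divMap (E := E) j)).symm ▸ N.zero_mem
    · rintro a b ⟨ha, ha'⟩ ⟨hb, hb'⟩
      refine ⟨add_mem ha hb, ?_⟩
      have := map_add (divMap j) ⟨a, ha⟩ ⟨b, hb⟩
      exact this ▸ N.add_mem ha' hb'
  exact key.2

variable (E) in
/-- Multiplication by a function. -/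
def mulMap {U : C.AffOpen} (f : C.𝒪 U) : E.M U →ₗ[OA A U] E.M U :=
  algebraMap (C.𝒪 U) (OA A U) f • LinearMap.id

@[simp]
theorem mulMap_apply {U : C.AffOpen} (f : C.𝒪 U) (m : E.M U) : E.mulMap f m = f • m := rfl

theorem sub_smul_mem {x : C.Pt} {U : C.AffOpen} {N N' : Submodule (OA A U) (E.M U)}
    (h : ptIdealA x A U • N ≤ N') (hx : x.1 ∈ U.1.1) {f : C.𝒪 U} (hf : evU hx f = 1) {m : E.M U}
    (hm : m ∈ N) : m - f • m ∈ N' := by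
  have h1 : (1 - f) ∈ ptIdeal x U := by rw [mem_ptIdeal_iff hx]; simp [hf]
  have h2 := ptIdealA_smul_le.mp h _ h1 m hm
  rwa [sub_smul, one_smul] at h2

/-- A local equation of `x`, up to functions which are invertible at `x`. -/
theorem exists_twistMul_eq {x : C.Pt} {U : C.AffOpen} (hx : x.1 ∈ U.1.1) (y : C.Pt) :
    ∃ (f : ptIdeal y U) (j : twistFun y U), evU hx (twistMul f j) = 1 := by
  obtain ⟨m, f, j, h⟩ := C.exists_twist_partition y U
  have h1 : ∃ a, evU hx (twistMul (f a) (j a)) ≠ 0 := by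
    by_contra! h0
    have := congrArg (evU hx) h
    rw [map_sum, map_one] at this
    simp [h0] at this
  obtain ⟨a, ha⟩ := h1
  refine ⟨(algebraMap ℂ (C.𝒪 U) (evU hx (twistMul (f a) (j a)))⁻¹) • f a, j a, ?_⟩
  have h2 : twistMul ((algebraMap ℂ (C.𝒪 U) (evU hx (twistMul (f a) (j a)))⁻¹) • f a) (j a) =
      (algebraMap ℂ (C.𝒪 U) (evU hx (twistMul (f a) (j a)))⁻¹) * twistMul (f a) (j a) := by
    apply algebraMap_injective U
    rw [map_mul, algebraMap_twistMul, algebraMap_twistMul]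
    change algebraMap _ _ (_ * (f a : C.𝒪 U)) * _ = _
    rw [map_mul, mul_assoc]
  rw [h2, map_mul, AlgHom.commutes]
  exact inv_mul_cancel₀ ha

/-- Choose f ∈ I_x and j with f j = 1 at x. Multiplication by f carries N₀/N₁ to I_xN₀/I_xN₁, and
multiplication by j inverts it, since f j is 1 modulo I_x and I_xN₀ ⊆ N₁. -/
theorem invQuot_ptIdealA_smul {x : C.Pt} {U : C.AffOpen} (hx : x.1 ∈ U.1.1)
    {N₀ N₁ : Submodule (OA A U) (E.M U)} {φ : A →+* OA A U} (h : InvQuot φ N₀ N₁)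
    (h01 : ptIdealA x A U • N₀ ≤ N₁) :
    InvQuot φ (ptIdealA x A U • N₀) (ptIdealA x A U • N₁) := by
  obtain ⟨f, j, hfj⟩ := exists_twistMul_eq hx x
  refine h.of_map ((E.mulMap (f : C.𝒪 U)).comp N₀.subtype)
    (fun y => smul_mem_ptIdealA_smul f.2 y.2) (fun y => ⟨fun hy => ?_, fun hy =>
      smul_mem_ptIdealA_smul f.2 hy⟩) (fun y hy => ?_)
  · replace hy : (f : C.𝒪 U) • (y : E.M U) ∈ ptIdealA x A U • N₁ := hy
    have h1 := divMap_mem j ⟨(f : C.𝒪 U) • (y : E.M U), smul_mem_vanishing f.2 _⟩ hy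
    have h2 : divMap j ⟨(f : C.𝒪 U) • (y : E.M U), smul_mem_vanishing f.2 _⟩ =
        twistMul f j • (y : E.M U) := by
      refine eq_of_forall_smul_eq x fun g hg => ?_
      rw [smul_divMap j _ ⟨g, hg⟩, smul_smul, smul_smul]
      congr 1
      apply algebraMap_injective U
      rw [map_mul, map_mul, algebraMap_twistMul, algebraMap_twistMul]
      ring
    rw [h2] at h1
    have h3 := sub_smul_mem h01 hx hfj y.2
    have := add_mem h3 h1
    rwa [sub_add_cancel] at this
  · have hy' : y ∈ E.vanishing x U := Submodule.smul_mono le_rfl le_top hy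
    refine ⟨⟨divMap j ⟨y, hy'⟩, divMap_mem j _ hy⟩, ?_⟩
    change y - (f : C.𝒪 U) • divMap j ⟨y, hy'⟩ ∈ _
    rw [smul_divMap]
    exact sub_smul_mem (Submodule.smul_mono le_rfl h01) hx hfj hy

theorem exists_add_eq_one {i i' : Fin n} (ht : Function.Injective t) (hi : i' ≠ i) (U : C.AffOpen) :
    ∃ f ∈ ptIdeal (t i) U, ∃ f' ∈ ptIdeal (t i') U, f + f' = 1 := by
  have h : t i ≠ t i' := fun h => hi (ht h.symm)
  have h1 := ptIdeal_sup_eq_top h U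
  exact Submodule.mem_sup.mp (h1 ▸ (Submodule.mem_top : (1 : C.𝒪 U) ∈ _))

/-- Write 1 = f + f' with f and f' in the ideals of the two distinct points. The purpose is base
change: an intersection need not commute with it, while sums and products with ideals do. -/
theorem inf_eq_sup {i i' : Fin n} (ht : Function.Injective t) (hi : i' ≠ i) {U : C.AffOpen}
    {N N' : Submodule (OA A U) (E.M U)} (hN : E.vanishing (t i) U ≤ N)
    (hN' : E.vanishing (t i') U ≤ N') :
    N' ⊓ N = ptIdealA (t i) A U • N' ⊔ ptIdealA (t i') A U • N := by
  apply le_antisymm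
  · rintro y ⟨hy', hy⟩
    obtain ⟨f, hf, f', hf', h⟩ := exists_add_eq_one ht hi U
    have h1 : y = f • y + f' • y := by rw [← add_smul, h, one_smul]
    rw [h1]
    exact Submodule.add_mem_sup (smul_mem_ptIdealA_smul hf hy') (smul_mem_ptIdealA_smul hf' hy)
  · exact sup_le (le_inf Submodule.smul_le_right
      ((Submodule.smul_mono le_rfl le_top).trans hN)) (le_inf
      ((Submodule.smul_mono le_rfl le_top).trans hN') Submodule.smul_le_right)

end VectorBundle

namespace LogConn.Modification

variable {X : LogConn t r} {i : Fin n} (N : X.Modification i)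

open SmoothProjCurve.VectorBundle

theorem comap_ptIdealA_smul (U : C.AffOpen) (x : C.Pt) :
    (ptIdealA x X.A U • N.N U).comap (N.N U).subtype = N.bundle.vanishing x U := by
  have h1 : ptIdealA x X.A U • N.N U =
      (ptIdealA x X.A U • (⊤ : Submodule (OA X.A U) (N.N U))).map (N.N U).subtype := by
    rw [Submodule.map_smul'', Submodule.map_top, Submodule.range_subtype]
  rw [h1, Submodule.comap_map_eq_of_injective (N.N U).subtype_injective]
  rfl

theorem mem_vanishing_iff {U : C.AffOpen} {x : C.Pt} {m : N.bundle.M U} :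
    m ∈ N.bundle.vanishing x U ↔ m.1 ∈ ptIdealA x X.A U • N.N U := by
  rw [← comap_ptIdealA_smul]
  rfl

theorem smul_mem {U : C.AffOpen} {f : C.𝒪 U} (hf : f ∈ ptIdeal (t i) U) (m : X.M U) :
    f • m ∈ N.N U := N.vanishing_le U (smul_mem_vanishing hf m)

theorem smul_mem_ptIdealA {U : C.AffOpen} {f : C.𝒪 U} (hf : f ∈ ptIdeal (t i) U) {x : C.Pt}
    {m : X.M U} (hm : m ∈ X.E.vanishing x U) : f • m ∈ ptIdealA x X.A U • N.N U := by
  refine ptIdealA_smul_induction (P := fun m => f • m ∈ ptIdealA x X.A U • N.N U) hm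
    (fun g hg y _ => ?_) ?_ (fun a b ha hb => ?_)
  · rw [smul_comm]
    exact smul_mem_ptIdealA_smul hg (N.smul_mem hf y)
  · rw [smul_zero]; exact zero_mem _
  · rw [smul_add]; exact add_mem ha hb

/-- A section of `E` lying in `N`, as a section of the bundle `N`. -/
def sec {U : C.AffOpen} {m : X.M U} (hm : m ∈ N.N U) : N.bundle.M U := ⟨m, hm⟩

variable (ht : Function.Injective t)

/-- The residue of the induced connection on sections of `E(-t_i)`. -/
theorem resid_smul {U : C.AffOpen} (hU : (t i).1 ∈ U.1.1) {f : C.𝒪 U}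
    (hf : f ∈ ptIdeal (t i) U) {m m' : X.M U}
    (hm : X.resid ht hU m = (X.E.vanishing (t i) U).mkQ m') :
    (N.conn ht).resid ht hU (N.sec (N.smul_mem hf m)) =
      (N.bundle.vanishing (t i) U).mkQ (N.sec (N.smul_mem hf (m + m'))) := by
  obtain ⟨k, g, j, hgj⟩ := C.exists_twist_partition (t i) U
  let mulN : X.M U →ₗ[C.𝒪 U] N.bundle.M U :=
    { toFun := fun y => N.sec (N.smul_mem hf y)
      map_add' := fun a b => Subtype.ext (smul_add f a b)
      map_smul' := fun s y => Subtype.ext (smul_comm f s y) }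
  -- An explicit lift of ∇(fm) = m ⊗ df + f∇m to N ⊗ Ω¹(D). Since m need not lie in N, the first
  -- term is rewritten as Σ (g_a m) ⊗ j_a df. The residue of j_a df is the value of f j_a, which
  -- contributes Σ f j_a g_a m = f m: this is the shift of the exponent by 1.
  let z : N.bundle.M U ⊗[C.𝒪 U] logDiff t U :=
    ∑ a, N.sec (N.smul_mem (g a).2 m) ⊗ₜ[C.𝒪 U] twistD (j a) f +
      mulN.rTensor (logDiff t U) (X.nabla U m)
  have hz : N.nabla ht U (N.sec (N.smul_mem hf m)) = z := by
    apply N.rTensor_injective U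
    rw [rTensor_nabla]
    change X.nabla U (f • m) = _
    rw [X.leibniz, map_add, map_sum]
    congr 1
    · have h1 : ∀ a, (N.lin U).rTensor (logDiff t U)
          (N.sec (N.smul_mem (g a).2 m) ⊗ₜ[C.𝒪 U] twistD (j a) f) =
          m ⊗ₜ[C.𝒪 U] (twistMul (g a) (j a) • dform t f) := by
        intro a
        change ((g a : C.𝒪 U) • m) ⊗ₜ[C.𝒪 U] twistD (j a) f = _
        rw [TensorProduct.smul_tmul]
        congr 1
        apply Subtype.ext
        change (g a : C.𝒪 U) • ((j a : C.K) • (dform t f).1) = twistMul (g a) (j a) • (dform t f).1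
        rw [← algebraMap_smul C.K (g a : C.𝒪 U), smul_smul, ← algebraMap_twistMul, algebraMap_smul]
      simp only [h1]
      rw [← TensorProduct.tmul_sum, ← Finset.sum_smul, hgj, one_smul]
    · rw [← LinearMap.rTensor_comp_apply]
      have h1 : (N.lin U).comp mulN = f • LinearMap.id := LinearMap.ext fun y => rfl
      rw [h1, LinearMap.rTensor_smul, LinearMap.rTensor_id]
      rfl
  change N.bundle.resTensor ht hU (N.nabla ht U _) = _
  rw [hz, map_add, map_sum]
  have key : ∀ y : X.M U ⊗[C.𝒪 U] logDiff t U, ∃ m',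
      X.E.resTensor ht hU y = (X.E.vanishing (t i) U).mkQ m' ∧
      N.bundle.resTensor ht hU (mulN.rTensor (logDiff t U) y) =
        (N.bundle.vanishing (t i) U).mkQ (mulN m') := by
    intro y
    induction y with
    | zero => exact ⟨0, by simp, by simp⟩
    | add a b ha hb =>
      obtain ⟨m, h1, h2⟩ := ha
      obtain ⟨m', h1', h2'⟩ := hb
      exact ⟨m + m', by rw [map_add, map_add, h1, h1'],
        by rw [map_add, map_add, map_add, map_add, h2, h2']⟩
    | tmul y ω =>
      refine ⟨algebraMap ℂ (OA X.A U) (resLog ht hU ω) • y, rfl, ?_⟩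
      rw [LinearMap.rTensor_tmul, resTensor_tmul]
      congr 1
      exact Subtype.ext (smul_comm _ f y)
  obtain ⟨m'', h1, h2⟩ := key (X.nabla U m)
  have h3 : (N.bundle.vanishing (t i) U).mkQ (mulN m'') =
      (N.bundle.vanishing (t i) U).mkQ (mulN m') := by
    rw [mk_vanishing_eq, ← map_sub, mem_vanishing_iff]
    refine N.smul_mem_ptIdealA hf ?_
    rw [← mk_vanishing_eq, ← h1]
    exact hm
  have h4 : ∑ a, N.bundle.resTensor ht hU
      (N.sec (N.smul_mem (g a).2 m) ⊗ₜ[C.𝒪 U] twistD (j a) f) =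
        (N.bundle.vanishing (t i) U).mkQ (mulN m) := by
    have h5 : ∀ a, N.bundle.resTensor ht hU
        (N.sec (N.smul_mem (g a).2 m) ⊗ₜ[C.𝒪 U] twistD (j a) f) =
          (N.bundle.vanishing (t i) U).mkQ (twistMul (g a) (j a) • mulN m) := by
      intro a
      rw [resTensor_tmul, resLog_twistD ht hU (j a) ⟨f, hf⟩, eq_comm]
      have h6 : twistMul (g a) (j a) • mulN m = twistMul ⟨f, hf⟩ (j a) •
          N.sec (N.smul_mem (g a).2 m) := by
        apply Subtype.ext
        change twistMul (g a) (j a) • f • m = twistMul ⟨f, hf⟩ (j a) • (g a : C.𝒪 U) • m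
        rw [smul_smul, smul_smul]
        congr 1
        apply algebraMap_injective U
        rw [map_mul, map_mul, algebraMap_twistMul, algebraMap_twistMul]
        ring
      rw [h6, mk_vanishing_eq]
      exact N.bundle.const_smul_sub_mem hU _ _
    simp only [h5]
    rw [← map_sum, ← Finset.sum_smul, hgj, one_smul]
  rw [h4, h2, h3, ← map_add, ← map_add]
  rfl

theorem exists_resid {i' : Fin n} {U : C.AffOpen} (hU : (t i').1 ∈ U.1.1) {m : N.bundle.M U}
    {m' : X.M U} (hm : X.resid ht hU m.1 = (X.E.vanishing (t i') U).mkQ m') :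
    ∃ y : N.bundle.M U, (N.conn ht).resid ht hU m = (N.bundle.vanishing (t i') U).mkQ y ∧
      y.1 - m' ∈ X.E.vanishing (t i') U := by
  obtain ⟨y, hy⟩ := LogConn.exists_resid_eq (X := N.conn ht) ht hU m
  refine ⟨y, hy, ?_⟩
  have h1 := LogConn.resid_hom ht (N.incl ht) hU hy
  exact X.E.mk_vanishing_eq.mp (h1.symm.trans hm)

/-- The residue of the induced connection at another point. -/
theorem resid_of_ne {i' : Fin n} {U : C.AffOpen} (hU : (t i').1 ∈ U.1.1) {f : C.𝒪 U}
    (hf : f ∈ ptIdeal (t i) U) (hf1 : evU hU f = 1) {m : N.bundle.M U}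
    {m' : X.M U} (hm : X.resid ht hU m.1 = (X.E.vanishing (t i') U).mkQ m') :
    (N.conn ht).resid ht hU m =
      (N.bundle.vanishing (t i') U).mkQ (N.sec (N.smul_mem hf m')) := by
  obtain ⟨y, hy, hy'⟩ := N.exists_resid ht hU hm
  refine hy.trans (N.bundle.mk_vanishing_eq.mpr (N.mem_vanishing_iff.mpr ?_))
  -- Agreement modulo I_{t_{i'}}E is weaker than agreement modulo I_{t_{i'}}N. Multiplication by f,
  -- which is 1 at t_{i'} and maps E into N, upgrades the former to the latter.
  have h1 : y.1 - f • y.1 ∈ ptIdealA (t i') X.A U • N.N U := sub_smul_mem le_rfl hU hf1 y.2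
  have h2 := N.smul_mem_ptIdealA hf hy'
  have h3 := add_mem h1 h2
  rw [smul_sub, sub_add_sub_cancel] at h3
  exact h3

end LogConn.Modification
end SmoothProjCurve

theorem InvQuot.comap_subtype {A R M : Type} [CommRing A] [CommRing R] {φ : A →+* R}
    [AddCommGroup M] [Module R M] {N N₀ N₁ : Submodule R M} (h : InvQuot φ N₀ N₁) (h0 : N₀ ≤ N) :
    InvQuot φ (N₀.comap N.subtype) (N₁.comap N.subtype) := by
  refine h.of_map (Submodule.inclusion h0) (fun x => x.2) (fun x => Iff.rfl) (fun y hy => ?_)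
  refine ⟨⟨y, hy⟩, ?_⟩
  have h1 : y - Submodule.inclusion h0 ⟨y, hy⟩ = 0 := sub_eq_zero.mpr rfl
  rw [h1]
  exact zero_mem _

theorem comap_subtype_eq_span {R R' M M' : Type} [CommRing R] [CommRing R'] [AddCommGroup M]
    [AddCommGroup M'] [Module R M] [Module R' M'] {N S : Submodule R M} {N' S' : Submodule R' M'}
    {g : M →+ M'} {g' : N →+ N'} (hg' : ∀ y, (g' y : M') = g y) (hS : S ≤ N)
    (hS' : S' = Submodule.span R' (g '' (S : Set M))) :
    S'.comap N'.subtype = Submodule.span R' (g' '' (S.comap N.subtype : Set N)) := by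
  have h1 : Submodule.map N'.subtype (Submodule.span R' (g' '' (S.comap N.subtype : Set N))) = S' := by
    rw [Submodule.map_span, hS', ← Set.image_comp]
    congr 1
    ext x
    constructor
    · rintro ⟨y, hy, rfl⟩
      exact ⟨y, hy, (hg' y).symm⟩
    · rintro ⟨y, hy, rfl⟩
      exact ⟨⟨y, hS hy⟩, hy, hg' _⟩
  rw [← h1, Submodule.comap_map_eq_of_injective N'.subtype_injective]

/-! ### Elementary transforms of parabolic connections -/

namespace SmoothProjCurve

variable {C : SmoothProjCurve} {n : ℕ} {t : Fin n → C.Pt} {r : ℕ}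

namespace ParConn

variable {lam : Fin n → Fin r → ℂ} (X : ParConn t lam)

open SmoothProjCurve.VectorBundle

/-- The flag at `t_i`, indexed by natural numbers. -/
def Ln (i : Fin n) (k : ℕ) (U : C.AffOpen) : Submodule (OA X.A U) (X.M U) :=
  X.L i ⟨min k r, by omega⟩ U

/-- The flag at `t_i`, continued by `l_{k+r} = l_k(-t_i)`. -/
def lx (i : Fin n) (k : ℕ) (U : C.AffOpen) : Submodule (OA X.A U) (X.M U) :=
  if k ≤ r then X.Ln i k U else ptIdealA (t i) X.A U • X.Ln i (k - r) U

theorem Ln_eq (i : Fin n) (q : Fin (r + 1)) {k : ℕ} (hk : k = q) (U : C.AffOpen) :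
    X.Ln i k U = X.L i q U := by
  subst hk
  exact congrArg (fun q => X.L i q U) (Fin.ext (min_eq_left (Nat.lt_succ_iff.mp q.2)))

theorem Ln_zero (i : Fin n) (U : C.AffOpen) : X.Ln i 0 U = ⊤ :=
  (X.Ln_eq i 0 rfl U).trans (X.L_zero i U)

theorem Ln_of_le (i : Fin n) {k : ℕ} (hk : r ≤ k) (U : C.AffOpen) :
    X.Ln i k U = X.E.vanishing (t i) U := by
  rw [← X.L_last]
  exact congrArg (fun q => X.L i q U) (Fin.ext (min_eq_right hk))

theorem Ln_antitone (i : Fin n) (U : C.AffOpen) : Antitone fun k => X.Ln i k U :=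
  fun _ _ h => X.L_antitone i U (Fin.mk_le_mk.mpr (min_le_min_right r h))

theorem vanishing_le_Ln (i : Fin n) (k : ℕ) (U : C.AffOpen) :
    X.E.vanishing (t i) U ≤ X.Ln i k U := X.vanishing_le i _ U

theorem lx_of_le (i : Fin n) {k : ℕ} (hk : k ≤ r) (U : C.AffOpen) : X.lx i k U = X.Ln i k U :=
  if_pos hk

theorem lx_add (i : Fin n) (k : ℕ) (U : C.AffOpen) :
    X.lx i (k + r) U = ptIdealA (t i) X.A U • X.Ln i k U := by
  rcases Nat.eq_zero_or_pos k with rfl | hk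
  · rw [zero_add, X.lx_of_le i le_rfl, X.Ln_of_le i le_rfl, X.Ln_zero]
    rfl
  · rw [lx, if_neg (by omega), Nat.add_sub_cancel]

theorem lx_antitone (i : Fin n) (U : C.AffOpen) : Antitone fun k => X.lx i k U := by
  refine antitone_nat_of_succ_le fun k => ?_
  rcases Nat.lt_or_ge k r with h | h
  · rw [X.lx_of_le i h, X.lx_of_le i h.le]
    exact X.Ln_antitone i U k.le_succ
  · obtain ⟨k, rfl⟩ := Nat.exists_eq_add_of_le' h
    rw [Nat.add_right_comm, X.lx_add, X.lx_add]
    exact Submodule.smul_mono le_rfl (X.Ln_antitone i U k.le_succ)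

theorem smul_Ln_le (i : Fin n) (k k' : ℕ) (U : C.AffOpen) :
    ptIdealA (t i) X.A U • X.Ln i k U ≤ X.Ln i k' U :=
  (Submodule.smul_mono le_rfl le_top).trans (X.vanishing_le_Ln i k' U)

/-- The flags of the elementary transform along `l_j`. -/
def elmL (i : Fin n) (j : Fin (r + 1)) (i' : Fin n) (q : ℕ) (U : C.AffOpen) :
    Submodule (OA X.A U) (X.M U) :=
  if i' = i then X.lx i (q + j) U else X.Ln i' q U ⊓ X.L i j U

theorem elmL_self (i : Fin n) (j : Fin (r + 1)) (q : ℕ) (U : C.AffOpen) :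
    X.elmL i j i q U = X.lx i (q + j) U := if_pos rfl

theorem elmL_of_ne {i i' : Fin n} (h : i' ≠ i) (j : Fin (r + 1)) (q : ℕ) (U : C.AffOpen) :
    X.elmL i j i' q U = X.Ln i' q U ⊓ X.L i j U := if_neg h

theorem elmL_antitone (i : Fin n) (j : Fin (r + 1)) (i' : Fin n) (U : C.AffOpen) :
    Antitone fun q => X.elmL i j i' q U := by
  intro q q' h
  by_cases hi : i' = i
  · subst hi
    simp only [elmL_self]
    exact X.lx_antitone i' U (Nat.add_le_add_right h _)
  · simp only [X.elmL_of_ne hi]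
    exact inf_le_inf_right _ (X.Ln_antitone i' U h)

theorem elmL_zero (i : Fin n) (j : Fin (r + 1)) (i' : Fin n) (U : C.AffOpen) :
    X.elmL i j i' 0 U = X.L i j U := by
  by_cases hi : i' = i
  · subst hi
    rw [elmL_self, zero_add, X.lx_of_le _ (Nat.lt_succ_iff.mp j.2), X.Ln_eq i' j rfl]
  · rw [X.elmL_of_ne hi, Ln_zero, top_inf_eq]

theorem elmL_le (i : Fin n) (j : Fin (r + 1)) (i' : Fin n) (q : ℕ) (U : C.AffOpen) :
    X.elmL i j i' q U ≤ X.L i j U := by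
  rw [← X.elmL_zero i j i']
  exact X.elmL_antitone i j i' U (Nat.zero_le q)

variable (ht : Function.Injective t)

/-- The modification of `(E, ∇)` along `l_j`. -/
def modification (i : Fin n) (j : Fin (r + 1)) : X.toLogConn.Modification i where
  N U := X.L i j U
  vanishing_le U := X.vanishing_le i j U
  res_eq h := X.L_res i j h
  exists_projection U := X.exists_projection i j U
  exists_residue U hU m hm := by
    obtain ⟨m', h1, h2⟩ := X.exists_resid_mem ht j hU hm
    exact ⟨m', h1, (LogConn.isResidue_iff ht hU).mpr h2⟩

include ht in
-- At t_i this is the periodicity of the continued flag. At another point the intersection of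
-- E(-t_{i'}) with l_j is computed by coprimality of the two ideals.
theorem elmL_last (i : Fin n) (j : Fin (r + 1)) (i' : Fin n) (U : C.AffOpen) :
    X.elmL i j i' r U = ptIdealA (t i') X.A U • X.L i j U := by
  by_cases hi : i' = i
  · subst hi
    rw [elmL_self, add_comm, lx_add, X.Ln_eq i' j rfl]
  · rw [X.elmL_of_ne hi, X.Ln_of_le i' le_rfl]
    apply le_antisymm
    · rintro y ⟨hy', hy⟩
      have : y ∈ X.E.vanishing (t i') U ⊓ X.L i j U := ⟨hy', hy⟩
      rw [VectorBundle.inf_eq_sup ht hi (X.vanishing_le i j U) le_rfl] at this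
      refine (sup_le ?_ le_rfl : _ ≤ ptIdealA (t i') X.A U • X.L i j U) this
      exact ptIdealA_smul_le.mpr fun f hf m hm =>
        (X.modification ht i j).smul_mem_ptIdealA hf hm
    · exact le_inf (Submodule.smul_mono le_rfl le_top) Submodule.smul_le_right

include ht in
-- Because g may be semilinear over a restriction and a change of base at once, one proof gives both
-- the quasi-coherence of the new flags and their behaviour under morphisms. Intersections are first
-- turned into sums of products with ideals.
theorem elmL_eq_span {X Y : ParConn t lam} {U V : C.AffOpen} (h : U ≤ V) {φ : X.A →ₐ[ℂ] Y.A}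
    {g : X.M V →+ Y.M U} (hg : ∀ a m, g (a • m) = OAmap h φ a • g m)
    (hL : ∀ i q, Y.L i q U = Submodule.span (OA Y.A U) (g '' (X.L i q V : Set (X.M V))))
    (i : Fin n) (j : Fin (r + 1)) (i' : Fin n) (q : ℕ) :
    Y.elmL i j i' q U = Submodule.span (OA Y.A U) (g '' (X.elmL i j i' q V : Set (X.M V))) := by
  have hLn : ∀ i k, Y.Ln i k U = Submodule.span (OA Y.A U) (g '' (X.Ln i k V : Set (X.M V))) :=
    fun i k => hL i _
  by_cases hi : i' = i
  · subst hi
    rw [elmL_self, elmL_self]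
    generalize q + (j : ℕ) = k
    rcases Nat.lt_or_ge k r with hk | hk
    · rw [Y.lx_of_le _ hk.le, X.lx_of_le _ hk.le, hLn]
    · obtain ⟨k, rfl⟩ := Nat.exists_eq_add_of_le' hk
      rw [lx_add, lx_add, span_image_smul hg, ptIdealA_map, hLn]
  · rw [elmL_of_ne _ hi, elmL_of_ne _ hi,
      VectorBundle.inf_eq_sup ht hi (Y.vanishing_le i j U) (Y.vanishing_le_Ln i' q U),
      VectorBundle.inf_eq_sup ht hi (X.vanishing_le i j V) (X.vanishing_le_Ln i' q V),
      span_image_sup, span_image_smul hg, span_image_smul hg, ptIdealA_map, ptIdealA_map, hLn, hL]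

/-- The exponents `ν` are obtained from `λ` by the elementary transform at `t_i` along `l_j`. -/
structure IsElmExponents (i : Fin n) (j : Fin (r + 1)) (lam nu : Fin n → Fin r → ℂ) : Prop where
  eq_of_lt : ∀ p q : Fin r, (p : ℕ) = q + j → nu i q = lam i p
  eq_of_ge : ∀ p q : Fin r, (p : ℕ) + r = q + j → nu i q = lam i p + 1
  eq_of_ne : ∀ i' ≠ i, nu i' = lam i'

theorem invQuot_Ln (i : Fin n) {k : ℕ} (hk : k < r) {U : C.AffOpen} (hU : (t i).1 ∈ U.1.1) :
    InvQuot (Algebra.TensorProduct.includeRight : X.A →ₐ[ℂ] OA X.A U).toRingHom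
      (X.Ln i k U) (X.Ln i (k + 1) U) := by
  have h0 : X.Ln i k U = _ := X.Ln_eq i (Fin.castSucc ⟨k, hk⟩) rfl U
  have h1 : X.Ln i (k + 1) U = _ := X.Ln_eq i (Fin.succ ⟨k, hk⟩) rfl U
  rw [h0, h1]
  exact X.invQuot i ⟨k, hk⟩ U hU

include ht in
-- At t_i the quotients are old ones, or old ones multiplied by I_{t_i}. At another point,
-- multiplication by a function equal to 1 there and vanishing at t_i carries the old quotient
-- isomorphically to the new one.
theorem invQuot_elmL (i : Fin n) (j : Fin (r + 1)) (i' : Fin n) {q : ℕ} (hq : q < r)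
    {U : C.AffOpen} (hU : (t i').1 ∈ U.1.1) :
    InvQuot (Algebra.TensorProduct.includeRight : X.A →ₐ[ℂ] OA X.A U).toRingHom
      (X.elmL i j i' q U) (X.elmL i j i' (q + 1) U) := by
  by_cases hi : i' = i
  · subst hi
    rw [elmL_self, elmL_self, Nat.add_right_comm]
    have hk : q + (j : ℕ) < r + r := by omega
    generalize q + (j : ℕ) = k at hk
    rcases Nat.lt_or_ge k r with h | h
    · rw [X.lx_of_le _ h.le, X.lx_of_le _ h]
      exact X.invQuot_Ln i' h hU
    · obtain ⟨k, rfl⟩ := Nat.exists_eq_add_of_le' h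
      rw [Nat.add_right_comm, lx_add, lx_add]
      exact invQuot_ptIdealA_smul hU (X.invQuot_Ln i' (by omega) hU) (X.smul_Ln_le i' _ _ U)
  · rw [X.elmL_of_ne hi, X.elmL_of_ne hi]
    obtain ⟨f, hf, f', hf', hff⟩ := exists_add_eq_one (C := C) ht hi U
    have hf1 : evU hU f = 1 := by
      have := congrArg (evU hU) hff
      rwa [map_add, (mem_ptIdeal_iff hU).mp hf', add_zero, map_one] at this
    have hle := X.smul_Ln_le i' q (q + 1) U
    refine (X.invQuot_Ln i' hq hU).of_map ((X.E.mulMap f).comp (X.Ln i' q U).subtype)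
      (fun y => ⟨smul_mem_of_mem _ y.2, X.vanishing_le i j U (smul_mem_vanishing hf _)⟩)
      (fun y => ⟨fun hy => ?_, fun hy => ⟨smul_mem_of_mem _ hy,
        X.vanishing_le i j U (smul_mem_vanishing hf _)⟩⟩) (fun y hy => ⟨⟨y, hy.1⟩, ?_, ?_⟩)
    · have h1 := add_mem (sub_smul_mem hle hU hf1 y.2) hy.1
      rwa [LinearMap.comp_apply, mulMap_apply, Submodule.subtype_apply, sub_add_cancel] at h1
    · exact sub_smul_mem hle hU hf1 hy.1
    · exact sub_mem hy.2 (X.vanishing_le i j U (smul_mem_vanishing hf _))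

theorem exists_resid_Ln {i : Fin n} (p : Fin r) {k : ℕ} (hk : k = p) {U : C.AffOpen}
    (hU : (t i).1 ∈ U.1.1) {m : X.M U}
    (hm : m ∈ X.Ln i k U) : ∃ m' ∈ X.Ln i (k + 1) U, X.resid ht hU m =
      (X.E.vanishing (t i) U).mkQ (algebraMap ℂ (OA X.A U) (lam i p) • m + m') := by
  rw [X.Ln_eq i p.succ (by rw [hk]; rfl)]
  rw [X.Ln_eq i p.castSucc hk] at hm
  exact X.exists_resid_eq_add ht p hU hm

theorem elm_residue_of_lt {i : Fin n} {j : Fin (r + 1)} (p : Fin r) {k : ℕ} (hk : k = p)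
    {U : C.AffOpen} (hU : (t i).1 ∈ U.1.1)
    {m : (X.modification ht i j).bundle.M U} (hm : m.1 ∈ X.Ln i k U) :
    ∃ y : (X.modification ht i j).bundle.M U,
      ((X.modification ht i j).conn ht).resid ht hU m =
        ((X.modification ht i j).bundle.vanishing (t i) U).mkQ y ∧
      y.1 - algebraMap ℂ (OA X.A U) (lam i p) • m.1 ∈ X.Ln i (k + 1) U := by
  obtain ⟨m', h1, h2⟩ := X.exists_resid_Ln ht p hk hU hm
  obtain ⟨y, h3, h4⟩ := (X.modification ht i j).exists_resid ht hU h2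
  refine ⟨y, h3, ?_⟩
  have h5 := add_mem (X.vanishing_le_Ln i (k + 1) U h4) h1
  convert h5 using 1
  abel

/-- Such sections are sums of products f m with f ∈ I_{t_i}. In ∇(fm) = m ⊗ df + f∇m the first term
contributes f m to the residue on the subsheaf and raises the exponent by 1. -/
theorem elm_residue_of_ge {i : Fin n} {j : Fin (r + 1)} (p : Fin r) {k : ℕ} (hk : k = p)
    {U : C.AffOpen} (hU : (t i).1 ∈ U.1.1)
    {m : (X.modification ht i j).bundle.M U} (hm : m.1 ∈ ptIdealA (t i) X.A U • X.Ln i k U) :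
    ∃ y : (X.modification ht i j).bundle.M U,
      ((X.modification ht i j).conn ht).resid ht hU m =
        ((X.modification ht i j).bundle.vanishing (t i) U).mkQ y ∧
      y.1 - algebraMap ℂ (OA X.A U) (lam i p + 1) • m.1 ∈
        ptIdealA (t i) X.A U • X.Ln i (k + 1) U := by
  let N := X.modification ht i j
  have key : ∃ (h : m.1 ∈ N.N U) (y : N.bundle.M U),
      (N.conn ht).resid ht hU (N.sec h) = (N.bundle.vanishing (t i) U).mkQ y ∧
      y.1 - algebraMap ℂ (OA X.A U) (lam i p + 1) • m.1 ∈
        ptIdealA (t i) X.A U • X.Ln i (k + 1) U := by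
    refine ptIdealA_smul_induction (P := fun m => ∃ (h : m ∈ N.N U) (y : N.bundle.M U),
      (N.conn ht).resid ht hU (N.sec h) = (N.bundle.vanishing (t i) U).mkQ y ∧
      y.1 - algebraMap ℂ (OA X.A U) (lam i p + 1) • m ∈
        ptIdealA (t i) X.A U • X.Ln i (k + 1) U) hm (fun f hf m hm => ?_) ?_ ?_
    · obtain ⟨m', h1, h2⟩ := X.exists_resid_Ln ht p hk hU hm
      refine ⟨N.smul_mem hf m, N.sec (N.smul_mem hf _), N.resid_smul ht hU hf h2, ?_⟩
      have h3 : f • (m + (algebraMap ℂ (OA X.A U) (lam i p) • m + m')) -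
          algebraMap ℂ (OA X.A U) (lam i p + 1) • f • m = f • m' := by
        rw [map_add, map_one, add_smul, one_smul, smul_comm _ f m, smul_add, smul_add]
        abel
      exact h3 ▸ smul_mem_ptIdealA_smul hf h1
    · refine ⟨zero_mem _, 0, ?_, ?_⟩
      · rw [map_zero]
        exact map_zero ((N.conn ht).resid ht hU)
      · rw [smul_zero]
        exact (sub_zero (0 : X.M U)).symm ▸ zero_mem _
    · rintro a b ⟨ha, y, h1, h2⟩ ⟨hb, z, h3, h4⟩
      refine ⟨add_mem ha hb, y + z, ?_, ?_⟩
      · rw [map_add, ← h1, ← h3]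
        exact map_add ((N.conn ht).resid ht hU) (N.sec ha) (N.sec hb)
      · have h5 := add_mem h2 h4
        rw [smul_add]
        convert h5 using 1
        exact add_sub_add_comm y.1 z.1 _ _
  obtain ⟨h, y, h1, h2⟩ := key
  exact ⟨y, h1, h2⟩

/-- A function equal to 1 at t_{i'} and vanishing at t_i moves the residue computed in E into l_j
without changing its value at t_{i'}. -/
theorem elm_residue_of_ne {i i' : Fin n} (hi : i' ≠ i) {j : Fin (r + 1)} (p : Fin r) {k : ℕ}
    (hk : k = p) {U : C.AffOpen} (hU : (t i').1 ∈ U.1.1)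
    {m : (X.modification ht i j).bundle.M U} (hm : m.1 ∈ X.Ln i' k U) :
    ∃ y : (X.modification ht i j).bundle.M U,
      ((X.modification ht i j).conn ht).resid ht hU m =
        ((X.modification ht i j).bundle.vanishing (t i') U).mkQ y ∧
      y.1 - algebraMap ℂ (OA X.A U) (lam i' p) • m.1 ∈ X.Ln i' (k + 1) U ⊓ X.L i j U := by
  let N := X.modification ht i j
  obtain ⟨f, hf, f', hf', hff⟩ := exists_add_eq_one (C := C) ht hi U
  have hf1 : evU hU f = 1 := by
    have := congrArg (evU hU) hff
    rwa [map_add, (mem_ptIdeal_iff hU).mp hf', add_zero, map_one] at this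
  obtain ⟨m', h1, h2⟩ := X.exists_resid_Ln ht p hk hU hm
  refine ⟨_, N.resid_of_ne ht hU hf hf1 h2, ?_⟩
  change f • (algebraMap ℂ (OA X.A U) (lam i' p) • m.1 + m') -
    algebraMap ℂ (OA X.A U) (lam i' p) • m.1 ∈ _
  refine ⟨?_, sub_mem (N.smul_mem hf _) (Submodule.smul_mem _ _ m.2)⟩
  change _ ∈ X.Ln i' (k + 1) U
  have h3 := sub_smul_mem (X.smul_Ln_le i' k (k + 1) U) hU hf1
    (Submodule.smul_mem _ (algebraMap ℂ (OA X.A U) (lam i' p)) hm)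
  have h4 := sub_mem (smul_mem_of_mem (f := f) _ h1) h3
  convert h4 using 1
  rw [smul_add]
  abel

/-- The flags of the elementary transform, as subsheaves of the bundle `l_j`. -/
def elmFlag (i : Fin n) (j : Fin (r + 1)) (i' : Fin n) (q : ℕ) (U : C.AffOpen) :
    Submodule (OA X.A U) ((X.modification ht i j).bundle.M U) :=
  (X.elmL i j i' q U).comap (X.L i j U).subtype

/-- The elementary transform along `l_j` (for `j = r`, the twist by `𝒪_C(-t_i)`). -/
def elm {nu : Fin n → Fin r → ℂ} {i : Fin n} {j : Fin (r + 1)}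
    (hnu : IsElmExponents i j lam nu) : ParConn t nu where
  toLogConn := (X.modification ht i j).conn ht
  L i' q U := X.elmFlag ht i j i' q U
  L_zero i' U := by
    rw [Fin.val_zero, elmFlag, elmL_zero]
    exact Submodule.comap_subtype_self _
  L_last i' U := by
    rw [Fin.val_last, elmFlag, X.elmL_last ht]
    exact (X.modification ht i j).comap_ptIdealA_smul U (t i')
  L_succ_le i' q U := Submodule.comap_mono (X.elmL_antitone i j i' U (Nat.le_succ q))
  L_res i' q {U V} h := comap_subtype_eq_span (g := X.E.res h) (fun _ => rfl)
    (X.elmL_le i j i' q V) (elmL_eq_span ht h (X.E.res_smul h) (fun i q => X.L_res i q h) i j i' q)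
  invertible i' q U hU :=
    (X.invQuot_elmL ht i j i' q.2 hU).comap_subtype (X.elmL_le i j i' q U)
  residue i' q U hU m hm := by
    have key : ∃ y : (X.modification ht i j).bundle.M U,
        ((X.modification ht i j).conn ht).resid ht hU m =
          ((X.modification ht i j).bundle.vanishing (t i') U).mkQ y ∧
        y.1 - algebraMap ℂ (OA X.A U) (nu i' q) • m.1 ∈ X.elmL i j i' (q + 1) U := by
      replace hm : m.1 ∈ X.elmL i j i' q U := hm
      by_cases hi : i' = i
      · subst hi
        rw [elmL_self] at hm ⊢
        rw [Nat.add_right_comm]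
        rcases Nat.lt_or_ge (q + j) r with h | h
        · rw [X.lx_of_le _ h.le] at hm
          rw [X.lx_of_le _ h, hnu.eq_of_lt ⟨q + j, h⟩ q rfl]
          exact X.elm_residue_of_lt ht ⟨q + j, h⟩ rfl hU hm
        · obtain ⟨k, hk⟩ := Nat.exists_eq_add_of_le' h
          have hq := q.2
          have hj := j.2
          rw [hk, lx_add] at hm
          rw [hk, Nat.add_right_comm, lx_add, hnu.eq_of_ge ⟨k, by omega⟩ q hk.symm]
          exact X.elm_residue_of_ge ht (k := k) ⟨k, by omega⟩ rfl hU hm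
      · rw [X.elmL_of_ne hi] at hm ⊢
        rw [hnu.eq_of_ne i' hi]
        exact X.elm_residue_of_ne ht hi q rfl hU hm.1
    obtain ⟨y, h1, h2⟩ := key
    exact ⟨y, (LogConn.isResidue_iff ht hU).mpr h1, h2⟩

variable {nu : Fin n → Fin r → ℂ} {i : Fin n} {j : Fin (r + 1)}

/-- The inclusion of the elementary transform. -/
def elmIncl (hnu : IsElmExponents i j lam nu) : (X.elm ht hnu).toLogConn ⟶ X.toLogConn :=
  (X.modification ht i j).incl ht

variable {X} {Y : ParConn t lam}

theorem Hom.app_mem (f : X ⟶ Y) {i : Fin n} {q : Fin (r + 1)} {U : C.AffOpen} {m : X.M U}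
    (hm : m ∈ X.L i q U) : f.hom.app U m ∈ Y.L i q U := by
  rw [f.flag]
  exact Submodule.subset_span ⟨m, hm, rfl⟩

/-- Functoriality of the elementary transform. -/
def elmMap (hnu : IsElmExponents i j lam nu) (f : X ⟶ Y) : X.elm ht hnu ⟶ Y.elm ht hnu where
  hom := (X.modification ht i j).map ht (Y.modification ht i j) f.hom
    (fun _ _ hm => Hom.app_mem f hm)
  cartesian U := (X.modification ht i j).map_isBaseChangeAlong ht (Y.modification ht i j) f.hom U
    (fun U => f.flag i j U) (f.cartesian U) _
  flag i' q U := comap_subtype_eq_span (g := f.hom.app U)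
    ((X.modification ht i j).map_app ht (Y.modification ht i j) f.hom _ U) (X.elmL_le i j i' q U)
    (elmL_eq_span ht (LogConn.le_rfl' U) (f.hom.app_smul U) (fun i q => f.flag i q U) i j i' q)

theorem elmMap_incl (hnu : IsElmExponents i j lam nu) (f : X ⟶ Y) :
    (elmMap ht hnu f).hom ≫ Y.elmIncl ht hnu = X.elmIncl ht hnu ≫ f.hom :=
  LogConn.hom_ext (by change f.hom.base ≫ 𝟙 _ = 𝟙 _ ≫ f.hom.base; simp)
    (fun U m => (X.modification ht i j).map_app ht (Y.modification ht i j) f.hom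
      (fun _ _ hm => Hom.app_mem f hm) U m)

end ParConn
end SmoothProjCurve

theorem smul_const_mem_iff {R M : Type} [CommRing R] [Algebra ℂ R] [AddCommGroup M] [Module R M]
    {N : Submodule R M} {c : ℂ} (hc : c ≠ 0) {m : M} : algebraMap ℂ R c • m ∈ N ↔ m ∈ N := by
  refine ⟨fun h => ?_, N.smul_mem _⟩
  have := N.smul_mem (algebraMap ℂ R c⁻¹) h
  rwa [smul_smul, ← map_mul, inv_mul_cancel₀ hc, map_one, one_smul] at this

section ModuleIdentities

variable {R M : Type} [CommRing R] [AddCommGroup M] [Module R M] (α β : R) (m m' x y : M)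

/-- Here αm + x and βx + y stand for the residues of m and of x, with α and β the exponents to be
exchanged. -/
theorem smul_residue_sub : y = (α - β) • (α • m + x) + (β • x + y) - α • ((α - β) • m + x) := by
  module

theorem sub_smul_eq_add : m' - β • m = m' - (α • m + x) + ((α - β) • m + x) := by module

theorem sub_smul_eq_sub : (β - α) • m = β • m + x - α • m - x := by module

theorem neg_sub_smul_sub : -(β - α) • m - (-1 : R) • x = α • m + x - β • m := by module

end ModuleIdentities

/-! ### Exchanging two adjacent exponents: the new step of the flag -/

namespace SmoothProjCurve

variable {C : SmoothProjCurve} {n : ℕ} {t : Fin n → C.Pt} {r : ℕ}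

namespace ParConn

variable {lam nu : Fin n → Fin r → ℂ} (X : ParConn t lam) (ht : Function.Injective t)

open SmoothProjCurve.VectorBundle

/-- The exponents `ν` are obtained from `λ` by exchanging the adjacent and distinct entries at
the positions `a` and `b`. -/
structure IsSwap (i : Fin n) (a b : Fin r) (lam nu : Fin n → Fin r → ℂ) : Prop where
  succ : (b : ℕ) = a + 1
  ne : lam i a ≠ lam i b
  left : nu i a = lam i b
  right : nu i b = lam i a
  eq_of_ne : ∀ p, p ≠ a → p ≠ b → nu i p = lam i p
  eq_of_ne' : ∀ i' ≠ i, nu i' = lam i'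

theorem IsSwap.symm {i : Fin n} {a b : Fin r} (h : IsSwap i a b lam nu) : IsSwap i a b nu lam where
  succ := h.succ
  ne := by rw [h.left, h.right]; exact h.ne.symm
  left := h.right.symm
  right := h.left.symm
  eq_of_ne p ha hb := (h.eq_of_ne p ha hb).symm
  eq_of_ne' i' hi := (h.eq_of_ne' i' hi).symm

theorem IsSwap.succ_eq {i : Fin n} {a b : Fin r} (h : IsSwap i a b lam nu) :
    a.succ = b.castSucc := Fin.ext h.succ.symm

/-- The sections `m` of `l_a` with `(res_{t_i}(∇) - c) m` in `l_{b+1}`. -/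
def swapMid (i : Fin n) (a b : Fin r) (c : ℂ) (U : C.AffOpen) : Submodule (OA X.A U) (X.M U) where
  carrier := {m | m ∈ X.L i a.castSucc U ∧ ∀ (hU : (t i).1 ∈ U.1.1) (m' : X.M U),
    X.resid ht hU m = (X.E.vanishing (t i) U).mkQ m' →
      m' - algebraMap ℂ (OA X.A U) c • m ∈ X.L i b.succ U}
  zero_mem' := ⟨zero_mem _, fun hU m' h => by
    rw [map_zero, eq_comm] at h
    rw [smul_zero, sub_zero]
    exact X.vanishing_le i _ U ((Submodule.Quotient.mk_eq_zero _).mp h)⟩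
  add_mem' {x y} hx hy := ⟨add_mem hx.1 hy.1, fun hU m' h => by
    obtain ⟨x', hx'⟩ := LogConn.exists_resid_eq ht hU x
    obtain ⟨y', hy'⟩ := LogConn.exists_resid_eq ht hU y
    have h1 := add_mem (hx.2 hU x' hx') (hy.2 hU y' hy')
    rw [map_add, hx', hy', ← map_add, eq_comm, mk_vanishing_eq] at h
    have h2 := add_mem (X.vanishing_le i b.succ U h) h1
    have h3 : m' - algebraMap ℂ (OA X.A U) c • (x + y) = m' - (x' + y') +
      (x' - algebraMap ℂ (OA X.A U) c • x + (y' - algebraMap ℂ (OA X.A U) c • y)) := by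
      rw [smul_add]; abel
    exact h3 ▸ h2⟩
  smul_mem' s x hx := ⟨Submodule.smul_mem _ s hx.1, fun hU m' h => by
    obtain ⟨x', hx'⟩ := LogConn.exists_resid_eq ht hU x
    have h1 := Submodule.smul_mem _ s (hx.2 hU x' hx')
    rw [LogConn.resid_smul, hx', ← map_smul, eq_comm, mk_vanishing_eq] at h
    have h2 := add_mem (X.vanishing_le i b.succ U h) h1
    have h3 : m' - algebraMap ℂ (OA X.A U) c • s • x =
        m' - s • x' + s • (x' - algebraMap ℂ (OA X.A U) c • x) := by
      rw [smul_sub, smul_comm s]; abel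
    exact h3 ▸ h2⟩

variable {ht}

theorem mem_swapMid {i : Fin n} {a b : Fin r} {c : ℂ} {U : C.AffOpen} (hU : (t i).1 ∈ U.1.1)
    {m m' : X.M U} (h : X.resid ht hU m = (X.E.vanishing (t i) U).mkQ m') :
    m ∈ X.swapMid ht i a b c U ↔ m ∈ X.L i a.castSucc U ∧
      m' - algebraMap ℂ (OA X.A U) c • m ∈ X.L i b.succ U := by
  refine ⟨fun hm => ⟨hm.1, hm.2 hU m' h⟩, fun hm => ⟨hm.1, fun _ m'' h' => ?_⟩⟩
  have h1 := h'.symm.trans h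
  rw [mk_vanishing_eq] at h1
  have h2 := add_mem (X.vanishing_le i b.succ U h1) hm.2
  rwa [sub_add_sub_cancel] at h2

variable {i : Fin n} {a b : Fin r} (hs : IsSwap i a b lam nu)

theorem swapMid_le (c : ℂ) (U : C.AffOpen) : X.swapMid ht i a b c U ≤ X.L i a.castSucc U :=
  fun _ h => h.1

include hs in
theorem L_right_le (U : C.AffOpen) : X.L i b.succ U ≤ X.L i a.succ U := by
  rw [hs.succ_eq]
  exact X.L_succ_le i b U

include hs in
theorem le_swapMid (c : ℂ) (U : C.AffOpen) : X.L i b.succ U ≤ X.swapMid ht i a b c U := by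
  refine fun m hm => ⟨X.L_succ_le i a U (X.L_right_le hs U hm), fun hU m' h => ?_⟩
  obtain ⟨m'', h1, h2⟩ := X.exists_resid_mem ht b.succ hU hm
  rw [h2, eq_comm, mk_vanishing_eq] at h
  have h3 := add_mem (X.vanishing_le i b.succ U h) h1
  rw [sub_add_cancel] at h3
  exact sub_mem h3 (Submodule.smul_mem _ _ hm)

include hs in
/-- `(res - λ_b) l_a` lies in the new step of the flag. -/
theorem resid_sub_mem_swapMid {U : C.AffOpen} (hU : (t i).1 ∈ U.1.1) {m m' : X.M U}
    (hm : m ∈ X.L i a.castSucc U) (h : X.resid ht hU m = (X.E.vanishing (t i) U).mkQ m') :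
    m' - algebraMap ℂ (OA X.A U) (lam i b) • m ∈ X.swapMid ht i a b (lam i a) U := by
  have h0 : X.E.vanishing (t i) U ≤ X.swapMid ht i a b (lam i a) U :=
    (X.vanishing_le i b.succ U).trans (X.le_swapMid hs _ U)
  obtain ⟨n₁, h1, h2⟩ := X.exists_resid_eq_add ht a hU hm
  rw [hs.succ_eq] at h1
  obtain ⟨n₂, h3, h4⟩ := X.exists_resid_eq_add ht b hU h1
  rw [h2, eq_comm, mk_vanishing_eq] at h
  -- The operators res - λ_a and res - λ_b commute, and their product lowers l_a by two steps, into
  -- l_{b+1}.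
  have hx : (algebraMap ℂ (OA X.A U) (lam i a - lam i b) • m + n₁) ∈
      X.swapMid ht i a b (lam i a) U := by
    have h5 : X.resid ht hU (algebraMap ℂ (OA X.A U) (lam i a - lam i b) • m + n₁) =
        (X.E.vanishing (t i) U).mkQ (algebraMap ℂ (OA X.A U) (lam i a - lam i b) •
          (algebraMap ℂ (OA X.A U) (lam i a) • m + n₁) +
            (algebraMap ℂ (OA X.A U) (lam i b) • n₁ + n₂)) := by
      rw [map_add, LogConn.resid_smul, h2, h4, ← map_smul, ← map_add]
    refine (X.mem_swapMid hU h5).mpr ⟨add_mem (Submodule.smul_mem _ _ hm) ?_, ?_⟩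
    · exact X.L_succ_le i a U (hs.succ_eq ▸ h1)
    · convert h3 using 1
      rw [map_sub]
      exact (smul_residue_sub _ _ _ _ _).symm
  have h6 := add_mem (h0 h) hx
  convert h6 using 1
  rw [map_sub]
  exact sub_smul_eq_add _ _ _ _ _

include hs in
-- On l_{a+1} = l_b the operator res - λ_b maps into l_{b+1}, and on the new step res - λ_a does.
-- The two differ by the nonzero scalar λ_b - λ_a.
theorem swapMid_inf_le {U : C.AffOpen} (hU : (t i).1 ∈ U.1.1) {m : X.M U}
    (hm : m ∈ X.swapMid ht i a b (lam i a) U) (hm' : m ∈ X.L i a.succ U) :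
    m ∈ X.L i b.succ U := by
  rw [hs.succ_eq] at hm'
  obtain ⟨n₂, h1, h2⟩ := X.exists_resid_eq_add ht b hU hm'
  have h3 := ((X.mem_swapMid hU h2).mp hm).2
  have h4 := sub_mem h3 h1
  have h5 : algebraMap ℂ (OA X.A U) (lam i b - lam i a) • m ∈ X.L i b.succ U := by
    convert h4 using 1
    rw [map_sub]
    exact sub_smul_eq_sub _ _ _ _
  exact (smul_const_mem_iff (sub_ne_zero.mpr hs.ne.symm)).mp h5

include hs in
-- The scalar λ_b - λ_a is (res - λ_a) - (res - λ_b), where the first operator maps l_a into l_{a+1}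
-- and the second into the new step. With `swapMid_inf_le`, l_a / l_{b+1} is the direct sum of the
-- images of the old and the new middle step.
theorem exists_sub_mem_swapMid {U : C.AffOpen} (hU : (t i).1 ∈ U.1.1) {m : X.M U}
    (hm : m ∈ X.L i a.castSucc U) :
    ∃ y ∈ X.L i a.succ U, m - y ∈ X.swapMid ht i a b (lam i a) U := by
  obtain ⟨n₁, h1, h2⟩ := X.exists_resid_eq_add ht a hU hm
  have h3 := X.resid_sub_mem_swapMid hs hU hm h2
  have hc : (lam i b - lam i a) ≠ 0 := sub_ne_zero.mpr hs.ne.symm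
  refine ⟨algebraMap ℂ (OA X.A U) (lam i b - lam i a)⁻¹ • n₁, Submodule.smul_mem _ _ h1, ?_⟩
  rw [← smul_const_mem_iff (neg_ne_zero.mpr hc), smul_sub, smul_smul, ← map_mul, neg_mul,
    mul_inv_cancel₀ hc]
  convert h3 using 1
  simp only [map_sub, map_neg, map_one]
  exact neg_sub_smul_sub _ _ _ _

include hs in
-- The new step is defined as a kernel, which need not commute with base change. It is also (res -
-- λ_b) l_a + l_{b+1}, because res - λ_b acts on it as the nonzero scalar λ_a - λ_b modulo l_{b+1},
-- and such images do commute.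
theorem swapMid_eq_span {X Y : ParConn t lam} {U V : C.AffOpen} (h : U ≤ V) {φ : X.A →ₐ[ℂ] Y.A}
    {g : X.M V →+ Y.M U} (hg : ∀ a m, g (a • m) = OAmap h φ a • g m)
    (hL : ∀ i q, Y.L i q U = Submodule.span (OA Y.A U) (g '' (X.L i q V : Set (X.M V))))
    (hres : ∀ (hU : (t i).1 ∈ U.1.1) m m',
      X.resid ht (h hU : (t i).1 ∈ V.1.1) m = (X.E.vanishing (t i) V).mkQ m' →
      Y.resid ht hU (g m) = (Y.E.vanishing (t i) U).mkQ (g m')) :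
    Y.swapMid ht i a b (lam i a) U =
      Submodule.span (OA Y.A U) (g '' (X.swapMid ht i a b (lam i a) V : Set (X.M V))) := by
  set S := Submodule.span (OA Y.A U) (g '' (X.swapMid ht i a b (lam i a) V : Set (X.M V))) with hS
  have hmem : ∀ q m, m ∈ X.L i q V → g m ∈ Y.L i q U := fun q m hm => by
    rw [hL]; exact Submodule.subset_span ⟨m, hm, rfl⟩
  have hle : Y.L i b.succ U ≤ S := by
    rw [hL]
    exact Submodule.span_mono (Set.image_mono (X.le_swapMid hs _ V))
  apply le_antisymm
  · intro y hy
    by_cases hU : (t i).1 ∈ U.1.1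
    · have key : ∀ y ∈ Y.L i a.castSucc U, ∀ y', Y.resid ht hU y = (Y.E.vanishing (t i) U).mkQ y' →
          y' - algebraMap ℂ (OA Y.A U) (lam i b) • y ∈ S := by
        intro y hy
        have hind : ∃ y', Y.resid ht hU y = (Y.E.vanishing (t i) U).mkQ y' ∧
            y' - algebraMap ℂ (OA Y.A U) (lam i b) • y ∈ S := by
          rw [hL] at hy
          induction hy using Submodule.span_induction with
          | mem y hy =>
            obtain ⟨m, hm, rfl⟩ := hy
            obtain ⟨m', hm'⟩ := LogConn.exists_resid_eq ht (h hU : (t i).1 ∈ V.1.1) m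
            refine ⟨g m', hres hU m m' hm', ?_⟩
            have h1 := X.resid_sub_mem_swapMid hs (h hU : (t i).1 ∈ V.1.1) hm hm'
            rw [← OAmap_const h φ, ← hg, ← map_sub]
            exact Submodule.subset_span ⟨_, h1, rfl⟩
          | zero => exact ⟨0, by simp, by simp⟩
          | add x y _ _ hx hy =>
            obtain ⟨x', h1, h2⟩ := hx
            obtain ⟨y', h3, h4⟩ := hy
            refine ⟨x' + y', by rw [map_add, map_add, h1, h3], ?_⟩
            rw [smul_add, add_sub_add_comm]
            exact add_mem h2 h4
          | smul s x _ hx =>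
            obtain ⟨x', h1, h2⟩ := hx
            refine ⟨s • x', by rw [LogConn.resid_smul, h1, map_smul], ?_⟩
            rw [smul_comm, ← smul_sub]
            exact S.smul_mem _ h2
        obtain ⟨y₁, h1, h2⟩ := hind
        intro y' hy'
        rw [h1, eq_comm, mk_vanishing_eq] at hy'
        have h3 := add_mem (hle (Y.vanishing_le i b.succ U hy')) h2
        rwa [sub_add_sub_cancel] at h3
      obtain ⟨y', hy'⟩ := LogConn.exists_resid_eq ht hU y
      have h1 := key y hy.1 y' hy'
      have h2 := hle (hy.2 hU y' hy')
      have h3 := sub_mem h1 h2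
      rw [sub_sub_sub_cancel_left, ← sub_smul, ← map_sub] at h3
      exact (smul_const_mem_iff (sub_ne_zero.mpr hs.ne)).mp h3
    · apply hle
      rw [Y.L_eq_top hU]
      trivial
  · rw [hS, Submodule.span_le]
    rintro _ ⟨m, hm, rfl⟩
    refine ⟨hmem _ m hm.1, fun hU y' hy' => ?_⟩
    obtain ⟨m', hm'⟩ := LogConn.exists_resid_eq ht (h hU : (t i).1 ∈ V.1.1) m
    have h1 := hmem _ _ (hm.2 (h hU) m' hm')
    rw [hres hU m m' hm', eq_comm, mk_vanishing_eq] at hy'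
    rw [map_sub, hg, OAmap_const] at h1
    have h2 := add_mem (Y.vanishing_le i b.succ U hy') h1
    rwa [sub_add_sub_cancel] at h2

end ParConn
end SmoothProjCurve

/-! ### Isomorphisms of parabolic connections -/

namespace SmoothProjCurve

variable {C : SmoothProjCurve} {n : ℕ} {t : Fin n → C.Pt} {r : ℕ}

namespace LogConn

variable {X Y : LogConn t r}

theorem hom_inv_app (e : X ≅ Y) (U : C.AffOpen) (m : X.M U) :
    e.inv.app U (e.hom.app U m) = m := by
  rw [← comp_app, e.hom_inv_id, id_app]

theorem inv_hom_app (e : X ≅ Y) (U : C.AffOpen) (m : Y.M U) :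
    e.hom.app U (e.inv.app U m) = m := by
  rw [← comp_app, e.inv_hom_id, id_app]

theorem OAmap_inv (e : X ≅ Y) (U : C.AffOpen) (a : OA X.A U) :
    OAmap (le_rfl' U) e.inv.base.hom (OAmap (le_rfl' U) e.hom.base.hom a) = a := by
  rw [← OAmap_comp]
  have h : (e.hom ≫ e.inv).base = 𝟙 X.A := by rw [e.hom_inv_id]; rfl
  have h' : e.inv.base.hom.comp e.hom.base.hom = AlgHom.id ℂ X.A := congrArg CommAlgCat.Hom.hom h
  rw [h', OAmap_id]

end LogConn

namespace ParConn

variable {lam nu : Fin n → Fin r → ℂ}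

section Iso

variable {X Y : ParConn t lam} (e : X.toLogConn ≅ Y.toLogConn)
  (h : ∀ i q U m, m ∈ X.L i q U ↔ e.hom.app U m ∈ Y.L i q U)

include h in
theorem span_image_hom (i : Fin n) (q : Fin (r + 1)) (U : C.AffOpen) :
    Y.L i q U = Submodule.span (OA Y.A U) (e.hom.app U '' (X.L i q U : Set (X.M U))) := by
  apply le_antisymm
  · intro y hy
    refine Submodule.subset_span ⟨e.inv.app U y, (h i q U _).mpr ?_, LogConn.inv_hom_app e U y⟩
    rwa [LogConn.inv_hom_app]
  · rw [Submodule.span_le]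
    rintro _ ⟨m, hm, rfl⟩
    exact (h i q U m).mp hm

/-- An isomorphism of the underlying connections, as a morphism of parabolic connections. -/
def homOfIso : X ⟶ Y where
  hom := e.hom
  cartesian U := IsBaseChangeAlong.of_bijective
    ⟨Function.LeftInverse.injective (LogConn.OAmap_inv e U),
      Function.RightInverse.surjective (LogConn.OAmap_inv e.symm U)⟩
    ⟨Function.LeftInverse.injective (LogConn.hom_inv_app e U),
      Function.RightInverse.surjective (LogConn.inv_hom_app e U)⟩ _
  flag := span_image_hom e h

/-- An isomorphism of the underlying connections respecting the flags. -/
def isoMk : X ≅ Y where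
  hom := homOfIso e h
  inv := homOfIso e.symm fun i q U m => by
    rw [h]
    exact iff_of_eq (congrArg (· ∈ Y.L i q U) (LogConn.inv_hom_app e U m).symm)
  hom_inv_id := Hom.ext e.hom_inv_id
  inv_hom_id := Hom.ext e.inv_hom_id

end Iso

theorem hom_ext' {X Y : ParConn t lam} {f g : X ⟶ Y} (h : f.hom = g.hom) : f = g := Hom.ext h

/-! ### Exchanging adjacent exponents -/

section Swap

variable (X : ParConn t lam) (ht : Function.Injective t) {i : Fin n} {a b : Fin r}

/-- The flags obtained by replacing the step `l_b`. -/
def swapL (i : Fin n) (a b : Fin r) (i' : Fin n) (q : Fin (r + 1)) (U : C.AffOpen) :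
    Submodule (OA X.A U) (X.M U) :=
  if i' = i ∧ q = b.castSucc then X.swapMid ht i a b (lam i a) U else X.L i' q U

theorem swapL_mid (i : Fin n) (a b : Fin r) (U : C.AffOpen) :
    X.swapL ht i a b i b.castSucc U = X.swapMid ht i a b (lam i a) U := if_pos ⟨rfl, rfl⟩

theorem swapL_of_ne {i i' : Fin n} {b : Fin r} {q : Fin (r + 1)} (h : ¬ (i' = i ∧ q = b.castSucc))
    (a : Fin r) (U : C.AffOpen) : X.swapL ht i a b i' q U = X.L i' q U := if_neg h

theorem swapL_eq_span (hs : IsSwap i a b lam nu) {X Y : ParConn t lam} {U V : C.AffOpen}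
    (h : U ≤ V) {φ : X.A →ₐ[ℂ] Y.A}
    {g : X.M V →+ Y.M U} (hg : ∀ a m, g (a • m) = OAmap h φ a • g m)
    (hL : ∀ i q, Y.L i q U = Submodule.span (OA Y.A U) (g '' (X.L i q V : Set (X.M V))))
    (hres : ∀ (hU : (t i).1 ∈ U.1.1) m m',
      X.resid ht (h hU : (t i).1 ∈ V.1.1) m = (X.E.vanishing (t i) V).mkQ m' →
      Y.resid ht hU (g m) = (Y.E.vanishing (t i) U).mkQ (g m')) (i' : Fin n) (q : Fin (r + 1)) :
    Y.swapL ht i a b i' q U =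
      Submodule.span (OA Y.A U) (g '' (X.swapL ht i a b i' q V : Set (X.M V))) := by
  by_cases hq : i' = i ∧ q = b.castSucc
  · obtain ⟨rfl, rfl⟩ := hq
    rw [swapL_mid, swapL_mid]
    exact swapMid_eq_span hs h hg hL hres
  · rw [swapL_of_ne _ _ hq, swapL_of_ne _ _ hq, hL]

theorem IsSwap.ne_index {i : Fin n} {a b : Fin r} (hs : IsSwap i a b lam nu) : a ≠ b := fun h => by
  have := hs.succ
  rw [h] at this
  omega

/-- By the decomposition of l_a / l_{b+1}, the quotient of l_a by the new step is the old l_b /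
l_{b+1}, and the new step modulo l_{b+1} is the old l_a / l_b. -/
theorem swap_invQuot (hs : IsSwap i a b lam nu) (i' : Fin n) (j : Fin r) {U : C.AffOpen}
    (hU : (t i').1 ∈ U.1.1) :
    InvQuot (Algebra.TensorProduct.includeRight : X.A →ₐ[ℂ] OA X.A U).toRingHom
      (X.swapL ht i a b i' j.castSucc U) (X.swapL ht i a b i' j.succ U) := by
  by_cases hi : i' = i
  · subst hi
    by_cases hj : j = a
    · subst hj
      have h1 : ¬ (i' = i' ∧ j.castSucc = b.castSucc) := fun h =>
        hs.ne_index (Fin.castSucc_injective _ h.2)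
      have h2 := X.invQuot i' b U hU
      rw [swapL_of_ne _ _ h1, hs.succ_eq, swapL_mid]
      have h3 : X.L i' b.castSucc U ≤ X.L i' j.castSucc U := by
        rw [← hs.succ_eq]; exact X.L_succ_le i' j U
      refine h2.of_map (X.L i' b.castSucc U).subtype (fun y => h3 y.2) (fun y =>
        ⟨fun hy => X.swapMid_inf_le hs hU hy (by rw [hs.succ_eq]; exact y.2), fun hy => X.le_swapMid hs _ U hy⟩)
        (fun y hy => ?_)
      obtain ⟨x, hx, hx'⟩ := X.exists_sub_mem_swapMid (ht := ht) hs hU hy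
      exact ⟨⟨x, hs.succ_eq ▸ hx⟩, hx'⟩
    · by_cases hj' : j = b
      · subst hj'
        have h1 : ¬ (i' = i' ∧ j.succ = j.castSucc) := fun h => by
          have := congrArg Fin.val h.2
          simp at this
        have h2 := X.invQuot i' a U hU
        rw [swapL_of_ne _ _ h1, swapL_mid]
        refine h2.of_comap (X.swapMid ht i' a j (lam i' a) U).subtype (fun y => y.2.1) (fun y =>
          ⟨fun hy => X.swapMid_inf_le hs hU y.2 hy, fun hy => X.L_right_le hs U hy⟩)
          (fun y hy => ?_)
        obtain ⟨x, hx, hx'⟩ := X.exists_sub_mem_swapMid (ht := ht) hs hU hy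
        refine ⟨⟨y - x, hx'⟩, ?_⟩
        change y - (y - x) ∈ _
        rwa [sub_sub_cancel]
      · have h1 : ¬ (i' = i' ∧ j.castSucc = b.castSucc) := fun h =>
          hj' (Fin.castSucc_injective _ h.2)
        have h2 : ¬ (i' = i' ∧ j.succ = b.castSucc) := fun h =>
          hj (Fin.succ_injective _ (h.2.trans hs.succ_eq.symm))
        rw [swapL_of_ne _ _ h1, swapL_of_ne _ _ h2]
        exact X.invQuot i' j U hU
  · rw [swapL_of_ne _ _ fun h => hi h.1, swapL_of_ne _ _ fun h => hi h.1]
    exact X.invQuot i' j U hU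

/-- The parabolic connection with the exponents at the positions `a` and `b` exchanged. -/
def swap (hs : IsSwap i a b lam nu) : ParConn t nu where
  toLogConn := X.toLogConn
  L := X.swapL ht i a b
  L_zero i' U := by
    rw [swapL_of_ne _ _ fun h => ?_, X.L_zero]
    have h1 := congrArg Fin.val h.2
    have h2 := hs.succ
    simp at h1
    omega
  L_last i' U := by
    rw [swapL_of_ne _ _ fun h => ?_, X.L_last]
    exact (Fin.castSucc_lt_last b).ne' h.2
  L_succ_le i' j U := by
    by_cases h1 : i' = i ∧ j.castSucc = b.castSucc
    · obtain ⟨rfl, h1⟩ := h1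
      obtain rfl := Fin.castSucc_injective _ h1
      rw [swapL_mid, swapL_of_ne _ _ fun h => ?_]
      · exact X.le_swapMid hs _ U
      · have := congrArg Fin.val h.2
        simp at this
    · rw [swapL_of_ne _ _ h1]
      by_cases h2 : i' = i ∧ j.succ = b.castSucc
      · obtain ⟨rfl, h2⟩ := h2
        obtain rfl := Fin.succ_injective _ (h2.trans hs.succ_eq.symm)
        rw [h2, swapL_mid]
        exact X.swapMid_le _ U
      · rw [swapL_of_ne _ _ h2]
        exact X.L_succ_le i' j U
  L_res i' q {U V} h := swapL_eq_span ht hs h (X.E.res_smul h) (fun i q => X.L_res i q h)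
    (fun hU _ _ hm => LogConn.resid_res ht h hU hm) i' q
  invertible i' j U hU := X.swap_invQuot ht hs i' j hU
  residue i' j U hU m hm := by
    by_cases hi : i' = i
    · subst hi
      by_cases hj : j = a
      · subst hj
        rw [swapL_of_ne _ _ fun h => hs.ne_index (Fin.castSucc_injective _ h.2)] at hm
        obtain ⟨m', hm'⟩ := LogConn.exists_resid_eq ht hU m
        refine ⟨m', (LogConn.isResidue_iff ht hU).mpr hm', ?_⟩
        rw [hs.succ_eq, swapL_mid, hs.left]
        exact X.resid_sub_mem_swapMid hs hU hm hm'
      · by_cases hj' : j = b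
        · subst hj'
          rw [swapL_mid] at hm
          obtain ⟨m', hm'⟩ := LogConn.exists_resid_eq ht hU m
          refine ⟨m', (LogConn.isResidue_iff ht hU).mpr hm', ?_⟩
          rw [swapL_of_ne _ _ fun h => ?_, hs.right]
          · exact hm.2 hU m' hm'
          · have := congrArg Fin.val h.2
            simp at this
        · have h1 : ¬ (i' = i' ∧ j.castSucc = b.castSucc) := fun h =>
            hj' (Fin.castSucc_injective _ h.2)
          have h2 : ¬ (i' = i' ∧ j.succ = b.castSucc) := fun h =>
            hj (Fin.succ_injective _ (h.2.trans hs.succ_eq.symm))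
          rw [swapL_of_ne _ _ h1] at hm
          rw [swapL_of_ne _ _ h2, hs.eq_of_ne j hj hj']
          exact X.residue i' j U hU m hm
    · rw [swapL_of_ne _ _ fun h => hi h.1] at hm
      rw [swapL_of_ne _ _ fun h => hi h.1, hs.eq_of_ne' i' hi]
      exact X.residue i' j U hU m hm

/-- For m ∈ l_a with (res - λ_b) m ∈ l_{b+1}, also (res - λ_a) m ∈ l_b, so (λ_a - λ_b) m ∈ l_b. Thus
the kernel formed with λ_b is the old step, which is why exchanging twice restores the flag. -/
theorem swapMid_right (hs : IsSwap i a b lam nu) (U : C.AffOpen) :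
    X.swapMid ht i a b (lam i b) U = X.L i b.castSucc U := by
  have hle : X.L i b.castSucc U ≤ X.L i a.castSucc U := by
    rw [← hs.succ_eq]; exact X.L_succ_le i a U
  by_cases hU : (t i).1 ∈ U.1.1
  · ext m
    obtain ⟨m', hm'⟩ := LogConn.exists_resid_eq ht hU m
    rw [X.mem_swapMid hU hm']
    constructor
    · rintro ⟨h1, h2⟩
      obtain ⟨n₁, h3, h4⟩ := X.exists_resid_eq_add ht a hU h1
      have h5 := X.L_right_le hs U h2
      rw [hs.succ_eq] at h3 h5
      have h6 := hm'.symm.trans h4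
      rw [VectorBundle.mk_vanishing_eq] at h6
      have h7 := sub_mem h5 (add_mem (X.vanishing_le i b.castSucc U h6) h3)
      rw [← smul_const_mem_iff (sub_ne_zero.mpr hs.ne)]
      convert h7 using 1
      rw [map_sub, sub_smul]
      abel
    · intro h1
      obtain ⟨n₂, h3, h4⟩ := X.exists_resid_eq_add ht b hU h1
      refine ⟨hle h1, ?_⟩
      have h6 := hm'.symm.trans h4
      rw [VectorBundle.mk_vanishing_eq] at h6
      have h7 := add_mem (X.vanishing_le i b.succ U h6) h3
      convert h7 using 1
      abel
  · have h1 : X.L i b.castSucc U = ⊤ := X.L_eq_top hU _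
    rw [h1, eq_top_iff]
    refine le_trans ?_ (X.le_swapMid hs _ U)
    rw [X.L_eq_top hU]

theorem swapMid_swap (hs : IsSwap i a b lam nu) (c : ℂ) (U : C.AffOpen) :
    (X.swap ht hs).swapMid ht i a b c U = X.swapMid ht i a b c U := by
  have ha : (X.swap ht hs).L i a.castSucc U = X.L i a.castSucc U :=
    X.swapL_of_ne ht (fun h => hs.ne_index (Fin.castSucc_injective _ h.2)) _ _
  have hb : (X.swap ht hs).L i b.succ U = X.L i b.succ U := by
    refine X.swapL_of_ne ht (fun h => ?_) _ _
    have := congrArg Fin.val h.2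
    simp at this
  refine Submodule.ext fun (m : X.M U) => ?_
  change (m ∈ (X.swap ht hs).L i a.castSucc U ∧ ∀ (hU : (t i).1 ∈ U.1.1) (m' : X.M U),
    X.resid ht hU m = (X.E.vanishing (t i) U).mkQ m' →
      m' - algebraMap ℂ (OA X.A U) c • m ∈ (X.swap ht hs).L i b.succ U) ↔ _
  rw [ha, hb]
  rfl

theorem swap_swap_L (hs : IsSwap i a b lam nu) (i' : Fin n) (q : Fin (r + 1)) (U : C.AffOpen) :
    ((X.swap ht hs).swap ht hs.symm).L i' q U = X.L i' q U := by
  change (X.swap ht hs).swapL ht i a b i' q U = _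
  by_cases hq : i' = i ∧ q = b.castSucc
  · obtain ⟨rfl, rfl⟩ := hq
    rw [swapL_mid, hs.left, swapMid_swap]
    exact X.swapMid_right ht hs U
  · rw [swapL_of_ne _ _ hq]
    exact swapL_of_ne _ _ hq _ _

variable {X} {Y : ParConn t lam}

/-- Functoriality of `swap`. -/
def swapMap (hs : IsSwap i a b lam nu) (f : X ⟶ Y) : X.swap ht hs ⟶ Y.swap ht hs where
  hom := f.hom
  cartesian := f.cartesian
  flag i' q U := swapL_eq_span ht hs (LogConn.le_rfl' U) (f.hom.app_smul U)
    (fun i q => f.flag i q U) (fun hU _ _ hm => LogConn.resid_hom ht f.hom hU hm) i' q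

/-- Exchanging adjacent exponents, as a functor. -/
def swapFunctor (hs : IsSwap i a b lam nu) : BasedFunctor (parStack t lam) (parStack t nu) where
  obj X := ParConn.swap (lam := lam) X ht hs
  map f := swapMap (lam := lam) ht hs f
  w := rfl

/-- The identity on underlying connections, from the twofold exchange. -/
def swapSwapIso (hs : IsSwap i a b lam nu) (X : ParConn t lam) :
    (X.swap ht hs).swap ht hs.symm ≅ X :=
  isoMk (Iso.refl X.toLogConn) fun i' q U _ =>
    iff_of_eq (congrArg (_ ∈ ·) (X.swap_swap_L ht hs i' q U))

/-- Exchanging adjacent exponents, as an isomorphism of stacks. -/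
def swapIso (hs : IsSwap i a b lam nu) : StackIso (parStack t lam) (parStack t nu) where
  functor := swapFunctor ht hs
  isEquivalence :=
    (CategoryTheory.Equivalence.mk (swapFunctor ht hs).toFunctor (swapFunctor ht hs.symm).toFunctor
      (NatIso.ofComponents (fun X => (swapSwapIso ht hs X).symm) (fun _ => hom_ext' rfl))
      (NatIso.ofComponents (fun X => swapSwapIso ht hs.symm X)
        (fun _ => hom_ext' rfl))).isEquivalence_functor

/-- On l_j / l_{j+1} the operator res - c is the nonzero scalar λ_j - c, so a section killed by one
of its powers vanishes in this quotient. -/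
theorem genEigen_subset_of_ne (X : ParConn t lam) (ht : Function.Injective t) {i : Fin n} (j : Fin r) {c : ℂ} (hc : lam i j ≠ c)
    {U : C.AffOpen} (hU : (t i).1 ∈ U.1.1) (k : ℕ) :
    ∀ m ∈ X.L i j.castSucc U, m ∈ X.toLogConn.genEigen i c U k → m ∈ X.L i j.succ U := by
  induction k with
  | zero => exact fun m _ hm => X.vanishing_le i _ U hm
  | succ k ih =>
    rintro m hm ⟨m', h1, h2⟩
    rw [LogConn.isResidue_iff ht hU] at h1
    obtain ⟨n₁, h3, h4⟩ := X.exists_resid_eq_add ht j hU hm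
    have h5 := h1.symm.trans h4
    rw [VectorBundle.mk_vanishing_eq] at h5
    have h6 := add_mem (X.vanishing_le i j.succ U h5) h3
    have h7 : m' - algebraMap ℂ (OA X.A U) (lam i j) • m ∈ X.L i j.succ U := by
      convert h6 using 1
      abel
    have h8 : m' - algebraMap ℂ (OA X.A U) c • m ∈ X.L i j.castSucc U := by
      have h9 := add_mem (X.L_succ_le i j U h7) (Submodule.smul_mem _
        (algebraMap ℂ (OA X.A U) (lam i j) - algebraMap ℂ (OA X.A U) c) hm)
      convert h9 using 1
      rw [sub_smul]
      abel
    have h9 := sub_mem (ih _ h8 h2) h7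
    rw [sub_sub_sub_cancel_left, ← sub_smul, ← map_sub] at h9
    exact (smul_const_mem_iff (sub_ne_zero.mpr hc)).mp h9

end Swap

end ParConn
end SmoothProjCurve

/-- The number of occurrences of `c` among the first `p` entries. -/
abbrev countBelow {r : ℕ} (v : Fin r → ℂ) (c : ℂ) (p : Fin (r + 1)) : ℕ :=
  (Finset.univ.filter fun s : Fin r => s.castSucc < p ∧ v s = c).card

/-- The set counted by p is contained in the one counted by q, so equal cardinalities leave no
occurrence of c in between. -/
theorem ne_of_countBelow_eq {r : ℕ} {v : Fin r → ℂ} {c : ℂ} {p q : Fin (r + 1)}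
    (h : countBelow v c p = countBelow v c q) {s : Fin r} (hp : p ≤ s.castSucc)
    (hq : s.castSucc < q) : v s ≠ c := by
  intro hs
  have hsub : (Finset.univ.filter fun s : Fin r => s.castSucc < p ∧ v s = c) ⊆
      Finset.univ.filter fun s : Fin r => s.castSucc < q ∧ v s = c := by
    intro x hx
    rw [Finset.mem_filter] at hx ⊢
    exact ⟨hx.1, hx.2.1.trans (hp.trans_lt hq), hx.2.2⟩
  have heq := Finset.eq_of_subset_of_card_le hsub h.ge
  have hmem : s ∈ Finset.univ.filter fun s : Fin r => s.castSucc < p ∧ v s = c := by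
    rw [heq, Finset.mem_filter]
    exact ⟨Finset.mem_univ s, hq, hs⟩
  rw [Finset.mem_filter] at hmem
  exact absurd hmem.2.1 hp.not_gt

theorem countBelow_succ_of_ne {r : ℕ} {v : Fin r → ℂ} {c : ℂ} {s : Fin r} (h : v s ≠ c) :
    countBelow v c s.succ = countBelow v c s.castSucc := by
  unfold countBelow
  congr 1
  ext x
  simp only [Finset.mem_filter, Finset.mem_univ, true_and]
  refine and_congr_left fun hx => ?_
  have : x ≠ s := fun hxs => h (hxs ▸ hx)
  simp only [Fin.lt_def, Fin.val_succ, Fin.val_castSucc]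
  have := Fin.val_ne_of_ne this
  omega

/-! ### The exchange of exponents on generalized eigenspaces -/

namespace SmoothProjCurve

variable {C : SmoothProjCurve} {n : ℕ} {t : Fin n → C.Pt} {r : ℕ}

namespace ParConn

variable {lam nu : Fin n → Fin r → ℂ} (ht : Function.Injective t) {i : Fin n}

include ht in
theorem mem_L_iff_of_le (X : ParConn t lam) {c : ℂ} {p q : Fin (r + 1)} (hpq : p ≤ q)
    (h : countBelow (lam i) c p = countBelow (lam i) c q) {U : C.AffOpen} {m : X.M U}
    (hm : m ∈ X.toLogConn.genEigen i c U r) : m ∈ X.L i p U ↔ m ∈ X.L i q U := by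
  refine ⟨fun hp => ?_, fun hq => X.L_antitone i U hpq hq⟩
  by_cases hU : (t i).1 ∈ U.1.1
  · induction q using Fin.induction with
    | zero => rwa [show p = 0 from Fin.le_zero_iff.mp hpq] at hp
    | succ s ih =>
      rcases hpq.eq_or_lt with rfl | hlt
      · exact hp
      · have hps : p ≤ s.castSucc := Fin.le_castSucc_iff.mpr hlt
        have hs := ne_of_countBelow_eq h hps (Fin.castSucc_lt_succ)
        refine X.genEigen_subset_of_ne ht s hs hU r m (ih hps ?_) hm
        rw [h, countBelow_succ_of_ne hs]
  · rw [X.L_eq_top hU]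
    trivial

include ht in
theorem mem_L_iff (X : ParConn t lam) {c : ℂ} {p q : Fin (r + 1)}
    (h : countBelow (lam i) c p = countBelow (lam i) c q) {U : C.AffOpen} {m : X.M U}
    (hm : m ∈ X.toLogConn.genEigen i c U r) : m ∈ X.L i p U ↔ m ∈ X.L i q U := by
  rcases le_total p q with hpq | hpq
  · exact X.mem_L_iff_of_le ht hpq h hm
  · exact (X.mem_L_iff_of_le ht hpq h.symm hm).symm

/-- If q is not b, the positions a and b lie on the same side of q, and the transposition matches
the two counted sets. -/
theorem countBelow_swap {a b : Fin r} (hs : IsSwap i a b lam nu) {q : Fin (r + 1)}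
    (hq : q ≠ b.castSucc) (c : ℂ) : countBelow (nu i) c q = countBelow (lam i) c q := by
  refine Finset.card_equiv (Equiv.swap a b) fun s => ?_
  simp only [Finset.mem_filter, Finset.mem_univ, true_and]
  have hq' : (q : ℕ) ≠ b := fun h => hq (Fin.ext h)
  have h1 := hs.succ
  rcases eq_or_ne s a with rfl | hsa
  · rw [Equiv.swap_apply_left, hs.left]
    refine and_congr_left fun _ => ?_
    simp only [Fin.lt_def, Fin.val_castSucc]
    omega
  · rcases eq_or_ne s b with rfl | hsb
    · rw [Equiv.swap_apply_right, hs.right]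
      refine and_congr_left fun _ => ?_
      simp only [Fin.lt_def, Fin.val_castSucc]
      omega
    · rw [Equiv.swap_apply_of_ne_of_ne hsa hsb, hs.eq_of_ne s hsa hsb]

/-- Only the step at b is altered, and it can be avoided: ν_a ≠ ν_b, so c differs from one of them,
and the count at b agrees with the count at a or at b + 1. -/
theorem exists_countBelow_swap {a b : Fin r} (hs : IsSwap i a b lam nu) (q : Fin (r + 1)) (c : ℂ) :
    ∃ q' ≠ b.castSucc, countBelow (nu i) c q' = countBelow (nu i) c q := by
  rcases ne_or_eq q b.castSucc with hq | rfl
  · exact ⟨q, hq, rfl⟩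
  · by_cases h : nu i b = c
    · have h1 : nu i a ≠ c := by
        rw [hs.left, ← h, hs.right]
        exact hs.ne.symm
      exact ⟨a.castSucc, fun h => hs.ne_index (Fin.castSucc_injective _ h),
        by rw [← countBelow_succ_of_ne h1, hs.succ_eq]⟩
    · exact ⟨b.succ, fun h => (Fin.castSucc_lt_succ (i := b)).ne' h, countBelow_succ_of_ne h⟩

theorem isPermutation_swapIso {a b : Fin r} (hs : IsSwap i a b lam nu) :
    IsPermutation i (swapIso ht hs) := by
  refine ⟨⟨Equiv.swap a b, fun j => ?_⟩, hs.eq_of_ne', ?_⟩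
  · rcases eq_or_ne j a with rfl | hja
    · rw [Equiv.swap_apply_left, hs.left]
    · rcases eq_or_ne j b with rfl | hjb
      · rw [Equiv.swap_apply_right, hs.right]
      · rw [Equiv.swap_apply_of_ne_of_ne hja hjb, hs.eq_of_ne j hja hjb]
  · refine ⟨𝟙 (forgetFlags t lam), fun X => ?_⟩
    intro Y f U
    refine ⟨Function.bijective_id, fun i' hi q m => ?_, fun c p q h m hm => ?_⟩
    · exact iff_of_eq (congrArg (m ∈ ·) (X.swapL_of_ne ht (fun h => hi h.1) a U))
    · obtain ⟨q', hq', h1⟩ := exists_countBelow_swap hs q c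
      have h2 : m ∈ Y.L i q U ↔ m ∈ Y.L i q' U := Y.mem_L_iff ht h1.symm hm
      have h3 : m ∈ Y.L i q' U ↔ m ∈ X.L i q' U :=
        iff_of_eq (congrArg (m ∈ ·) (X.swapL_of_ne ht (fun h => hq' h.2) a U))
      have h4 : m ∈ X.L i q' U ↔ m ∈ X.L i p U := by
        refine X.mem_L_iff ht ?_ hm
        rw [← countBelow_swap hs hq' c, h1]
        exact h.symm
      exact h2.trans (h3.trans h4)

end ParConn
end SmoothProjCurve

/-! ### The bundle E ⊗ 𝒪(x) -/

namespace SmoothProjCurve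

variable {C : SmoothProjCurve} {A : Type} [CommRing A] [Algebra ℂ A] {r : ℕ}

theorem twistMul_add {x : C.Pt} {U : C.AffOpen} (f : ptIdeal x U) (k k' : twistFun x U) :
    twistMul f (k + k') = twistMul f k + twistMul f k' := by
  apply algebraMap_injective U
  rw [map_add, algebraMap_twistMul, algebraMap_twistMul, algebraMap_twistMul]
  exact mul_add _ _ _

theorem twistMul_smul {x : C.Pt} {U : C.AffOpen} (f : ptIdeal x U) (s : C.𝒪 U) (k : twistFun x U) :
    twistMul f (s • k) = s * twistMul f k := by
  apply algebraMap_injective U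
  rw [map_mul, algebraMap_twistMul, algebraMap_twistMul, ← mul_left_comm]
  congr 1

theorem twistMul_smul_comm {x : C.Pt} {U : C.AffOpen} (f : ptIdeal x U) (k k' : twistFun x U) :
    twistMul f k • k' = twistMul f k' • k := by
  apply Subtype.ext
  change twistMul f k • (k' : C.K) = twistMul f k' • (k : C.K)
  rw [Algebra.smul_def, Algebra.smul_def, algebraMap_twistMul, algebraMap_twistMul]
  ring

theorem mul_twistMul_comm {x : C.Pt} {U : C.AffOpen} (f g : ptIdeal x U) (k : twistFun x U) :
    (f : C.𝒪 U) * twistMul g k = g * twistMul f k := by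
  apply algebraMap_injective U
  rw [map_mul, map_mul, algebraMap_twistMul, algebraMap_twistMul]
  ring

/-- The constant function `1`, as a section of `𝒪_C(x)`. -/
def twistOne (x : C.Pt) (U : C.AffOpen) : twistFun x U :=
  ⟨1, fun f _ => ⟨f, by rw [Algebra.smul_def, mul_one]⟩⟩

theorem twistMul_one {x : C.Pt} {U : C.AffOpen} (f : ptIdeal x U) :
    twistMul f (twistOne x U) = f := by
  apply algebraMap_injective U
  rw [algebraMap_twistMul]
  exact mul_one _

theorem smul_eq_twistMul_smul_one {x : C.Pt} {U : C.AffOpen} (f : ptIdeal x U) (k : twistFun x U) :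
    (f : C.𝒪 U) • k = twistMul f k • twistOne x U := by
  rw [twistMul_smul_comm, twistMul_one]

/-- Restriction of sections of `𝒪_C(x)`. -/
def twistRestHom {x : C.Pt} {U V : C.AffOpen} (h : U ≤ V) : twistFun x V →+ twistFun x U where
  toFun := twistRest h
  map_zero' := rfl
  map_add' _ _ := rfl

theorem twistRestHom_smul {x : C.Pt} {U V : C.AffOpen} (h : U ≤ V) (f : C.𝒪 V)
    (k : twistFun x V) : twistRestHom h (f • k) = (rest h).toRingHom f • twistRestHom h k := by
  apply Subtype.ext
  change f • (k : C.K) = rest h f • (k : C.K)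
  rw [Algebra.smul_def, Algebra.smul_def, algebraMap_rest]

namespace VectorBundle

variable (E : C.VectorBundle r A) (x : C.Pt)

/-- The sections of `E ⊗ 𝒪_C(x)`. -/
abbrev TwistM (U : C.AffOpen) : Type := E.M U ⊗[C.𝒪 U] twistFun x U

variable {x}

/-- Contraction with a function vanishing at `x`. -/
def twistContr {U : C.AffOpen} (f : ptIdeal x U) : E.TwistM x U →ₗ[OA A U] E.M U :=
  AlgebraTensorModule.lift
    { toFun := fun m =>
        { toFun := fun k => twistMul f k • m
          map_add' := fun k k' => by rw [twistMul_add, add_smul]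
          map_smul' := fun s k => by rw [twistMul_smul, mul_smul]; rfl }
      map_add' := fun m m' => by ext k; exact smul_add _ _ _
      map_smul' := fun a m => by ext k; exact smul_comm _ _ _ }

@[simp]
theorem twistContr_tmul {U : C.AffOpen} (f : ptIdeal x U) (m : E.M U) (k : twistFun x U) :
    E.twistContr f (m ⊗ₜ k) = twistMul f k • m := rfl

/-- Multiplication by a section of `𝒪_C(x)`. -/
def twistMk {U : C.AffOpen} (k : twistFun x U) : E.M U →ₗ[OA A U] E.TwistM x U where
  toFun m := m ⊗ₜ k
  map_add' m m' := TensorProduct.add_tmul m m' k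
  map_smul' _ _ := rfl

@[simp]
theorem twistContr_twistMk {U : C.AffOpen} (f : ptIdeal x U) (k : twistFun x U) (m : E.M U) :
    E.twistContr f (E.twistMk k m) = twistMul f k • m := rfl

/-- Sections k and j of 𝒪(x) are proportional, (f k) j = (f j) k, so the sum collapses by the
partition of unity. It exhibits E ⊗ 𝒪(x) as a retract of a power of E, whence projectivity,
finiteness and base change. -/
theorem sum_twistMk_twistContr {U : C.AffOpen} {m : ℕ} (f : Fin m → ptIdeal x U)
    (j : Fin m → twistFun x U) (hfj : ∑ a, twistMul (f a) (j a) = 1) (y : E.TwistM x U) :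
    ∑ a, E.twistMk (j a) (E.twistContr (f a) y) = y := by
  induction y using TensorProduct.induction_on with
  | zero => simp
  | add a b ha hb => simp only [map_add, Finset.sum_add_distrib, ha, hb]
  | tmul y k =>
    have h1 : ∀ a, E.twistMk (j a) (E.twistContr (f a) (y ⊗ₜ k)) =
        y ⊗ₜ[C.𝒪 U] (twistMul (f a) (j a) • k) := by
      intro a
      change (twistMul (f a) k • y) ⊗ₜ[C.𝒪 U] j a = _
      rw [TensorProduct.smul_tmul, twistMul_smul_comm]
    simp only [h1]
    rw [← TensorProduct.tmul_sum, ← Finset.sum_smul, hfj, one_smul]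

/-- Restriction of sections of `E ⊗ 𝒪_C(x)`. -/
def twistRes {U V : C.AffOpen} (h : U ≤ V) : E.TwistM x V →+ E.TwistM x U :=
  tensorMapAlong (rest h).toRingHom (E.res h) (twistRestHom h) (E.res_smul' h) (twistRestHom_smul h)

theorem twistRes_tmul {U V : C.AffOpen} (h : U ≤ V) (m : E.M V) (k : twistFun x V) :
    E.twistRes h (m ⊗ₜ k) = E.res h m ⊗ₜ twistRest h k := rfl

theorem twistRes_smul {U V : C.AffOpen} (h : U ≤ V) (a : OA A V) (y : E.TwistM x V) :
    E.twistRes h (a • y) = OAmap h (AlgHom.id ℂ A) a • E.twistRes h y := by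
  induction y using TensorProduct.induction_on with
  | zero => simp
  | add y z hy hz => rw [smul_add, map_add, map_add, smul_add, hy, hz]
  | tmul m k =>
    rw [TensorProduct.smul_tmul', twistRes_tmul, twistRes_tmul, TensorProduct.smul_tmul',
      E.res_smul]

theorem twistContr_twistRes {U V : C.AffOpen} (h : U ≤ V) (f : ptIdeal x V) (y : E.TwistM x V) :
    E.twistContr (idealRest h f) (E.twistRes h y) = E.res h (E.twistContr f y) := by
  induction y using TensorProduct.induction_on with
  | zero => simp
  | add y z hy hz => simp only [map_add, hy, hz]
  | tmul m k =>
    rw [twistRes_tmul, twistContr_tmul, twistContr_tmul, twistMul_rest, E.res_smul']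
    rfl

theorem isBaseChangeAlong_twistRes {U V : C.AffOpen} (h : U ≤ V) :
    IsBaseChangeAlong (OAmap h (AlgHom.id ℂ A)) (E.twistRes (x := x) h) (E.twistRes_smul h) := by
  obtain ⟨m, f, j, hfj⟩ := C.exists_twist_partition x V
  have hfj' : ∑ a, twistMul (idealRest h (f a)) (twistRest h (j a)) = 1 := by
    simp only [twistMul_rest]
    rw [← map_sum, hfj, map_one]
  exact IsBaseChangeAlong.of_retract _ (E.quasiCoherent h) (fun a => E.twistContr (f a))
    (fun a => E.twistMk (j a)) (fun a => E.twistContr (idealRest h (f a)))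
    (fun a => E.twistMk (twistRest h (j a))) (fun a y => E.twistContr_twistRes h (f a) y)
    (fun _ _ => rfl) (E.sum_twistMk_twistContr f j hfj)
    (E.sum_twistMk_twistContr _ _ hfj')

theorem twistRes_id {U : C.AffOpen} (h : U ≤ U) (y : E.TwistM x U) : E.twistRes h y = y := by
  induction y using TensorProduct.induction_on with
  | zero => simp
  | add y z hy hz => rw [map_add, hy, hz]
  | tmul m k => rw [twistRes_tmul, E.res_id]; rfl

theorem twistRes_twistRes {U V W : C.AffOpen} (h : U ≤ V) (h' : V ≤ W) (h'' : U ≤ W)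
    (y : E.TwistM x W) : E.twistRes h (E.twistRes h' y) = E.twistRes h'' y := by
  induction y using TensorProduct.induction_on with
  | zero => simp
  | add y z hy hz => rw [map_add, map_add, map_add, hy, hz]
  | tmul m k =>
    rw [twistRes_tmul, twistRes_tmul, twistRes_tmul, E.res_res]
    rfl

theorem twist_projective (U : C.AffOpen) : Module.Projective (OA A U) (E.TwistM x U) := by
  obtain ⟨m, f, j, hfj⟩ := C.exists_twist_partition x U
  have := E.projective U
  exact Module.Projective.of_retract (fun a => E.twistContr (f a)) (fun a => E.twistMk (j a))
    (E.sum_twistMk_twistContr f j hfj)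

theorem twist_finite (U : C.AffOpen) : Module.Finite (OA A U) (E.TwistM x U) := by
  obtain ⟨m, f, j, hfj⟩ := C.exists_twist_partition x U
  have := E.finite U
  exact Module.Finite.of_retract (fun a => E.twistContr (f a)) (fun a => E.twistMk (j a))
    (E.sum_twistMk_twistContr f j hfj)

theorem twistMk_injective {U : C.AffOpen} :
    Function.Injective (E.twistMk (twistOne x U)) := by
  intro m m' h
  refine eq_of_forall_smul_eq x fun f hf => ?_
  have := congrArg (E.twistContr ⟨f, hf⟩) h
  rwa [twistContr_twistMk, twistContr_twistMk, twistMul_one] at this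

theorem algebraMap_smul_twist {U : C.AffOpen} (f : ptIdeal x U) (y : E.TwistM x U) :
    algebraMap (C.𝒪 U) (OA A U) f • y = E.twistMk (twistOne x U) (E.twistContr f y) := by
  induction y using TensorProduct.induction_on with
  | zero => simp
  | add y z hy hz => rw [smul_add, hy, hz, map_add, map_add]
  | tmul m k =>
    rw [TensorProduct.smul_tmul', algebraMap_smul_eq, twistContr_tmul, TensorProduct.smul_tmul,
      smul_eq_twistMul_smul_one, ← TensorProduct.smul_tmul]
    rfl

theorem twist_rank_eq (U : C.AffOpen) :
    Module.rankAtStalk (R := OA A U) (E.TwistM x U) = fun _ => r := by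
  have := E.projective U
  have := E.finite U
  have := E.twist_projective (x := x) U
  have := E.twist_finite (x := x) U
  obtain ⟨f, hf, hf0⟩ := exists_mem_ptIdeal_ne_zero x U
  rw [← E.rank_eq U, eq_comm]
  exact rankAtStalk_eq_of_injective (E.twistMk (twistOne x U)) E.twistMk_injective
    (algebraMap_mem_nonZeroDivisors hf0) fun y => ⟨_, (E.algebraMap_smul_twist ⟨f, hf⟩ y).symm⟩

variable (x) in
/-- The bundle `E ⊗ 𝒪_C(x)`. -/
def twist : C.VectorBundle r A where
  M U := E.TwistM x U
  res h := E.twistRes h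
  res_id := E.twistRes_id
  res_res := E.twistRes_twistRes
  res_smul := E.twistRes_smul
  quasiCoherent := E.isBaseChangeAlong_twistRes
  finite := E.twist_finite
  projective := E.twist_projective
  rank_eq := E.twist_rank_eq

/-- Contraction with a function vanishing at `x`. -/
def contr {U : C.AffOpen} (f : ptIdeal x U) : (E.twist x).M U →ₗ[OA A U] E.M U := E.twistContr f

/-- Multiplication by a section of `𝒪_C(x)`. -/
def mulTwist {U : C.AffOpen} (k : twistFun x U) : E.M U →ₗ[OA A U] (E.twist x).M U := E.twistMk k

variable (x) in
/-- The inclusion `E → E ⊗ 𝒪_C(x)`. -/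
def toTwist (U : C.AffOpen) : E.M U →ₗ[OA A U] (E.twist x).M U := E.mulTwist (twistOne x U)

variable {E} {U : C.AffOpen}

theorem contr_mulTwist (f : ptIdeal x U) (k : twistFun x U) (m : E.M U) :
    E.contr f (E.mulTwist k m) = twistMul f k • m := rfl

theorem contr_toTwist (f : ptIdeal x U) (m : E.M U) :
    E.contr f (E.toTwist x U m) = (f : C.𝒪 U) • m := by
  rw [toTwist, contr_mulTwist, twistMul_one]

theorem sum_mulTwist_contr {m : ℕ} {f : Fin m → ptIdeal x U}
    {j : Fin m → twistFun x U} (hfj : ∑ a, twistMul (f a) (j a) = 1) (y : (E.twist x).M U) :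
    ∑ a, E.mulTwist (j a) (E.contr (f a) y) = y := E.sum_twistMk_twistContr f j hfj y

theorem toTwist_contr (f : ptIdeal x U) (y : (E.twist x).M U) :
    E.toTwist x U (E.contr f y) = (f : C.𝒪 U) • y := (E.algebraMap_smul_twist f y).symm

theorem toTwist_injective : Function.Injective (E.toTwist x U) := E.twistMk_injective

theorem smul_mulTwist (f : ptIdeal x U) (k : twistFun x U) (m : E.M U) :
    (f : C.𝒪 U) • E.mulTwist k m = E.toTwist x U (twistMul f k • m) := by
  rw [← toTwist_contr, contr_mulTwist]

theorem twistMul_smul_contr_comm (f g : ptIdeal x U) (k : twistFun x U) (y : (E.twist x).M U) :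
    twistMul f k • E.contr g y = twistMul g k • E.contr f y := by
  apply E.toTwist_injective (x := x)
  rw [← smul_mulTwist, ← smul_mulTwist]
  refine eq_of_forall_smul_eq x fun h hh => ?_
  rw [smul_comm h, smul_comm h, smul_mulTwist ⟨h, hh⟩, smul_mulTwist ⟨h, hh⟩]
  have key : ∀ a b : ptIdeal x U, (a : C.𝒪 U) • E.toTwist x U (twistMul ⟨h, hh⟩ k • E.contr b y) =
      ((a : C.𝒪 U) * b) • twistMul ⟨h, hh⟩ k • y := by
    intro a b
    rw [← algebraMap_smul_eq (twistMul ⟨h, hh⟩ k), map_smul, toTwist_contr, mul_smul]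
    rw [algebraMap_smul_eq, smul_comm (twistMul ⟨h, hh⟩ k)]
  rw [key, key, mul_comm]

theorem contr_res {V : C.AffOpen} (h : U ≤ V) (f : ptIdeal x V) (y : (E.twist x).M V) :
    E.contr (idealRest h f) ((E.twist x).res h y) = E.res h (E.contr f y) :=
  E.twistContr_twistRes h f y

theorem range_toTwist : LinearMap.range (E.toTwist x U) = (E.twist x).vanishing x U := by
  apply le_antisymm
  · rintro _ ⟨m, rfl⟩
    obtain ⟨k, f, j, hfj⟩ := C.exists_twist_partition x U
    rw [← sum_mulTwist_contr hfj (E.toTwist x U m)]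
    refine sum_mem fun a _ => ?_
    rw [contr_toTwist, ← algebraMap_smul_eq, map_smul, algebraMap_smul_eq]
    exact smul_mem_vanishing (f a).2 _
  · rw [vanishing_eq, ptIdealA_smul_le]
    exact fun f hf y _ => ⟨E.contr ⟨f, hf⟩ y, toTwist_contr ⟨f, hf⟩ y⟩

end VectorBundle
end SmoothProjCurve

/-! ### The connection on E ⊗ 𝒪(t_i) -/

namespace SmoothProjCurve

variable {C : SmoothProjCurve} {A : Type} [CommRing A] [Algebra ℂ A] {n : ℕ} {t : Fin n → C.Pt}
variable {r : ℕ}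

namespace VectorBundle

variable {E F : C.VectorBundle r A} {U : C.AffOpen}

variable (t) in
/-- The map `g ⊗ id` on sections of `E ⊗ Ω¹(t_1 + ⋯ + t_n)`. -/
def tens (g : E.M U →ₗ[OA A U] F.M U) :
    E.M U ⊗[C.𝒪 U] logDiff t U →ₗ[C.𝒪 U] F.M U ⊗[C.𝒪 U] logDiff t U :=
  (g.restrictScalars (C.𝒪 U)).rTensor (logDiff t U)

theorem tens_tmul (g : E.M U →ₗ[OA A U] F.M U) (m : E.M U) (ω : logDiff t U) :
    tens t g (m ⊗ₜ ω) = g m ⊗ₜ ω := rfl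

theorem tens_smul (g : E.M U →ₗ[OA A U] F.M U) (s : OA A U) (y : E.M U ⊗[C.𝒪 U] logDiff t U) :
    tens t g (s • y) = s • tens t g y := by
  induction y with
  | zero => simp
  | add a b ha hb => rw [smul_add, map_add, map_add, smul_add, ha, hb]
  | tmul m ω =>
    rw [TensorProduct.smul_tmul', tens_tmul, tens_tmul, map_smul, TensorProduct.smul_tmul']

theorem smul_tens_mulTwist {x : C.Pt} (f : ptIdeal x U) (k : twistFun x U)
    (y : E.M U ⊗[C.𝒪 U] logDiff t U) :
    (f : C.𝒪 U) • tens t (E.mulTwist k) y = tens t (E.toTwist x U) (twistMul f k • y) := by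
  induction y with
  | zero => simp
  | add a b ha hb => rw [map_add, smul_add, smul_add, map_add, ha, hb]
  | tmul m ω =>
    rw [tens_tmul, TensorProduct.smul_tmul', TensorProduct.smul_tmul', tens_tmul, smul_mulTwist]

theorem smul_tensor_injective {f : C.𝒪 U} (hf : f ≠ 0) :
    Function.Injective fun y : E.M U ⊗[C.𝒪 U] logDiff t U => f • y :=
  fun _ _ h => Module.Flat.smul_left_injective hf h

end VectorBundle

open SmoothProjCurve.VectorBundle

theorem dform_add {U : C.AffOpen} (f g : C.𝒪 U) : dform t (f + g) = dform t f + dform t g := by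
  apply Subtype.ext
  change KaehlerDifferential.D ℂ C.K _ = _ + _
  rw [map_add, map_add]
  rfl

/-- Each summand is d(f_a j_a g) = f_a j_a dg + g d(f_a j_a), and summing over the partition of
unity leaves dg + g d(1). -/
theorem sum_smul_dform {i : Fin n} {U : C.AffOpen} {m : ℕ} {f : Fin m → ptIdeal (t i) U}
    {j : Fin m → twistFun (t i) U} (hfj : ∑ a, twistMul (f a) (j a) = 1) (g : ptIdeal (t i) U) :
    ∑ a, ((f a : C.𝒪 U) • dform t (twistMul g (j a)) + (g : C.𝒪 U) • twistD (j a) (f a).1) =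
      dform t (g : C.𝒪 U) := by
  have key : ∀ a, ((f a : C.𝒪 U) • dform t (twistMul g (j a)) +
      (g : C.𝒪 U) • twistD (j a) (f a).1) =
      twistMul (f a) (j a) • dform t (g : C.𝒪 U) + (g : C.𝒪 U) • dform t (twistMul (f a) (j a)) := by
    intro a
    apply Subtype.ext
    change (f a : C.𝒪 U) • KaehlerDifferential.D ℂ C.K _ + (g : C.𝒪 U) • (j a).1 •
        KaehlerDifferential.D ℂ C.K _ = twistMul (f a) (j a) • KaehlerDifferential.D ℂ C.K _ +
          (g : C.𝒪 U) • KaehlerDifferential.D ℂ C.K _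
    simp only [← algebraMap_smul C.K (f a : C.𝒪 U), ← algebraMap_smul C.K (g : C.𝒪 U),
      ← algebraMap_smul C.K (twistMul (f a) (j a)), algebraMap_twistMul, Derivation.leibniz]
    module
  have h1 : dform t (1 : C.𝒪 U) = 0 := by
    apply Subtype.ext
    change KaehlerDifferential.D ℂ C.K _ = 0
    rw [map_one, Derivation.map_one_eq_zero]
  have h2 : ∑ a, dform t (twistMul (f a) (j a)) = 0 := by
    let D : C.𝒪 U →+ logDiff t U := AddMonoidHom.mk' (dform t) dform_add
    change ∑ a, D _ = 0
    rw [← map_sum, hfj]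
    exact h1
  rw [Finset.sum_congr rfl fun a _ => key a, Finset.sum_add_distrib, ← Finset.sum_smul,
    ← Finset.smul_sum, hfj, h2, one_smul, smul_zero, add_zero]

namespace LogConn

variable (X : LogConn t r) (i : Fin n)

/-- A connection on E(t_i) has to satisfy g∇x = ∇(gx) - x ⊗ dg for g ∈ I_{t_i}, where gx lies in E,
and by flatness this determines ∇x. The partition of unity suggests Σ (j_a ∇(f_a x) - x ⊗ j_a df_a);
the point is that it meets the condition for all g at once. -/
theorem smul_twist_formula {U : C.AffOpen} {m : ℕ} {f : Fin m → ptIdeal (t i) U}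
    {j : Fin m → twistFun (t i) U} (hfj : ∑ a, twistMul (f a) (j a) = 1)
    (x : (X.E.twist (t i)).M U) (g : ptIdeal (t i) U) :
    (g : C.𝒪 U) • ∑ a, (tens t (X.E.mulTwist (j a)) (X.nabla U (X.E.contr (f a) x)) -
      x ⊗ₜ[C.𝒪 U] twistD (j a) (f a).1) =
      tens t (X.E.toTwist (t i) U) (X.nabla U (X.E.contr g x)) - x ⊗ₜ[C.𝒪 U] dform t (g : C.𝒪 U) := by
  have h1 : ∀ a, (g : C.𝒪 U) • (tens t (X.E.mulTwist (j a)) (X.nabla U (X.E.contr (f a) x)) -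
      x ⊗ₜ[C.𝒪 U] twistD (j a) (f a).1) =
      tens t (X.E.toTwist (t i) U) (X.nabla U (twistMul (f a) (j a) • X.E.contr g x)) -
        x ⊗ₜ[C.𝒪 U] ((f a : C.𝒪 U) • dform t (twistMul g (j a)) +
          (g : C.𝒪 U) • twistD (j a) (f a).1) := by
    intro a
    rw [smul_sub, smul_tens_mulTwist, TensorProduct.tmul_add, ← twistMul_smul_contr_comm, X.leibniz,
      map_add, tens_tmul, toTwist_contr, TensorProduct.smul_tmul, TensorProduct.tmul_smul,
      TensorProduct.tmul_smul]
    abel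
  rw [Finset.smul_sum, Finset.sum_congr rfl fun a _ => h1 a, Finset.sum_sub_distrib,
    ← TensorProduct.tmul_sum, sum_smul_dform hfj, ← map_sum, ← map_sum, ← Finset.sum_smul, hfj,
    one_smul]

theorem exists_twistNabla {U : C.AffOpen} (x : (X.E.twist (t i)).M U) :
    ∃ z : (X.E.twist (t i)).M U ⊗[C.𝒪 U] logDiff t U, ∀ g : ptIdeal (t i) U, (g : C.𝒪 U) • z =
      tens t (X.E.toTwist (t i) U) (X.nabla U (X.E.contr g x)) -
        x ⊗ₜ[C.𝒪 U] dform t (g : C.𝒪 U) := by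
  obtain ⟨m, f, j, hfj⟩ := C.exists_twist_partition (t i) U
  exact ⟨_, X.smul_twist_formula i hfj x⟩

variable {X i} in
theorem eq_of_ptIdeal_smul_eq {E : C.VectorBundle r A} {U : C.AffOpen}
    {z z' : E.M U ⊗[C.𝒪 U] logDiff t U}
    (h : ∀ g : ptIdeal (t i) U, (g : C.𝒪 U) • z = (g : C.𝒪 U) • z') : z = z' := by
  obtain ⟨f, hf, hf0⟩ := exists_mem_ptIdeal_ne_zero (t i) U
  exact smul_tensor_injective hf0 (h ⟨f, hf⟩)

/-- The induced connection on `E ⊗ 𝒪_C(t_i)`. -/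
def twistNabla (U : C.AffOpen) :
    (X.E.twist (t i)).M U →+ (X.E.twist (t i)).M U ⊗[C.𝒪 U] logDiff t U :=
  AddMonoidHom.mk' (fun x => (X.exists_twistNabla i x).choose) (fun x y => by
    refine eq_of_ptIdeal_smul_eq (i := i) fun g => ?_
    rw [smul_add, (X.exists_twistNabla i _).choose_spec, (X.exists_twistNabla i _).choose_spec,
      (X.exists_twistNabla i _).choose_spec, map_add, map_add, map_add, TensorProduct.add_tmul]
    abel)

theorem smul_twistNabla {U : C.AffOpen} (x : (X.E.twist (t i)).M U) (g : ptIdeal (t i) U) :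
    (g : C.𝒪 U) • X.twistNabla i U x =
      tens t (X.E.toTwist (t i) U) (X.nabla U (X.E.contr g x)) -
        x ⊗ₜ[C.𝒪 U] dform t (g : C.𝒪 U) := (X.exists_twistNabla i x).choose_spec g

theorem twistNabla_eq {U : C.AffOpen} {m : ℕ} {f : Fin m → ptIdeal (t i) U}
    {j : Fin m → twistFun (t i) U} (hfj : ∑ a, twistMul (f a) (j a) = 1)
    (x : (X.E.twist (t i)).M U) : X.twistNabla i U x =
      ∑ a, (tens t (X.E.mulTwist (j a)) (X.nabla U (X.E.contr (f a) x)) -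
        x ⊗ₜ[C.𝒪 U] twistD (j a) (f a).1) :=
  eq_of_ptIdeal_smul_eq (i := i) fun g => by rw [smul_twistNabla, smul_twist_formula X i hfj]

/-- The tensor product with `𝒪_C(t_i)`. -/
def twist : LogConn t r where
  A := X.A
  E := X.E.twist (t i)
  nabla := X.twistNabla i
  linear U a x := eq_of_ptIdeal_smul_eq (i := i) fun g => by
    rw [smul_twistNabla, map_smul, X.linear, tens_smul, smul_comm (g : C.𝒪 U), smul_twistNabla,
      smul_sub, TensorProduct.smul_tmul']
  leibniz U s x := eq_of_ptIdeal_smul_eq (i := i) fun g => by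
    rw [smul_twistNabla, smul_add, smul_comm (g : C.𝒪 U) s, smul_twistNabla, smul_sub,
      ← algebraMap_smul_eq s x, map_smul, algebraMap_smul_eq, algebraMap_smul_eq, X.leibniz,
      map_add, tens_tmul, toTwist_contr, map_smul]
    rw [TensorProduct.smul_tmul', TensorProduct.smul_tmul']
    abel
  nabla_res {U V} h x := by
    obtain ⟨f, hf, hf0⟩ := exists_mem_ptIdeal_ne_zero (t i) V
    refine smul_tensor_injective (f := rest h f) (fun h0 => hf0 (rest_injective h ?_)) ?_
    · rw [h0, map_zero]
    have h1 := X.smul_twistNabla i ((X.E.twist (t i)).res h x) (idealRest h ⟨f, hf⟩)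
    refine h1.trans ?_
    rw [contr_res, X.nabla_res]
    have h2 : ∀ z, rest h f • tensorMapAlong (rest h).toRingHom ((X.E.twist (t i)).res h)
        (logRest t h) ((X.E.twist (t i)).res_smul' h) (logRest_smul t h) z =
        tensorMapAlong (rest h).toRingHom ((X.E.twist (t i)).res h)
        (logRest t h) ((X.E.twist (t i)).res_smul' h) (logRest_smul t h) (f • z) := by
      intro z
      induction z with
      | zero => simp
      | add a b ha hb => rw [map_add, smul_add, smul_add, map_add, ha, hb]
      | tmul m ω =>
        rw [TensorProduct.smul_tmul', tensorMapAlong_tmul, tensorMapAlong_tmul,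
          TensorProduct.smul_tmul', VectorBundle.res_smul']
        rfl
    refine Eq.trans ?_ (h2 _).symm
    rw [X.smul_twistNabla i x ⟨f, hf⟩, map_sub]
    congr 1
    · induction X.nabla V (X.E.contr ⟨f, hf⟩ x) with
      | zero => simp
      | add a b ha hb => simp only [map_add, ha, hb]
      | tmul m ω => rfl
    · rw [tensorMapAlong_tmul]
      congr 1
      apply Subtype.ext
      change KaehlerDifferential.D ℂ C.K _ = KaehlerDifferential.D ℂ C.K _
      rw [← algebraMap_rest h]
      rfl

/-- The inclusion `E → E ⊗ 𝒪_C(t_i)`. -/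
def toTwist : X ⟶ X.twist i :=
  homMk (Y := X.twist i) (𝟙 X.A) (fun U => (X.E.toTwist (t i) U).toAddMonoidHom)
    (fun U (a : OA X.A U) (m : X.M U) => by
      change X.E.toTwist (t i) U (a • m) = OAmap _ (AlgHom.id ℂ X.A) a • X.E.toTwist (t i) U m
      rw [OAmap_id]
      exact map_smul (X.E.toTwist (t i) U) a m)
    (fun _ _ => rfl) (fun U => (X.E.toTwist (t i) U).restrictScalars (C.𝒪 U)) (fun _ _ => rfl)
    (fun U m => eq_of_ptIdeal_smul_eq (i := i) fun g => by
      refine (X.smul_twistNabla i (X.E.toTwist (t i) U m) g).trans ?_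
      rw [contr_toTwist, X.leibniz, map_add, tens_tmul, map_smul, add_sub_cancel_left]
      rfl)

theorem toTwist_injective (U : C.AffOpen) : Function.Injective ((X.toTwist i).app U) :=
  VectorBundle.toTwist_injective

end LogConn
end SmoothProjCurve

/-! ### Flags and residues on E ⊗ 𝒪(t_i) -/

namespace SmoothProjCurve

variable {C : SmoothProjCurve} {n : ℕ} {t : Fin n → C.Pt} {r : ℕ}

namespace VectorBundle

variable {A : Type} [CommRing A] [Algebra ℂ A] {E F : C.VectorBundle r A} {U : C.AffOpen}

theorem map_vanishing_le {x : C.Pt} (g : E.M U →ₗ[OA A U] F.M U) {m : E.M U}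
    (hm : m ∈ E.vanishing x U) : g m ∈ F.vanishing x U := by
  have h1 : (E.vanishing x U).map g ≤ F.vanishing x U := by
    rw [vanishing, Submodule.map_smul'']
    exact Submodule.smul_mono le_rfl le_top
  exact h1 (Submodule.mem_map_of_mem hm)

theorem resTensor_tens (ht : Function.Injective t) {i : Fin n} (hU : (t i).1 ∈ U.1.1)
    (g : E.M U →ₗ[OA A U] F.M U) {y : E.M U ⊗[C.𝒪 U] logDiff t U} {m : E.M U}
    (hy : E.resTensor ht hU y = (E.vanishing (t i) U).mkQ m) :
    F.resTensor ht hU (tens t g y) = (F.vanishing (t i) U).mkQ (g m) := by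
  have key : ∃ m, E.resTensor ht hU y = (E.vanishing (t i) U).mkQ m ∧
      F.resTensor ht hU (tens t g y) = (F.vanishing (t i) U).mkQ (g m) := by
    clear hy
    induction y with
    | zero => exact ⟨0, by simp, by simp⟩
    | add a b ha hb =>
      obtain ⟨m, h1, h2⟩ := ha
      obtain ⟨m', h1', h2'⟩ := hb
      exact ⟨m + m', by rw [map_add, map_add, h1, h1'],
        by rw [map_add, map_add, map_add, map_add, h2, h2']⟩
    | tmul m ω =>
      exact ⟨algebraMap ℂ (OA A U) (resLog ht hU ω) • m, rfl, by
        rw [tens_tmul, resTensor_tmul, g.map_smul]⟩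
  obtain ⟨m', h1, h2⟩ := key
  rw [h2, mk_vanishing_eq, ← map_sub]
  rw [hy, eq_comm, mk_vanishing_eq] at h1
  exact map_vanishing_le g h1

theorem exists_mem_ptIdeal_evU_eq_one (ht : Function.Injective t) {i i' : Fin n} (hi : i' ≠ i)
    (hU : (t i').1 ∈ U.1.1) : ∃ f ∈ ptIdeal (t i) U, evU hU f = 1 := by
  obtain ⟨f, hf, f', hf', hff⟩ := exists_add_eq_one (C := C) ht hi U
  refine ⟨f, hf, ?_⟩
  have := congrArg (evU hU) hff
  rwa [map_add, (mem_ptIdeal_iff hU).mp hf', add_zero, map_one] at this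

end VectorBundle

open SmoothProjCurve.VectorBundle

namespace ParConn

variable {lam : Fin n → Fin r → ℂ} (X : ParConn t lam) (i : Fin n)

/-- The flags of `E ⊗ 𝒪_C(t_i)`. -/
def twistL (i' : Fin n) (q : Fin (r + 1)) (U : C.AffOpen) :
    Submodule (OA X.A U) ((X.E.twist (t i)).M U) :=
  ⨅ f : ptIdeal (t i) U, (X.L i' q U).comap (X.E.contr f)

variable {i} {i' : Fin n} {q : Fin (r + 1)} {U : C.AffOpen}

theorem mem_twistL {x : (X.E.twist (t i)).M U} :
    x ∈ X.twistL i i' q U ↔ ∀ f : ptIdeal (t i) U, X.E.contr f x ∈ X.L i' q U := by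
  simp only [twistL, Submodule.mem_iInf, Submodule.mem_comap]

theorem mulTwist_mem (k : twistFun (t i) U) {m : X.M U} (hm : m ∈ X.L i' q U) :
    X.E.mulTwist k m ∈ X.twistL i i' q U :=
  X.mem_twistL.mpr fun f => by
    rw [contr_mulTwist]
    exact smul_mem_of_mem _ hm

theorem mem_twistL_of_sum {m : ℕ} {f : Fin m → ptIdeal (t i) U} {j : Fin m → twistFun (t i) U}
    (hfj : ∑ a, twistMul (f a) (j a) = 1) {x : (X.E.twist (t i)).M U}
    (h : ∀ a, X.E.contr (f a) x ∈ X.L i' q U) : x ∈ X.twistL i i' q U := by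
  rw [← sum_mulTwist_contr hfj x]
  exact sum_mem fun a _ => X.mulTwist_mem (j a) (h a)

theorem twistL_zero : X.twistL i i' 0 U = ⊤ := by
  rw [eq_top_iff]
  exact fun x _ => X.mem_twistL.mpr fun f => by rw [X.L_zero]; trivial

theorem twistL_last : X.twistL i i' (Fin.last r) U = (X.E.twist (t i)).vanishing (t i') U := by
  apply le_antisymm
  · intro x hx
    obtain ⟨m, f, j, hfj⟩ := C.exists_twist_partition (t i) U
    rw [← sum_mulTwist_contr hfj x]
    refine sum_mem fun a _ => map_vanishing_le _ ?_
    rw [← X.L_last]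
    exact X.mem_twistL.mp hx (f a)
  · exact fun x hx => X.mem_twistL.mpr fun f => by
      rw [X.L_last]
      exact map_vanishing_le _ hx

theorem twistL_succ_le (p : Fin r) : X.twistL i i' p.succ U ≤ X.twistL i i' p.castSucc U :=
  fun _ hx => X.mem_twistL.mpr fun f => X.L_succ_le i' p U (X.mem_twistL.mp hx f)

theorem twistL_res {V : C.AffOpen} (h : U ≤ V) :
    X.twistL i i' q U = Submodule.span (OA X.A U)
      ((X.E.twist (t i)).res h '' (X.twistL i i' q V : Set ((X.E.twist (t i)).M V))) := by
  obtain ⟨m, f, j, hfj⟩ := C.exists_twist_partition (t i) V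
  have hfj' : ∑ a, twistMul (idealRest h (f a)) (twistRest h (j a)) = 1 := by
    simp only [twistMul_rest]
    rw [← map_sum, hfj, map_one]
  apply le_antisymm
  · intro x hx
    rw [← sum_mulTwist_contr hfj' x]
    refine sum_mem fun a _ => ?_
    have h1 := X.mem_twistL.mp hx (idealRest h (f a))
    rw [X.L_res i' q h] at h1
    have h2 := Submodule.mem_map_of_mem (f := X.E.mulTwist (twistRest h (j a))) h1
    rw [Submodule.map_span] at h2
    refine Submodule.span_mono ?_ h2
    rintro _ ⟨_, ⟨y, hy, rfl⟩, rfl⟩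
    exact ⟨X.E.mulTwist (j a) y, X.mulTwist_mem _ hy, rfl⟩
  · rw [Submodule.span_le]
    rintro _ ⟨x, hx, rfl⟩
    refine X.mem_twistL_of_sum hfj' fun a => ?_
    rw [contr_res, X.L_res i' q h]
    exact Submodule.subset_span ⟨_, X.mem_twistL.mp hx (f a), rfl⟩

theorem smul_L_le (p : Fin r) :
    ptIdealA (t i') X.A U • X.L i' p.castSucc U ≤ X.L i' p.succ U :=
  (Submodule.smul_mono le_rfl le_top).trans (X.vanishing_le i' _ U)

/-- Multiplication by j and contraction with f, where f j = 1 at t_{i'}, are inverse to each other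
modulo the next step. The choice works for i' = i as well as for i' ≠ i. -/
theorem invQuot_twistL (p : Fin r) (hU : (t i').1 ∈ U.1.1) :
    InvQuot (Algebra.TensorProduct.includeRight : X.A →ₐ[ℂ] OA X.A U).toRingHom
      (X.twistL i i' p.castSucc U) (X.twistL i i' p.succ U) := by
  obtain ⟨f, j, hfj⟩ := exists_twistMul_eq hU (t i)
  refine (X.invQuot i' p U hU).of_map ((X.E.mulTwist j).comp (X.L i' p.castSucc U).subtype)
    (fun x => X.mulTwist_mem j x.2) (fun x => ⟨fun hx => ?_, fun hx => X.mulTwist_mem j hx⟩)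
    (fun y hy => ⟨⟨X.E.contr f y, X.mem_twistL.mp hy f⟩, X.mem_twistL.mpr fun g => ?_⟩)
  · have h1 := X.mem_twistL.mp hx f
    have h2 := add_mem (sub_smul_mem (X.smul_L_le p) hU hfj x.2) h1
    change x.1 - twistMul f j • x.1 + twistMul f j • x.1 ∈ _ at h2
    rwa [sub_add_cancel] at h2
  · have h1 := sub_smul_mem (X.smul_L_le p) hU hfj (X.mem_twistL.mp hy g)
    rw [← twistMul_smul_contr_comm g f] at h1
    rw [map_sub]
    exact h1

variable (ht : Function.Injective t)

include ht in
-- At t_i the terms x ⊗ j_a df_a of the explicit formula have total residue Σ f_a j_a x = x and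
-- lower the exponent by 1. At another point, f∇x = ∇(fx) - x ⊗ df with f = 1 there and df without
-- residue gives the old exponent.
theorem exists_resid_twist (p : Fin r) (hU : (t i').1 ∈ U.1.1) {nu : Fin n → Fin r → ℂ}
    (hnu : ∀ p, nu i p = lam i p - 1) (hnu' : ∀ i' ≠ i, nu i' = lam i')
    {x : (X.E.twist (t i)).M U} (hx : x ∈ X.twistL i i' p.castSucc U) :
    ∃ x' : (X.E.twist (t i)).M U, (X.E.twist (t i)).resTensor ht hU (X.twistNabla i U x) =
        ((X.E.twist (t i)).vanishing (t i') U).mkQ x' ∧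
      x' - algebraMap ℂ (OA X.A U) (nu i' p) • x ∈ X.twistL i i' p.succ U := by
  by_cases hi : i' = i
  · subst hi
    obtain ⟨m, f, j, hfj⟩ := C.exists_twist_partition (t i') U
    choose y hy hy' using fun a => X.exists_resid_eq_add ht p hU (X.mem_twistL.mp hx (f a))
    have h1 : ∀ a, (X.E.twist (t i')).resTensor ht hU
        (tens t (X.E.mulTwist (j a)) (X.nabla U (X.E.contr (f a) x))) =
        ((X.E.twist (t i')).vanishing (t i') U).mkQ (algebraMap ℂ (OA X.A U) (lam i' p) •
          X.E.mulTwist (j a) (X.E.contr (f a) x) + X.E.mulTwist (j a) (y a)) := by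
      intro a
      rw [← map_smul, ← map_add]
      exact resTensor_tens ht hU (X.E.mulTwist (j a)) (hy' a)
    refine ⟨algebraMap ℂ (OA X.A U) (lam i' p) • x + ∑ a, X.E.mulTwist (j a) (y a) - x, ?_, ?_⟩
    · rw [X.twistNabla_eq i' hfj, map_sum]
      simp only [map_sub, resTensor_tmul, h1, resLog_twistD]
      rw [Finset.sum_sub_distrib, ← map_sum, ← map_sum, Finset.sum_add_distrib, ← Finset.smul_sum,
        sum_mulTwist_contr hfj, ← Finset.sum_smul, ← map_sum, ← map_sum, hfj, map_one, map_one,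
        one_smul]
    · have h2 : algebraMap ℂ (OA X.A U) (lam i' p) • x + ∑ a, X.E.mulTwist (j a) (y a) - x -
          algebraMap ℂ (OA X.A U) (nu i' p) • x = ∑ a, X.E.mulTwist (j a) (y a) := by
        rw [hnu, map_sub, map_one, sub_smul, one_smul]
        abel
      rw [h2]
      exact sum_mem fun a _ => X.mulTwist_mem (j a) (hy a)
  · obtain ⟨f, hf, hf1⟩ := exists_mem_ptIdeal_evU_eq_one ht hi hU
    obtain ⟨y, hy, hy'⟩ := X.exists_resid_eq_add ht p hU (X.mem_twistL.mp hx ⟨f, hf⟩)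
    refine ⟨algebraMap ℂ (OA X.A U) (nu i' p) • x + X.E.toTwist (t i) U y, ?_, ?_⟩
    · have h0 : X.E.toTwist (t i) U
          (algebraMap ℂ (OA X.A U) (lam i' p) • X.E.contr ⟨f, hf⟩ x + y) =
          algebraMap ℂ (OA X.A U) (lam i' p) • f • x + X.E.toTwist (t i) U y := by
        rw [(X.E.toTwist (t i) U).map_add, (X.E.toTwist (t i) U).map_smul, toTwist_contr]
      have h1 : (X.E.twist (t i)).resTensor ht hU (f • X.twistNabla i U x) = _ :=
        congrArg ((X.E.twist (t i)).resTensor ht hU) (X.smul_twistNabla i x ⟨f, hf⟩)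
      rw [map_sub, resTensor_tmul, resLog_dform, map_zero, zero_smul, map_zero, sub_zero,
        resTensor_tens ht hU _ hy', h0] at h1
      obtain ⟨x', hx'⟩ := ((X.E.twist (t i)).vanishing (t i') U).mkQ_surjective
        ((X.E.twist (t i)).resTensor ht hU (X.twistNabla i U x))
      rw [← algebraMap_smul (OA X.A U) f, resTensor_smul, ← hx', ← map_smul, mk_vanishing_eq] at h1
      rw [← hx', mk_vanishing_eq, hnu' i' hi]
      have h2 : ∀ z : (X.E.twist (t i)).M U, z - f • z ∈ (X.E.twist (t i)).vanishing (t i') U :=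
        fun z => sub_smul_mem (N := ⊤) le_rfl hU hf1 trivial
      have h3 := add_mem (h2 x') (sub_mem h1 (Submodule.smul_mem _
        (algebraMap ℂ (OA X.A U) (lam i' p)) (h2 x)))
      convert h3 using 1
      rw [algebraMap_smul_eq, smul_sub]
      abel
    · rw [add_sub_cancel_left]
      exact X.mulTwist_mem _ hy

variable (i) in
/-- The tensor product with `𝒪_C(t_i)`. -/
def twist {nu : Fin n → Fin r → ℂ} (hnu : ∀ p, nu i p = lam i p - 1)
    (hnu' : ∀ i' ≠ i, nu i' = lam i') : ParConn t nu where
  toLogConn := X.toLogConn.twist i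
  L i' q U := X.twistL i i' q U
  L_zero _ _ := X.twistL_zero
  L_last _ _ := X.twistL_last
  L_succ_le _ p _ := X.twistL_succ_le p
  L_res _ _ {_ _} h := X.twistL_res h
  invertible _ p _ hU := X.invQuot_twistL p hU
  residue i' p U hU x hx := by
    obtain ⟨x', h1, h2⟩ := X.exists_resid_twist ht p hU hnu hnu' hx
    exact ⟨x', (LogConn.isResidue_iff ht hU).mpr h1, h2⟩

theorem isTwistPair_twist {nu : Fin n → Fin r → ℂ} (hnu : ∀ p, nu i p = lam i p - 1)
    (hnu' : ∀ i' ≠ i, nu i' = lam i') :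
    IsTwistPair i X (X.twist i ht hnu hnu') (X.toLogConn.toTwist i) := by
  refine fun U => ⟨LogConn.toTwist_injective _ i U, ?_, fun i' q => ?_⟩
  · exact congrArg (fun N : Submodule (OA X.A U) ((X.E.twist (t i)).M U) =>
      (N : Set ((X.E.twist (t i)).M U))) range_toTwist
  · change (X.E.toTwist (t i) U) '' (X.L i' q U : Set (X.M U)) =
      (ptIdealA (t i) X.A U • X.twistL i i' q U : Submodule (OA X.A U) ((X.E.twist (t i)).M U))
    apply Set.Subset.antisymm
    · rintro _ ⟨m, hm, rfl⟩
      obtain ⟨k, f, j, hfj⟩ := C.exists_twist_partition (t i) U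
      rw [← one_smul (C.𝒪 U) m, ← hfj, Finset.sum_smul, map_sum]
      refine sum_mem fun a _ => ?_
      rw [← smul_mulTwist]
      exact smul_mem_ptIdealA_smul (f a).2 (X.mulTwist_mem (j a) hm)
    · have h1 : ptIdealA (t i) X.A U • X.twistL i i' q U ≤
          (X.L i' q U).map (X.E.toTwist (t i) U) :=
        ptIdealA_smul_le.mpr fun f hf x hx =>
          ⟨X.E.contr ⟨f, hf⟩ x, X.mem_twistL.mp hx ⟨f, hf⟩, toTwist_contr ⟨f, hf⟩ x⟩
      exact h1

end ParConn
end SmoothProjCurve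

/-! ### Isomorphic subsheaves, and extension of morphisms from E(-t_i) to E -/

namespace SmoothProjCurve

variable {C : SmoothProjCurve} {n : ℕ} {t : Fin n → C.Pt} {r : ℕ}

open SmoothProjCurve.VectorBundle

namespace LogConn

variable {X Y Z : LogConn t r}

theorem eq_of_comp_eq {f g : X ⟶ Y} {k : Y ⟶ Z} (hk : ∀ U, Function.Injective (k.app U))
    (hb : f.base = g.base) (h : f ≫ k = g ≫ k) : f = g :=
  hom_ext hb fun U m => hk U (by rw [← comp_app, ← comp_app, h])

theorem exists_app_eq_of_range {h : X ⟶ Z} {k : Y ⟶ Z}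
    (hr : ∀ U, Set.range (h.app U) = Set.range (k.app U)) (U : C.AffOpen) (m : X.M U) :
    ∃ y, k.app U y = h.app U m := by
  change h.app U m ∈ Set.range (k.app U)
  rw [← hr]
  exact ⟨m, rfl⟩

/-- Two subsheaves with the same sections are isomorphic. -/
def isoOfRange (h : X ⟶ Z) (k : Y ⟶ Z) (b : X.A ≅ Y.A) (hb : h.base = b.hom ≫ k.base)
    (hh : ∀ U, Function.Injective (h.app U)) (hk : ∀ U, Function.Injective (k.app U))
    (hr : ∀ U, Set.range (h.app U) = Set.range (k.app U)) : X ≅ Y where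
  hom := lift h k b.hom hb hk (exists_app_eq_of_range hr)
  inv := lift k h b.inv (by rw [hb, Iso.inv_hom_id_assoc]) hh
    (exists_app_eq_of_range fun U => (hr U).symm)
  hom_inv_id := hom_ext b.hom_inv_id fun U m => hh U (by
    rw [comp_app, app_lift, app_lift, id_app])
  inv_hom_id := hom_ext b.inv_hom_id fun U m => hk U (by
    rw [comp_app, app_lift, app_lift, id_app])

theorem isoOfRange_hom_comp (h : X ⟶ Z) (k : Y ⟶ Z) (b : X.A ≅ Y.A)
    (hb : h.base = b.hom ≫ k.base) (hh : ∀ U, Function.Injective (h.app U))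
    (hk : ∀ U, Function.Injective (k.app U))
    (hr : ∀ U, Set.range (h.app U) = Set.range (k.app U)) :
    (isoOfRange h k b hb hh hk hr).hom ≫ k = h :=
  hom_ext hb.symm fun U m => app_lift h k b.hom hb hk (exists_app_eq_of_range hr) U m

namespace Modification

variable {X Y : LogConn t r} {i : Fin n} (N : X.Modification i) (P : Y.Modification i)

/-- Multiplication by a function vanishing at `t_i`. -/
def mulSec {U : C.AffOpen} (f : ptIdeal (t i) U) : X.M U →ₗ[OA X.A U] N.bundle.M U :=
  (X.E.mulMap (f : C.𝒪 U)).codRestrict (N.N U) fun m => N.smul_mem f.2 m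

theorem mulSec_of_mem {U : C.AffOpen} (f : ptIdeal (t i) U) (z : N.bundle.M U) :
    N.mulSec f z.1 = (f : C.𝒪 U) • z := rfl

theorem twistMul_smul_mulSec {U : C.AffOpen} (f g : ptIdeal (t i) U) (j : twistFun (t i) U)
    (m : X.M U) : twistMul f j • N.mulSec g m = twistMul g j • N.mulSec f m := by
  apply Subtype.ext
  change twistMul f j • (g : C.𝒪 U) • m = twistMul g j • (f : C.𝒪 U) • m
  rw [smul_smul, smul_smul, mul_comm, mul_twistMul_comm, mul_comm]

variable {N} in
/-- Multiplication by a function with a simple pole at `t_i`. -/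
def divSec {U : C.AffOpen} (hN : N.N U ≤ X.E.vanishing (t i) U) (j : twistFun (t i) U) :
    N.bundle.M U →ₗ[OA X.A U] X.M U :=
  (divMap j).comp (Submodule.inclusion hN)

variable {N} in
theorem smul_divSec {U : C.AffOpen} (hN : N.N U ≤ X.E.vanishing (t i) U) (j : twistFun (t i) U)
    (f : ptIdeal (t i) U) (z : N.bundle.M U) :
    (f : C.𝒪 U) • divSec hN j z = twistMul f j • z.1 := smul_divMap j ⟨z.1, hN z.2⟩ f

variable {N} in
theorem sum_divSec_mulSec {U : C.AffOpen} (hN : N.N U ≤ X.E.vanishing (t i) U) {k : ℕ}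
    {f : Fin k → ptIdeal (t i) U} {j : Fin k → twistFun (t i) U}
    (hfj : ∑ a, twistMul (f a) (j a) = 1) (m : X.M U) :
    ∑ a, divSec hN (j a) (N.mulSec (f a) m) = m := by
  refine eq_of_forall_smul_eq (t i) fun g hg => ?_
  rw [Finset.smul_sum]
  have h1 : ∀ a, g • divSec hN (j a) (N.mulSec (f a) m) = twistMul (f a) (j a) • g • m := fun a =>
    (smul_divSec hN (j a) ⟨g, hg⟩ _).trans
      (congrArg Subtype.val (N.twistMul_smul_mulSec ⟨g, hg⟩ (f a) (j a) m))
  rw [Finset.sum_congr rfl fun a _ => h1 a, ← Finset.sum_smul, hfj, one_smul]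

variable (ht : Function.Injective t) {N P} (hP : ∀ U, P.N U ≤ Y.E.vanishing (t i) U)
  (ψ : N.conn ht ⟶ P.conn ht)

include hP in
-- The value at m should be ψ(fm)/f; the partition of unity turns this into Σ j_a ψ(f_a m), which by
-- linearity of ψ does not depend on f. The extension is what makes tensoring with 𝒪(-t_i) full.
theorem exists_extend (U : C.AffOpen) (m : X.M U) : ∃ y : Y.M U, ∀ f : ptIdeal (t i) U,
    (f : C.𝒪 U) • y = (P.lin U) (ψ.app U (N.mulSec f m)) := by
  obtain ⟨k, f, j, hfj⟩ := C.exists_twist_partition (t i) U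
  refine ⟨∑ a, divSec (hP U) (j a) (ψ.app U (N.mulSec (f a) m)), fun g => ?_⟩
  rw [Finset.smul_sum]
  have h1 : ∀ a, (g : C.𝒪 U) • divSec (hP U) (j a) (ψ.app U (N.mulSec (f a) m)) =
      twistMul (f a) (j a) • (P.lin U) (ψ.app U (N.mulSec g m)) := fun a =>
    (smul_divSec (hP U) (j a) g _).trans (by
      have h2 := (ψ.app_smul' U (twistMul g (j a)) (N.mulSec (f a) m)).symm.trans
        ((congrArg (ψ.app U) (N.twistMul_smul_mulSec g (f a) (j a) m)).trans
          (ψ.app_smul' U (twistMul (f a) (j a)) (N.mulSec g m)))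
      exact congrArg Subtype.val h2)
  rw [Finset.sum_congr rfl fun a _ => h1 a, ← Finset.sum_smul, hfj, one_smul]

/-- The extension of a morphism `X(-t_i) → Y(-t_i)`, on sections. -/
def extendApp (U : C.AffOpen) : X.M U →+ Y.M U :=
  AddMonoidHom.mk' (fun m => (exists_extend ht hP ψ U m).choose) fun m m' =>
    eq_of_forall_smul_eq (t i) fun f hf => by
      rw [smul_add, (exists_extend ht hP ψ U m).choose_spec ⟨f, hf⟩,
        (exists_extend ht hP ψ U m').choose_spec ⟨f, hf⟩,
        (exists_extend ht hP ψ U (m + m')).choose_spec ⟨f, hf⟩, map_add (N.mulSec _)]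
      exact congrArg Subtype.val (map_add (ψ.app U) (N.mulSec ⟨f, hf⟩ m) (N.mulSec ⟨f, hf⟩ m'))

theorem smul_extendApp {U : C.AffOpen} (f : ptIdeal (t i) U) (m : X.M U) :
    (f : C.𝒪 U) • extendApp ht hP ψ U m = (P.lin U) (ψ.app U (N.mulSec f m)) :=
  (exists_extend ht hP ψ U m).choose_spec f

theorem extendApp_smul' {U : C.AffOpen} (s : C.𝒪 U) (m : X.M U) :
    extendApp ht hP ψ U (s • m) = s • extendApp ht hP ψ U m := by
  refine eq_of_forall_smul_eq (t i) fun f hf => ?_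
  rw [smul_comm f s, smul_extendApp ht hP ψ ⟨f, hf⟩, smul_extendApp ht hP ψ ⟨f, hf⟩,
    ← algebraMap_smul_eq, map_smul]
  exact congrArg Subtype.val (ψ.app_smul' U s (N.mulSec ⟨f, hf⟩ m))

/-- The extension of a morphism `X(-t_i) → Y(-t_i)`, as a linear map. -/
def extendLin (U : C.AffOpen) : X.M U →ₗ[C.𝒪 U] Y.M U where
  __ := extendApp ht hP ψ U
  map_smul' := extendApp_smul' ht hP ψ

theorem extendApp_of_mem {U : C.AffOpen} (z : N.bundle.M U) :
    extendApp ht hP ψ U z.1 = (P.lin U) (ψ.app U z) := by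
  refine eq_of_forall_smul_eq (t i) fun f hf => ?_
  rw [smul_extendApp ht hP ψ ⟨f, hf⟩, mulSec_of_mem]
  exact congrArg Subtype.val (ψ.app_smul' U f z)

theorem extendLin_comp (U : C.AffOpen) :
    (extendLin ht hP ψ U).comp (N.lin U) = (P.lin U).comp (ψ.lin U) :=
  LinearMap.ext fun z => extendApp_of_mem ht hP ψ z

/-- The extension of a morphism `X(-t_i) → Y(-t_i)` to a morphism `X → Y`. -/
def extend : X ⟶ Y :=
  homMk (X := X) (Y := Y) ψ.base (extendApp ht hP ψ)
    (fun U a m => eq_of_forall_smul_eq (t i) fun f hf => by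
      rw [smul_comm f, smul_extendApp ht hP ψ ⟨f, hf⟩, smul_extendApp ht hP ψ ⟨f, hf⟩, map_smul]
      exact congrArg Subtype.val (ψ.app_smul U a (N.mulSec ⟨f, hf⟩ m)))
    (fun {U V} h m => by
      obtain ⟨f, hf, hf0⟩ := exists_mem_ptIdeal_ne_zero (t i) V
      refine smul_left_injective (f := rest h f)
        (fun h0 => hf0 (rest_injective h (h0.trans (map_zero _).symm))) ?_
      refine (smul_extendApp ht hP ψ (idealRest h ⟨f, hf⟩) _).trans ?_
      refine Eq.trans ?_ (map_smul_of_semilinear h (Y.E.res_smul h) f _)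
      rw [smul_extendApp ht hP ψ ⟨f, hf⟩]
      have h1 : N.mulSec (idealRest h ⟨f, hf⟩) (X.E.res h m) =
          N.bundle.res h (N.mulSec ⟨f, hf⟩ m) :=
        Subtype.ext (map_smul_of_semilinear h (X.E.res_smul h) f m).symm
      rw [h1]
      exact congrArg Subtype.val (ψ.app_res h (N.mulSec ⟨f, hf⟩ m)))
    (extendLin ht hP ψ) (fun _ _ => rfl)
    (fun U m => by
      obtain ⟨f, hf, hf0⟩ := exists_mem_ptIdeal_ne_zero (t i) U
      refine smul_tensor_injective hf0 ?_
      -- Horizontality is known for f m, which lies in the subsheaf. Expanding both sides by the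
      -- Leibniz rule, the terms with df cancel.
      have h1 : Y.nabla U (f • extendApp ht hP ψ U m) =
          (extendLin ht hP ψ U).rTensor (logDiff t U) (X.nabla U (f • m)) := by
        rw [smul_extendApp ht hP ψ ⟨f, hf⟩]
        refine (P.rTensor_nabla ht U (ψ.app U (N.mulSec ⟨f, hf⟩ m))).symm.trans ?_
        refine (congrArg _ (ψ.horizontal' U (N.mulSec ⟨f, hf⟩ m))).trans ?_
        refine (LinearMap.rTensor_comp_apply _ _ _ _).symm.trans ?_
        rw [← extendLin_comp ht hP ψ U]
        refine (LinearMap.rTensor_comp_apply _ _ _ _).trans ?_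
        exact congrArg _ (N.rTensor_nabla ht U (N.mulSec ⟨f, hf⟩ m))
      rw [Y.leibniz, X.leibniz, map_add, LinearMap.rTensor_tmul] at h1
      exact (add_left_cancel h1).trans (map_smul _ f _))

theorem mulSec_extendApp {U : C.AffOpen} (f : ptIdeal (t i) U) (m : X.M U) :
    P.mulSec f (extendApp ht hP ψ U m) = ψ.app U (N.mulSec f m) :=
  Subtype.ext (smul_extendApp ht hP ψ f m)

theorem divSec_app (hN : ∀ U, N.N U ≤ X.E.vanishing (t i) U) {U : C.AffOpen}
    (j : twistFun (t i) U) (z : N.bundle.M U) :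
    divSec (hP U) j (ψ.app U z) = extendApp ht hP ψ U (divSec (hN U) j z) := by
  refine eq_of_forall_smul_eq (t i) fun f hf => ?_
  refine (smul_divSec (hP U) j ⟨f, hf⟩ (ψ.app U z)).trans ?_
  rw [smul_extendApp ht hP ψ ⟨f, hf⟩]
  have h1 : N.mulSec ⟨f, hf⟩ (divSec (hN U) j z) = twistMul ⟨f, hf⟩ j • z :=
    Subtype.ext (smul_divSec (hN U) j ⟨f, hf⟩ z)
  rw [h1]
  exact congrArg Subtype.val (ψ.app_smul' U (twistMul ⟨f, hf⟩ j) z).symm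

end Modification
end LogConn
end SmoothProjCurve

/-! ### Elementary transforms as equivalences of categories -/

namespace SmoothProjCurve

variable {C : SmoothProjCurve} {n : ℕ} {t : Fin n → C.Pt} {r : ℕ}

open SmoothProjCurve.VectorBundle

namespace ParConn

variable {lam nu mu : Fin n → Fin r → ℂ} (ht : Function.Injective t) {i : Fin n} {j : Fin (r + 1)}

section IsoOfRange

variable {X Y : ParConn t lam} {Z : LogConn t r} (h : X.toLogConn ⟶ Z) (k : Y.toLogConn ⟶ Z)
  (b : X.A ≅ Y.A) (hb : h.base = b.hom ≫ k.base)
  (hh : ∀ U, Function.Injective (h.app U)) (hk : ∀ U, Function.Injective (k.app U))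
  (hr : ∀ U, Set.range (h.app U) = Set.range (k.app U))
  (hf : ∀ i q U m m', h.app U m = k.app U m' → (m ∈ X.L i q U ↔ m' ∈ Y.L i q U))

/-- Two parabolic subsheaves with the same sections and flags are isomorphic. -/
def isoOfRange : X ≅ Y :=
  isoMk (LogConn.isoOfRange h k b hb hh hk hr) fun i q U m => hf i q U m _
    (LogConn.app_lift h k b.hom hb hk (LogConn.exists_app_eq_of_range hr) U m).symm

theorem isoOfRange_hom_comp : (isoOfRange h k b hb hh hk hr hf).hom.hom ≫ k = h :=
  LogConn.isoOfRange_hom_comp h k b hb hh hk hr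

end IsoOfRange

/-- The elementary transform as a functor. -/
def elmFunctor (hnu : IsElmExponents i j lam nu) : ParConn t lam ⥤ ParConn t nu where
  obj X := X.elm ht hnu
  map f := elmMap ht hnu f
  map_id X := hom_ext' (LogConn.eq_of_comp_eq (k := X.elmIncl ht hnu)
    ((X.modification ht i j).incl_injective ht) rfl (elmMap_incl ht hnu (𝟙 X)))
  map_comp {_ _ Z} f g := hom_ext' (LogConn.eq_of_comp_eq (k := Z.elmIncl ht hnu)
    ((Z.modification ht i j).incl_injective ht) rfl
    ((elmMap_incl ht hnu (f ≫ g)).trans ((Category.assoc _ _ _).symm.trans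
      ((congrArg (· ≫ g.hom) (elmMap_incl ht hnu f).symm).trans ((Category.assoc _ _ _).trans
        ((congrArg ((elmMap ht hnu f).hom ≫ ·) (elmMap_incl ht hnu g).symm).trans
          (Category.assoc _ _ _).symm))))))

theorem elmIncl_injective (hnu : IsElmExponents i j lam nu) (X : ParConn t lam) (U : C.AffOpen) :
    Function.Injective ((X.elmIncl ht hnu).app U) := (X.modification ht i j).incl_injective ht U

theorem elmIncl_range (hnu : IsElmExponents i j lam nu) (X : ParConn t lam) (U : C.AffOpen) :
    Set.range ((X.elmIncl ht hnu).app U) = (X.L i j U : Set (X.M U)) :=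
  Subtype.range_coe

theorem mem_elm (hnu : IsElmExponents i j lam nu) (X : ParConn t lam) {i' : Fin n}
    {q : Fin (r + 1)} {U : C.AffOpen} {m : (X.elm ht hnu).M U} :
    m ∈ (X.elm ht hnu).L i' q U ↔ (X.elmIncl ht hnu).app U m ∈ X.elmL i j i' q U := Iff.rfl

theorem elmIncl_image (hnu : IsElmExponents i j lam nu) (X : ParConn t lam) (i' : Fin n)
    (q : Fin (r + 1)) (U : C.AffOpen) :
    (X.elmIncl ht hnu).app U '' ((X.elm ht hnu).L i' q U : Set ((X.elm ht hnu).M U)) =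
      (X.elmL i j i' q U : Set (X.M U)) := by
  apply Set.Subset.antisymm
  · rintro _ ⟨m, hm, rfl⟩
    exact hm
  · intro m hm
    exact ⟨(X.modification ht i j).sec (X.elmL_le i j i' q U hm), hm, rfl⟩

/-- A morphism is determined by its values on s m for one nonzero s ∈ I_{t_i}, since the target is
torsion-free, and these sections lie in the subsheaf. -/
instance elmFunctor_faithful (hnu : IsElmExponents i j lam nu) :
    (elmFunctor (t := t) ht hnu).Faithful where
  map_injective {X Y f g} h := by
    have h1 : X.elmIncl ht hnu ≫ f.hom = X.elmIncl ht hnu ≫ g.hom := by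
      rw [← elmMap_incl, ← elmMap_incl]
      exact congrArg (fun e : X.elm ht hnu ⟶ Y.elm ht hnu => e.hom ≫ Y.elmIncl ht hnu) h
    have h2 : 𝟙 X.A ≫ f.hom.base = 𝟙 X.A ≫ g.hom.base :=
      congrArg (fun e : (X.elm ht hnu).toLogConn ⟶ Y.toLogConn => e.base) h1
    rw [Category.id_comp, Category.id_comp] at h2
    refine hom_ext' (LogConn.hom_ext h2 fun U m => ?_)
    obtain ⟨s, hs, hs0⟩ := exists_mem_ptIdeal_ne_zero (t i) U
    refine smul_left_injective hs0 ?_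
    rw [← LogConn.Hom.app_smul', ← LogConn.Hom.app_smul']
    exact congrArg (fun e : (X.elm ht hnu).toLogConn ⟶ Y.toLogConn =>
      e.app U ((X.modification ht i j).mulSec ⟨s, hs⟩ m)) h1

/-! ### Tensoring with `𝒪_C(-t_i)` -/

/-- At t_i this is the periodicity of the continued flag; at the other points coprimality turns the
intersection with E(-t_i) into a product. -/
theorem elmL_last_index (ht : Function.Injective t) (X : ParConn t lam) (i i' : Fin n) (q : Fin (r + 1)) (U : C.AffOpen) :
    X.elmL i (Fin.last r) i' q U = ptIdealA (t i) X.A U • X.L i' q U := by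
  by_cases hi : i' = i
  · subst hi
    rw [elmL_self, Fin.val_last, lx_add, X.Ln_eq i' q rfl]
  · rw [X.elmL_of_ne hi, X.L_last, X.Ln_eq i' q rfl]
    apply le_antisymm
    · rintro y ⟨hy', hy⟩
      have h1 : y ∈ X.L i' q U ⊓ X.E.vanishing (t i) U := ⟨hy', hy⟩
      rw [VectorBundle.inf_eq_sup ht hi le_rfl (X.vanishing_le i' q U)] at h1
      refine (sup_le le_rfl ?_ : _ ≤ ptIdealA (t i) X.A U • X.L i' q U) h1
      refine ptIdealA_smul_le.mpr fun f hf m hm => ?_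
      exact (X.modification ht i' q).smul_mem_ptIdealA hf hm
    · exact le_inf Submodule.smul_le_right (Submodule.smul_mono le_rfl le_top)

section Untwist

variable {X Y : ParConn t lam} (hnu : IsElmExponents i (Fin.last r) lam nu)

theorem modification_last_le (X : ParConn t lam) (U : C.AffOpen) :
    (X.modification ht i (Fin.last r)).N U ≤ X.E.vanishing (t i) U := (X.L_last i U).le

variable (ψ : X.elm ht hnu ⟶ Y.elm ht hnu)

/-- The extension of a morphism on `𝒪_C(-t_i)`-twists. -/
def extendHom : X.toLogConn ⟶ Y.toLogConn :=
  LogConn.Modification.extend ht (modification_last_le ht Y) ψ.hom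

theorem extendHom_cartesian (U : C.AffOpen) :
    IsBaseChangeAlong (OAmap (LogConn.le_rfl' U) (extendHom ht hnu ψ).base.hom)
      ((extendHom ht hnu ψ).app U) ((extendHom ht hnu ψ).app_smul U) := by
  obtain ⟨k, f, j, hfj⟩ := C.exists_twist_partition (t i) U
  exact IsBaseChangeAlong.of_retract (M := (X.modification ht i (Fin.last r)).bundle.M U)
    (M' := (Y.modification ht i (Fin.last r)).bundle.M U) _ (ψ.cartesian U)
    (fun a => (X.modification ht i (Fin.last r)).mulSec (f a))
    (fun a => LogConn.Modification.divSec (modification_last_le ht X U) (j a))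
    (fun a => (Y.modification ht i (Fin.last r)).mulSec (f a))
    (fun a => LogConn.Modification.divSec (modification_last_le ht Y U) (j a))
    (fun a m => LogConn.Modification.mulSec_extendApp ht (modification_last_le ht Y) ψ.hom (f a) m)
    (fun a z => LogConn.Modification.divSec_app ht (modification_last_le ht Y) ψ.hom
      (modification_last_le ht X) (j a) z)
    (LogConn.Modification.sum_divSec_mulSec (modification_last_le ht X U) hfj)
    (LogConn.Modification.sum_divSec_mulSec (modification_last_le ht Y U) hfj)

theorem divSec_mem {i' : Fin n} {q : Fin (r + 1)} {U : C.AffOpen} (j : twistFun (t i) U)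
    {z : (X.modification ht i (Fin.last r)).bundle.M U} (hz : z ∈ (X.elm ht hnu).L i' q U) :
    LogConn.Modification.divSec (modification_last_le ht X U) j z ∈ X.L i' q U :=
  divMap_mem j _ (by
    rw [← elmL_last_index ht]
    exact hz)

theorem mulSec_mem {i' : Fin n} {q : Fin (r + 1)} {U : C.AffOpen} (f : ptIdeal (t i) U)
    {m : X.M U} (hm : m ∈ X.L i' q U) :
    (X.modification ht i (Fin.last r)).mulSec f m ∈ (X.elm ht hnu).L i' q U := by
  change (f : C.𝒪 U) • m ∈ X.elmL i (Fin.last r) i' q U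
  rw [elmL_last_index ht]
  exact smul_mem_ptIdealA_smul f.2 hm

theorem extendHom_flag (i' : Fin n) (q : Fin (r + 1)) (U : C.AffOpen) :
    Y.L i' q U = Submodule.span (OA Y.A U)
      ((extendHom ht hnu ψ).app U '' (X.L i' q U : Set (X.M U))) := by
  obtain ⟨k, f, j, hfj⟩ := C.exists_twist_partition (t i) U
  apply le_antisymm
  · intro y hy
    have h1 := LogConn.Modification.sum_divSec_mulSec (modification_last_le ht Y U) hfj y
    rw [← h1]
    refine sum_mem fun a _ => ?_
    have h2 : (Y.elm ht hnu).L i' q U ≤ (Submodule.span (OA Y.A U)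
        ((extendHom ht hnu ψ).app U '' (X.L i' q U : Set (X.M U)))).comap
          (LogConn.Modification.divSec (modification_last_le ht Y U) (j a)) := by
      refine (ψ.flag i' q U).le.trans (Submodule.span_le.mpr ?_)
      rintro _ ⟨z, hz, rfl⟩
      exact Submodule.subset_span ⟨_, divSec_mem ht hnu (j a) hz, (LogConn.Modification.divSec_app ht
        (modification_last_le ht Y) ψ.hom (modification_last_le ht X) (j a) z).symm⟩
    exact h2 (mulSec_mem ht hnu (f a) hy)
  · rw [Submodule.span_le]
    rintro _ ⟨m, hm, rfl⟩
    have h1 := LogConn.Modification.sum_divSec_mulSec (modification_last_le ht Y U) hfj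
      ((extendHom ht hnu ψ).app U m)
    rw [SetLike.mem_coe, ← h1]
    refine sum_mem fun a _ => divSec_mem ht hnu (j a) ?_
    have h2 := LogConn.Modification.mulSec_extendApp ht (modification_last_le ht Y) ψ.hom (f a) m
    have h3 := Hom.app_mem ψ (mulSec_mem ht hnu (f a) hm)
    exact h2.symm ▸ h3

instance elmFunctor_full : (elmFunctor (t := t) ht hnu).Full where
  map_surjective {X Y} ψ := by
    refine ⟨⟨extendHom ht hnu ψ, extendHom_cartesian ht hnu ψ, extendHom_flag ht hnu ψ⟩, ?_⟩
    refine hom_ext' (LogConn.eq_of_comp_eq (k := Y.elmIncl ht hnu)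
      (elmIncl_injective ht hnu Y) rfl ?_)
    refine (elmMap_incl ht hnu _).trans (LogConn.hom_ext ?_ fun U z => ?_)
    · change 𝟙 _ ≫ ψ.hom.base = ψ.hom.base ≫ 𝟙 _
      simp
    · exact LogConn.Modification.extendApp_of_mem ht (modification_last_le ht Y) ψ.hom z

/-- The isomorphism `(E ⊗ 𝒪_C(t_i)) ⊗ 𝒪_C(-t_i) ≅ E`. -/
def elmTwistIso (X : ParConn t nu) (h : ∀ p, lam i p = nu i p - 1) (h' : ∀ i' ≠ i, lam i' = nu i') :
    (X.twist i ht h h').elm ht hnu ≅ X :=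
  isoOfRange ((X.twist i ht h h').elmIncl ht hnu) (X.toLogConn.toTwist i) (Iso.refl X.A)
    (Category.comp_id _).symm (elmIncl_injective ht hnu _) (LogConn.toTwist_injective _ i)
    (fun U => by
      rw [elmIncl_range, ((X.isTwistPair_twist ht h h') U).2.1, L_last])
    (fun i' q U m m' hm => by
      rw [mem_elm, hm, elmL_last_index ht]
      have h1 := ((X.isTwistPair_twist ht h h') U).2.2 i' q
      rw [← SetLike.mem_coe]
      refine (iff_of_eq (congrArg (_ ∈ ·) h1.symm)).trans ?_
      exact (LogConn.toTwist_injective _ i U).mem_set_image)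

theorem elmTwistIso_hom_comp (X : ParConn t nu) (h : ∀ p, lam i p = nu i p - 1)
    (h' : ∀ i' ≠ i, lam i' = nu i') :
    (elmTwistIso ht hnu X h h').hom.hom ≫ X.toLogConn.toTwist i =
      (X.twist i ht h h').elmIncl ht hnu := isoOfRange_hom_comp ..

theorem IsElmExponents.eq_sub_one (hnu : IsElmExponents i (Fin.last r) lam nu) (p : Fin r) :
    lam i p = nu i p - 1 := by
  rw [hnu.eq_of_ge p p rfl, add_sub_cancel_right]

/-- Tensoring with 𝒪(t_i) supplies the preimages of objects, and the extension of morphisms supplies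
fullness. -/
theorem elmFunctor_last_isEquivalence : (elmFunctor (t := t) ht hnu).IsEquivalence where
  essSurj := ⟨fun X => ⟨X.twist i ht hnu.eq_sub_one fun i' hi => (hnu.eq_of_ne i' hi).symm,
    ⟨elmTwistIso ht hnu X _ _⟩⟩⟩

end Untwist

/-! ### Composites of elementary transforms -/

/-- The row is rotated by j + j' = r places, hence returns to itself, and each entry has been raised
by 1 exactly once. -/
theorem IsElmExponents.comp {j' : Fin (r + 1)} (hj : (j : ℕ) + j' = r)
    (hnu : IsElmExponents i j lam nu) (hmu : IsElmExponents i j' nu mu) :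
    IsElmExponents i (Fin.last r) lam mu where
  eq_of_lt p q h := by
    have := p.2
    rw [Fin.val_last] at h
    omega
  eq_of_ge p q h := by
    obtain rfl : p = q := Fin.ext (by rw [Fin.val_last] at h; omega)
    rcases Nat.lt_or_ge (p + j') r with h1 | h1
    · rw [hmu.eq_of_lt ⟨p + j', h1⟩ p rfl, hnu.eq_of_ge p ⟨p + j', h1⟩ (by simp; omega)]
    · have hp := p.2
      have hj' := j'.2
      rw [hmu.eq_of_ge ⟨p + j' - r, by omega⟩ p (by simp; omega),
        hnu.eq_of_lt p ⟨p + j' - r, by omega⟩ (by simp; omega)]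
  eq_of_ne i' hi := (hmu.eq_of_ne i' hi).trans (hnu.eq_of_ne i' hi)

theorem elmIncl_mem_lx (hnu : IsElmExponents i j lam nu) (X : ParConn t lam) {k : ℕ} (hk : k ≤ r)
    (U : C.AffOpen) (m : (X.elm ht hnu).M U) :
    m ∈ (X.elm ht hnu).Ln i k U ↔ (X.elmIncl ht hnu).app U m ∈ X.lx i (k + j) U := by
  rw [(X.elm ht hnu).Ln_eq i ⟨k, Nat.lt_succ_iff.mpr hk⟩ rfl, mem_elm, elmL_self]

/-- At t_i the two transforms shift the index of the continued flag by j and j', so together by r,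
which is the twist by 𝒪(-t_i). -/
theorem mem_elm_elm {j' : Fin (r + 1)} (hj : (j : ℕ) + j' = r) (hnu : IsElmExponents i j lam nu)
    (hmu : IsElmExponents i j' nu mu) (X : ParConn t lam) {i' : Fin n} {q : Fin (r + 1)}
    {U : C.AffOpen} {m : ((X.elm ht hnu).elm ht hmu).M U} :
    m ∈ ((X.elm ht hnu).elm ht hmu).L i' q U ↔ (X.elmIncl ht hnu).app U
      (((X.elm ht hnu).elmIncl ht hmu).app U m) ∈ X.elmL i (Fin.last r) i' q U := by
  rw [mem_elm]
  set y := ((X.elm ht hnu).elmIncl ht hmu).app U m with hy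
  by_cases hi : i' = i
  · subst hi
    rw [elmL_last_index ht, elmL_self]
    have hq := q.2
    have hj1 := j.2
    have hj2 := j'.2
    rcases Nat.lt_or_ge (q + j') (r + 1) with h | h
    · have h1 : (q : ℕ) + j' + j = q + r := by omega
      rw [(X.elm ht hnu).lx_of_le i' (by omega), elmIncl_mem_lx ht hnu X (by omega), h1, lx_add,
        X.Ln_eq i' q rfl]
    · obtain ⟨k, hk⟩ := Nat.exists_eq_add_of_le' (show r ≤ q + j' by omega)
      rw [hk, lx_add]
      -- For q + j' ≥ r the step is a product of the ideal with a submodule of l_j, to be compared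
      -- with a product formed in E; the product is pushed forward along the inclusion of l_j.
      let Lk : Submodule (OA X.A U) (X.L i' j U) := (X.elm ht hnu).Ln i' k U
      have h1 : Lk.map ((X.L i' j U).subtype) = X.L i' q U := by
        have h2 : k + (j : ℕ) = q := by omega
        ext m
        constructor
        · rintro ⟨z, hz, rfl⟩
          have h3 := (elmIncl_mem_lx ht hnu X (by omega) U z).mp hz
          rwa [h2, X.lx_of_le i' (by omega), X.Ln_eq i' q rfl] at h3
        · intro hm
          have h3 : m ∈ X.L i' j U := X.L_antitone i' U (Fin.le_def.mpr (by omega)) hm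
          refine ⟨⟨m, h3⟩, (elmIncl_mem_lx ht hnu X (by omega) U _).mpr ?_, rfl⟩
          rw [h2, X.lx_of_le i' (by omega), X.Ln_eq i' q rfl]
          exact hm
      have h2 : ptIdealA (t i') X.A U • X.L i' q U =
          (ptIdealA (t i') X.A U • Lk).map ((X.L i' j U).subtype) := by
        rw [← h1]
        exact (Submodule.map_smul'' _ _ _).symm
      rw [h2]
      exact ((X.L i' j U).subtype_injective.mem_set_image).symm
  · have h1 : (X.elmIncl ht hnu).app U y ∈ X.L i (Fin.last r) U := by
      have h2 : y ∈ (X.elm ht hnu).L i j' U := m.2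
      rw [mem_elm, elmL_self, add_comm, hj, X.lx_of_le i le_rfl, X.Ln_eq (k := r) i (Fin.last r) rfl] at h2
      exact h2
    rw [elmL_of_ne _ hi, elmL_of_ne _ hi, Submodule.mem_inf, Submodule.mem_inf,
      (X.elm ht hnu).Ln_eq i' q rfl, mem_elm, elmL_of_ne _ hi, Submodule.mem_inf]
    exact ⟨fun h => ⟨h.1.1, h1⟩, fun h => ⟨⟨h.1, y.2⟩, m.2⟩⟩

/-- The composite of the elementary transforms along `l_j` and along `l'_{r-j}` is the twist by
`𝒪_C(-t_i)`. -/
def elmElmIso {j' : Fin (r + 1)} (hj : (j : ℕ) + j' = r) (hnu : IsElmExponents i j lam nu)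
    (hmu : IsElmExponents i j' nu mu) (X : ParConn t lam) :
    (X.elm ht hnu).elm ht hmu ≅ X.elm ht (hnu.comp hj hmu) :=
  isoOfRange ((X.elm ht hnu).elmIncl ht hmu ≫ X.elmIncl ht hnu) (X.elmIncl ht (hnu.comp hj hmu))
    (Iso.refl X.A) rfl
    (fun U => (elmIncl_injective ht hnu X U).comp (elmIncl_injective ht hmu _ U))
    (elmIncl_injective ht _ X)
    (fun U => by
      have h0 : ∀ m : ((X.elm ht hnu).elm ht hmu).M U, m ∈ ((X.elm ht hnu).elm ht hmu).L i 0 U :=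
        fun m => by rw [L_zero]; trivial
      rw [elmIncl_range]
      apply Set.Subset.antisymm
      · rintro _ ⟨m, rfl⟩
        have h1 := (mem_elm_elm ht hj hnu hmu X).mp (h0 m)
        exact X.elmL_le _ _ _ _ _ h1
      · intro m hm
        have h1 : m ∈ X.L i j U := X.L_antitone i U (Fin.le_last j) hm
        have h2 : (X.modification ht i j).sec h1 ∈ (X.elm ht hnu).L i j' U := by
          change m ∈ X.elmL i j i j' U
          rw [elmL_self, add_comm, hj, X.lx_of_le i le_rfl, X.Ln_eq (k := r) i (Fin.last r) rfl]
          exact hm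
        exact ⟨((X.elm ht hnu).modification ht i j').sec h2, rfl⟩)
    (fun i' q U m m' hm => by
      rw [mem_elm_elm ht hj hnu hmu X, mem_elm, ← hm]
      rfl)

theorem elmElmIso_hom_comp {j' : Fin (r + 1)} (hj : (j : ℕ) + j' = r)
    (hnu : IsElmExponents i j lam nu) (hmu : IsElmExponents i j' nu mu) (X : ParConn t lam) :
    (elmElmIso ht hj hnu hmu X).hom.hom ≫ X.elmIncl ht (hnu.comp hj hmu) =
      (X.elm ht hnu).elmIncl ht hmu ≫ X.elmIncl ht hnu := isoOfRange_hom_comp ..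

/-- The composite of elementary transforms as a natural isomorphism. -/
def elmCompIso {j' : Fin (r + 1)} (hj : (j : ℕ) + j' = r) (hnu : IsElmExponents i j lam nu)
    (hmu : IsElmExponents i j' nu mu) :
    elmFunctor (t := t) ht hnu ⋙ elmFunctor ht hmu ≅ elmFunctor ht (hnu.comp hj hmu) :=
  NatIso.ofComponents (elmElmIso ht hj hnu hmu) fun {X Y} f =>
    hom_ext' (LogConn.eq_of_comp_eq (elmIncl_injective ht (hnu.comp hj hmu) Y)
      (by
        change f.hom.base ≫ 𝟙 _ = 𝟙 _ ≫ f.hom.base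
        simp) (by
      change ((elmMap ht hmu (elmMap ht hnu f)).hom ≫ (elmElmIso ht hj hnu hmu Y).hom.hom) ≫ _ =
        ((elmElmIso ht hj hnu hmu X).hom.hom ≫ (elmMap ht (hnu.comp hj hmu) f).hom) ≫ _
      rw [Category.assoc, Category.assoc, elmElmIso_hom_comp, elmMap_incl, ← Category.assoc, elmMap_incl, Category.assoc, elmMap_incl,
        ← Category.assoc, ← elmElmIso_hom_comp ht hj hnu hmu X]
      exact Category.assoc _ _ _))

/-- The exponents of the elementary transform along `l_j`. -/
def elmExponents (i : Fin n) (j : Fin (r + 1)) (lam : Fin n → Fin r → ℂ) : Fin n → Fin r → ℂ :=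
  Function.update lam i fun q =>
    if h : (q : ℕ) + j < r then lam i ⟨q + j, h⟩ else lam i ⟨q + j - r, by omega⟩ + 1

theorem isElmExponents_elmExponents (i : Fin n) (j : Fin (r + 1)) (lam : Fin n → Fin r → ℂ) :
    IsElmExponents i j lam (elmExponents i j lam) where
  eq_of_lt p q h := by
    have hp := p.2
    rw [elmExponents, Function.update_self, dif_pos (h ▸ hp)]
    exact congrArg (lam i) (Fin.ext h.symm)
  eq_of_ge p q h := by
    rw [elmExponents, Function.update_self, dif_neg (by omega)]
    exact congrArg (lam i · + 1) (Fin.ext (by simp; omega))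
  eq_of_ne i' hi := Function.update_of_ne hi _ _

/-- The transforms along j' and then j together raise the row by 1, so the exponents before both are
ν with row i lowered by 1. -/
theorem IsElmExponents.exists_left (hnu : IsElmExponents i j lam nu) {j' : Fin (r + 1)}
    (hj : (j' : ℕ) + j = r) : ∃ kap, IsElmExponents i j' kap lam := by
  refine ⟨Function.update lam i fun p => nu i p - 1, fun p q h => ?_, fun p q h => ?_,
    fun i' hi => (Function.update_of_ne hi _ _).symm⟩
  · rw [Function.update_self, hnu.eq_of_ge q p (by omega), add_sub_cancel_right]
  · rw [Function.update_self, hnu.eq_of_lt q p (by omega), sub_add_cancel]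

/-- The transform along j followed by the one along r - j is isomorphic to an equivalence, the twist
by 𝒪(-t_i); as the second factor is faithful, the first is full. The composite in the other order,
starting from `kap`, is again such a twist and gives essential surjectivity. -/
theorem elmFunctor_isEquivalence (hnu : IsElmExponents i j lam nu) :
    (elmFunctor (t := t) ht hnu).IsEquivalence := by
  have hj0 := j.2
  let j' : Fin (r + 1) := ⟨r - j, by omega⟩
  have hj : (j : ℕ) + j' = r := by simp [j']; omega
  have hj' : (j' : ℕ) + j = r := by omega
  have hmu := isElmExponents_elmExponents i j' nu
  obtain ⟨kap, hkap⟩ := hnu.exists_left hj'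
  have h1 := elmFunctor_last_isEquivalence (t := t) ht (hnu.comp hj hmu)
  have h2 := elmFunctor_last_isEquivalence (t := t) ht (hkap.comp hj' hnu)
  have full := Functor.Full.of_comp_faithful_iso (elmCompIso (t := t) ht hj hnu hmu)
  exact
    { essSurj := ⟨fun X => ⟨(elmFunctor ht hkap).obj ((elmFunctor ht (hkap.comp hj' hnu)).objPreimage X),
        ⟨(elmCompIso ht hj' hkap hnu).app _ ≪≫ (elmFunctor ht (hkap.comp hj' hnu)).objObjPreimageIso X⟩⟩⟩ }

end ParConn
end SmoothProjCurve

/-- This is used to build a functor in the direction opposite to a full and faithful F: morphisms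
are preimages of conjugates by chosen isomorphisms, and the functor laws follow by faithfulness. -/
theorem CategoryTheory.Functor.map_preimage_conj {𝒞 𝒟 : Type*} [Category* 𝒞] [Category* 𝒟]
    (F : 𝒞 ⥤ 𝒟) [F.Full] {a b : 𝒞} {x y : 𝒟} (e : F.obj a ≅ x) (e' : F.obj b ≅ y) (f : x ⟶ y) :
    F.map (F.preimage (e.hom ≫ f ≫ e'.inv)) ≫ e'.hom = e.hom ≫ f := by
  simp

theorem CategoryTheory.Functor.eq_id_of_map_comp {𝒞 𝒟 : Type*} [Category* 𝒞] [Category* 𝒟]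
    (F : 𝒞 ⥤ 𝒟) [F.Faithful] {a : 𝒞} {x : 𝒟} (e : F.obj a ≅ x) {k : a ⟶ a}
    (h : F.map k ≫ e.hom = e.hom ≫ 𝟙 x) : k = 𝟙 a :=
  F.map_injective (by rw [F.map_id, ← cancel_mono e.hom, h, Category.comp_id, Category.id_comp])

theorem CategoryTheory.Functor.eq_comp_of_map_comp {𝒞 𝒟 : Type*} [Category* 𝒞] [Category* 𝒟]
    (F : 𝒞 ⥤ 𝒟) [F.Faithful] {a b c : 𝒞} {x y z : 𝒟} (e : F.obj a ≅ x) (e' : F.obj b ≅ y)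
    (e'' : F.obj c ≅ z) {k : a ⟶ c} {l : a ⟶ b} {l' : b ⟶ c} {f : x ⟶ y} {f' : y ⟶ z}
    (h : F.map k ≫ e''.hom = e.hom ≫ f ≫ f') (hl : F.map l ≫ e'.hom = e.hom ≫ f)
    (hl' : F.map l' ≫ e''.hom = e'.hom ≫ f') : k = l ≫ l' :=
  F.map_injective (by
    rw [F.map_comp, ← cancel_mono e''.hom, h, Category.assoc, hl', ← Category.assoc,
      ← Category.assoc, hl])

/-! ### The transforms as isomorphisms of stacks -/

namespace SmoothProjCurve

variable {C : SmoothProjCurve} {n : ℕ} {t : Fin n → C.Pt} {r : ℕ}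

open SmoothProjCurve.VectorBundle

namespace ParConn

variable {lam nu mu : Fin n → Fin r → ℂ} (ht : Function.Injective t) {i : Fin n} {j : Fin (r + 1)}

/-- The elementary transform as an isomorphism of stacks. -/
def elmIso (hnu : IsElmExponents i j lam nu) : StackIso (parStack t lam) (parStack t nu) where
  functor :=
    { toFunctor := elmFunctor ht hnu
      w := rfl }
  isEquivalence := elmFunctor_isEquivalence ht hnu

/-- The inclusion of the elementary transform, as a natural transformation. -/
def elmInclTrans (hnu : IsElmExponents i j lam nu) :
    BasedFunctor.comp (elmIso ht hnu).functor (forgetFlags t nu) ⟶ forgetFlags t lam where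
  app X := elmIncl (lam := lam) X ht hnu
  naturality _ _ f := elmMap_incl (lam := lam) ht hnu f
  isHomLift' X := IsHomLift.map (LogConn.based t r).p (elmIncl (lam := lam) X ht hnu)

theorem isUntwist_elmIso (hnu : IsElmExponents i (Fin.last r) lam nu) :
    IsUntwist i (elmIso (t := t) ht hnu) := by
  refine ⟨fun p => hnu.eq_of_ge p p rfl, hnu.eq_of_ne, elmInclTrans ht hnu, fun X U =>
    ⟨elmIncl_injective ht hnu X U, ?_, fun i' q => ?_⟩⟩
  · exact (elmIncl_range ht hnu X U).trans (congrArg _ (X.L_last i U))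
  · exact (elmIncl_image ht hnu X i' q U).trans (congrArg _ (elmL_last_index ht X i i' q U))

theorem isElementary_elmIso {j : Fin r} (hnu : IsElmExponents i j.castSucc lam nu) :
    IsElementary i j (elmIso (t := t) ht hnu) := by
  refine ⟨hnu.eq_of_lt, hnu.eq_of_ge, hnu.eq_of_ne, elmInclTrans ht hnu, fun X => ?_⟩
  intro Y f U
  refine ⟨elmIncl_injective ht hnu X U, elmIncl_range ht hnu X U, fun p q h m => ?_,
    fun p q h => ?_, fun i' hi q m => ?_⟩
  · refine (mem_elm ht hnu X).trans ?_
    have h1 : (q : ℕ) + j.castSucc = p := h.symm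
    rw [elmL_self, h1, X.lx_of_le i (Nat.lt_succ_iff.mp p.2), X.Ln_eq i p rfl]
    exact Iff.rfl
  · refine (elmIncl_image ht hnu X i q U).trans (congrArg _ ?_)
    have h1 : (q : ℕ) + j.castSucc = p + r := h.symm
    rw [elmL_self, h1, lx_add, X.Ln_eq i p rfl]
  · refine (mem_elm ht hnu X).trans ?_
    rw [X.elmL_of_ne hi, X.Ln_eq i' q rfl]
    exact ⟨fun h => h.1, fun h => ⟨h, m.2⟩⟩

section Twist

variable (h : ∀ p, nu i p = lam i p - 1) (h' : ∀ i' ≠ i, nu i' = lam i')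

include h h' in
theorem isElmExponents_of_sub_one : IsElmExponents i (Fin.last r) nu lam where
  eq_of_lt p q hpq := by
    have := p.2
    rw [Fin.val_last] at hpq
    omega
  eq_of_ge p q hpq := by
    obtain rfl : p = q := Fin.ext (by rw [Fin.val_last] at hpq; omega)
    rw [h, sub_add_cancel]
  eq_of_ne i' hi := (h' i' hi).symm

/-- Tensoring with `𝒪_C(t_i)` on morphisms. -/
def twistMap {X Y : ParConn t lam} (f : X ⟶ Y) : X.twist i ht h h' ⟶ Y.twist i ht h h' :=
  have := elmFunctor_full (t := t) ht (isElmExponents_of_sub_one h h')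
  (elmFunctor ht (isElmExponents_of_sub_one h h')).preimage
    ((elmTwistIso ht (isElmExponents_of_sub_one h h') X h h').hom ≫ f ≫
      (elmTwistIso ht (isElmExponents_of_sub_one h h') Y h h').inv)

theorem elmMap_twistMap {X Y : ParConn t lam} (f : X ⟶ Y) :
    elmMap ht (isElmExponents_of_sub_one h h') (twistMap ht h h' f) ≫
      (elmTwistIso ht (isElmExponents_of_sub_one h h') Y h h').hom =
    (elmTwistIso ht (isElmExponents_of_sub_one h h') X h h').hom ≫ f := by
  have := elmFunctor_full (t := t) ht (isElmExponents_of_sub_one h h')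
  exact Functor.map_preimage_conj (elmFunctor ht (isElmExponents_of_sub_one h h'))
    (elmTwistIso ht (isElmExponents_of_sub_one h h') X h h')
    (elmTwistIso ht (isElmExponents_of_sub_one h h') Y h h') f

theorem twistMap_base {X Y : ParConn t lam} (f : X ⟶ Y) :
    (twistMap ht h h' f).hom.base = f.hom.base := by
  have h1 := congrArg (fun e : (X.twist i ht h h').elm ht (isElmExponents_of_sub_one h h') ⟶ Y =>
    e.hom.base) (elmMap_twistMap ht h h' f)
  have h2 : (twistMap ht h h' f).hom.base ≫ 𝟙 Y.A = 𝟙 X.A ≫ f.hom.base := h1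
  exact (Category.comp_id _).symm.trans (h2.trans (Category.id_comp _))

theorem twistMap_naturality {X Y : ParConn t lam} (f : X ⟶ Y) :
    f.hom ≫ Y.toLogConn.toTwist i = X.toLogConn.toTwist i ≫ (twistMap ht h h' f).hom := by
  let hnu := isElmExponents_of_sub_one h h'
  let e := elmTwistIso ht hnu X h h'
  have h0 : ∀ {W Z : LogConn t r} (d : W ≅ X.toLogConn) (a b : X.toLogConn ⟶ Z),
      d.hom ≫ a = d.hom ≫ b → a = b := fun d a b h => (cancel_epi d.hom).mp h
  -- The isomorphism is passed to the underlying connections, where it can be cancelled: the two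
  -- sides are compared after composition with it.
  let d : ((X.twist i ht h h').elm ht hnu).toLogConn ≅ X.toLogConn :=
    { hom := e.hom.hom
      inv := e.inv.hom
      hom_inv_id := congrArg Hom.hom e.hom_inv_id
      inv_hom_id := congrArg Hom.hom e.inv_hom_id }
  refine h0 d _ _ ?_
  have h1 := elmTwistIso_hom_comp ht hnu X h h'
  have h2 := elmTwistIso_hom_comp ht hnu Y h h'
  have h3 : (elmMap ht hnu (twistMap ht h h' f)).hom ≫ (elmTwistIso ht hnu Y h h').hom.hom =
      e.hom.hom ≫ f.hom := congrArg Hom.hom (elmMap_twistMap ht h h' f)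
  have h4 := elmMap_incl ht hnu (twistMap ht h h' f)
  have h5 : (e.hom.hom ≫ f.hom) ≫ Y.toLogConn.toTwist i =
      (e.hom.hom ≫ X.toLogConn.toTwist i) ≫ (twistMap ht h h' f).hom := by
    rw [← h3]
    refine (Category.assoc _ _ _).trans ?_
    refine (congrArg (_ ≫ ·) h2).trans ?_
    refine h4.trans ?_
    exact congrArg (· ≫ (twistMap ht h h' f).hom) h1.symm
  exact (Category.assoc _ _ _).symm.trans (h5.trans (Category.assoc _ _ _))

/-- Tensoring with `𝒪_C(t_i)` as a functor. -/
def twistFunctor : ParConn t lam ⥤ ParConn t nu where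
  obj X := X.twist i ht h h'
  map f := twistMap ht h h' f
  map_id X := (elmFunctor ht (isElmExponents_of_sub_one h h')).eq_id_of_map_comp
    (elmTwistIso ht (isElmExponents_of_sub_one h h') X h h') (elmMap_twistMap ht h h' (𝟙 X))
  map_comp {X Y Z} f g := (elmFunctor ht (isElmExponents_of_sub_one h h')).eq_comp_of_map_comp
    (elmTwistIso ht (isElmExponents_of_sub_one h h') X h h')
    (elmTwistIso ht (isElmExponents_of_sub_one h h') Y h h')
    (elmTwistIso ht (isElmExponents_of_sub_one h h') Z h h')
    (elmMap_twistMap ht h h' (f ≫ g)) (elmMap_twistMap ht h h' f) (elmMap_twistMap ht h h' g)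

/-- Tensoring with `𝒪_C(t_i)` is right inverse to tensoring with `𝒪_C(-t_i)`. -/
def twistElmIso : twistFunctor (t := t) ht h h' ⋙ elmFunctor ht (isElmExponents_of_sub_one h h') ≅
    𝟭 (ParConn t lam) :=
  NatIso.ofComponents (fun X => elmTwistIso ht (isElmExponents_of_sub_one h h') X h h')
    fun f => elmMap_twistMap ht h h' f

/-- Followed by tensoring with 𝒪(-t_i), which is an equivalence, the functor is isomorphic to the
identity. -/
theorem twistFunctor_isEquivalence : (twistFunctor (t := t) ht h h').IsEquivalence := by
  have h1 := elmFunctor_isEquivalence (t := t) ht (isElmExponents_of_sub_one h h')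
  have h2 : (twistFunctor (t := t) ht h h' ⋙
      elmFunctor ht (isElmExponents_of_sub_one h h')).IsEquivalence :=
    Functor.isEquivalence_of_iso (twistElmIso (t := t) ht h h').symm
  exact Functor.isEquivalence_of_comp_right _ (elmFunctor ht (isElmExponents_of_sub_one h h'))

/-- Tensoring with `𝒪_C(t_i)` as an isomorphism of stacks. -/
def twistIso : StackIso (parStack t lam) (parStack t nu) where
  functor :=
    { toFunctor := twistFunctor ht h h'
      w := CategoryTheory.Functor.ext (fun _ => rfl) fun X Y f => by
        change (twistMap (lam := lam) ht h h' f).hom.base =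
          𝟙 _ ≫ LogConn.Hom.base (Hom.hom (X := X) (Y := Y) f) ≫ 𝟙 _
        exact (twistMap_base (lam := lam) ht h h' f).trans
          ((Category.id_comp _).trans (Category.comp_id _)).symm }
  isEquivalence := twistFunctor_isEquivalence ht h h'

theorem isTwist_twistIso : IsTwist i (twistIso (t := t) ht h h') := by
  refine ⟨h, h',
    { app := fun X => LogConn.toTwist (ParConn.toLogConn (lam := lam) X) i
      naturality := fun _ _ f => twistMap_naturality (lam := lam) ht h h' f
      isHomLift' := fun X => IsHomLift.map (LogConn.based t r).p
        (LogConn.toTwist (ParConn.toLogConn (lam := lam) X) i) }, fun X => ?_⟩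
  exact X.isTwistPair_twist ht h h'

end Twist

end ParConn
end SmoothProjCurve

/-! ### Combinatorics of the exponents -/

namespace SmoothProjCurve

variable {C : SmoothProjCurve} {n : ℕ} {t : Fin n → C.Pt} {r : ℕ}

open ParConn

variable (t) in
/-- The moduli stacks with exponents `λ` and `ν` are related by a composite of transforms. -/
def Reach (lam nu : Fin n → Fin r → ℂ) : Prop :=
  ∃ σ : StackIso (parStack t lam) (parStack t nu), IsComposite t σ

theorem Reach.refl (lam : Fin n → Fin r → ℂ) : Reach t lam lam := ⟨_, IsComposite.refl lam⟩

theorem Reach.trans {lam nu mu : Fin n → Fin r → ℂ} (h : Reach t lam nu) (h' : Reach t nu mu) :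
    Reach t lam mu := by
  obtain ⟨σ, hσ⟩ := h
  obtain ⟨τ, hτ⟩ := h'
  exact ⟨_, IsComposite.trans σ τ hσ hτ⟩

variable (t) in
/-- The same relation, when only one row of the exponents changes. -/
def RowReach (v w : Fin r → ℂ) : Prop :=
  ∀ (i : Fin n) (lam : Fin n → Fin r → ℂ),
    Reach t (Function.update lam i v) (Function.update lam i w)

namespace RowReach

theorem refl (v : Fin r → ℂ) : RowReach t v v := fun _ _ => Reach.refl _

theorem trans {v w u : Fin r → ℂ} (h : RowReach t v w) (h' : RowReach t w u) : RowReach t v u :=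
  fun i lam => (h i lam).trans (h' i lam)

variable (ht : Function.Injective t)

include ht

/-- Equal entries require no transform at all; distinct ones are exchanged by a_i. -/
theorem swap {a b : Fin r} (hab : (b : ℕ) = a + 1) (v : Fin r → ℂ) :
    RowReach t v (v ∘ Equiv.swap a b) := by
  by_cases h : v a = v b
  · have h1 : v ∘ Equiv.swap a b = v := by
      funext p
      rcases eq_or_ne p a with rfl | hpa
      · rw [Function.comp_apply, Equiv.swap_apply_left, h]
      · rcases eq_or_ne p b with rfl | hpb
        · rw [Function.comp_apply, Equiv.swap_apply_right, h]
        · rw [Function.comp_apply, Equiv.swap_apply_of_ne_of_ne hpa hpb]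
    rw [h1]
    exact refl v
  · intro i lam
    have hs : IsSwap i a b (Function.update lam i v)
        (Function.update lam i (v ∘ Equiv.swap a b)) :=
      { succ := hab
        ne := by simpa using h
        left := by simp
        right := by simp
        eq_of_ne := fun p ha hb => by simp [Equiv.swap_apply_of_ne_of_ne ha hb]
        eq_of_ne' := fun i' hi => by simp [hi] }
    exact ⟨_, IsComposite.permutation i _ (isPermutation_swapIso ht hs)⟩

/-- Adjacent transpositions generate the symmetric group. -/
theorem perm (π : Equiv.Perm (Fin r)) : ∀ v : Fin r → ℂ, RowReach t v (v ∘ π) := by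
  cases r with
  | zero => exact fun v => Subsingleton.elim v (v ∘ π) ▸ refl v
  | succ s =>
    have h : π ∈ Submonoid.closure
        (Set.range fun k : Fin s => Equiv.swap k.castSucc k.succ) := by
      rw [Equiv.Perm.mclosure_swap_castSucc_succ]
      trivial
    induction h using Submonoid.closure_induction with
    | mem π h =>
      obtain ⟨k, rfl⟩ := h
      exact swap ht (by simp)
    | one => exact refl
    | mul π π' _ _ h h' => exact fun v => (h v).trans (h' (v ∘ π))

/-- The last index j = r is not among the elementary transforms of the theorem; there the move is
b_i⁻¹. -/
theorem elementary (j : Fin (r + 1)) {v w : Fin r → ℂ}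
    (h1 : ∀ p q : Fin r, (p : ℕ) = q + j → w q = v p)
    (h2 : ∀ p q : Fin r, (p : ℕ) + r = q + j → w q = v p + 1) : RowReach t v w := by
  intro i lam
  have hnu : IsElmExponents i j (Function.update lam i v) (Function.update lam i w) :=
    { eq_of_lt := by simpa using h1
      eq_of_ge := by simpa using h2
      eq_of_ne := fun i' hi => by simp [hi] }
  induction j using Fin.lastCases with
  | last => exact ⟨_, IsComposite.untwist i _ (isUntwist_elmIso ht hnu)⟩
  | cast j => exact ⟨_, IsComposite.elementary i j _ (isElementary_elmIso ht hnu)⟩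

theorem sub_one (v : Fin r → ℂ) : RowReach t v (fun p => v p - 1) := by
  intro i lam
  exact ⟨_, IsComposite.twist i _ (isTwist_twistIso ht (i := i) (lam := Function.update lam i v)
    (nu := Function.update lam i fun p => v p - 1) (by simp) (fun i' hi => by simp [hi]))⟩

/-- The transform with j = 1 turns (u_0, …, u_s) into (u_1, …, u_s, u_0 + 1), a rotation of u + e_0,
and permuting back gives u + e_0. Conjugation by the transposition of 0 and k moves the increment to
position k. For r = 1 the index 1 is the last one, so the move is b_i⁻¹. -/
theorem add_single (k : Fin r) (v : Fin r → ℂ) : RowReach t v (v + Pi.single k 1) := by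
  cases r with
  | zero => exact k.elim0
  | succ s =>
    have key : ∀ u : Fin (s + 1) → ℂ, RowReach t u (u + Pi.single 0 1) := by
      intro u
      have h1 : RowReach t u ((u + Pi.single 0 1) ∘ finRotate (s + 1)) := by
        refine elementary ht 1 (fun p q h => ?_) (fun p q h => ?_)
        · cases s with
          | zero => simp at h
          | succ s =>
            have hp := p.2
            have hq : q ≠ Fin.last (s + 1) := by
              rintro rfl
              simp at h
              omega
            have h3 : finRotate (s + 1 + 1) q = p :=
              Fin.ext (by rw [coe_finRotate_of_ne_last hq, h]; simp)
            have h4 : p ≠ 0 := by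
              rintro rfl
              simp at h
            simp [h3, h4]
        · have h3 : q = Fin.last s := by
            apply Fin.ext
            have := q.2
            have h5 : ((1 : Fin (s + 1 + 1)) : ℕ) = 1 := by simp
            rw [h5] at h
            simp
            omega
          have h4 : p = 0 := by
            apply Fin.ext
            have h5 : ((1 : Fin (s + 1 + 1)) : ℕ) = 1 := by simp
            rw [h5, h3] at h
            simp at h ⊢
            omega
          rw [h3, h4, Function.comp_apply, finRotate_last]
          simp
      have h2 := h1.trans (perm ht (finRotate (s + 1)).symm _)
      rwa [Function.comp_assoc, Equiv.self_comp_symm, Function.comp_id] at h2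
    have h1 := ((perm ht (Equiv.swap 0 k) v).trans (key _)).trans (perm ht (Equiv.swap 0 k) _)
    have h2 : (v ∘ Equiv.swap 0 k + Pi.single 0 1) ∘ Equiv.swap 0 k = v + Pi.single k 1 := by
      funext p
      simp only [Function.comp_apply, Pi.add_apply, Equiv.swap_apply_self]
      congr 1
      rcases eq_or_ne p k with rfl | hp
      · simp
      · rw [Pi.single_eq_of_ne hp, Pi.single_eq_of_ne]
        rw [Ne, Equiv.swap_apply_eq_iff, Equiv.swap_apply_left]
        exact hp
    rwa [h2] at h1

theorem add_nat (m : Fin r → ℕ) (v : Fin r → ℂ) : RowReach t v (fun p => v p + m p) := by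
  have h1 : ∀ (k : Fin r) (a : ℕ) (v : Fin r → ℂ), RowReach t v (v + Pi.single k (a : ℂ)) := by
    intro k a
    induction a with
    | zero => intro v; simpa using refl v
    | succ a ih =>
      intro v
      have h2 := (ih v).trans (add_single ht k _)
      rwa [add_assoc, ← Pi.single_add, ← Nat.cast_succ] at h2
  have h2 : ∀ s : Finset (Fin r), RowReach t v (v + ∑ k ∈ s, Pi.single k (m k : ℂ)) := by
    intro s
    induction s using Finset.induction_on with
    | empty => simpa using refl v
    | insert k s hk ih =>
      rw [Finset.sum_insert hk, add_comm (Pi.single _ _), ← add_assoc]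
      exact ih.trans (h1 k (m k) _)
  have h3 := h2 Finset.univ
  rwa [Finset.univ_sum_single fun k => (m k : ℂ)] at h3

/-- Lowering the whole row by a large N, through N tensor products with 𝒪(t_i), leaves only the
nonnegative increments m_p + N. -/
theorem add_int (m : Fin r → ℤ) (v : Fin r → ℂ) : RowReach t v (fun p => v p + m p) := by
  obtain ⟨N, hN⟩ : ∃ N : ℕ, ∀ p, 0 ≤ m p + N := by
    refine ⟨∑ p, (m p).natAbs, fun p => ?_⟩
    have h1 := Finset.single_le_sum (f := fun p => (m p).natAbs) (fun _ _ => Nat.zero_le _)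
      (Finset.mem_univ p)
    have h2 : (m p).natAbs ≤ ∑ p, (m p).natAbs := h1
    omega
  have h1 : ∀ N : ℕ, RowReach t v (fun p => v p - N) := by
    intro N
    induction N with
    | zero => simpa using refl v
    | succ N ih =>
      have h2 := ih.trans (sub_one ht _)
      refine Eq.subst (motive := RowReach t v) ?_ h2
      funext p
      push_cast
      ring
  have h2 := (h1 N).trans (add_nat ht (fun p => (m p + N).toNat) _)
  refine Eq.subst (motive := RowReach t v) ?_ h2
  funext p
  have h3 : (((m p + N).toNat : ℕ) : ℂ) = ((m p + N : ℤ) : ℂ) := by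
    rw [← Int.cast_natCast, Int.toNat_of_nonneg (hN p)]
  rw [h3]
  push_cast
  ring

omit ht in
-- Rows are changed one at a time; at each stage the rows in the finite set s come from μ and the
-- others from λ.
theorem reach {lam mu : Fin n → Fin r → ℂ} (h : ∀ i, RowReach t (lam i) (mu i)) :
    Reach t lam mu := by
  have h1 : ∀ s : Finset (Fin n), Reach t lam (s.piecewise mu lam) := by
    intro s
    induction s using Finset.induction_on with
    | empty => simpa using Reach.refl lam
    | insert i s hi ih =>
      rw [Finset.piecewise_insert]
      have h2 := h i i (s.piecewise mu lam)
      have h3 : Function.update (s.piecewise mu lam) i (lam i) = s.piecewise mu lam := by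
        rw [Function.update_eq_self_iff, Finset.piecewise_eq_of_notMem _ _ _ hi]
      rw [h3] at h2
      exact ih.trans h2
  simpa using h1 Finset.univ

end RowReach

/-- The fibres of f and g over each value have the same cardinality, and bijections between fibres
glue. -/
theorem exists_perm_of_map_eq {α β : Type*} [Fintype α] {f g : α → β}
    (h : Finset.univ.val.map f = Finset.univ.val.map g) : ∃ π : Equiv.Perm α, ∀ a, g (π a) = f a := by
  classical
  have h1 : ∀ c, Nonempty ({a // f a = c} ≃ {a // g a = c}) := by
    intro c
    rw [← Fintype.card_eq, Fintype.card_subtype, Fintype.card_subtype]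
    have h2 := congrArg (Multiset.count c) h
    rw [Multiset.count_map, Multiset.count_map] at h2
    change (Multiset.filter _ Finset.univ.val).card = (Multiset.filter _ Finset.univ.val).card
    simpa only [eq_comm (a := c)] using h2
  exact ⟨Equiv.ofFiberEquiv fun c => (h1 c).some, fun a => Equiv.ofFiberEquiv_map _ a⟩

/-- Both products are monic of degree r, so the coefficients below r determine them, and equal
polynomials have equal multisets of roots. -/
theorem exists_perm_of_prod_eq {r : ℕ} {f g : Fin r → ℂ}
    (h : ∀ k : Fin r, (∏ j, (Polynomial.X - Polynomial.C (f j))).coeff k =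
      (∏ j, (Polynomial.X - Polynomial.C (g j))).coeff k) :
    ∃ π : Equiv.Perm (Fin r), ∀ j, g (π j) = f j := by
  have h1 : ∏ j, (Polynomial.X - Polynomial.C (f j)) = ∏ j, (Polynomial.X - Polynomial.C (g j)) := by
    have hd : ∀ f : Fin r → ℂ, (∏ j, (Polynomial.X - Polynomial.C (f j))).natDegree = r := fun f => by
      rw [Polynomial.natDegree_finsetProd_X_sub_C_eq_card, Finset.card_univ, Fintype.card_fin]
    have hm : ∀ f : Fin r → ℂ, (∏ j, (Polynomial.X - Polynomial.C (f j))).coeff r = 1 := fun f => by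
      have := Polynomial.monic_prod_X_sub_C f Finset.univ
      rwa [Polynomial.Monic, Polynomial.leadingCoeff, hd] at this
    ext k
    rcases lt_trichotomy k r with hk | rfl | hk
    · exact h ⟨k, hk⟩
    · rw [hm, hm]
    · rw [Polynomial.coeff_eq_zero_of_natDegree_lt (by rwa [hd]),
        Polynomial.coeff_eq_zero_of_natDegree_lt (by rwa [hd])]
  have h2 : ∀ f : Fin r → ℂ, (∏ j, (Polynomial.X - Polynomial.C (f j))).roots =
      Finset.univ.val.map f := fun f => by
    rw [← Polynomial.roots_multiset_prod_X_sub_C (Finset.univ.val.map f), Multiset.map_map]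
    rfl
  exact exists_perm_of_map_eq (by rw [← h2, ← h2, h1])

end SmoothProjCurve

open SmoothProjCurve

theorem proposition3p1 (C : SmoothProjCurve) (n r : ℕ) (hn : 0 < n) (hr : 0 < r)
    (t : Fin n → C.Pt) (ht : Function.Injective t) :
    (∀ (d : ℤ) (lam : Fin n → Fin r → ℂ), lam ∈ exponents n r d →
      ∃ (d' : ℤ) (mu : Fin n → Fin r → ℂ),
        mu ∈ exponents n r d' ∧ (∀ i j, 0 ≤ (mu i j).re ∧ (mu i j).re < 1) ∧
        ∃ σ : StackIso (parStack t lam) (parStack t mu), IsComposite t σ) ∧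
    (∀ (d d' : ℤ) (lam mu : Fin n → Fin r → ℂ),
      lam ∈ exponents n r d → mu ∈ exponents n r d' → rh lam = rh mu →
      ∃ σ : StackIso (parStack t lam) (parStack t mu), IsComposite t σ) := by
  constructor
  · intro d lam hlam
    -- Subtracting ⌊Re λ⌋ puts the real parts into [0, 1); the degree grows by the total amount
    -- subtracted, which keeps the sum equal to zero.
    refine ⟨d + ∑ i, ∑ j, ⌊(lam i j).re⌋, fun i j => lam i j + (-⌊(lam i j).re⌋ : ℤ), ?_,
      fun i j => ?_, RowReach.reach fun i => RowReach.add_int ht _ _⟩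
    · change (_ : ℂ) + _ = 0
      change (_ : ℂ) + _ = 0 at hlam
      rw [← hlam]
      push_cast
      simp only [Finset.sum_add_distrib, Finset.sum_neg_distrib]
      ring
    · have h1 : (lam i j + (-⌊(lam i j).re⌋ : ℤ)).re = (lam i j).re - ⌊(lam i j).re⌋ := by
        rw [Complex.add_re, Complex.intCast_re]
        push_cast
        ring
      rw [h1]
      exact ⟨sub_nonneg.mpr (Int.floor_le _), by linarith [Int.lt_floor_add_one (lam i j).re]⟩
  · intro d d' lam mu _ _ h
    refine RowReach.reach fun i => ?_
    obtain ⟨π, hπ⟩ := exists_perm_of_prod_eq fun k => congrFun (congrFun h i) k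
    -- The exponentials have argument -2πi times the exponent, so equality gives μ at π j equal to λ
    -- at j minus the integer m_j.
    choose m hm using fun j => Complex.exp_eq_exp_iff_exists_int.mp (hπ j)
    have h1 : mu i ∘ π = fun j => lam i j + (-m j : ℤ) := by
      funext j
      have h2 := hm j
      have h3 : (2 * Real.pi * Complex.I : ℂ) ≠ 0 := Complex.two_pi_I_ne_zero
      apply mul_left_cancel₀ h3
      rw [Function.comp_apply]
      push_cast
      linear_combination -h2
    have h2 : RowReach t (lam i) (mu i ∘ π) := h1 ▸ RowReach.add_int ht _ _
    have h3 := h2.trans (RowReach.perm ht π.symm _)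
    rwa [Function.comp_assoc, Equiv.self_comp_symm, Function.comp_id] at h3

end
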